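/- **Theorem (Sampling distributions).** *Setting.* Let $\Theta\subset\mathbb{R}^{p}$ be open and for $\theta\in\Theta$ let $Y_\theta$ be a random vector in $\mathbb{R}^m$ (columns) with moment generating function $M_0(s;\theta)=\mathbb{E}(e^{sY_\theta})$ and $K_0=\log M_0$, where $s$ is a row vector. Put $\mathcal S=\{(s,\theta)\colon \theta\in\Theta,\ s\in\mathbb{R}^{1\times m},\ \mathbb{E}(e^{sY_\theta})<\infty\}$; primes denote gradients and Hessians in $s$. Let $X_\theta=X_{\theta,n}$ be the sum of $n$ i.i.d. copies of $Y_\theta$, with cumulant generating function $K=nK_0$. The true likelihood $L_n(\theta;x)$ is the (continuous) density of $X_{\theta,n}$ at $x$, and the saddlepoint likelihood is $$\hat L_n(\theta;x)=\frac{\exp\left(K(\hat s;\theta)-\hat s x\right)}{\sqrt{\det(2\pi K''(\hat s;\theta))}},\qquad K'(\hat s;\theta)=x .$$ *Regularity.* Assume: 1. There is a continuous $\delta\colon\operatorname{int}\mathcal S\to(0,\infty)$ with $\left|\frac{M_0(s+\mathrm{i}\varphi;\theta)}{M_0(s;\theta)}\right|\le(1+\delta(s,\theta)|\varphi|^2)^{-\delta(s,\theta)}$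 for all $(s,\theta)\in\operatorname{int}\mathcal S$ and $\varphi\in\mathbb{R}^{1\times m}$. 2. There is a continuous $\gamma\colon\operatorname{int}\mathcal S\to(0,\infty)$ such that, for $k\in\{0,1\}$, $1\le k+\ell\le 6$, and for $k=2$, $0\le\ell\le2$, every partial derivative of $M_0$ of order $k$ in $\theta$ and order $\ell$ in $s$ exists and is continuous in all its variables on $\{(s+\mathrm i\varphi,\theta)\colon(s,\theta)\in\operatorname{int}\mathcal S\}$, and is there bounded in absolute value by $\gamma(s,\theta)(1+|\varphi|)^{\gamma(s,\theta)}$. *Full identifiability.* Let $(s_0,\theta_0)\in\operatorname{int}\mathcal S$ and $y_0=K_0'(s_0;\theta_0)$, let $\nabla_\theta K_0(s_0;\theta_0)=0$, write $A=K_0''(s_0;\theta_0)$ and $B=\nabla_s\nabla_\theta K_0(s_0;\theta_0)$ (an $m\times p$ matrix), and assume that $$H=\nabla_\theta^T\nabla_\theta K_0(s_0;\theta_0)-B^TA^{-1}B$$ is negative definite. *Observations.* Let $\chi_n$ be random vectors in $\mathbb{R}^m$ with $(\chi_n-ny_0)/\sqrt n\to\mathcal N(0,\Sigma)$ in distribution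 as $n\to\infty$, where $\Sigma$ is a positive semi-definite matrix. *Conclusion.* There are neighbourhoods $U\subset\Theta$ of $\theta_0$ and $V$ of $y_0$ and $n_0\in\mathbb{N}$ such that, for all $n\ge n_0$ and $x=ny$ with $y\in V$, each of the functions $\theta\mapsto L_n(\theta;x)$ and $\theta\mapsto\hat L_n(\theta;x)$ has a unique local maximiser in $U$, denoted $\theta_{\mathrm{MLE\,in\,}U}(x)$ and $\hat\theta_{\mathrm{MLE\,in\,}U}(x)$ respectively; for suitable $U,V,n_0$ these are measurable functions of $x\in nV$. For every such $U,V,n_0$, and with the two estimators extended in any way to other $n$ and $x$ so that their values at $\chi_n$ are random vectors: (i) As $n\to\infty$, $$\left(\sqrt n\,(\theta_{\mathrm{MLE\,in\,}U}(\chi_n)-\theta_0),\ \sqrt n\,(\hat\theta_{\mathrm{MLE\,in\,}U}(\chi_n)-\theta_0)\right)\to(Z,Z)\quad\text{in distribution},$$ with $Z\sim\mathcal N(0,\,H^{-1}B^TA^{-1}\Sigma A^{-1}BH^{-1})$. (ii) If in addition $y_0=K_0'(0;\theta_0)$ and $\Sigma=K_0''(0;\theta_0)$, then $Z\sim\mathcal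 N(0,-H^{-1})$. -/

import Mathlib

open MeasureTheory ProbabilityTheory Filter Topology

noncomputable section

namespace Saddlepoint

/-- Real Euclidean space of dimension `d`. It is used both for column vectors (observations,
parameters) and for the dual row vectors `s`; the product `s x` is the inner product. -/
abbrev Vec (d : ℕ) : Type := EuclideanSpace ℝ (Fin d)

/-- Complex dual vectors of dimension `d`. -/
abbrev CVec (d : ℕ) : Type := EuclideanSpace ℂ (Fin d)

/-- The complex vector `s + i φ`. -/
def cplx {d : ℕ} (s φ : Vec d) : CVec d :=
  WithLp.toLp 2 fun j => (s j : ℂ) + (φ j : ℂ) * Complex.I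

/-- The coordinatewise real part. -/
def rePart {d : ℕ} (z : CVec d) : Vec d := WithLp.toLp 2 fun j => (z j).re

/-! ### Partial derivatives -/

/-- The partial derivative `∂f/∂xᵢ`. -/
def pd {𝕜 F : Type*} [RCLike 𝕜] [NormedAddCommGroup F] [NormedSpace 𝕜 F] {d : ℕ}
    (i : Fin d) (f : EuclideanSpace 𝕜 (Fin d) → F) (x : EuclideanSpace 𝕜 (Fin d)) : F :=
  lineDeriv 𝕜 f x (EuclideanSpace.single i 1)

/-- The partial derivative `∂f/∂xᵢ` exists at `x`. -/
def HasPd {𝕜 F : Type*} [RCLike 𝕜] [NormedAddCommGroup F] [NormedSpace 𝕜 F] {d : ℕ}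
    (i : Fin d) (f : EuclideanSpace 𝕜 (Fin d) → F) (x : EuclideanSpace 𝕜 (Fin d)) : Prop :=
  LineDifferentiableAt 𝕜 f x (EuclideanSpace.single i 1)

/-- The Hessian matrix `(∂²f/∂xᵢ∂xⱼ)`. -/
def hess {d : ℕ} (f : Vec d → ℝ) (x : Vec d) : Matrix (Fin d) (Fin d) ℝ :=
  Matrix.of fun i j => pd i (fun x' => pd j f x') x

/-! ### Generating functions of a law `P` on `ℝᵐ` -/

/-- The set of real `s` with `E(exp(s X)) < ∞`. -/
def expDomain {m : ℕ} (P : Measure (Vec m)) : Set (Vec m) :=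
  {s | Integrable (fun x => Real.exp (inner ℝ s x)) P}

/-- The moment generating function at a complex argument. -/
def mgfC {m : ℕ} (P : Measure (Vec m)) (z : CVec m) : ℂ :=
  ∫ x, Complex.exp (∑ j, z j * (x j : ℂ)) ∂P

/-- The cumulant generating function at a real argument. -/
def cumGF {m : ℕ} (P : Measure (Vec m)) (s : Vec m) : ℝ :=
  Real.log (∫ x, Real.exp (inner ℝ s x) ∂P)

/-! ### True and saddlepoint likelihood of a law `P` on `ℝᵐ` -/

/-- `f` is a continuous density function of `P`; there is at most one. -/
def IsContinuousDensity {m : ℕ} (P : Measure (Vec m)) (f : Vec m → ℝ) : Prop :=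
  Continuous f ∧ (∀ x, 0 ≤ f x) ∧ P = volume.withDensity (fun x => ENNReal.ofReal (f x))

open Classical in
/-- The density of `P` at `x`: the continuous density function where there is one,
and otherwise some version of the Radon-Nikodym derivative. -/
def density {m : ℕ} (P : Measure (Vec m)) (x : Vec m) : ℝ :=
  if h : ∃ f : Vec m → ℝ, IsContinuousDensity P f then h.choose x
  else (P.rnDeriv volume x).toReal

/-- `s` solves the saddlepoint equation `K'(s) = x`. -/
def IsSaddlepoint {m : ℕ} (P : Measure (Vec m)) (x s : Vec m) : Prop :=
  s ∈ interior (expDomain P) ∧ HasGradientAt (cumGF P) x s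

open Classical in
/-- The saddlepoint `ŝ(x)` (zero if the saddlepoint equation has no solution). -/
def saddlepoint {m : ℕ} (P : Measure (Vec m)) (x : Vec m) : Vec m :=
  if h : ∃ s : Vec m, IsSaddlepoint P x s then h.choose else 0

/-- The saddlepoint approximation `exp(K(ŝ) - ŝ x) / √(det(2π K''(ŝ)))` to the density at `x`. -/
def saddlepointDensity {m : ℕ} (P : Measure (Vec m)) (x : Vec m) : ℝ :=
  Real.exp (cumGF P (saddlepoint P x) - inner ℝ (saddlepoint P x) x) /
    Real.sqrt (((2 * Real.pi) • hess (cumGF P) (saddlepoint P x)).det)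

/-! ### The standard asymptotic regime -/

/-- The law of the sum of `n` independent random vectors with law `P`. -/
def sumLaw {m : ℕ} (P : Measure (Vec m)) (n : ℕ) : Measure (Vec m) :=
  (Measure.pi fun _ : Fin n => P).map fun y => ∑ i, y i

/-- The true likelihood `Lₙ(θ; x)`, where `Q θ` is the law of one summand `Y_θ`. -/
def trueLik {m p : ℕ} (Q : Vec p → Measure (Vec m)) (n : ℕ) (x : Vec m) (θ : Vec p) : ℝ :=
  density (sumLaw (Q θ) n) x

/-- The saddlepoint likelihood `L̂ₙ(θ; x)`. -/
def saddleLik {m p : ℕ} (Q : Vec p → Measure (Vec m)) (n : ℕ) (x : Vec m) (θ : Vec p) : ℝ :=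
  saddlepointDensity (sumLaw (Q θ) n) x

/-- The set of `(s, θ)` with `θ` in the parameter domain and `E(exp(s Y_θ)) < ∞`. -/
def jointDomain {m p : ℕ} (Θ : Set (Vec p)) (Q : Vec p → Measure (Vec m)) :
    Set (Vec m × Vec p) :=
  {q | q.2 ∈ Θ ∧ q.1 ∈ expDomain (Q q.2)}

/-- The decay condition on `M₀`. -/
def DecayBound {m p : ℕ} (Θ : Set (Vec p)) (Q : Vec p → Measure (Vec m)) : Prop :=
  ∃ δ : Vec m × Vec p → ℝ,
    ContinuousOn δ (interior (jointDomain Θ Q)) ∧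
    (∀ q ∈ interior (jointDomain Θ Q), 0 < δ q) ∧
    ∀ s θ, (s, θ) ∈ interior (jointDomain Θ Q) → ∀ φ : Vec m,
      ‖mgfC (Q θ) (cplx s φ) / mgfC (Q θ) (cplx s 0)‖
        ≤ (1 + δ (s, θ) * ‖φ‖ ^ 2) ^ (-δ (s, θ))

/-- `∂/∂sⱼ` (a complex derivative) of a function of complex `s` and real `θ`. -/
def sPartial {m p : ℕ} (j : Fin m) (f : CVec m → Vec p → ℂ) : CVec m → Vec p → ℂ :=
  fun z θ => pd (𝕜 := ℂ) j (fun w => f w θ) z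

/-- `∂/∂θᵢ` of a function of complex `s` and real `θ`. -/
def thetaPartial {m p : ℕ} (i : Fin p) (f : CVec m → Vec p → ℂ) : CVec m → Vec p → ℂ :=
  fun z θ => pd (𝕜 := ℝ) i (fun t => f z t) θ

/-- The mixed partial derivative of `M₀` in the parameter directions `is` and the dual
directions `js`. -/
def mgfPartial {m p : ℕ} (Q : Vec p → Measure (Vec m)) (is : List (Fin p)) (js : List (Fin m)) :
    CVec m → Vec p → ℂ :=
  is.foldr thetaPartial (js.foldr sPartial fun z θ => mgfC (Q θ) z)

/-- The orders for which the growth condition is imposed (`k` derivatives in `θ`, `l` in `s`). -/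
def GrowthOrder (k l : ℕ) : Prop :=
  (k ≤ 1 ∧ 1 ≤ k + l ∧ k + l ≤ 6) ∨ (k = 2 ∧ l ≤ 2)

/-- The growth condition on the partial derivatives of `M₀`: they exist, are continuous in all
variables and grow at most polynomially in the imaginary direction. -/
def GrowthBound {m p : ℕ} (Θ : Set (Vec p)) (Q : Vec p → Measure (Vec m)) : Prop :=
  ∃ γ : Vec m × Vec p → ℝ,
    ContinuousOn γ (interior (jointDomain Θ Q)) ∧
    (∀ q ∈ interior (jointDomain Θ Q), 0 < γ q) ∧
    (∀ (js : List (Fin m)) (j : Fin m), GrowthOrder 0 (js.length + 1) →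
      ∀ z θ, (rePart z, θ) ∈ interior (jointDomain Θ Q) →
        HasPd (𝕜 := ℂ) j (fun w => mgfPartial Q [] js w θ) z) ∧
    (∀ (is : List (Fin p)) (js : List (Fin m)) (i : Fin p),
      GrowthOrder (is.length + 1) js.length →
      ∀ z θ, (rePart z, θ) ∈ interior (jointDomain Θ Q) →
        HasPd (𝕜 := ℝ) i (fun t => mgfPartial Q is js z t) θ) ∧
    ∀ (is : List (Fin p)) (js : List (Fin m)), GrowthOrder is.length js.length →
      ContinuousOn (fun q : CVec m × Vec p => mgfPartial Q is js q.1 q.2)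
        {q | (rePart q.1, q.2) ∈ interior (jointDomain Θ Q)} ∧
      ∀ s θ, (s, θ) ∈ interior (jointDomain Θ Q) → ∀ φ : Vec m,
        ‖mgfPartial Q is js (cplx s φ) θ‖ ≤ γ (s, θ) * (1 + ‖φ‖) ^ (γ (s, θ))

/-! ### The matrices `A`, `B`, `H` -/

/-- `A = K₀''(s; θ)`. -/
def matA {m p : ℕ} (Q : Vec p → Measure (Vec m)) (s : Vec m) (θ : Vec p) :
    Matrix (Fin m) (Fin m) ℝ :=
  hess (cumGF (Q θ)) s

/-- `B = ∇ₛ∇_θ K₀(s; θ)`, with entries `∂²K₀/∂sᵢ∂θⱼ`. -/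
def matB {m p : ℕ} (Q : Vec p → Measure (Vec m)) (s : Vec m) (θ : Vec p) :
    Matrix (Fin m) (Fin p) ℝ :=
  Matrix.of fun i j => pd i (fun s' => pd j (fun t => cumGF (Q t) s') θ) s

/-- `H = ∇_θᵀ∇_θ K₀ - Bᵀ A⁻¹ B`. -/
def matH {m p : ℕ} (Q : Vec p → Measure (Vec m)) (s : Vec m) (θ : Vec p) :
    Matrix (Fin p) (Fin p) ℝ :=
  hess (fun t => cumGF (Q t) s) θ - (matB Q s θ).transpose * (matA Q s θ)⁻¹ * matB Q s θ

/-! ### Local maximum likelihood estimators -/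

/-- `θ` is a local maximiser in `U` of the function `L`. -/
def IsLocalMaximiserIn {p : ℕ} (U : Set (Vec p)) (L : Vec p → ℝ) (θ : Vec p) : Prop :=
  θ ∈ U ∧ IsLocalMaxOn L U θ

/-- `U ⊆ Θ` and `V` are neighbourhoods of `θ₀` and `y₀` such that for `n ≥ n₀` and `x = n y`,
`y ∈ V`, the true and saddlepoint likelihoods have unique local maximisers in `U`. -/
structure IsMLENeighbourhood {m p : ℕ} (Θ : Set (Vec p)) (Q : Vec p → Measure (Vec m))
    (θ₀ : Vec p) (y₀ : Vec m) (U : Set (Vec p)) (V : Set (Vec m)) (n₀ : ℕ) : Prop where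
  subset : U ⊆ Θ
  mem_nhds_param : U ∈ 𝓝 θ₀
  mem_nhds_obs : V ∈ 𝓝 y₀
  unique_true : ∀ n ≥ n₀, ∀ y ∈ V,
    ∃! θ, IsLocalMaximiserIn U (trueLik Q n ((n : ℝ) • y)) θ
  unique_saddle : ∀ n ≥ n₀, ∀ y ∈ V,
    ∃! θ, IsLocalMaximiserIn U (saddleLik Q n ((n : ℝ) • y)) θ

/-- `T n x` is the local maximiser in `U` of the likelihood `L n x` whenever `n ≥ n₀` and
`x = n y` with `y ∈ V`; for other `n`, `x` its value is arbitrary. -/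
def IsLocalMLE {m p : ℕ} (L : ℕ → Vec m → Vec p → ℝ) (U : Set (Vec p)) (V : Set (Vec m)) (n₀ : ℕ)
    (T : ℕ → Vec m → Vec p) : Prop :=
  ∀ n ≥ n₀, ∀ y ∈ V, IsLocalMaximiserIn U (L n ((n : ℝ) • y)) (T n ((n : ℝ) • y))

end Saddlepoint

end

/-! Both normalised log-likelihoods `n⁻¹ log L(θ; n y)` are small perturbations of one profile
function `κ(y, θ) = K₀(σ; θ) - σ y`, where `σ = σ(y, θ)` solves `K₀'(σ; θ) = y` (inverse function
theorem, `exists_saddleMap`). By the envelope theorem its parameter gradient is `∇_θ K₀(σ; θ)`,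
called `profileScore`. Implicit differentiation shows that at the base point this gradient has
`y`-derivative `Bᵀ A⁻¹` and `θ`-derivative the Schur complement `H`
(`IsSaddleMapAt.fderiv_profileScore_apply`). So `θ₀` is a critical point of `κ(y₀, ·)` with negative
definite Hessian.

The statistical part is deterministic. Suppose that the normalised score at `θ₀` is `Bᵀ A⁻¹ (y -
y₀)` up to `o(n^(-1/2) + |y - y₀|)`, and that the Hessian is uniformly close to `H` near the base
point (`IsRegularLik`). Then strong concavity yields existence and uniqueness of the local maximiser
and the expansion `θ - θ₀ = -H⁻¹ Bᵀ A⁻¹ (y - y₀) + o(n^(-1/2) + |y - y₀|)`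
(`IsRegularLik.expansion`). With `y = χₙ / n` both estimators have the same linear part, up to
errors that vanish in probability, which gives the joint limit `(Z, Z)`
(`tendstoInDistribution_pair`).

For the saddlepoint likelihood, regularity is direct: apart from a constant, its normalised
logarithm is `κ` minus `n⁻¹` times the fixed C² function `½ log det A`.

For the true likelihood, exponential tilting and Fourier inversion give `L = (2π)⁻ᵐ exp(n (K₀(s; θ)
- s y)) J(s, θ)` for every admissible `s`, with `J = ∫ ρⁿ exp(-i n φ y) dφ` and `ρ = M₀(s + iφ; θ) /
M₀(s; θ)`. This is differentiated in `θ` with `s` frozen, and `s = σ(y, θ)` is inserted afterwards.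
The exponent then contributes exactly the profile score, but only `∇_θ² K₀` to the Hessian; the
missing `-Bᵀ A⁻¹ B` comes from `J`. After `φ = ψ / √n`, `ρⁿ` with its oscillating factor tends to
`exp(-ψ A ψ / 2)`, and each parameter derivative of `ρ` brings out `i ψ B / √n`. The first
derivative has an odd limiting integrand, so `J' / J = o(√n)`; the second is a Gaussian second
moment times `i² = -1`, so `J'' / (n J) → -Bᵀ A⁻¹ B`. The decay and growth conditions supply the
dominating functions.

In (ii), convexity of `K₀` and positivity of `A` force `s₀ = 0`. Since `K₀(0; θ) = 0` for all `θ`,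
this gives `H = -Bᵀ A⁻¹ B` and the covariance collapses. -/

open MeasureTheory ProbabilityTheory Filter Topology

namespace Saddlepoint

/-! ### Differentiability from continuous partial derivatives; interchange of derivatives. -/

section Calculus

/-- The linear form with given coefficients in the standard coordinates, as a continuous linear
function of the coefficients. -/
noncomputable def coordForm {𝕜 F : Type*} [RCLike 𝕜] [NormedAddCommGroup F] [NormedSpace 𝕜 F] {d : ℕ} :
    (Fin d → F) →L[𝕜] (EuclideanSpace 𝕜 (Fin d) →L[𝕜] F) :=
  ∑ i, (ContinuousLinearMap.smulRightL 𝕜 (EuclideanSpace 𝕜 (Fin d)) F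
    (EuclideanSpace.proj i)).comp (ContinuousLinearMap.proj i)

@[simp]
theorem coordForm_apply {𝕜 F : Type*} [RCLike 𝕜] [NormedAddCommGroup F] [NormedSpace 𝕜 F] {d : ℕ}
    (a : Fin d → F) (v : EuclideanSpace 𝕜 (Fin d)) :
    coordForm (𝕜 := 𝕜) a v = ∑ i, v i • a i := by
  simp [coordForm]

theorem hasDerivAt_line_of_hasPd {𝕜 F : Type*} [RCLike 𝕜] [NormedAddCommGroup F]
    [NormedSpace 𝕜 F] {d : ℕ} {i : Fin d} {f : EuclideanSpace 𝕜 (Fin d) → F}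
    {x : EuclideanSpace 𝕜 (Fin d)} {c : 𝕜} (h : HasPd i f (x + c • EuclideanSpace.single i 1)) :
    HasDerivAt (fun c' : 𝕜 => f (x + c' • EuclideanSpace.single i 1))
      (pd i f (x + c • EuclideanSpace.single i 1)) c := by
  have h1 := h.hasLineDerivAt
  unfold HasLineDerivAt at h1
  have h2 : HasDerivAt (fun t : 𝕜 => t - c) 1 c := (hasDerivAt_id c).sub_const c
  have h1' : HasDerivAt (fun t : 𝕜 => f (x + c • EuclideanSpace.single i 1 +
      t • EuclideanSpace.single i (1 : 𝕜))) (pd i f (x + c • EuclideanSpace.single i 1))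
      (c - c) := by
    rw [sub_self]; exact h1
  have h3 := HasDerivAt.scomp (h := fun t : 𝕜 => t - c) c h1' h2
  rw [one_smul] at h3
  refine h3.congr_of_eventuallyEq (Eventually.of_forall fun t => ?_)
  simp only [Function.comp_apply]
  congr 1
  rw [add_assoc, ← add_smul]
  congr 2
  ring

/-- A function with continuous partial derivatives is differentiable. -/
theorem hasFDerivAt_of_continuousAt_pd {𝕜 F : Type*} [RCLike 𝕜] [NormedAddCommGroup F]
    [NormedSpace 𝕜 F] {d : ℕ} {f : EuclideanSpace 𝕜 (Fin d) → F}
    {x : EuclideanSpace 𝕜 (Fin d)} (hd : ∀ᶠ z in 𝓝 x, ∀ i, HasPd i f z)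
    (hc : ∀ i, ContinuousAt (pd i f) x) :
    HasFDerivAt f (coordForm (𝕜 := 𝕜) fun i => pd i f x) x := by
  rw [hasFDerivAt_iff_isLittleO_nhds_zero, Asymptotics.isLittleO_iff]
  intro ε hε
  -- Each of the `d` coordinate moves below costs `ε' * ‖h‖`; the extra one in the denominator
  -- covers `d = 0`.
  set ε' : ℝ := ε / (d + 1) with hε'
  have hε'pos : 0 < ε' := by positivity
  have hc' : ∀ᶠ z in 𝓝 x, ∀ i, ‖pd i f z - pd i f x‖ ≤ ε' := by
    refine eventually_all.2 fun i => ?_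
    have := (hc i).eventually (Metric.closedBall_mem_nhds _ hε'pos)
    filter_upwards [this] with z hz
    simpa [dist_eq_norm] using hz
  obtain ⟨r, hr, hball⟩ := Metric.eventually_nhds_iff.1 (hd.and hc')
  filter_upwards [Metric.ball_mem_nhds (0 : EuclideanSpace 𝕜 (Fin d)) hr] with h hh
  have hhr : ‖h‖ < r := by simpa using hh
  -- The coordinates of `h` are switched on one at a time, each by a mean value estimate along a
  -- coordinate line.
  have key : ∀ s : Finset (Fin d),
      ‖f (x + ∑ i ∈ s, h i • EuclideanSpace.single i (1 : 𝕜)) - f x - ∑ i ∈ s, h i • pd i f x‖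
        ≤ s.card * (ε' * ‖h‖) := by
    intro s
    induction s using Finset.induction_on with
    | empty => simp
    | insert a s ha ih =>
      set q : EuclideanSpace 𝕜 (Fin d) := x + ∑ i ∈ s, h i • EuclideanSpace.single i (1 : 𝕜)
      -- The path stays within distance `‖h‖` of `x`, because each coordinate of the displacement is
      -- bounded by that of `h`. A whole disc of `c` is needed, as the mean value inequality over
      -- `𝕜` uses a convex set.
      have hmem : ∀ c ∈ Metric.closedBall (0 : 𝕜) ‖h a‖,
          dist (q + c • EuclideanSpace.single a (1 : 𝕜)) x < r := by
        intro c hcm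
        refine lt_of_le_of_lt ?_ hhr
        rw [dist_eq_norm]
        have e1 : q + c • EuclideanSpace.single a (1 : 𝕜) - x =
            ∑ i ∈ s, h i • EuclideanSpace.single i (1 : 𝕜) + c • EuclideanSpace.single a 1 := by
          simp only [q]; abel
        rw [e1, EuclideanSpace.norm_eq, EuclideanSpace.norm_eq]
        apply Real.sqrt_le_sqrt
        refine Finset.sum_le_sum fun k _ => ?_
        have e2 : (∑ i ∈ s, h i • EuclideanSpace.single i (1 : 𝕜) +
            c • EuclideanSpace.single a 1 : EuclideanSpace 𝕜 (Fin d)) k =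
            (if k ∈ s then h k else 0) + (if k = a then c else 0) := by
          simp [Pi.single_apply]
        rw [e2]
        have hcn : ‖c‖ ≤ ‖h a‖ := by simpa using hcm
        by_cases hka : k = a
        · subst hka
          simp only [ha, if_false, if_true, zero_add]
          gcongr
        · simp only [hka, if_false, add_zero]
          split_ifs
          · exact le_rfl
          · simp
      have hmv : ‖(f (q + (h a) • EuclideanSpace.single a (1 : 𝕜)) - (h a) • pd a f x) -
          (f (q + (0 : 𝕜) • EuclideanSpace.single a (1 : 𝕜)) - (0 : 𝕜) • pd a f x)‖
            ≤ ε' * ‖h a - 0‖ := by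
        refine Convex.norm_image_sub_le_of_norm_hasDerivWithin_le
          (f := fun c : 𝕜 => f (q + c • EuclideanSpace.single a (1 : 𝕜)) - c • pd a f x)
          (f' := fun c : 𝕜 => pd a f (q + c • EuclideanSpace.single a (1 : 𝕜)) - pd a f x)
          (s := Metric.closedBall (0 : 𝕜) ‖h a‖) ?_ ?_ (convex_closedBall _ _) (by simp) (by simp)
        · intro c hcm
          have h1 := hasDerivAt_line_of_hasPd ((hball (hmem c hcm)).1 a)
          have h2 : HasDerivAt (fun c : 𝕜 => c • pd a f x) ((1 : 𝕜) • pd a f x) c :=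
            (hasDerivAt_id c).smul_const _
          rw [one_smul] at h2
          exact (h1.sub h2).hasDerivWithinAt
        · intro c hcm
          exact (hball (hmem c hcm)).2 a
      rw [Finset.sum_insert ha, Finset.sum_insert ha, Finset.card_insert_of_notMem ha]
      have e3 : x + (h a • EuclideanSpace.single a (1 : 𝕜) +
          ∑ i ∈ s, h i • EuclideanSpace.single i (1 : 𝕜)) =
          q + h a • EuclideanSpace.single a (1 : 𝕜) := by simp only [q]; abel
      rw [e3]
      have e4 : f (q + h a • EuclideanSpace.single a (1 : 𝕜)) - f x -
          (h a • pd a f x + ∑ i ∈ s, h i • pd i f x) =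
          ((f (q + (h a) • EuclideanSpace.single a (1 : 𝕜)) - (h a) • pd a f x) -
          (f (q + (0 : 𝕜) • EuclideanSpace.single a (1 : 𝕜)) - (0 : 𝕜) • pd a f x)) +
          (f q - f x - ∑ i ∈ s, h i • pd i f x) := by
        simp only [zero_smul, add_zero]; abel
      rw [e4]
      refine (norm_add_le _ _).trans ?_
      have h5 : ε' * ‖h a - 0‖ ≤ ε' * ‖h‖ := by
        rw [sub_zero]; gcongr; exact PiLp.norm_apply_le h a
      push_cast
      linarith
  have h6 := key Finset.univ
  have h7 : (∑ i, h i • EuclideanSpace.single i (1 : 𝕜) : EuclideanSpace 𝕜 (Fin d)) = h := by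
    ext k
    simp [Pi.single_apply]
  rw [h7] at h6
  rw [coordForm_apply]
  refine h6.trans ?_
  simp only [Finset.card_univ, Fintype.card_fin]
  have : (d : ℝ) * (ε / (d + 1) * ‖h‖) = (d / (d + 1)) * (ε * ‖h‖) := by ring
  rw [hε', this]
  have h8 : (d : ℝ) / (d + 1) ≤ 1 := by rw [div_le_one (by positivity)]; linarith
  exact mul_le_of_le_one_left (by positivity) h8

/-- Interchange of a parameter derivative with a Fréchet derivative: only the mixed derivative
in one order is assumed to exist and to be continuous. -/
theorem hasFDerivAt_deriv_of_mixed {E F : Type*} [NormedAddCommGroup E] [NormedSpace ℝ E]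
    [NormedAddCommGroup F] [NormedSpace ℝ F] {f : E → ℝ → F} {fz fzt : E → ℝ → E →L[ℝ] F}
    {ft : E → F} {z₀ : E} {t₀ : ℝ}
    (hz : ∀ᶠ q : E × ℝ in 𝓝 (z₀, t₀), HasFDerivAt (f · q.2) (fz q.1 q.2) q.1)
    (hzt : ∀ᶠ q : E × ℝ in 𝓝 (z₀, t₀), HasDerivAt (fz q.1 ·) (fzt q.1 q.2) q.2)
    (hc : ContinuousAt (fun q : E × ℝ => fzt q.1 q.2) (z₀, t₀))
    (ht : ∀ᶠ z in 𝓝 z₀, HasDerivAt (f z ·) (ft z) t₀) :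
    HasFDerivAt ft (fzt z₀ t₀) z₀ := by
  rw [hasFDerivAt_iff_isLittleO, Asymptotics.isLittleO_iff]
  intro ε hε
  have hc' : ∀ᶠ q : E × ℝ in 𝓝 (z₀, t₀), ‖fzt q.1 q.2 - fzt z₀ t₀‖ ≤ ε := by
    filter_upwards [hc.eventually (Metric.closedBall_mem_nhds _ hε)] with q hq
    simpa [dist_eq_norm] using hq
  obtain ⟨r, hr, hball⟩ := Metric.eventually_nhds_iff.1 (hz.and (hzt.and hc'))
  filter_upwards [ht, Metric.ball_mem_nhds z₀ hr] with z hzz hzr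
  have hzr' : dist z z₀ < r := hzr
  have hin : ∀ w ∈ Metric.closedBall z₀ (dist z z₀), ∀ t ∈ Metric.ball t₀ r,
      dist (w, t) (z₀, t₀) < r := by
    intro w hw t htt
    rw [Prod.dist_eq]
    exact max_lt (lt_of_le_of_lt hw hzr') htt
  -- A mixed second difference: the mean value inequality in `z` reduces it to an increment of `fz`
  -- in `t`, and the one in `t` to the oscillation of `fzt`.
  have hquot : ∀ h : ℝ, |h| < r →
      ‖(f z (t₀ + h) - f z t₀) - (f z₀ (t₀ + h) - f z₀ t₀) - h • (fzt z₀ t₀ (z - z₀))‖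
        ≤ ε * |h| * ‖z - z₀‖ := by
    intro h hh
    have hth : t₀ + h ∈ Metric.ball t₀ r := by simpa [Real.dist_eq] using hh
    have ht0 : t₀ ∈ Metric.ball t₀ r := Metric.mem_ball_self hr
    have hmv := Convex.norm_image_sub_le_of_norm_hasFDerivWithin_le'
      (f := fun w => f w (t₀ + h) - f w t₀)
      (f' := fun w => fz w (t₀ + h) - fz w t₀) (φ := h • fzt z₀ t₀) (C := ε * |h|)
      (s := Metric.closedBall z₀ (dist z z₀)) (x := z₀) (y := z) ?_ ?_ (convex_closedBall _ _)
      (by simp) (by simp)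
    · simpa using hmv
    · intro w hw
      exact (((hball (hin w hw _ hth)).1).sub ((hball (hin w hw _ ht0)).1)).hasFDerivWithinAt
    · intro w hw
      have hmt := Convex.norm_image_sub_le_of_norm_hasDerivWithin_le
        (f := fun t : ℝ => fz w t - t • fzt z₀ t₀) (f' := fun t => fzt w t - fzt z₀ t₀) (C := ε)
        (s := Metric.ball t₀ r) (x := t₀) (y := t₀ + h) ?_ ?_ (convex_ball _ _) ht0 hth
      · have e : fz w (t₀ + h) - fz w t₀ - h • fzt z₀ t₀ =
            fz w (t₀ + h) - (t₀ + h) • fzt z₀ t₀ - (fz w t₀ - t₀ • fzt z₀ t₀) := by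
          rw [add_smul]; abel
        rw [e]
        simpa using hmt
      · intro t htt
        have h2 : HasDerivAt (fun t : ℝ => t • fzt z₀ t₀) ((1 : ℝ) • fzt z₀ t₀) t :=
          (hasDerivAt_id' t).smul_const (fzt z₀ t₀)
        rw [one_smul] at h2
        exact ((hball (hin w hw t htt)).2.1.sub h2).hasDerivWithinAt
      · intro t htt
        exact (hball (hin w hw t htt)).2.2
  have hz0 : HasDerivAt (f z₀ ·) (ft z₀) t₀ := ht.self_of_nhds
  have hlim : Tendsto (fun h : ℝ => ‖(h⁻¹ • (f z (t₀ + h) - f z t₀)) -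
      (h⁻¹ • (f z₀ (t₀ + h) - f z₀ t₀)) - fzt z₀ t₀ (z - z₀)‖) (𝓝[≠] 0)
      (𝓝 ‖ft z - ft z₀ - fzt z₀ t₀ (z - z₀)‖) :=
    (((hasDerivAt_iff_tendsto_slope_zero.1 hzz).sub
      (hasDerivAt_iff_tendsto_slope_zero.1 hz0)).sub_const _).norm
  -- The bound on the mixed difference is uniform in `h`, so it survives division by `h` and the
  -- limit `h → 0`.
  refine le_of_tendsto hlim ?_
  have hsmall : ∀ᶠ h : ℝ in 𝓝[≠] 0, |h| < r := by
    refine nhdsWithin_le_nhds ?_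
    filter_upwards [Metric.ball_mem_nhds (0 : ℝ) hr] with h hh
    simpa using hh
  filter_upwards [hsmall, self_mem_nhdsWithin] with h hh hne
  have hne' : h ≠ 0 := hne
  have hq := hquot h hh
  have e : (h⁻¹ • (f z (t₀ + h) - f z t₀)) - (h⁻¹ • (f z₀ (t₀ + h) - f z₀ t₀)) -
      fzt z₀ t₀ (z - z₀) = h⁻¹ • ((f z (t₀ + h) - f z t₀) - (f z₀ (t₀ + h) - f z₀ t₀) -
        h • (fzt z₀ t₀ (z - z₀))) := by
    rw [smul_sub h⁻¹ (_ - _) (h • _), smul_smul, inv_mul_cancel₀ hne', one_smul,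
      smul_sub h⁻¹ (f z (t₀ + h) - f z t₀)]
  rw [e, norm_smul, norm_inv, Real.norm_eq_abs]
  have : 0 < |h| := abs_pos.2 hne'
  rw [inv_mul_le_iff₀ this]
  calc _ ≤ _ := hq
    _ = _ := by ring

theorem contDiffOn_succ_of_hasFDerivAt {E F : Type*} [NormedAddCommGroup E] [NormedSpace ℝ E]
    [NormedAddCommGroup F] [NormedSpace ℝ F] {n : ℕ} {f : E → F} {f' : E → E →L[ℝ] F} {D : Set E}
    (hD : IsOpen D) (hf : ∀ x ∈ D, HasFDerivAt f (f' x) x) (hf' : ContDiffOn ℝ n f' D) :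
    ContDiffOn ℝ (n + 1) f D := by
  rw [contDiffOn_succ_iff_fderiv_of_isOpen hD]
  refine ⟨fun x hx => (hf x hx).differentiableAt.differentiableWithinAt, by simp, ?_⟩
  exact hf'.congr fun x hx => (hf x hx).fderiv

end Calculus

end Saddlepoint

namespace Saddlepoint

/-! ### Joint C¹ and C² regularity in a complex dual variable and a real parameter. -/

section Partials

variable {m p : ℕ}

/-- The real-linear form on complex dual vectors with given complex coefficients. -/
noncomputable def complexForm : (Fin m → ℂ) →L[ℝ] (CVec m →L[ℝ] ℂ) :=
  (ContinuousLinearMap.restrictScalarsL ℂ (CVec m) ℂ ℝ ℝ).comp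
    ((coordForm (𝕜 := ℂ) (F := ℂ) (d := m)).restrictScalars ℝ)

@[simp]
theorem complexForm_apply (a : Fin m → ℂ) (w : CVec m) : complexForm a w = ∑ j, w j * a j := by
  change coordForm (𝕜 := ℂ) a w = _
  simp

/-- The first partial derivatives of `f` exist and are continuous on `D`. -/
structure ContPartials (f : CVec m → Vec p → ℂ) (D : Set (CVec m × Vec p)) : Prop where
  hasPd_s : ∀ q ∈ D, ∀ j, HasPd (𝕜 := ℂ) j (fun w => f w q.2) q.1
  hasPd_t : ∀ q ∈ D, ∀ i, HasPd (𝕜 := ℝ) i (fun t => f q.1 t) q.2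
  cont_s : ∀ j, ContinuousOn (fun q : CVec m × Vec p => sPartial j f q.1 q.2) D
  cont_t : ∀ i, ContinuousOn (fun q : CVec m × Vec p => thetaPartial i f q.1 q.2) D

/-- The derivative of `f` in the dual variable. -/
noncomputable def sForm (f : CVec m → Vec p → ℂ) (z : CVec m) (θ : Vec p) : CVec m →L[ℝ] ℂ :=
  complexForm fun j => sPartial j f z θ

/-- The derivative of `f` in the parameter. -/
noncomputable def tForm (f : CVec m → Vec p → ℂ) (z : CVec m) (θ : Vec p) : Vec p →L[ℝ] ℂ :=
  coordForm (𝕜 := ℝ) fun i => thetaPartial i f z θ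

theorem ContPartials.hasFDerivAt_s {f : CVec m → Vec p → ℂ} {D : Set (CVec m × Vec p)}
    (hf : ContPartials f D) (hD : IsOpen D) {q : CVec m × Vec p} (hq : q ∈ D) :
    HasFDerivAt (fun z => f z q.2) (sForm f q.1 q.2) q.1 := by
  have hD' : ∀ᶠ z in 𝓝 q.1, (z, q.2) ∈ D :=
    (Continuous.prodMk_left q.2).continuousAt.eventually (hD.mem_nhds hq)
  have := hasFDerivAt_of_continuousAt_pd (𝕜 := ℂ) (f := fun z => f z q.2) (x := q.1)
    (hD'.mono fun z hz i => hf.hasPd_s _ hz i) (fun j => by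
      have h1 : ContinuousAt (fun q : CVec m × Vec p => sPartial j f q.1 q.2) q :=
        (hf.cont_s j).continuousAt (hD.mem_nhds hq)
      exact ContinuousAt.comp (f := fun z => (z, q.2)) (x := q.1) h1
        (Continuous.prodMk_left q.2).continuousAt)
  exact this.restrictScalars ℝ

theorem ContPartials.hasFDerivAt_t {f : CVec m → Vec p → ℂ} {D : Set (CVec m × Vec p)}
    (hf : ContPartials f D) (hD : IsOpen D) {q : CVec m × Vec p} (hq : q ∈ D) :
    HasFDerivAt (fun t => f q.1 t) (tForm f q.1 q.2) q.2 := by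
  have hD' : ∀ᶠ t in 𝓝 q.2, (q.1, t) ∈ D :=
    (Continuous.prodMk_right q.1).continuousAt.eventually (hD.mem_nhds hq)
  exact hasFDerivAt_of_continuousAt_pd (𝕜 := ℝ) (f := fun t => f q.1 t) (x := q.2)
    (hD'.mono fun z hz i => hf.hasPd_t _ hz i) (fun j => by
      have h1 : ContinuousAt (fun q : CVec m × Vec p => thetaPartial j f q.1 q.2) q :=
        (hf.cont_t j).continuousAt (hD.mem_nhds hq)
      exact ContinuousAt.comp (f := fun t => (q.1, t)) (x := q.2) h1
        (Continuous.prodMk_right q.1).continuousAt)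

theorem ContPartials.continuousOn_sForm {f : CVec m → Vec p → ℂ} {D : Set (CVec m × Vec p)}
    (hf : ContPartials f D) : ContinuousOn (fun q : CVec m × Vec p => sForm f q.1 q.2) D :=
  complexForm.continuous.comp_continuousOn (continuousOn_pi.2 hf.cont_s)

theorem ContPartials.continuousOn_tForm {f : CVec m → Vec p → ℂ} {D : Set (CVec m × Vec p)}
    (hf : ContPartials f D) : ContinuousOn (fun q : CVec m × Vec p => tForm f q.1 q.2) D :=
  coordForm.continuous.comp_continuousOn (continuousOn_pi.2 hf.cont_t)

theorem hasFDerivAt_uncurry_of_partial {E₁ E₂ F : Type*} [NormedAddCommGroup E₁]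
    [NormedSpace ℝ E₁] [NormedAddCommGroup E₂] [NormedSpace ℝ E₂] [NormedAddCommGroup F]
    [NormedSpace ℝ F] {D : Set (E₁ × E₂)} (hD : IsOpen D) {f : E₁ → E₂ → F}
    {f₁ : E₁ → E₂ → E₁ →L[ℝ] F} {f₂ : E₁ → E₂ → E₂ →L[ℝ] F}
    (df₁ : ∀ q ∈ D, HasFDerivAt (f · q.2) (f₁ q.1 q.2) q.1)
    (df₂ : ∀ q ∈ D, HasFDerivAt (f q.1 ·) (f₂ q.1 q.2) q.2)
    (cf₁ : ContinuousOn (fun q : E₁ × E₂ => f₁ q.1 q.2) D)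
    (cf₂ : ContinuousOn (fun q : E₁ × E₂ => f₂ q.1 q.2) D) {q : E₁ × E₂} (hq : q ∈ D) :
    HasFDerivAt (fun q : E₁ × E₂ => f q.1 q.2) ((f₁ q.1 q.2).coprod (f₂ q.1 q.2)) q := by
  have hDq := hD.mem_nhds hq
  exact (hasStrictFDerivAt_uncurry_coprod (𝕜 := ℝ) (f := f) (f₁ := f₁) (f₂ := f₂)
    (mem_of_superset hDq df₁) (mem_of_superset hDq df₂)
    (cf₁.continuousAt hDq) (cf₂.continuousAt hDq)).hasFDerivAt

theorem contDiffOn_one_of_partial {E₁ E₂ F : Type*} [NormedAddCommGroup E₁]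
    [NormedSpace ℝ E₁] [NormedAddCommGroup E₂] [NormedSpace ℝ E₂] [NormedAddCommGroup F]
    [NormedSpace ℝ F] {D : Set (E₁ × E₂)} (hD : IsOpen D) {f : E₁ → E₂ → F}
    {f₁ : E₁ → E₂ → E₁ →L[ℝ] F} {f₂ : E₁ → E₂ → E₂ →L[ℝ] F}
    (df₁ : ∀ q ∈ D, HasFDerivAt (f · q.2) (f₁ q.1 q.2) q.1)
    (df₂ : ∀ q ∈ D, HasFDerivAt (f q.1 ·) (f₂ q.1 q.2) q.2)
    (cf₁ : ContinuousOn (fun q : E₁ × E₂ => f₁ q.1 q.2) D)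
    (cf₂ : ContinuousOn (fun q : E₁ × E₂ => f₂ q.1 q.2) D) :
    ContDiffOn ℝ 1 (fun q : E₁ × E₂ => f q.1 q.2) D := by
  have h := contDiffOn_succ_of_hasFDerivAt (n := 0) hD
    (fun q hq => hasFDerivAt_uncurry_of_partial hD df₁ df₂ cf₁ cf₂ hq) ?_
  · simpa using h
  · have : ContDiffOn ℝ 0 (fun q : E₁ × E₂ => (f₁ q.1 q.2).coprod (f₂ q.1 q.2)) D := by
      rw [contDiffOn_zero]
      exact (ContinuousLinearMap.coprodEquivL (S := ℝ) (𝕜 := ℝ) (E := E₁) (F := E₂) (G := F)).continuous.comp_continuousOn (cf₁.prodMk cf₂)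
    exact_mod_cast this

theorem ContPartials.contDiffOn {f : CVec m → Vec p → ℂ} {D : Set (CVec m × Vec p)}
    (hf : ContPartials f D) (hD : IsOpen D) :
    ContDiffOn ℝ 1 (fun q : CVec m × Vec p => f q.1 q.2) D :=
  contDiffOn_one_of_partial hD (fun _ hq => hf.hasFDerivAt_s hD hq)
    (fun _ hq => hf.hasFDerivAt_t hD hq) hf.continuousOn_sForm hf.continuousOn_tForm

/-- The partial derivatives of `f` up to order two, with the derivatives in the dual variable
taken first, exist and are continuous on `D`. -/
structure ContPartialsTwo (f : CVec m → Vec p → ℂ) (D : Set (CVec m × Vec p)) : Prop where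
  first : ContPartials f D
  second_s : ∀ j, ContPartials (sPartial j f) D
  hasPd_tt : ∀ q ∈ D, ∀ i k, HasPd (𝕜 := ℝ) k (fun t => thetaPartial i f q.1 t) q.2
  cont_tt : ∀ i k, ContinuousOn
    (fun q : CVec m × Vec p => thetaPartial k (thetaPartial i f) q.1 q.2) D

/-- Only `∂_θ ∂_s f` is given, not `∂_s ∂_θ f`. The interchange lemma, applied along the line
through `θ` in direction `i`, produces the second from the first. -/
theorem ContPartialsTwo.hasFDerivAt_thetaPartial_s {f : CVec m → Vec p → ℂ}
    {D : Set (CVec m × Vec p)} (hf : ContPartialsTwo f D) (hD : IsOpen D) (i : Fin p)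
    {q : CVec m × Vec p} (hq : q ∈ D) :
    HasFDerivAt (fun z => thetaPartial i f z q.2)
      (complexForm fun j => thetaPartial i (sPartial j f) q.1 q.2) q.1 := by
  set e : Vec p := EuclideanSpace.single i (1 : ℝ)
  have hcont : Continuous fun r : CVec m × ℝ => ((r.1, q.2 + r.2 • e) : CVec m × Vec p) := by
    fun_prop
  have hev : ∀ᶠ r : CVec m × ℝ in 𝓝 (q.1, 0), (r.1, q.2 + r.2 • e) ∈ D := by
    refine hcont.continuousAt.eventually (hD.mem_nhds ?_)
    simpa using hq
  have := hasFDerivAt_deriv_of_mixed (z₀ := q.1) (t₀ := (0 : ℝ))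
    (f := fun z t => f z (q.2 + t • e)) (fz := fun z t => sForm f z (q.2 + t • e))
    (fzt := fun z t => complexForm fun j => thetaPartial i (sPartial j f) z (q.2 + t • e))
    (ft := fun z => thetaPartial i f z q.2) ?_ ?_ ?_ ?_
  · simpa using this
  · filter_upwards [hev] with r hr
    exact hf.first.hasFDerivAt_s hD hr
  · filter_upwards [hev] with r hr
    refine complexForm.hasFDerivAt.comp_hasDerivAt _ (hasDerivAt_pi.2 fun j => ?_)
    exact hasDerivAt_line_of_hasPd ((hf.second_s j).hasPd_t _ hr i)
  · refine complexForm.continuous.continuousAt.comp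
      (f := fun r : CVec m × ℝ => fun j => thetaPartial i (sPartial j f) r.1 (q.2 + r.2 • e))
      (continuousAt_pi.2 fun j => ?_)
    have h1 : ContinuousAt (fun q : CVec m × Vec p => thetaPartial i (sPartial j f) q.1 q.2)
        (q.1, q.2 + (0 : ℝ) • e) :=
      ((hf.second_s j).cont_t i).continuousAt (hD.mem_nhds (by simpa using hq))
    exact ContinuousAt.comp (f := fun r : CVec m × ℝ => ((r.1, q.2 + r.2 • e) : CVec m × Vec p))
      (x := (q.1, (0 : ℝ))) h1 hcont.continuousAt
  · have hD' : ∀ᶠ z in 𝓝 q.1, (z, q.2) ∈ D :=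
      (Continuous.prodMk_left q.2).continuousAt.eventually (hD.mem_nhds hq)
    filter_upwards [hD'] with z hz
    have h1 := hasDerivAt_line_of_hasPd (c := (0 : ℝ)) (x := q.2) (i := i) (f := fun t => f z t)
      (by simpa using hf.first.hasPd_t _ hz i)
    simpa [thetaPartial] using h1

theorem ContPartialsTwo.contDiffOn_thetaPartial {f : CVec m → Vec p → ℂ}
    {D : Set (CVec m × Vec p)} (hf : ContPartialsTwo f D) (hD : IsOpen D) (i : Fin p) :
    ContDiffOn ℝ 1 (fun q : CVec m × Vec p => thetaPartial i f q.1 q.2) D := by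
  refine contDiffOn_one_of_partial (f := thetaPartial i f)
    (f₁ := fun z θ => complexForm fun j => thetaPartial i (sPartial j f) z θ)
    (f₂ := fun z θ => tForm (thetaPartial i f) z θ) hD
    (fun q hq => hf.hasFDerivAt_thetaPartial_s hD i hq) ?_ ?_ ?_
  · intro q hq
    have hD' : ∀ᶠ t in 𝓝 q.2, (q.1, t) ∈ D :=
      (Continuous.prodMk_right q.1).continuousAt.eventually (hD.mem_nhds hq)
    exact hasFDerivAt_of_continuousAt_pd (𝕜 := ℝ) (f := fun t => thetaPartial i f q.1 t) (x := q.2)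
      (hD'.mono fun z hz k => hf.hasPd_tt _ hz i k) (fun k => by
        have h1 : ContinuousAt
            (fun q : CVec m × Vec p => thetaPartial k (thetaPartial i f) q.1 q.2) q :=
          (hf.cont_tt i k).continuousAt (hD.mem_nhds hq)
        exact ContinuousAt.comp (f := fun t => (q.1, t)) (x := q.2) h1
          (Continuous.prodMk_right q.1).continuousAt)
  · exact complexForm.continuous.comp_continuousOn
      (continuousOn_pi.2 fun j => (hf.second_s j).cont_t i)
  · exact coordForm.continuous.comp_continuousOn (continuousOn_pi.2 fun k => hf.cont_tt i k)

theorem ContPartialsTwo.hasFDerivAt {f : CVec m → Vec p → ℂ} {D : Set (CVec m × Vec p)}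
    (hf : ContPartialsTwo f D) (hD : IsOpen D) {q : CVec m × Vec p} (hq : q ∈ D) :
    HasFDerivAt (fun q : CVec m × Vec p => f q.1 q.2)
      ((sForm f q.1 q.2).coprod (tForm f q.1 q.2)) q :=
  hasFDerivAt_uncurry_of_partial hD (fun _ hq => hf.first.hasFDerivAt_s hD hq)
    (fun _ hq => hf.first.hasFDerivAt_t hD hq) hf.first.continuousOn_sForm
    hf.first.continuousOn_tForm hq

theorem ContPartialsTwo.contDiffOn_tForm {f : CVec m → Vec p → ℂ} {D : Set (CVec m × Vec p)}
    (hf : ContPartialsTwo f D) (hD : IsOpen D) :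
    ContDiffOn ℝ 1 (fun q : CVec m × Vec p => tForm f q.1 q.2) D :=
  (coordForm (𝕜 := ℝ) (F := ℂ) (d := p)).contDiff.comp_contDiffOn (contDiffOn_pi.2 fun i => hf.contDiffOn_thetaPartial hD i)

theorem ContPartialsTwo.contDiffOn {f : CVec m → Vec p → ℂ} {D : Set (CVec m × Vec p)}
    (hf : ContPartialsTwo f D) (hD : IsOpen D) :
    ContDiffOn ℝ 2 (fun q : CVec m × Vec p => f q.1 q.2) D := by
  have h := contDiffOn_succ_of_hasFDerivAt (n := 1) hD (fun q hq => hf.hasFDerivAt hD hq) ?_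
  · exact_mod_cast h
  · have h1 : ContDiffOn ℝ 1 (fun q : CVec m × Vec p => sForm f q.1 q.2) D :=
      complexForm.contDiff.comp_contDiffOn
        (contDiffOn_pi.2 fun j => (hf.second_s j).contDiffOn hD)
    have := (ContinuousLinearMap.coprodEquivL (S := ℝ) (𝕜 := ℝ) (E := CVec m) (F := Vec p) (G := ℂ)).contDiff.comp_contDiffOn
      (h1.prodMk (hf.contDiffOn_tForm hD))
    exact_mod_cast this

end Partials

/-! ### The growth condition provides C² regularity on a tube. -/

section Growth

variable {m p : ℕ} {Θ : Set (Vec p)} {Q : Vec p → Measure (Vec m)}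

/-- The complex arguments with real part in the interior of the joint domain. -/
def tube (Θ : Set (Vec p)) (Q : Vec p → Measure (Vec m)) : Set (CVec m × Vec p) :=
  {q | (rePart q.1, q.2) ∈ interior (jointDomain Θ Q)}

theorem continuous_rePart : Continuous (rePart : CVec m → Vec m) := by
  unfold rePart
  fun_prop

theorem isOpen_tube : IsOpen (tube Θ Q) :=
  isOpen_interior.preimage ((continuous_rePart.comp continuous_fst).prodMk continuous_snd)

@[simp]
theorem rePart_cplx (s φ : Vec m) : rePart (cplx s φ) = s := by
  ext j
  simp [rePart, cplx]

theorem cplx_mem_tube {s φ : Vec m} {θ : Vec p} (h : (s, θ) ∈ interior (jointDomain Θ Q)) :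
    (cplx s φ, θ) ∈ tube Θ Q := by
  simpa [tube] using h

/-- The limit of two dual directions is that of the orders `k = 2`, `ℓ ≤ 2`: every second parameter
derivative in `ContPartialsTwo` comes from there. -/
theorem GrowthBound.contPartialsTwo (h : GrowthBound Θ Q)
    (js : List (Fin m)) (hjs : js.length ≤ 2) : ContPartialsTwo (mgfPartial Q [] js) (tube Θ Q) := by
  obtain ⟨γ, -, -, hs, ht, hb⟩ := h
  refine ⟨⟨?_, ?_, ?_, ?_⟩, fun j => ⟨?_, ?_, ?_, ?_⟩, ?_, ?_⟩
  · intro q hq j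
    exact hs js j (Or.inl ⟨by omega, by omega, by omega⟩) q.1 q.2 hq
  · intro q hq i
    exact ht [] js i (Or.inl ⟨by simp, by simp, by simp; omega⟩) q.1 q.2 hq
  · intro j
    exact (hb [] (j :: js) (Or.inl ⟨by simp, by simp, by simp; omega⟩)).1
  · intro i
    exact (hb [i] js (Or.inl ⟨by simp, by simp, by simp; omega⟩)).1
  · intro q hq k
    exact hs (j :: js) k (Or.inl ⟨by omega, by simp, by simp; omega⟩) q.1 q.2 hq
  · intro q hq i
    exact ht [] (j :: js) i (Or.inl ⟨by simp, by simp, by simp; omega⟩) q.1 q.2 hq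
  · intro k
    exact (hb [] (k :: j :: js) (Or.inl ⟨by simp, by simp, by simp; omega⟩)).1
  · intro i
    exact (hb [i] (j :: js) (Or.inl ⟨by simp, by simp, by simp; omega⟩)).1
  · intro q hq i k
    exact ht [i] js k (Or.inr ⟨by simp, hjs⟩) q.1 q.2 hq
  · intro i k
    exact (hb [k, i] js (Or.inr ⟨by simp, hjs⟩)).1

end Growth

end Saddlepoint

namespace Saddlepoint

/-! ### Fourier inversion for finite measures. -/

section Inversion

open Real FourierTransform
open scoped ContDiff

variable {m : ℕ}

/-- A compactly supported continuous function is a uniform limit of smooth ones supported in the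
same compact set, which has finite measure; so its integrals agree too, and these determine a
regular measure. -/
theorem measure_ext_of_integral_contDiff {μ ν : Measure (Vec m)} [μ.Regular] [ν.Regular]
    (h : ∀ g : Vec m → ℝ, ContDiff ℝ ∞ g → HasCompactSupport g →
      ∫ x, g x ∂μ = ∫ x, g x ∂ν) : μ = ν := by
  refine Measure.ext_of_integral_eq_on_compactlySupported fun f => ?_
  set K : Set (Vec m) := tsupport f
  have hK : IsCompact K := f.hasCompactSupport
  have hex : ∀ k : ℕ, ∃ g : Vec m → ℝ, ContDiff ℝ ∞ g ∧ (∀ x, dist (g x) (f x) < 1 / ((k : ℝ) + 1)) ∧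
      Function.support g ⊆ Function.support f := fun k =>
    f.continuous.exists_contDiff_approx ⊤ continuous_const (fun _ => by positivity)
  choose g hg hgf hgs using hex
  have hgK : ∀ k, tsupport (g k) ⊆ K := fun k => closure_mono (hgs k)
  have hgc : ∀ k, HasCompactSupport (g k) := fun k => hK.of_isClosed_subset isClosed_closure (hgK k)
  have hlim : ∀ (κ : Measure (Vec m)) [κ.Regular],
      Tendsto (fun k => ∫ x, g k x ∂κ) atTop (𝓝 (∫ x, f x ∂κ)) := by
    intro κ _
    obtain ⟨C, hC⟩ := hK.exists_bound_of_continuousOn (f := f) f.continuous.continuousOn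
    refine tendsto_integral_of_dominated_convergence (K.indicator fun _ => C + 1) ?_ ?_ ?_ ?_
    · exact fun k => (hg k).continuous.aestronglyMeasurable
    · rw [integrable_indicator_iff hK.measurableSet]
      exact integrableOn_const hK.measure_lt_top.ne
    · intro k
      refine Eventually.of_forall fun x => ?_
      by_cases hx : x ∈ K
      · rw [Set.indicator_of_mem hx]
        have h1 := (hgf k x).le
        have h2 := hC x hx
        have h3 : 1 / ((k : ℝ) + 1) ≤ 1 := by
          rw [div_le_one (by positivity)]; linarith [(Nat.cast_nonneg k : (0 : ℝ) ≤ k)]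
        have h4 : ‖g k x‖ ≤ ‖g k x - f x‖ + ‖f x‖ := by
          simpa using norm_add_le (g k x - f x) (f x)
        rw [dist_eq_norm] at h1
        linarith
      · rw [Set.indicator_of_notMem hx]
        have : g k x = 0 := image_eq_zero_of_notMem_tsupport fun hx' => hx (hgK k hx')
        simp [this]
    · refine Eventually.of_forall fun x => ?_
      rw [tendsto_iff_dist_tendsto_zero]
      exact squeeze_zero (fun _ => dist_nonneg) (fun k => (hgf k x).le)
        tendsto_one_div_add_atTop_nhds_zero_nat
  refine tendsto_nhds_unique (hlim μ) ?_
  simp_rw [h _ (hg _) (hgc _)]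
  exact hlim ν

/-- The Fourier transform of a finite measure. -/
noncomputable def measFourier (P : Measure (Vec m)) (ξ : Vec m) : ℂ :=
  VectorFourier.fourierIntegral 𝐞 P (innerₗ (Vec m)) 1 ξ

theorem measFourier_eq_charFun (P : Measure (Vec m)) (ξ : Vec m) :
    measFourier P ξ = charFun P ((-(2 * π)) • ξ) := by
  rw [charFun_eq_fourierIntegral', measFourier, smul_smul]
  congr 1
  have : (-(2 * π)⁻¹) * (-(2 * π)) = 1 := by
    have := Real.pi_ne_zero
    field_simp
  rw [this, one_smul]

/-- Write `g = 𝓕 h` with `h` Schwartz and move the transform twice by Fubini: `∫ 𝓕 h dP = ∫ h P̂ = ∫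
(𝓕⁻ g) P̂ = ∫ g 𝓕⁻ P̂`. -/
theorem integral_eq_integral_fourierInv_mul (P : Measure (Vec m)) [IsFiniteMeasure P]
    (hP : Integrable (measFourier P)) {g : Vec m → ℂ} (hg : ContDiff ℝ ∞ g)
    (hgc : HasCompactSupport g) :
    ∫ x, g x ∂P = ∫ x, 𝓕⁻ (measFourier P) x * g x := by
  set G : SchwartzMap (Vec m) ℂ := hgc.toSchwartzMap hg
  have hG : ∀ x, G x = g x := fun x => rfl
  set h : SchwartzMap (Vec m) ℂ := 𝓕⁻ G
  have hFh : 𝓕 (h : Vec m → ℂ) = g := by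
    rw [← SchwartzMap.fourier_coe, FourierTransform.fourier_fourierInv_eq]
    rfl
  have hFg : 𝓕⁻ g = (h : Vec m → ℂ) := by
    rw [SchwartzMap.fourierInv_coe]; rfl
  have h1 := VectorFourier.integral_fourierIntegral_smul_eq_flip (μ := P)
    (ν := (volume : Measure (Vec m))) (L := innerₗ (Vec m)) (f := 1) (g := h)
    Real.continuous_fourierChar continuous_inner (integrable_const (1 : ℂ)) h.integrable
  -- The inverse transform is the Fourier integral for the negated pairing, so the same
  -- self-adjointness applies.
  have h2 := VectorFourier.integral_fourierIntegral_smul_eq_flip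
    (μ := (volume : Measure (Vec m)))
    (ν := (volume : Measure (Vec m))) (L := -innerₗ (Vec m)) (f := measFourier P) (g := g)
    Real.continuous_fourierChar (continuous_inner.neg) hP
    (hg.continuous.integrable_of_hasCompactSupport hgc)
  have e1 : ∀ x, VectorFourier.fourierIntegral 𝐞 (volume : Measure (Vec m)) (innerₗ (Vec m)).flip h x
      = g x := by
    intro x
    rw [← hFh, Real.fourier_eq]
    simp [VectorFourier.fourierIntegral, real_inner_comm]
  have e2 : ∀ x, VectorFourier.fourierIntegral 𝐞 (volume : Measure (Vec m)) (-innerₗ (Vec m))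
      (measFourier P) x = 𝓕⁻ (measFourier P) x := by
    intro x
    rw [Real.fourierInv_eq]
    simp [VectorFourier.fourierIntegral]
  have e3 : ∀ x, VectorFourier.fourierIntegral 𝐞 (volume : Measure (Vec m))
      (-innerₗ (Vec m)).flip g x = h x := by
    intro x
    rw [← hFg, Real.fourierInv_eq]
    simp [VectorFourier.fourierIntegral, real_inner_comm]
  simp only [e1, e2, e3, Pi.one_apply, smul_eq_mul, one_mul] at h1 h2
  rw [h2, ← h1]
  rfl

/-- Hermitian symmetry: the transform of a real measure at `-ξ` is the conjugate of its value at
`ξ`, so `ξ ↦ -ξ` conjugates the integral. -/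
theorem im_fourierInv_measFourier (P : Measure (Vec m)) (x : Vec m) :
    (𝓕⁻ (measFourier P) x).im = 0 := by
  rw [← Complex.conj_eq_iff_im, Real.fourierInv_eq', ← integral_conj, ← integral_neg_eq_self]
  refine integral_congr_ae (Eventually.of_forall fun ξ => ?_)
  simp only [measFourier_eq_charFun, smul_eq_mul, map_mul, ← Complex.exp_conj, smul_neg,
    charFun_neg, Complex.conj_conj, inner_neg_left, Complex.conj_ofReal, Complex.conj_I]
  congr 2
  push_cast
  ring

theorem isContinuousDensity_of_integrable (P : Measure (Vec m)) [IsFiniteMeasure P]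
    (hP : Integrable (measFourier P)) :
    IsContinuousDensity P fun x => (𝓕⁻ (measFourier P) x).re := by
  set F : Vec m → ℂ := 𝓕⁻ (measFourier P)
  have hFc : Continuous F := by
    have : F = fun x => 𝓕 (measFourier P) (-x) := by
      ext x; exact Real.fourierInv_eq_fourier_neg _ _
    rw [this]
    exact (VectorFourier.fourierIntegral_continuous (μ := volume) Real.continuous_fourierChar
      (L := innerₗ (Vec m)) continuous_inner hP).comp continuous_neg
  set f : Vec m → ℝ := fun x => (F x).re
  have hfc : Continuous f := Complex.continuous_re.comp hFc
  have hFf : ∀ x, F x = (f x : ℂ) := fun x =>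
    Complex.ext rfl (by simpa using im_fourierInv_measFourier P x)
  have htest : ∀ g : Vec m → ℝ, ContDiff ℝ ∞ g → HasCompactSupport g →
      ∫ x, g x ∂P = ∫ x, f x * g x := by
    intro g hg hgc
    have h1 := integral_eq_integral_fourierInv_mul P hP (g := fun x => (g x : ℂ))
      (Complex.ofRealCLM.contDiff.comp hg) (hgc.comp_left (g := Complex.ofReal) (by simp))
    have h2 : ∀ x, 𝓕⁻ (measFourier P) x * (g x : ℂ) = ((f x * g x : ℝ) : ℂ) := by
      intro x
      have := hFf x
      simp only [F] at this
      rw [this]; push_cast; rfl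
    simp_rw [h2] at h1
    rw [integral_complex_ofReal, integral_complex_ofReal] at h1
    exact_mod_cast h1
  -- Near a negative value of `f`, a bump function would have negative integral against `f` but
  -- nonnegative integral against `P`.
  have hf0 : ∀ x, 0 ≤ f x := by
    intro x₀
    by_contra hneg
    push Not at hneg
    have hU : {x | f x < 0} ∈ 𝓝 x₀ := (isOpen_lt hfc continuous_const).mem_nhds hneg
    obtain ⟨g, hgs, hgc, hgd, hgr, hg1⟩ := exists_contDiff_tsupport_subset (n := ⊤) hU
    have hg0 : ∀ x, 0 ≤ g x := fun x => (hgr ⟨x, rfl⟩).1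
    have h1 := htest g hgd hgc
    have h2 : 0 ≤ ∫ x, g x ∂P := integral_nonneg hg0
    have h3 : 0 < ∫ x, -(f x * g x) := by
      refine Continuous.integral_pos_of_hasCompactSupport_nonneg_nonzero (x := x₀)
        (hfc.mul hgd.continuous).neg ?_ ?_ ?_
      · exact (hgc.mul_left (f := f)).neg
      · intro x
        by_cases hx : x ∈ tsupport g
        · have : f x < 0 := hgs hx
          simp only [Pi.zero_apply]
          nlinarith [hg0 x]
        · simp [image_eq_zero_of_notMem_tsupport hx]
      · rw [hg1]; simpa using hneg.ne
    rw [integral_neg] at h3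
    linarith
  refine ⟨hfc, hf0, ?_⟩
  have hlf : IsLocallyFiniteMeasure (volume.withDensity fun x => ENNReal.ofReal (f x)) :=
    IsLocallyFiniteMeasure.withDensity_ofReal hfc
  refine measure_ext_of_integral_contDiff fun g hg hgc => ?_
  rw [htest g hg hgc, integral_withDensity_eq_integral_toReal_smul]
  · simp [ENNReal.toReal_ofReal, hf0]
  · exact hfc.measurable.ennreal_ofReal
  · simp

end Inversion

/-! ### Exponential tilting and the inversion formula for the density. -/

section Density

open Real

variable {m : ℕ}

/-- Continuous densities agree almost everywhere, hence everywhere, so the choice in `density` is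
immaterial. -/
theorem density_eq_of_isContinuousDensity {P : Measure (Vec m)} [IsFiniteMeasure P]
    {f : Vec m → ℝ} (hf : IsContinuousDensity P f) : density P = f := by
  have hex : ∃ f : Vec m → ℝ, IsContinuousDensity P f := ⟨f, hf⟩
  have hd : density P = hex.choose := by
    ext x
    simp only [density, dif_pos hex]
  rw [hd]
  obtain ⟨hc, h0, hP⟩ := hex.choose_spec
  set g := hex.choose
  have hfin : ∫⁻ x, ENNReal.ofReal (f x) ≠ ⊤ := by
    have := measure_ne_top P Set.univ
    rw [hf.2.2] at this
    simpa using this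
  have h1 : volume.withDensity (fun x => ENNReal.ofReal (f x)) =
      volume.withDensity fun x => ENNReal.ofReal (g x) := by rw [← hf.2.2, ← hP]
  rw [withDensity_eq_iff hf.1.measurable.ennreal_ofReal.aemeasurable
    hc.measurable.ennreal_ofReal.aemeasurable hfin] at h1
  refine (hf.1.ae_eq_iff_eq volume hc).1 ?_ |>.symm
  filter_upwards [h1] with x hx
  exact (ENNReal.ofReal_eq_ofReal_iff (hf.2.1 x) (h0 x)).1 hx

theorem sum_cplx_mul (s φ x : Vec m) : ∑ j, cplx s φ j * (x j : ℂ) =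
    ((inner ℝ s x : ℝ) : ℂ) + ((inner ℝ φ x : ℝ) : ℂ) * Complex.I := by
  simp only [cplx, PiLp.inner_apply, RCLike.inner_apply, conj_trivial]
  push_cast
  rw [Finset.sum_mul, ← Finset.sum_add_distrib]
  refine Finset.sum_congr rfl fun j _ => ?_
  ring

theorem mgfC_cplx_zero (P : Measure (Vec m)) (s : Vec m) :
    mgfC P (cplx s 0) = ((∫ x, Real.exp (inner ℝ s x) ∂P : ℝ) : ℂ) := by
  rw [mgfC, ← integral_complex_ofReal]
  refine integral_congr_ae (Eventually.of_forall fun x => ?_)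
  simp [sum_cplx_mul]

theorem integral_exp_pos_of_mem {P : Measure (Vec m)} [IsProbabilityMeasure P] {s : Vec m}
    (hs : s ∈ expDomain P) : 0 < ∫ x, Real.exp (inner ℝ s x) ∂P :=
  integral_exp_pos hs

/-- Tilting shifts the argument of the generating function by `s`, so the decay condition becomes a
bound on an honest characteristic function. -/
theorem charFun_tilted {P : Measure (Vec m)} (s φ : Vec m) :
    charFun (P.tilted fun x => inner ℝ s x) φ = mgfC P (cplx s φ) / mgfC P (cplx s 0) := by
  rw [charFun_apply, integral_tilted, mgfC_cplx_zero, mgfC, ← integral_div]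
  refine integral_congr_ae (Eventually.of_forall fun x => ?_)
  simp only [sum_cplx_mul, Complex.exp_add, Complex.real_smul]
  rw [real_inner_comm φ x]
  push_cast
  ring

/-- The exponential inversion formula: if the characteristic function of the tilted law is
integrable, then the law has a continuous density. -/
theorem density_eq_integral {P : Measure (Vec m)} [IsProbabilityMeasure P] {s : Vec m}
    (hs : s ∈ expDomain P)
    (hint : Integrable fun φ : Vec m => mgfC P (cplx s φ) / mgfC P (cplx s 0)) (x : Vec m) :
    ((density P x : ℝ) : ℂ) = (((2 * π) ^ m)⁻¹ * (∫ y, Real.exp (inner ℝ s y) ∂P) *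
        Real.exp (-inner ℝ s x) : ℝ) *
      ∫ φ : Vec m, mgfC P (cplx s φ) / mgfC P (cplx s 0) *
        Complex.exp (-((inner ℝ φ x : ℝ) : ℂ) * Complex.I) := by
  set T : Measure (Vec m) := P.tilted fun x => inner ℝ s x
  have hT : IsProbabilityMeasure T := isProbabilityMeasure_tilted hs
  set Z : ℝ := ∫ y, Real.exp (inner ℝ s y) ∂P
  have hZ : 0 < Z := integral_exp_pos hs
  have hπ : (-(2 * π)) ≠ 0 := by have := Real.pi_pos; linarith
  have hTint : Integrable (measFourier T) := by
    have : measFourier T = fun ξ => (fun φ => charFun T φ) ((-(2 * π)) • ξ) := by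
      ext ξ; exact measFourier_eq_charFun T ξ
    rw [this]
    refine Integrable.comp_smul (f := fun φ => charFun T φ) ?_ hπ
    simpa only [T, charFun_tilted] using hint
  have hdens := isContinuousDensity_of_integrable T hTint
  obtain ⟨hc, h0, hTd⟩ := hdens
  set f : Vec m → ℝ := fun x => (FourierTransform.fourierInv (measFourier T) x).re
  -- The tilt is undone by multiplying with the reciprocal of its density.
  have hP : IsContinuousDensity P fun x => Z * Real.exp (-inner ℝ s x) * f x := by
    refine ⟨by fun_prop, fun x => mul_nonneg (by positivity) (h0 x), ?_⟩
    have h1 : P = T.withDensity fun x => ENNReal.ofReal (Z * Real.exp (-inner ℝ s x)) := by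
      simp only [T, Measure.tilted]
      rw [← withDensity_mul _ (by fun_prop) (by fun_prop)]
      have : ((fun x : Vec m => ENNReal.ofReal (Real.exp (inner ℝ s x) / Z)) *
          fun x => ENNReal.ofReal (Z * Real.exp (-inner ℝ s x))) = 1 := by
        ext x
        simp only [Pi.mul_apply, Pi.one_apply]
        rw [← ENNReal.ofReal_mul (by positivity), Real.exp_neg]
        have := (Real.exp_pos (inner ℝ s x)).ne'
        have e : Real.exp (inner ℝ s x) / Z * (Z * (Real.exp (inner ℝ s x))⁻¹) = 1 := by
          field_simp
        rw [e, ENNReal.ofReal_one]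
      change P = P.withDensity ((fun x : Vec m => ENNReal.ofReal (Real.exp (inner ℝ s x) / Z)) *
          fun x => ENNReal.ofReal (Z * Real.exp (-inner ℝ s x)))
      rw [this, withDensity_one]
    conv_lhs => rw [h1, hTd]
    rw [← withDensity_mul _ hc.measurable.ennreal_ofReal (by fun_prop)]
    congr 1
    ext x
    simp only [Pi.mul_apply]
    rw [← ENNReal.ofReal_mul (h0 x), mul_comm]
  rw [density_eq_of_isContinuousDensity hP]
  have hfx : (f x : ℂ) = ((((2 * π) ^ m)⁻¹ : ℝ) : ℂ) * ∫ φ : Vec m, charFun T φ *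
      Complex.exp (-((inner ℝ φ x : ℝ) : ℂ) * Complex.I) := by
    have e0 : (f x : ℂ) = FourierTransform.fourierInv (measFourier T) x :=
      Complex.ext (by simp [f]) (by simpa using (im_fourierInv_measFourier T x).symm)
    rw [e0, Real.fourierInv_eq']
    -- The substitution `φ = -2π ξ` passes from the transform to the characteristic function and
    -- produces `(2π)⁻ᵐ`.
    have := Measure.integral_comp_smul (volume : Measure (Vec m))
      (fun φ : Vec m => charFun T φ * Complex.exp (-((inner ℝ φ x : ℝ) : ℂ) * Complex.I))
      (-(2 * π))
    have e1 : |((-(2 * π)) ^ Module.finrank ℝ (Vec m))⁻¹| = ((2 * π) ^ m)⁻¹ := by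
      rw [abs_inv, abs_pow, abs_neg, abs_of_pos (by positivity : 0 < 2 * π)]
      simp
    rw [e1, Complex.real_smul] at this
    rw [← this]
    refine integral_congr_ae (Eventually.of_forall fun ξ => ?_)
    simp only [measFourier_eq_charFun, smul_eq_mul, inner_smul_left]
    rw [mul_comm]
    congr 2
    simp
  have e4 : ∀ φ, charFun T φ = mgfC P (cplx s φ) / mgfC P (cplx s 0) := charFun_tilted s
  simp only [e4] at hfx
  push_cast at hfx ⊢
  rw [hfx]
  ring

end Density

/-! ### Generating functions of sums of independent copies. -/

section SumLaw

variable {m : ℕ} (P : Measure (Vec m)) [IsProbabilityMeasure P] (n : ℕ)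

instance : IsProbabilityMeasure (sumLaw P n) := by
  unfold sumLaw
  exact Measure.isProbabilityMeasure_map (by fun_prop)

theorem mgfC_sumLaw (z : CVec m) : mgfC (sumLaw P n) z = mgfC P z ^ n := by
  rw [mgfC, sumLaw, integral_map (by fun_prop) (Continuous.aestronglyMeasurable (by fun_prop))]
  have : ∀ y : Fin n → Vec m, Complex.exp (∑ j, z j * (((∑ i, y i : Vec m) j : ℝ) : ℂ)) =
      ∏ i, Complex.exp (∑ j, z j * (y i j : ℂ)) := by
    intro y
    rw [← Complex.exp_sum, Finset.sum_comm]
    congr 1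
    refine Finset.sum_congr rfl fun j _ => ?_
    simp [Finset.mul_sum]
  simp_rw [this]
  rw [integral_fintype_prod_eq_prod (fun (_ : Fin n) (x : Vec m) => Complex.exp (∑ j, z j * (x j : ℂ)))]
  simp [mgfC]

theorem integral_exp_sumLaw (s : Vec m) :
    ∫ x, Real.exp (inner ℝ s x) ∂(sumLaw P n) = (∫ x, Real.exp (inner ℝ s x) ∂P) ^ n := by
  have h := mgfC_sumLaw P n (cplx s 0)
  rw [mgfC_cplx_zero, mgfC_cplx_zero] at h
  exact_mod_cast h

theorem cumGF_sumLaw : cumGF (sumLaw P n) = fun s => n * cumGF P s := by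
  ext s
  rw [cumGF, integral_exp_sumLaw, Real.log_pow, cumGF]

/-- The integral of a non-integrable function is zero by convention, while that of an integrable
exponential is positive. Integrability is thereby encoded in the value, which is known for sums. -/
theorem mem_expDomain_iff {P : Measure (Vec m)} [IsProbabilityMeasure P] {s : Vec m} :
    s ∈ expDomain P ↔ ∫ x, Real.exp (inner ℝ s x) ∂P ≠ 0 :=
  ⟨fun h => (integral_exp_pos h).ne', fun h => by
    by_contra hc
    exact h (integral_undef hc)⟩

/-- The empty sum is a point mass with all exponential moments finite, hence `n ≠ 0`. -/
theorem expDomain_sumLaw (hn : n ≠ 0) : expDomain (sumLaw P n) = expDomain P := by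
  ext s
  rw [mem_expDomain_iff, mem_expDomain_iff, integral_exp_sumLaw]
  simp [hn]

end SumLaw

end Saddlepoint

namespace Saddlepoint

/-! ### Parametric Laplace integrals: domination and differentiation under the integral. -/

section Laplace

variable {m : ℕ} {E : Type*} [NormedAddCommGroup E] [NormedSpace ℝ E]

/-- The oscillating factor `exp(-i φ x)`. -/
noncomputable def osc (x φ : Vec m) : ℂ := Complex.exp (-((inner ℝ φ x : ℝ) : ℂ) * Complex.I)

@[simp]
theorem norm_osc (x φ : Vec m) : ‖osc x φ‖ = 1 := by
  rw [osc, ← Complex.ofReal_neg, Complex.norm_exp_ofReal_mul_I]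

theorem continuous_osc (x : Vec m) : Continuous (osc x) := by
  unfold osc
  fun_prop

/-- The bilinear form `(v, w) ↦ c v * f w`. -/
noncomputable def tensor (c f : E →L[ℝ] ℂ) : E →L[ℝ] E →L[ℝ] ℂ :=
  ((ContinuousLinearMap.lsmul ℝ ℂ).flip f).comp c

@[simp]
theorem tensor_apply (c f : E →L[ℝ] ℂ) (v w : E) : tensor c f v w = c v * f w := by
  simp [tensor]

theorem norm_tensor_le (c f : E →L[ℝ] ℂ) : ‖tensor c f‖ ≤ ‖c‖ * ‖f‖ := by
  refine ContinuousLinearMap.opNorm_le_bound _ (by positivity) fun v => ?_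
  refine ContinuousLinearMap.opNorm_le_bound _ (by positivity) fun w => ?_
  rw [tensor_apply, norm_mul]
  calc ‖c v‖ * ‖f w‖ ≤ (‖c‖ * ‖v‖) * (‖f‖ * ‖w‖) := by
        gcongr
        · exact c.le_opNorm v
        · exact f.le_opNorm w
    _ = ‖c‖ * ‖f‖ * ‖v‖ * ‖w‖ := by ring

theorem continuous_tensor :
    Continuous fun x : (E →L[ℝ] ℂ) × (E →L[ℝ] ℂ) => tensor x.1 x.2 := by
  unfold tensor
  exact (((ContinuousLinearMap.lsmul ℝ ℂ).flip).continuous.comp continuous_snd).clm_comp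
    continuous_fst

instance : ContinuousAdd (E →L[ℝ] E →L[ℝ] ℂ) :=
  (SeminormedAddCommGroup.toIsTopologicalAddGroup (E := E →L[ℝ] E →L[ℝ] ℂ)).toContinuousAdd

instance : TopologicalSpace.PseudoMetrizableSpace (E →L[ℝ] E →L[ℝ] ℂ) :=
  PseudoEMetricSpace.pseudoMetrizableSpace (α := E →L[ℝ] E →L[ℝ] ℂ)

instance : ContinuousSMul ℂ (E →L[ℝ] E →L[ℝ] ℂ) :=
  (NormedSpace.toIsBoundedSMul (𝕜 := ℂ) (E := E →L[ℝ] E →L[ℝ] ℂ)).continuousSMul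

instance : NormSMulClass ℝ (E →L[ℝ] E →L[ℝ] ℂ) :=
  NormedSpace.toNormSMulClass (𝕜 := ℝ) (E := E →L[ℝ] E →L[ℝ] ℂ)

instance : NormSMulClass ℂ (E →L[ℝ] E →L[ℝ] ℂ) :=
  NormedSpace.toNormSMulClass (𝕜 := ℂ) (E := E →L[ℝ] E →L[ℝ] ℂ)

noncomputable instance : ContinuousENorm (E →L[ℝ] E →L[ℝ] ℂ) :=
  SeminormedAddGroup.toContinuousENorm (E := E →L[ℝ] E →L[ℝ] ℂ)

/-- The data of a parametric Laplace integral `∫ ρ(φ, s, θ) ^ n exp(-i n φ k(s, θ)) dφ`. -/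
structure LaplaceData (ρ : Vec m → Vec m × E → ℂ) (D₁ : Vec m → Vec m × E → E →L[ℝ] ℂ)
    (D₂ : Vec m → Vec m × E → E →L[ℝ] E →L[ℝ] ℂ) (k : Vec m × E → Vec m)
    (A : Vec m →L[ℝ] Vec m) (B : E →L[ℝ] Vec m) (q₀ : Vec m × E)
    (N : Set (Vec m × E)) (δ C : ℝ) (d : ℕ) : Prop where
  isOpen : IsOpen N
  mem : q₀ ∈ N
  delta_pos : 0 < δ
  const_nonneg : 0 ≤ C
  decay : ∀ q ∈ N, ∀ φ, ‖ρ φ q‖ ≤ (1 + δ * ‖φ‖ ^ 2) ^ (-δ)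
  cont_zero : ∀ q ∈ N, ∀ φ, ContinuousAt (fun x : Vec m × (Vec m × E) => ρ x.1 x.2) (φ, q)
  cont_one : ∀ q ∈ N, ∀ φ, ContinuousAt (fun x : Vec m × (Vec m × E) => D₁ x.1 x.2) (φ, q)
  cont_two : ∀ q ∈ N, ∀ φ, ContinuousAt (fun x : Vec m × (Vec m × E) => D₂ x.1 x.2) (φ, q)
  deriv_one : ∀ q ∈ N, ∀ φ, HasFDerivAt (fun θ => ρ φ (q.1, θ)) (D₁ φ q) q.2
  deriv_two : ∀ q ∈ N, ∀ φ, HasFDerivAt (fun θ => D₁ φ (q.1, θ)) (D₂ φ q) q.2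
  bound_one : ∀ q ∈ N, ∀ φ, ‖D₁ φ q‖ ≤ C * ‖φ‖ * (1 + ‖φ‖) ^ d
  bound_two : ∀ q ∈ N, ∀ φ, ‖D₂ φ q‖ ≤ C * (1 + ‖φ‖) ^ d
  at_zero : ρ 0 q₀ = 1
  two_at_zero : D₂ 0 q₀ = 0
  lim_zero : ∀ ψ : Vec m, Tendsto (fun x : ℕ × (Vec m × E) =>
    (ρ ((Real.sqrt x.1)⁻¹ • ψ) x.2 * osc (k x.2) ((Real.sqrt x.1)⁻¹ • ψ)) ^ x.1) (atTop ×ˢ 𝓝 q₀)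
    (𝓝 (Real.exp (-(inner ℝ ψ (A ψ) / 2)) : ℝ))
  lim_one : ∀ ψ : Vec m, Tendsto (fun x : ℕ × (Vec m × E) =>
    Real.sqrt x.1 • D₁ ((Real.sqrt x.1)⁻¹ • ψ) x.2) (atTop ×ˢ 𝓝 q₀)
    (𝓝 (Complex.I • Complex.ofRealCLM.comp ((innerSL ℝ ψ).comp B)))

/-- Bernoulli's inequality: `(1 + δt)^(-δ(n-2))` is the power `-R` of `(1 + δt)^w ≥ 1 + wδt`, with
`w = δ(n-2)/R` of order `n`. The exponent is `n - 2` because two parameter derivatives of an `n`-th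
power leave that many factors. -/
theorem pow_decay {δ : ℝ} (hδ : 0 < δ) (R : ℕ) (hR : 0 < R) : ∃ c > 0, ∃ n₀ : ℕ, 4 ≤ n₀ ∧
    ∀ n ≥ n₀, ∀ t ≥ (0 : ℝ), ∀ a ≥ (0 : ℝ), a ≤ (1 + δ * t) ^ (-δ) →
      a ^ (n - 2) ≤ ((1 + c * (n * t)) ^ R)⁻¹ := by
  -- This makes `w ≥ 1`, as Bernoulli requires; `n ≥ 4` gives `n ≤ 2 (n - 2)`, the source of the
  -- factor two in the constant.
  obtain ⟨n₁, hn₁⟩ := exists_nat_ge (2 + R / δ)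
  refine ⟨δ ^ 2 / (2 * R), by positivity, max n₁ 4, le_max_right _ _, fun n hn t ht a ha hat => ?_⟩
  have hn4 : 4 ≤ n := (le_max_right _ _).trans hn
  have hnn₁ : (n₁ : ℝ) ≤ n := by exact_mod_cast (le_max_left _ _).trans hn
  have hRpos : (0 : ℝ) < R := by exact_mod_cast hR
  have hn2 : ((n - 2 : ℕ) : ℝ) = (n : ℝ) - 2 := by
    rw [Nat.cast_sub (by omega)]; norm_num
  have hn4' : (4 : ℝ) ≤ n := by exact_mod_cast hn4
  set u := 1 + δ * t
  have hu : 1 ≤ u := by simp only [u]; nlinarith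
  have hu0 : 0 ≤ u := by linarith
  set w : ℝ := δ * ((n : ℝ) - 2) / R
  have hw : 1 ≤ w := by
    rw [le_div_iff₀ hRpos, one_mul]
    have : R / δ ≤ (n : ℝ) - 2 := by linarith
    rwa [div_le_iff₀' hδ] at this
  have h1 : a ^ (n - 2) ≤ (u ^ (-δ)) ^ (n - 2) := by gcongr
  have h2 : (u ^ (-δ)) ^ (n - 2) = ((u ^ w) ^ R)⁻¹ := by
    rw [← Real.rpow_natCast, ← Real.rpow_mul hu0, ← Real.rpow_natCast, ← Real.rpow_mul hu0,
      ← Real.rpow_neg hu0, hn2]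
    congr 1
    simp only [w]
    field_simp
  rw [h2] at h1
  refine h1.trans ?_
  have h3 : 1 + w * (δ * t) ≤ u ^ w :=
    one_add_mul_self_le_rpow_one_add (by nlinarith) hw
  have h4 : δ ^ 2 / (2 * R) * (n * t) ≤ w * (δ * t) := by
    simp only [w]
    rw [div_mul_eq_mul_div, div_mul_eq_mul_div, div_le_div_iff₀ (by positivity) hRpos]
    have : (n : ℝ) ≤ 2 * ((n : ℝ) - 2) := by linarith
    have h5 : 0 ≤ δ ^ 2 * t * R := by positivity
    nlinarith
  have h6 : 0 < 1 + δ ^ 2 / (2 * R) * (n * t) := by positivity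
  gcongr
  linarith

namespace LaplaceData

variable {ρ : Vec m → Vec m × E → ℂ} {D₁ : Vec m → Vec m × E → E →L[ℝ] ℂ}
    {D₂ : Vec m → Vec m × E → E →L[ℝ] E →L[ℝ] ℂ} {k : Vec m × E → Vec m}
    {A : Vec m →L[ℝ] Vec m} {B : E →L[ℝ] Vec m} {q₀ : Vec m × E}
    {N : Set (Vec m × E)} {δ C : ℝ} {d : ℕ}

theorem norm_le_one (h : LaplaceData ρ D₁ D₂ k A B q₀ N δ C d) {q : Vec m × E} (hq : q ∈ N)
    (φ : Vec m) : ‖ρ φ q‖ ≤ 1 := by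
  have hδ := h.delta_pos
  refine (h.decay q hq φ).trans (Real.rpow_le_one_of_one_le_of_nonpos ?_ (by linarith))
  have : 0 ≤ δ * ‖φ‖ ^ 2 := by positivity
  linarith

/-- The weak decay of one factor, raised to a large power, beats any given polynomial in the
rescaled variable `√n ‖φ‖`, uniformly in `n` and `q`. -/
theorem weight_bound (h : LaplaceData ρ D₁ D₂ k A B q₀ N δ C d) (r : ℕ) :
    ∃ K ≥ 0, ∃ n₀ : ℕ, 4 ≤ n₀ ∧ ∀ n ≥ n₀, ∀ q ∈ N, ∀ φ : Vec m,
      ‖ρ φ q‖ ^ (n - 2) ≤ K * ((1 + Real.sqrt n * ‖φ‖) ^ r)⁻¹ := by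
  obtain ⟨c, hc, n₀, hn₀, hb⟩ := pow_decay h.delta_pos (r + 1) (Nat.succ_pos r)
  refine ⟨(2 * max 1 (1 / c)) ^ (r + 1), by positivity, n₀, hn₀, fun n hn q hq φ => ?_⟩
  refine (hb n hn (‖φ‖ ^ 2) (by positivity) _ (norm_nonneg _) (h.decay q hq φ)).trans ?_
  set x := Real.sqrt n * ‖φ‖
  have hx : 0 ≤ x := by positivity
  have hx2 : (n : ℝ) * ‖φ‖ ^ 2 = x ^ 2 := by
    simp only [x]; rw [mul_pow, Real.sq_sqrt (Nat.cast_nonneg n)]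
  rw [hx2]
  have h1 : (1 + x) ^ r ≤ (2 * max 1 (1 / c)) ^ (r + 1) * (1 + c * x ^ 2) ^ (r + 1) := by
    rw [← mul_pow]
    have h2 : (1 + x) ^ r ≤ (1 + x) ^ (2 * (r + 1)) :=
      pow_le_pow_right₀ (by linarith) (by omega)
    refine h2.trans ?_
    rw [pow_mul]
    gcongr
    have h3 : 1 ≤ max 1 (1 / c) := le_max_left _ _
    have h4 : 1 / c ≤ max 1 (1 / c) := le_max_right _ _
    rw [div_le_iff₀ hc] at h4
    have h5 : x ^ 2 ≤ max 1 (1 / c) * c * x ^ 2 := le_mul_of_one_le_left (by positivity) h4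
    nlinarith [sq_nonneg (x - 1)]
  have h6 : 0 < (1 + x) ^ r := by positivity
  have h7 : 0 < (1 + c * x ^ 2) ^ (r + 1) := by positivity
  rw [← div_eq_mul_inv, inv_le_comm₀ h7 (by positivity), inv_div, div_le_iff₀' (by positivity)]
  exact h1

/-- The bound used to dominate all integrands. -/
theorem weight_bound' (h : LaplaceData ρ D₁ D₂ k A B q₀ N δ C d) :
    ∃ K ≥ 0, ∃ n₀ : ℕ, 4 ≤ n₀ ∧ ∀ n ≥ n₀, ∀ q ∈ N, ∀ φ : Vec m,
      ‖ρ φ q‖ ^ (n - 2) * (1 + Real.sqrt n * ‖φ‖) ^ (2 * d + 2) ≤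
        K * (1 + Real.sqrt n * ‖φ‖) ^ (-((m : ℝ) + 1)) := by
  -- `2 * d + 2` powers absorb the growth of the integrands, and `m + 1` powers remain for
  -- integrability on an `m`-dimensional space.
  obtain ⟨K, hK, n₀, hn₀, hb⟩ := h.weight_bound (2 * d + 2 + (m + 1))
  refine ⟨K, hK, n₀, hn₀, fun n hn q hq φ => ?_⟩
  set x := 1 + Real.sqrt n * ‖φ‖
  have hx : 0 < x := by positivity
  calc ‖ρ φ q‖ ^ (n - 2) * x ^ (2 * d + 2) ≤
      K * (x ^ (2 * d + 2 + (m + 1)))⁻¹ * x ^ (2 * d + 2) := by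
        gcongr; exact hb n hn q hq φ
    _ = K * x ^ (-((m : ℝ) + 1)) := by
        have e : x ^ (-((m : ℝ) + 1)) = (x ^ (m + 1))⁻¹ := by
          rw [Real.rpow_neg hx.le]
          congr 1
          exact_mod_cast Real.rpow_natCast x (m + 1)
        rw [e, pow_add x (2 * d + 2) (m + 1), mul_inv]
        field_simp

theorem integrable_dom (K : ℝ) :
    Integrable fun φ : Vec m => K * (1 + ‖φ‖) ^ (-((m : ℝ) + 1)) :=
  (integrable_one_add_norm (by simp)).const_mul K

/-- The Laplace integral. -/
noncomputable def int₀ (ρ : Vec m → Vec m × E → ℂ) (n : ℕ) (x : Vec m) (q : Vec m × E) : ℂ :=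
  ∫ φ, ρ φ q ^ n * osc x φ

/-- The integrand of the first parameter derivative of the Laplace integral. -/
noncomputable def integrand₁ (ρ : Vec m → Vec m × E → ℂ)
    (D₁ : Vec m → Vec m × E → E →L[ℝ] ℂ) (n : ℕ) (x : Vec m) (q : Vec m × E)
    (φ : Vec m) : E →L[ℝ] ℂ :=
  ((n : ℂ) * ρ φ q ^ (n - 1) * osc x φ) • D₁ φ q

/-- The integrand of the second parameter derivative of the Laplace integral. -/
noncomputable def integrand₂ (ρ : Vec m → Vec m × E → ℂ)
    (D₁ : Vec m → Vec m × E → E →L[ℝ] ℂ)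
    (D₂ : Vec m → Vec m × E → E →L[ℝ] E →L[ℝ] ℂ) (n : ℕ) (x : Vec m)
    (q : Vec m × E) (φ : Vec m) : E →L[ℝ] E →L[ℝ] ℂ :=
  ((n : ℂ) * ((n - 1 : ℕ) : ℂ) * ρ φ q ^ (n - 2) * osc x φ) • tensor (D₁ φ q) (D₁ φ q) +
    ((n : ℂ) * ρ φ q ^ (n - 1) * osc x φ) • D₂ φ q

theorem pow_le (h : LaplaceData ρ D₁ D₂ k A B q₀ N δ C d) {q : Vec m × E} (hq : q ∈ N)
    (φ : Vec m) {n j : ℕ} (hj : n - 2 ≤ j) : ‖ρ φ q‖ ^ j ≤ ‖ρ φ q‖ ^ (n - 2) :=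
  pow_le_pow_of_le_one (norm_nonneg _) (h.norm_le_one hq φ) hj

/-- The bound on `D₁` vanishes linearly at `φ = 0`, so `n ‖φ‖ = √n (√n ‖φ‖)` and the derivative
costs only `√n`. -/
theorem norm_integrand₁_le (h : LaplaceData ρ D₁ D₂ k A B q₀ N δ C d) {q : Vec m × E}
    (hq : q ∈ N) {n : ℕ} (hn : 1 ≤ n) (x φ : Vec m) :
    ‖integrand₁ ρ D₁ n x q φ‖ ≤
      Real.sqrt n * C * (‖ρ φ q‖ ^ (n - 2) * (1 + Real.sqrt n * ‖φ‖) ^ (2 * d + 2)) := by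
  have hC := h.const_nonneg
  set y := Real.sqrt n
  have hy1 : 1 ≤ y := Real.one_le_sqrt.2 (by exact_mod_cast hn)
  have hy2 : (n : ℝ) = y * y := (Real.mul_self_sqrt (Nat.cast_nonneg n)).symm
  rw [integrand₁, norm_smul, norm_mul, norm_mul, norm_pow, norm_osc, mul_one,
    Complex.norm_natCast, hy2]
  have hb := h.bound_one q hq φ
  have h1 : ‖φ‖ ≤ y * ‖φ‖ := le_mul_of_one_le_left (norm_nonneg _) hy1
  have h0 := norm_nonneg φ
  have h2 : (y * ‖φ‖) * (1 + ‖φ‖) ^ d ≤ (1 + y * ‖φ‖) ^ (2 * d + 2) := by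
    calc (y * ‖φ‖) * (1 + ‖φ‖) ^ d ≤ (1 + y * ‖φ‖) * (1 + y * ‖φ‖) ^ d := by
          gcongr
          linarith
      _ = (1 + y * ‖φ‖) ^ (d + 1) := by ring
      _ ≤ _ := pow_le_pow_right₀ (by nlinarith) (by omega)
  calc y * y * ‖ρ φ q‖ ^ (n - 1) * ‖D₁ φ q‖
      ≤ y * y * ‖ρ φ q‖ ^ (n - 2) * (C * ‖φ‖ * (1 + ‖φ‖) ^ d) := by
        gcongr ?_ * ?_ * ?_
        · exact h.pow_le hq φ (by omega)
    _ = y * C * (‖ρ φ q‖ ^ (n - 2) * ((y * ‖φ‖) * (1 + ‖φ‖) ^ d)) := by ring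
    _ ≤ _ := by gcongr

/-- In the `n²` term both factors `D₁` are linear in `φ`, each saving `√n`; hence it costs `n`, like
the `D₂` term. -/
theorem norm_integrand₂_le (h : LaplaceData ρ D₁ D₂ k A B q₀ N δ C d) {q : Vec m × E}
    (hq : q ∈ N) {n : ℕ} (hn : 1 ≤ n) (x φ : Vec m) :
    ‖integrand₂ ρ D₁ D₂ n x q φ‖ ≤
      n * (C ^ 2 + C) * (‖ρ φ q‖ ^ (n - 2) * (1 + Real.sqrt n * ‖φ‖) ^ (2 * d + 2)) := by
  have hC := h.const_nonneg
  set y := Real.sqrt n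
  have hy1 : 1 ≤ y := Real.one_le_sqrt.2 (by exact_mod_cast hn)
  have hy2 : (n : ℝ) = y * y := (Real.mul_self_sqrt (Nat.cast_nonneg n)).symm
  have hb1 := h.bound_one q hq φ
  have hb2 := h.bound_two q hq φ
  have h1 : ‖φ‖ ≤ y * ‖φ‖ := le_mul_of_one_le_left (norm_nonneg _) hy1
  have h0 := norm_nonneg φ
  have hy0 : 0 ≤ y * ‖φ‖ := by positivity
  have h2 : (y * ‖φ‖) ^ 2 * (1 + ‖φ‖) ^ (2 * d) ≤ (1 + y * ‖φ‖) ^ (2 * d + 2) := by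
    calc (y * ‖φ‖) ^ 2 * (1 + ‖φ‖) ^ (2 * d) ≤
          (1 + y * ‖φ‖) ^ 2 * (1 + y * ‖φ‖) ^ (2 * d) := by
          gcongr
          linarith
      _ = (1 + y * ‖φ‖) ^ (2 * d + 2) := by ring
  have h3 : (1 + ‖φ‖) ^ d ≤ (1 + y * ‖φ‖) ^ (2 * d + 2) := by
    calc (1 + ‖φ‖) ^ d ≤ (1 + y * ‖φ‖) ^ d := by gcongr
      _ ≤ _ := pow_le_pow_right₀ (by linarith) (by omega)
  have hn1 : ((n - 1 : ℕ) : ℝ) ≤ y * y := by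
    rw [← hy2]; exact_mod_cast Nat.sub_le n 1
  rw [integrand₂]
  refine le_trans (norm_add_le (E := E →L[ℝ] E →L[ℝ] ℂ) _ _) ?_
  refine le_trans (add_le_add ((norm_smul _ _).le) ((norm_smul _ _).le)) ?_
  rw [norm_mul, norm_mul, norm_mul, norm_mul, norm_mul, norm_pow, norm_pow,
    norm_osc, mul_one, mul_one, Complex.norm_natCast, Complex.norm_natCast]
  have ht := norm_tensor_le (D₁ φ q) (D₁ φ q)
  have e1 : (n : ℝ) * ((n - 1 : ℕ) : ℝ) * ‖ρ φ q‖ ^ (n - 2) * ‖tensor (D₁ φ q) (D₁ φ q)‖ ≤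
      n * C ^ 2 * (‖ρ φ q‖ ^ (n - 2) * (1 + y * ‖φ‖) ^ (2 * d + 2)) := by
    calc (n : ℝ) * ((n - 1 : ℕ) : ℝ) * ‖ρ φ q‖ ^ (n - 2) * ‖tensor (D₁ φ q) (D₁ φ q)‖
        ≤ n * (y * y) * ‖ρ φ q‖ ^ (n - 2) *
          ((C * ‖φ‖ * (1 + ‖φ‖) ^ d) * (C * ‖φ‖ * (1 + ‖φ‖) ^ d)) := by
          gcongr ?_ * ?_ * ?_ * ?_
          refine ht.trans ?_
          gcongr
      _ = n * C ^ 2 * (‖ρ φ q‖ ^ (n - 2) * ((y * ‖φ‖) ^ 2 * (1 + ‖φ‖) ^ (2 * d))) := by ring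
      _ ≤ _ := by gcongr
  have e2 : (n : ℝ) * ‖ρ φ q‖ ^ (n - 1) * ‖D₂ φ q‖ ≤
      n * C * (‖ρ φ q‖ ^ (n - 2) * (1 + y * ‖φ‖) ^ (2 * d + 2)) := by
    calc (n : ℝ) * ‖ρ φ q‖ ^ (n - 1) * ‖D₂ φ q‖ ≤
        n * ‖ρ φ q‖ ^ (n - 2) * (C * (1 + ‖φ‖) ^ d) := by
          gcongr ?_ * ?_ * ?_
          exact h.pow_le hq φ (by omega)
      _ = n * C * (‖ρ φ q‖ ^ (n - 2) * (1 + ‖φ‖) ^ d) := by ring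
      _ ≤ _ := by gcongr
  calc _ ≤ _ := add_le_add e1 e2
    _ = _ := by ring

theorem norm_integrand₀_le (h : LaplaceData ρ D₁ D₂ k A B q₀ N δ C d) {q : Vec m × E}
    (hq : q ∈ N) (n : ℕ) (x φ : Vec m) : ‖ρ φ q ^ n * osc x φ‖ ≤
      ‖ρ φ q‖ ^ (n - 2) * (1 + Real.sqrt n * ‖φ‖) ^ (2 * d + 2) := by
  rw [norm_mul, norm_osc, mul_one, norm_pow]
  calc ‖ρ φ q‖ ^ n ≤ ‖ρ φ q‖ ^ (n - 2) * 1 := by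
        rw [mul_one]; exact h.pow_le hq φ (by omega)
    _ ≤ _ := by
        gcongr
        exact one_le_pow₀ (by
          have : 0 ≤ Real.sqrt n * ‖φ‖ := by positivity
          linarith)

theorem continuous_slice {X : Type*} [TopologicalSpace X]
    {F : Vec m → Vec m × E → X} {N : Set (Vec m × E)}
    (hF : ∀ q ∈ N, ∀ φ, ContinuousAt (fun x : Vec m × (Vec m × E) => F x.1 x.2) (φ, q))
    {q : Vec m × E} (hq : q ∈ N) : Continuous fun φ => F φ q :=
  continuous_iff_continuousAt.2 fun φ =>
    ContinuousAt.comp (f := fun φ => (φ, q)) (x := φ) (hF q hq φ)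
      (Continuous.prodMk_left q).continuousAt

theorem continuous_integrand₁ (h : LaplaceData ρ D₁ D₂ k A B q₀ N δ C d) {q : Vec m × E}
    (hq : q ∈ N) (n : ℕ) (x : Vec m) : Continuous (integrand₁ ρ D₁ n x q) :=
  ((continuous_const.mul ((continuous_slice h.cont_zero hq).pow _)).mul (continuous_osc x)).smul
    (continuous_slice h.cont_one hq)

theorem continuous_integrand₂ (h : LaplaceData ρ D₁ D₂ k A B q₀ N δ C d) {q : Vec m × E}
    (hq : q ∈ N) (n : ℕ) (x : Vec m) : Continuous (integrand₂ ρ D₁ D₂ n x q) := by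
  have h0 := continuous_slice h.cont_zero hq
  have h1 := continuous_slice h.cont_one hq
  have h2 := continuous_slice h.cont_two hq
  exact (((continuous_const.mul (h0.pow _)).mul (continuous_osc x)).smul
    (continuous_tensor.comp (h1.prodMk h1))).add
    (((continuous_const.mul (h0.pow _)).mul (continuous_osc x)).smul h2)

theorem continuous_integrand₀ (h : LaplaceData ρ D₁ D₂ k A B q₀ N δ C d) {q : Vec m × E}
    (hq : q ∈ N) (n : ℕ) (x : Vec m) : Continuous fun φ => ρ φ q ^ n * osc x φ :=
  ((continuous_slice h.cont_zero hq).pow _).mul (continuous_osc x)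

theorem dom_mono {n : ℕ} (hn : 1 ≤ n) (φ : Vec m) :
    (1 + Real.sqrt n * ‖φ‖) ^ (-((m : ℝ) + 1)) ≤ (1 + ‖φ‖) ^ (-((m : ℝ) + 1)) := by
  have hy1 : 1 ≤ Real.sqrt n := Real.one_le_sqrt.2 (by exact_mod_cast hn)
  have h1 : ‖φ‖ ≤ Real.sqrt n * ‖φ‖ := le_mul_of_one_le_left (norm_nonneg _) hy1
  refine Real.rpow_le_rpow_of_nonpos (by positivity) (by linarith) ?_
  have : (0 : ℝ) ≤ m := Nat.cast_nonneg m
  linarith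

theorem hasFDerivAt_integrand₀ (h : LaplaceData ρ D₁ D₂ k A B q₀ N δ C d) {q : Vec m × E}
    (hq : q ∈ N) (n : ℕ) (x φ : Vec m) :
    HasFDerivAt (fun θ => ρ φ (q.1, θ) ^ n * osc x φ) (integrand₁ ρ D₁ n x q φ) q.2 := by
  have h1 := ((h.deriv_one q hq φ).pow n).mul_const (osc x φ)
  refine h1.congr_fderiv ?_
  ext v
  simp [integrand₁]
  ring

theorem hasFDerivAt_integrand₁ (h : LaplaceData ρ D₁ D₂ k A B q₀ N δ C d) {q : Vec m × E}
    (hq : q ∈ N) (n : ℕ) (x φ : Vec m) :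
    HasFDerivAt (fun θ => integrand₁ ρ D₁ n x (q.1, θ) φ) (integrand₂ ρ D₁ D₂ n x q φ) q.2 := by
  have h1 := (((h.deriv_one q hq φ).pow (n - 1)).const_mul (n : ℂ)).mul_const (osc x φ)
  have h2 := h1.smul (h.deriv_two q hq φ)
  refine h2.congr_fderiv ?_
  ext v w
  simp [integrand₂, Nat.sub_sub]
  ring

/-- For large `n` the Laplace integral is twice differentiable in the parameter, with the
derivatives taken under the integral sign. -/
theorem exists_hasFDerivAt (h : LaplaceData ρ D₁ D₂ k A B q₀ N δ C d) : ∃ n₀ : ℕ, 4 ≤ n₀ ∧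
    ∀ n ≥ n₀, ∀ q ∈ N, ∀ x : Vec m,
      Integrable (fun φ => ρ φ q ^ n * osc x φ) ∧
      ContinuousAt (fun y : Vec m × (Vec m × E) => int₀ ρ n y.1 y.2) (x, q) ∧
      HasFDerivAt (fun θ => int₀ ρ n x (q.1, θ)) (∫ φ, integrand₁ ρ D₁ n x q φ) q.2 ∧
      HasFDerivAt (fun θ => ∫ φ, integrand₁ ρ D₁ n x (q.1, θ) φ)
        (∫ φ, integrand₂ ρ D₁ D₂ n x q φ) q.2 := by
  obtain ⟨K, hK, n₀, hn₀, hb⟩ := h.weight_bound'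
  have hC := h.const_nonneg
  refine ⟨n₀, hn₀, fun n hn q hq x => ?_⟩
  have hn1 : 1 ≤ n := by omega
  -- For fixed `n` the rescaling may be dropped, giving one integrable bound for all `q` in `N`.
  have hw : ∀ q ∈ N, ∀ φ : Vec m,
      ‖ρ φ q‖ ^ (n - 2) * (1 + Real.sqrt n * ‖φ‖) ^ (2 * d + 2) ≤
        K * (1 + ‖φ‖) ^ (-((m : ℝ) + 1)) := fun q hq φ =>
    (hb n hn q hq φ).trans (mul_le_mul_of_nonneg_left (dom_mono hn1 φ) hK)
  have hb0 : ∀ q ∈ N, ∀ x φ, ‖ρ φ q ^ n * osc x φ‖ ≤ K * (1 + ‖φ‖) ^ (-((m : ℝ) + 1)) :=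
    fun q hq x φ => (h.norm_integrand₀_le hq n x φ).trans (hw q hq φ)
  have hb1 : ∀ q ∈ N, ∀ φ, ‖integrand₁ ρ D₁ n x q φ‖ ≤
      Real.sqrt n * C * (K * (1 + ‖φ‖) ^ (-((m : ℝ) + 1))) := fun q hq φ =>
    (h.norm_integrand₁_le hq hn1 x φ).trans (mul_le_mul_of_nonneg_left (hw q hq φ) (by positivity))
  have hb2 : ∀ q ∈ N, ∀ φ, ‖integrand₂ ρ D₁ D₂ n x q φ‖ ≤
      n * (C ^ 2 + C) * (K * (1 + ‖φ‖) ^ (-((m : ℝ) + 1))) := fun q hq φ =>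
    (h.norm_integrand₂_le hq hn1 x φ).trans (mul_le_mul_of_nonneg_left (hw q hq φ) (by positivity))
  have hi0 : Integrable fun φ => ρ φ q ^ n * osc x φ :=
    (integrable_dom K).mono' (h.continuous_integrand₀ hq n x).aestronglyMeasurable
      (Eventually.of_forall fun φ => hb0 q hq x φ)
  have hi1 : Integrable (integrand₁ ρ D₁ n x q) :=
    ((integrable_dom K).const_mul _).mono' (h.continuous_integrand₁ hq n x).aestronglyMeasurable
      (Eventually.of_forall fun φ => hb1 q hq φ)
  have hN : ∀ᶠ θ in 𝓝 q.2, (q.1, θ) ∈ N :=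
    (Continuous.prodMk_right q.1).continuousAt.eventually (h.isOpen.mem_nhds hq)
  refine ⟨hi0, ?_, ?_, ?_⟩
  · refine continuousAt_of_dominated (bound := fun φ => K * (1 + ‖φ‖) ^ (-((m : ℝ) + 1))) ?_ ?_
      (integrable_dom K) ?_
    · filter_upwards [continuous_snd.continuousAt.eventually (h.isOpen.mem_nhds hq)] with y hy
      exact (h.continuous_integrand₀ hy n y.1).aestronglyMeasurable
    · filter_upwards [continuous_snd.continuousAt.eventually (h.isOpen.mem_nhds hq)] with y hy
      exact Eventually.of_forall fun φ => hb0 y.2 hy y.1 φ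
    · refine Eventually.of_forall fun φ => ?_
      have h1 : ContinuousAt (fun y : Vec m × (Vec m × E) => ρ φ y.2) (x, q) :=
        ContinuousAt.comp (f := fun y : Vec m × (Vec m × E) => (φ, y.2)) (x := (x, q))
          (h.cont_zero q hq φ) (by fun_prop)
      refine (h1.pow n).mul ?_
      unfold osc
      fun_prop
  · refine hasFDerivAt_integral_of_dominated_of_fderiv_le (𝕜 := ℝ) (s := {θ | (q.1, θ) ∈ N})
      (F' := fun θ φ => integrand₁ ρ D₁ n x (q.1, θ) φ)
      (bound := fun φ => Real.sqrt n * C * (K * (1 + ‖φ‖) ^ (-((m : ℝ) + 1)))) hN ?_ hi0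
      hi1.aestronglyMeasurable ?_ ((integrable_dom K).const_mul _) ?_
    · filter_upwards [hN] with θ hθ
      exact (h.continuous_integrand₀ hθ n x).aestronglyMeasurable
    · exact Eventually.of_forall fun φ θ hθ => hb1 _ hθ φ
    · exact Eventually.of_forall fun φ θ hθ => h.hasFDerivAt_integrand₀ hθ n x φ
  · refine hasFDerivAt_integral_of_dominated_of_fderiv_le (𝕜 := ℝ) (s := {θ | (q.1, θ) ∈ N})
      (F' := fun θ φ => integrand₂ ρ D₁ D₂ n x (q.1, θ) φ)
      (bound := fun φ => n * (C ^ 2 + C) * (K * (1 + ‖φ‖) ^ (-((m : ℝ) + 1)))) hN ?_ hi1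
      (h.continuous_integrand₂ hq n x).aestronglyMeasurable ?_
      ((integrable_dom K).const_mul _) ?_
    · filter_upwards [hN] with θ hθ
      exact (h.continuous_integrand₁ hθ n x).aestronglyMeasurable
    · exact Eventually.of_forall fun φ θ hθ => hb2 _ hθ φ
    · exact Eventually.of_forall fun φ θ hθ => h.hasFDerivAt_integrand₁ hθ n x φ

end LaplaceData

end Laplace

end Saddlepoint

namespace Saddlepoint

/-! ### Gaussian second moments by integration by parts. -/

section GaussianMoments

variable {m : ℕ}

/-- The unnormalised Gaussian density with precision operator `A`. -/
noncomputable def gaussKernel (A : Vec m →L[ℝ] Vec m) (ψ : Vec m) : ℝ :=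
  Real.exp (-(inner ℝ ψ (A ψ) / 2))

theorem continuous_gaussKernel (A : Vec m →L[ℝ] Vec m) : Continuous (gaussKernel A) := by
  unfold gaussKernel
  fun_prop

theorem gaussKernel_pos (A : Vec m →L[ℝ] Vec m) (ψ : Vec m) : 0 < gaussKernel A ψ :=
  Real.exp_pos _

theorem gaussKernel_neg (A : Vec m →L[ℝ] Vec m) (ψ : Vec m) :
    gaussKernel A (-ψ) = gaussKernel A ψ := by
  simp [gaussKernel]

/-- The second moments of a Gaussian kernel. -/
theorem integral_inner_mul_inner_gaussKernel {A : Vec m →L[ℝ] Vec m}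
    (hA : ∀ x y, inner ℝ (A x) y = inner ℝ x (A y))
    (hint : Integrable fun ψ : Vec m => (1 + ‖ψ‖) ^ 2 * gaussKernel A ψ) (u b : Vec m) :
    ∫ ψ, inner ℝ ψ b * inner ℝ ψ (A u) * gaussKernel A ψ =
      inner ℝ u b * ∫ ψ, gaussKernel A ψ := by
  have hG := continuous_gaussKernel A
  have hdom : ∀ (f : Vec m → ℝ) (c : ℝ), Continuous f → (∀ ψ, |f ψ| ≤ c * (1 + ‖ψ‖) ^ 2) →
      Integrable fun ψ => f ψ * gaussKernel A ψ := by
    intro f c hf hb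
    refine (hint.const_mul c).mono' (hf.mul hG).aestronglyMeasurable
      (Eventually.of_forall fun ψ => ?_)
    rw [norm_mul, Real.norm_eq_abs, Real.norm_of_nonneg (gaussKernel_pos A ψ).le, ← mul_assoc]
    exact mul_le_mul_of_nonneg_right (hb ψ) (gaussKernel_pos A ψ).le
  have hlin : ∀ (b ψ : Vec m), |inner ℝ ψ b| ≤ ‖b‖ * (1 + ‖ψ‖) ^ 2 := by
    intro b ψ
    have h1 := abs_real_inner_le_norm ψ b
    have h2 : ‖ψ‖ ≤ (1 + ‖ψ‖) ^ 2 := by nlinarith [norm_nonneg ψ]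
    calc _ ≤ ‖ψ‖ * ‖b‖ := h1
      _ ≤ (1 + ‖ψ‖) ^ 2 * ‖b‖ := by gcongr
      _ = _ := mul_comm _ _
  have hquad : ∀ ψ : Vec m, |inner ℝ ψ b * inner ℝ ψ (A u)| ≤ (‖b‖ * ‖A u‖) * (1 + ‖ψ‖) ^ 2 := by
    intro ψ
    rw [abs_mul]
    calc |inner ℝ ψ b| * |inner ℝ ψ (A u)| ≤ (‖ψ‖ * ‖b‖) * (‖ψ‖ * ‖A u‖) := by
          gcongr <;> exact abs_real_inner_le_norm _ _
      _ = (‖b‖ * ‖A u‖) * ‖ψ‖ ^ 2 := by ring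
      _ ≤ _ := by gcongr; linarith [norm_nonneg ψ]
  -- By symmetry of `A`, the derivative of the kernel in direction `u` is `-⟪ψ, A u⟫` times the
  -- kernel; integrate by parts against `⟪ψ, b⟫`.
  have h1 := integral_bilinear_hasLineDerivAt_right_eq_neg_left_of_integrable
    (μ := (volume : Measure (Vec m))) (f := fun ψ => inner ℝ ψ b) (f' := fun _ => inner ℝ u b)
    (g := gaussKernel A) (g' := fun ψ => -(inner ℝ ψ (A u)) * gaussKernel A ψ) (v := u)
    (B := ContinuousLinearMap.mul ℝ ℝ) ?_ ?_ ?_ ?_ ?_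
  · simp only [ContinuousLinearMap.mul_apply'] at h1
    rw [integral_const_mul] at h1
    have h2 : ∀ ψ : Vec m, inner ℝ ψ b * (-(inner ℝ ψ (A u)) * gaussKernel A ψ) =
        -(inner ℝ ψ b * inner ℝ ψ (A u) * gaussKernel A ψ) := fun ψ => by ring
    simp_rw [h2] at h1
    rw [integral_neg] at h1
    linarith
  · refine hdom (fun _ => inner ℝ u b) |inner ℝ u b| continuous_const fun ψ => ?_
    exact le_mul_of_one_le_right (abs_nonneg _) (one_le_pow₀ (by linarith [norm_nonneg ψ]))
  · have := (hdom (fun ψ => inner ℝ ψ b * inner ℝ ψ (A u)) _ (by fun_prop) hquad).neg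
    refine this.congr (Eventually.of_forall fun ψ => ?_)
    simp only [ContinuousLinearMap.mul_apply', Pi.neg_apply]
    ring
  · exact hdom (fun ψ => inner ℝ ψ b) _ (by fun_prop) (hlin b)
  · intro ψ _
    have : HasFDerivAt (fun ψ : Vec m => inner ℝ ψ b) (innerSL ℝ b) ψ := by
      have := (innerSL ℝ b).hasFDerivAt (x := ψ)
      refine this.congr_of_eventuallyEq (Eventually.of_forall fun y => ?_)
      simp [real_inner_comm]
    have h2 := this.hasLineDerivAt u
    simpa [real_inner_comm] using h2
  · intro ψ _
    have h3 : HasFDerivAt (fun ψ : Vec m => inner ℝ ψ (A ψ)) _ ψ :=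
      (hasFDerivAt_id ψ).inner ℝ A.hasFDerivAt
    have h4 := ((h3.mul_const (1 / 2 : ℝ)).neg.exp).hasLineDerivAt u
    have h5 : (fun ψ : Vec m => Real.exp (-(inner ℝ ψ (A ψ) * (1 / 2)))) = gaussKernel A := by
      ext ψ; simp only [gaussKernel]; congr 1; ring
    have h6 : HasLineDerivAt ℝ (fun ψ : Vec m => Real.exp (-(inner ℝ ψ (A ψ) * (1 / 2))))
      (-(inner ℝ ψ (A u)) * gaussKernel A ψ) ψ u := by
      have e1 : inner ℝ u (A ψ) = inner ℝ ψ (A u) := by rw [← hA, real_inner_comm]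
      have e2 : -(inner ℝ ψ (A ψ) * (1 / 2)) = -(inner ℝ ψ (A ψ) / 2) := by ring
      have e3 : (Real.exp (-(inner ℝ ψ (A ψ) * (1 / 2))) • -((1 / 2 : ℝ) •
          (fderivInnerCLM ℝ (ψ, A ψ)).comp ((ContinuousLinearMap.id ℝ (Vec m)).prod A))) u =
          -(inner ℝ ψ (A u)) * gaussKernel A ψ := by
        simp only [gaussKernel, fderivInnerCLM_apply, ContinuousLinearMap.comp_apply, smul_apply,
          neg_apply, ContinuousLinearMap.prod_apply, smul_eq_mul, ContinuousLinearMap.id_apply]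
        rw [e1, e2]
        ring
      rw [← e3]
      exact h4
    rwa [h5] at h6

end GaussianMoments

/-! ### Limits of the rescaled integrals, jointly in `n → ∞` and `q → q₀`. -/

section Limits

variable {m : ℕ} {E : Type*} [NormedAddCommGroup E] [NormedSpace ℝ E]

theorem tendsto_sqrt_inv : Tendsto (fun n : ℕ => (Real.sqrt n)⁻¹) atTop (𝓝 0) :=
  tendsto_inv_atTop_zero.comp (Real.tendsto_sqrt_atTop.comp tendsto_natCast_atTop_atTop)

theorem osc_natCast_smul (n : ℕ) (x φ : Vec m) : osc ((n : ℝ) • x) φ = osc x φ ^ n := by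
  rw [osc, osc, ← Complex.exp_nat_mul, inner_smul_right]
  congr 1
  push_cast
  ring

theorem integral_comp_sqrt_inv_smul {F : Type*} [NormedAddCommGroup F] [NormedSpace ℝ F]
    (f : Vec m → F) (n : ℕ) :
    ∫ ψ, f ((Real.sqrt n)⁻¹ • ψ) = (Real.sqrt n ^ m) • ∫ φ, f φ := by
  rw [Measure.integral_comp_smul]
  congr 1
  rw [inv_pow, inv_inv]
  simp only [finrank_euclideanSpace, Fintype.card_fin]
  exact abs_of_nonneg (by positivity)

namespace LaplaceData

variable {ρ : Vec m → Vec m × E → ℂ} {D₁ : Vec m → Vec m × E → E →L[ℝ] ℂ}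
    {D₂ : Vec m → Vec m × E → E →L[ℝ] E →L[ℝ] ℂ} {k : Vec m × E → Vec m}
    {A : Vec m →L[ℝ] Vec m} {B : E →L[ℝ] Vec m} {q₀ : Vec m × E}
    {N : Set (Vec m × E)} {δ C : ℝ} {d : ℕ}

theorem tendsto_scaled (ψ : Vec m) :
    Tendsto (fun x : ℕ × (Vec m × E) => ((Real.sqrt x.1)⁻¹ • ψ, x.2)) (atTop ×ˢ 𝓝 q₀)
      (𝓝 ((0 : Vec m), q₀)) := by
  refine Tendsto.prodMk_nhds ?_ tendsto_snd
  have := (tendsto_sqrt_inv.comp (tendsto_fst (f := atTop) (g := 𝓝 q₀))).smul_const ψ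
  simpa [Function.comp_def] using this

theorem tendsto_rho (h : LaplaceData ρ D₁ D₂ k A B q₀ N δ C d) (ψ : Vec m) :
    Tendsto (fun x : ℕ × (Vec m × E) => ρ ((Real.sqrt x.1)⁻¹ • ψ) x.2) (atTop ×ˢ 𝓝 q₀)
      (𝓝 1) := by
  have := (h.cont_zero q₀ h.mem 0).tendsto.comp (tendsto_scaled (q₀ := q₀) ψ)
  simpa only [h.at_zero, Function.comp_def] using this

theorem tendsto_two (h : LaplaceData ρ D₁ D₂ k A B q₀ N δ C d) (ψ : Vec m) :
    Tendsto (fun x : ℕ × (Vec m × E) => D₂ ((Real.sqrt x.1)⁻¹ • ψ) x.2) (atTop ×ˢ 𝓝 q₀)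
      (𝓝 0) := by
  have := (h.cont_two q₀ h.mem 0).tendsto.comp (tendsto_scaled (q₀ := q₀) ψ)
  simpa only [h.two_at_zero, Function.comp_def] using this

theorem eventually_ge (N₀ : ℕ) :
    ∀ᶠ x : ℕ × (Vec m × E) in atTop ×ˢ 𝓝 q₀, N₀ ≤ x.1 :=
  tendsto_fst.eventually (eventually_ge_atTop N₀)

theorem eventually_mem (h : LaplaceData ρ D₁ D₂ k A B q₀ N δ C d) :
    ∀ᶠ x : ℕ × (Vec m × E) in atTop ×ˢ 𝓝 q₀, x.2 ∈ N :=
  tendsto_snd.eventually (h.isOpen.mem_nhds h.mem)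

/-- Dropping finitely many factors is harmless: each tends to `1` at the argument `ψ / √n`. -/
theorem tendsto_weight (h : LaplaceData ρ D₁ D₂ k A B q₀ N δ C d) (ψ : Vec m) (j : ℕ) :
    Tendsto (fun x : ℕ × (Vec m × E) => ρ ((Real.sqrt x.1)⁻¹ • ψ) x.2 ^ (x.1 - j) *
      osc ((x.1 : ℝ) • k x.2) ((Real.sqrt x.1)⁻¹ • ψ)) (atTop ×ˢ 𝓝 q₀)
      (𝓝 (gaussKernel A ψ : ℂ)) := by
  have h1 := (h.tendsto_rho ψ)
  have h2 : Tendsto (fun x : ℕ × (Vec m × E) =>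
      (ρ ((Real.sqrt x.1)⁻¹ • ψ) x.2 * osc (k x.2) ((Real.sqrt x.1)⁻¹ • ψ)) ^ x.1 *
        ((ρ ((Real.sqrt x.1)⁻¹ • ψ) x.2)⁻¹) ^ j) (atTop ×ˢ 𝓝 q₀)
      (𝓝 ((gaussKernel A ψ : ℂ) * (1⁻¹) ^ j)) :=
    (h.lim_zero ψ).mul ((h1.inv₀ one_ne_zero).pow j)
  rw [inv_one, one_pow, mul_one] at h2
  refine h2.congr' ?_
  filter_upwards [h1.eventually_ne one_ne_zero, eventually_ge j] with x hx hj
  rw [osc_natCast_smul, mul_pow, pow_sub₀ _ hx hj, inv_pow]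
  ring

/-- The uniform bound passes to the pointwise limit. Positivity of `A` is not assumed in
`LaplaceData`; it will be deduced from this decay. -/
theorem gaussKernel_bound (h : LaplaceData ρ D₁ D₂ k A B q₀ N δ C d) : ∃ K : ℝ, ∀ ψ : Vec m,
    (1 + ‖ψ‖) ^ 2 * gaussKernel A ψ ≤ K * (1 + ‖ψ‖) ^ (-((m : ℝ) + 1)) := by
  obtain ⟨K, hK, n₀, hn₀, hb⟩ := h.weight_bound'
  refine ⟨K, fun ψ => ?_⟩
  have h1 := (h.tendsto_weight ψ 2).norm.mul_const ((1 + ‖ψ‖) ^ (2 * d + 2))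
  rw [Complex.norm_real, Real.norm_of_nonneg (gaussKernel_pos A ψ).le] at h1
  have h2 : gaussKernel A ψ * (1 + ‖ψ‖) ^ (2 * d + 2) ≤ K * (1 + ‖ψ‖) ^ (-((m : ℝ) + 1)) := by
    refine le_of_tendsto h1 ?_
    filter_upwards [eventually_ge n₀, h.eventually_mem] with x hx hq
    have := hb x.1 hx x.2 hq ((Real.sqrt x.1)⁻¹ • ψ)
    have hpos : 0 < Real.sqrt x.1 := Real.sqrt_pos.2 (by
      have : 0 < x.1 := by omega
      exact_mod_cast this)
    rw [norm_smul, norm_inv, Real.norm_of_nonneg hpos.le, mul_inv_cancel_left₀ hpos.ne'] at this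
    rwa [norm_mul, norm_osc, mul_one, norm_pow]
  refine le_trans ?_ h2
  rw [mul_comm]
  have := (gaussKernel_pos A ψ).le
  gcongr
  · linarith [norm_nonneg ψ]
  · omega

theorem integrable_gaussKernel_sq (h : LaplaceData ρ D₁ D₂ k A B q₀ N δ C d) :
    Integrable fun ψ : Vec m => (1 + ‖ψ‖) ^ 2 * gaussKernel A ψ := by
  obtain ⟨K, hK⟩ := h.gaussKernel_bound
  refine (integrable_dom K).mono' ?_ (Eventually.of_forall fun ψ => ?_)
  · have := continuous_gaussKernel A
    exact Continuous.aestronglyMeasurable (by fun_prop)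
  · rw [Real.norm_of_nonneg (mul_nonneg (by positivity) (gaussKernel_pos A ψ).le)]
    exact hK ψ

theorem integrable_gaussKernel (h : LaplaceData ρ D₁ D₂ k A B q₀ N δ C d) :
    Integrable (gaussKernel A) := by
  refine h.integrable_gaussKernel_sq.mono' (continuous_gaussKernel A).aestronglyMeasurable
    (Eventually.of_forall fun ψ => ?_)
  rw [Real.norm_of_nonneg (gaussKernel_pos A ψ).le]
  exact le_mul_of_one_le_left (gaussKernel_pos A ψ).le
    (one_le_pow₀ (by linarith [norm_nonneg ψ]))

theorem integral_gaussKernel_pos (h : LaplaceData ρ D₁ D₂ k A B q₀ N δ C d) :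
    0 < ∫ ψ, gaussKernel A ψ :=
  integral_exp_pos h.integrable_gaussKernel

/-- Dominated convergence for the rescaled integrals. -/
theorem tendsto_integral_scaled (h : LaplaceData ρ D₁ D₂ k A B q₀ N δ C d)
    {F : Type*} [NormedAddCommGroup F] [NormedSpace ℝ F] {f : ℕ × (Vec m × E) → Vec m → F}
    {g : Vec m → F} {c : ℝ} (hc : 0 ≤ c)
    (hcont : ∀ᶠ x in atTop ×ˢ 𝓝 q₀, Continuous (f x))
    (hbound : ∀ᶠ x : ℕ × (Vec m × E) in atTop ×ˢ 𝓝 q₀, ∀ φ, ‖f x φ‖ ≤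
      c * (‖ρ φ x.2‖ ^ (x.1 - 2) * (1 + Real.sqrt x.1 * ‖φ‖) ^ (2 * d + 2)))
    (hlim : ∀ ψ, Tendsto (fun x : ℕ × (Vec m × E) => f x ((Real.sqrt x.1)⁻¹ • ψ))
      (atTop ×ˢ 𝓝 q₀) (𝓝 (g ψ))) :
    Tendsto (fun x : ℕ × (Vec m × E) => (Real.sqrt x.1 ^ m) • ∫ φ, f x φ) (atTop ×ˢ 𝓝 q₀)
      (𝓝 (∫ ψ, g ψ)) := by
  obtain ⟨K, hK, n₀, hn₀, hb⟩ := h.weight_bound'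
  simp_rw [← integral_comp_sqrt_inv_smul]
  refine tendsto_integral_filter_of_dominated_convergence
    (fun ψ => c * (K * (1 + ‖ψ‖) ^ (-((m : ℝ) + 1)))) ?_ ?_ ((integrable_dom K).const_mul c)
    (Eventually.of_forall hlim)
  · filter_upwards [hcont] with x hx
    exact (hx.comp (continuous_const_smul _)).aestronglyMeasurable
  · filter_upwards [hbound, eventually_ge n₀, h.eventually_mem] with x hx hn hq
    refine Eventually.of_forall fun ψ => (hx _).trans ?_
    have := hb x.1 hn x.2 hq ((Real.sqrt x.1)⁻¹ • ψ)
    have hpos : 0 < Real.sqrt x.1 := Real.sqrt_pos.2 (by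
      have : 0 < x.1 := by omega
      exact_mod_cast this)
    refine mul_le_mul_of_nonneg_left (this.trans (le_of_eq ?_)) hc
    rw [norm_smul, norm_inv, Real.norm_of_nonneg hpos.le, mul_inv_cancel_left₀ hpos.ne']

theorem tendsto_int₀ (h : LaplaceData ρ D₁ D₂ k A B q₀ N δ C d) :
    Tendsto (fun x : ℕ × (Vec m × E) =>
      (Real.sqrt x.1 ^ m) • int₀ ρ x.1 ((x.1 : ℝ) • k x.2) x.2) (atTop ×ˢ 𝓝 q₀)
      (𝓝 ((∫ ψ, gaussKernel A ψ : ℝ) : ℂ)) := by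
  rw [← integral_complex_ofReal]
  refine h.tendsto_integral_scaled zero_le_one ?_ ?_ fun ψ => ?_
  · filter_upwards [h.eventually_mem] with x hq
    exact h.continuous_integrand₀ hq _ _
  · filter_upwards [h.eventually_mem] with x hq φ
    rw [one_mul]
    exact h.norm_integrand₀_le hq _ _ _
  · exact h.tendsto_weight ψ 0

/-- The limiting derivative of the integrand in the parameter. -/
noncomputable def limitForm (B : E →L[ℝ] Vec m) (ψ : Vec m) : E →L[ℝ] ℂ :=
  Complex.I • Complex.ofRealCLM.comp ((innerSL ℝ ψ).comp B)

@[simp]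
theorem limitForm_apply (B : E →L[ℝ] Vec m) (ψ : Vec m) (v : E) :
    limitForm B ψ v = Complex.I * (inner ℝ ψ (B v) : ℝ) := by
  simp [limitForm]

/-- The limiting integrand is an even Gaussian times a linear form in `ψ`, so its integral vanishes.
-/
theorem tendsto_int₁ (h : LaplaceData ρ D₁ D₂ k A B q₀ N δ C d) :
    Tendsto (fun x : ℕ × (Vec m × E) => (Real.sqrt x.1 ^ m) •
      ∫ φ, (Real.sqrt x.1)⁻¹ • integrand₁ ρ D₁ x.1 ((x.1 : ℝ) • k x.2) x.2 φ) (atTop ×ˢ 𝓝 q₀)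
      (𝓝 0) := by
  have hzero : ∫ ψ : Vec m, (gaussKernel A ψ : ℂ) • limitForm B ψ = 0 := by
    have h1 := integral_neg_eq_self (μ := (volume : Measure (Vec m)))
      fun ψ : Vec m => (gaussKernel A ψ : ℂ) • limitForm B ψ
    have h2 : ∀ ψ : Vec m, (gaussKernel A (-ψ) : ℂ) • limitForm B (-ψ) =
        -((gaussKernel A ψ : ℂ) • limitForm B ψ) := by
      intro ψ
      rw [gaussKernel_neg]
      ext v
      simp
    simp_rw [h2] at h1
    rw [integral_neg] at h1
    have h3 := add_eq_zero_iff_eq_neg.2 h1.symm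
    rw [← two_smul ℝ] at h3
    exact (smul_eq_zero.1 h3).resolve_left two_ne_zero
  rw [← hzero]
  refine h.tendsto_integral_scaled h.const_nonneg ?_ ?_ fun ψ => ?_
  · filter_upwards [h.eventually_mem] with x hq
    exact (continuous_const_smul _).comp (h.continuous_integrand₁ hq _ _)
  · filter_upwards [h.eventually_mem, eventually_ge 1] with x hq hn φ
    have hpos : 0 < Real.sqrt x.1 := Real.sqrt_pos.2 (by exact_mod_cast hn)
    rw [norm_smul, norm_inv, Real.norm_of_nonneg hpos.le, inv_mul_le_iff₀ hpos, ← mul_assoc]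
    exact h.norm_integrand₁_le hq hn _ _
  · have h1 := (h.tendsto_weight ψ 1).smul (h.lim_one ψ)
    refine h1.congr' ?_
    filter_upwards [eventually_ge 1] with x hn
    have hpos : 0 < Real.sqrt x.1 := Real.sqrt_pos.2 (by exact_mod_cast hn)
    have hn' : (x.1 : ℂ) = (Real.sqrt x.1 : ℂ) * (Real.sqrt x.1 : ℂ) := by
      rw [← Complex.ofReal_mul, Real.mul_self_sqrt (Nat.cast_nonneg _)]; simp
    ext v
    simp only [integrand₁, smul_apply, smul_eq_mul, Complex.real_smul]
    rw [Complex.ofReal_inv]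
    have hne : (Real.sqrt x.1 : ℂ) ≠ 0 := by exact_mod_cast hpos.ne'
    rw [hn']
    field_simp

/-- After division by `n`, the two first-derivative factors each tend to a `limitForm`, while the
`D₂` term disappears because `D₂` is continuous and vanishes at the base point. -/
theorem tendsto_int₂ (h : LaplaceData ρ D₁ D₂ k A B q₀ N δ C d) :
    Tendsto (fun x : ℕ × (Vec m × E) => (Real.sqrt x.1 ^ m) •
      ∫ φ, ((x.1 : ℝ)⁻¹) • integrand₂ ρ D₁ D₂ x.1 ((x.1 : ℝ) • k x.2) x.2 φ) (atTop ×ˢ 𝓝 q₀)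
      (𝓝 (∫ ψ : Vec m, (gaussKernel A ψ : ℂ) • tensor (limitForm B ψ) (limitForm B ψ))) := by
  have hC := h.const_nonneg
  refine h.tendsto_integral_scaled (c := C ^ 2 + C) (by positivity) ?_ ?_ fun ψ => ?_
  · filter_upwards [h.eventually_mem] with x hq
    exact (continuous_const_smul _).comp (h.continuous_integrand₂ hq _ _)
  · filter_upwards [h.eventually_mem, eventually_ge 1] with x hq hn φ
    have hpos : (0 : ℝ) < x.1 := by exact_mod_cast hn
    rw [norm_smul, norm_inv, Real.norm_of_nonneg hpos.le, inv_mul_le_iff₀ hpos, ← mul_assoc]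
    exact h.norm_integrand₂_le hq hn _ _
  · have hratio : Tendsto (fun x : ℕ × (Vec m × E) => 1 - (x.1 : ℂ)⁻¹) (atTop ×ˢ 𝓝 q₀)
        (𝓝 (1 - 0)) :=
      tendsto_const_nhds.sub ((tendsto_inv_atTop_nhds_zero_nat (𝕜 := ℂ)).comp tendsto_fst)
    rw [sub_zero] at hratio
    have ht := continuous_tensor.tendsto (limitForm B ψ, limitForm B ψ) |>.comp
      ((h.lim_one ψ).prodMk_nhds (h.lim_one ψ))
    have h1 := ((hratio.mul (h.tendsto_weight ψ 2)).smul ht).add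
      ((h.tendsto_weight ψ 1).smul (h.tendsto_two ψ))
    have hlim : (1 * (gaussKernel A ψ : ℂ)) • tensor (limitForm B ψ) (limitForm B ψ) +
        (gaussKernel A ψ : ℂ) • (0 : E →L[ℝ] E →L[ℝ] ℂ) =
        (gaussKernel A ψ : ℂ) • tensor (limitForm B ψ) (limitForm B ψ) := by
      ext v w; simp
    rw [← hlim]
    refine h1.congr' ?_
    filter_upwards [eventually_ge 1] with x hn
    have hpos : (0 : ℝ) < x.1 := by exact_mod_cast hn
    have hn' : (Real.sqrt x.1 : ℂ) * (Real.sqrt x.1 : ℂ) = (x.1 : ℂ) := by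
      rw [← Complex.ofReal_mul, Real.mul_self_sqrt (Nat.cast_nonneg _)]; simp
    have hne : (x.1 : ℂ) ≠ 0 := by exact_mod_cast hpos.ne'
    have hc : ((x.1 - 1 : ℕ) : ℂ) = (x.1 : ℂ) - 1 := by
      rw [Nat.cast_sub hn]; simp
    ext v w
    simp only [integrand₂, smul_apply, add_apply, smul_eq_mul, Complex.real_smul, tensor_apply,
      Function.comp_apply, hc]
    rw [Complex.ofReal_inv, Complex.ofReal_natCast, mul_mul_mul_comm (Real.sqrt x.1 : ℂ), hn']
    field_simp

/-- The bilinear form `(v, w) ↦ ⟪A⁻¹ B v, B w⟫`. -/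
noncomputable def schurForm (Ai : Vec m →L[ℝ] Vec m) (B : E →L[ℝ] Vec m) :
    E →L[ℝ] E →L[ℝ] ℝ :=
  ((ContinuousLinearMap.compL ℝ (E) (Vec m) ℝ).flip B).comp ((innerSL ℝ).comp (Ai.comp B))

@[simp]
theorem schurForm_apply (Ai : Vec m →L[ℝ] Vec m) (B : E →L[ℝ] Vec m) (v w : E) :
    schurForm Ai B v w = inner ℝ (Ai (B v)) (B w) := by
  simp [schurForm]

theorem norm_limitForm_le (B : E →L[ℝ] Vec m) (ψ : Vec m) :
    ‖limitForm B ψ‖ ≤ ‖B‖ * (1 + ‖ψ‖) := by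
  refine ContinuousLinearMap.opNorm_le_bound _ (by positivity) fun v => ?_
  rw [limitForm_apply, norm_mul, Complex.norm_I, one_mul, Complex.norm_real, Real.norm_eq_abs]
  calc _ ≤ ‖ψ‖ * ‖B v‖ := abs_real_inner_le_norm _ _
    _ ≤ (1 + ‖ψ‖) * (‖B‖ * ‖v‖) := by
      gcongr
      · linarith
      · exact B.le_opNorm v
    _ = _ := by ring

theorem norm_gaussKernel_smul_tensor_le (ψ : Vec m) :
    ‖(gaussKernel A ψ : ℂ) • tensor (limitForm B ψ) (limitForm B ψ)‖ ≤
      ‖B‖ ^ 2 * ((1 + ‖ψ‖) ^ 2 * gaussKernel A ψ) := by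
  refine (norm_smul _ _).le.trans ?_
  rw [Complex.norm_real, Real.norm_of_nonneg (gaussKernel_pos A ψ).le]
  have := (gaussKernel_pos A ψ).le
  have hl := norm_limitForm_le B ψ
  calc gaussKernel A ψ * ‖tensor (limitForm B ψ) (limitForm B ψ)‖ ≤
      gaussKernel A ψ * ((‖B‖ * (1 + ‖ψ‖)) * (‖B‖ * (1 + ‖ψ‖))) := by
        gcongr
        refine (norm_tensor_le _ _).trans ?_
        gcongr
    _ = _ := by ring

theorem continuous_limitForm (B : E →L[ℝ] Vec m) : Continuous (limitForm B) := by
  unfold limitForm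
  fun_prop

theorem continuous_tensor_comp {X : Type*} [TopologicalSpace X] {c f : X → E →L[ℝ] ℂ}
    (hc : Continuous c) (hf : Continuous f) : Continuous fun x => tensor (c x) (f x) :=
  Continuous.comp (g := fun x : (E →L[ℝ] ℂ) × (E →L[ℝ] ℂ) => tensor x.1 x.2) continuous_tensor
    (hc.prodMk hf)

theorem continuous_gaussKernel_smul_tensor : Continuous fun ψ : Vec m =>
    (gaussKernel A ψ : ℂ) • tensor (limitForm B ψ) (limitForm B ψ) :=
  (Complex.continuous_ofReal.comp (continuous_gaussKernel A)).smul
    (continuous_tensor_comp (continuous_limitForm B) (continuous_limitForm B))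

theorem integrable_gaussKernel_smul_tensor (h : LaplaceData ρ D₁ D₂ k A B q₀ N δ C d) :
    Integrable (fun ψ : Vec m =>
      (gaussKernel A ψ : ℂ) • tensor (limitForm B ψ) (limitForm B ψ)) := by
  have h1 : AEStronglyMeasurable (fun ψ : Vec m =>
      (gaussKernel A ψ : ℂ) • tensor (limitForm B ψ) (limitForm B ψ)) volume :=
    (continuous_gaussKernel_smul_tensor (A := A) (B := B)).aestronglyMeasurable
  exact Integrable.mono' (β := E →L[ℝ] E →L[ℝ] ℂ) (h.integrable_gaussKernel_sq.const_mul (‖B‖ ^ 2)) h1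
    (Eventually.of_forall fun ψ => norm_gaussKernel_smul_tensor_le ψ)

/-- The Gaussian covariance is `A⁻¹`, and the two factors `i` give the sign. This is the Schur
correction to the Hessian of the true log-likelihood. -/
theorem integral_tensor_limitForm (h : LaplaceData ρ D₁ D₂ k A B q₀ N δ C d)
    (hA : ∀ x y, inner ℝ (A x) y = inner ℝ x (A y)) {Ai : Vec m →L[ℝ] Vec m}
    (hAi : ∀ x, A (Ai x) = x) (v w : E) :
    (∫ ψ : Vec m, (gaussKernel A ψ : ℂ) • tensor (limitForm B ψ) (limitForm B ψ)) v w =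
      ((-(∫ ψ, gaussKernel A ψ) * schurForm Ai B v w : ℝ) : ℂ) := by
  have hint := h.integrable_gaussKernel_smul_tensor
  rw [ContinuousLinearMap.integral_apply hint, ContinuousLinearMap.integral_apply]
  · have e : ∀ ψ : Vec m, ((gaussKernel A ψ : ℂ) • tensor (limitForm B ψ) (limitForm B ψ)) v w =
        ((-(inner ℝ ψ (B w) * inner ℝ ψ (A (Ai (B v))) * gaussKernel A ψ) : ℝ) : ℂ) := by
      intro ψ
      rw [hAi]
      simp only [smul_apply, tensor_apply, limitForm_apply, smul_eq_mul]
      push_cast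
      linear_combination ((gaussKernel A ψ : ℂ) * (inner ℝ ψ (B v) : ℝ) * (inner ℝ ψ (B w) : ℝ)) *
        Complex.I_mul_I
    simp_rw [e]
    rw [integral_complex_ofReal, integral_neg,
      integral_inner_mul_inner_gaussKernel hA h.integrable_gaussKernel_sq, schurForm_apply]
    congr 1
    ring
  · exact hint.apply_continuousLinearMap v

end LaplaceData

end Limits

end Saddlepoint

namespace Saddlepoint

/-! ### Logarithmic derivatives of the Laplace integral. -/

section LaplaceRatios

variable {m : ℕ} {E : Type*} [NormedAddCommGroup E] [NormedSpace ℝ E]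

namespace LaplaceData

variable {ρ : Vec m → Vec m × E → ℂ} {D₁ : Vec m → Vec m × E → E →L[ℝ] ℂ}
    {D₂ : Vec m → Vec m × E → E →L[ℝ] E →L[ℝ] ℂ} {k : Vec m × E → Vec m}
    {A : Vec m →L[ℝ] Vec m} {B : E →L[ℝ] Vec m} {q₀ : Vec m × E}
    {N : Set (Vec m × E)} {δ C : ℝ} {d : ℕ}

/-- If the form were nonpositive at `ψ`, the kernel would be at least `1` on the whole line through
`ψ`, against its polynomial decay. -/
theorem inner_self_pos (h : LaplaceData ρ D₁ D₂ k A B q₀ N δ C d) {ψ : Vec m} (hψ : ψ ≠ 0) :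
    0 < inner ℝ ψ (A ψ) := by
  by_contra! hle
  obtain ⟨K, hK⟩ := h.gaussKernel_bound
  obtain ⟨t, ht⟩ := exists_nat_gt (K / ‖ψ‖)
  have hpos : 0 < ‖ψ‖ := norm_pos_iff.2 hψ
  rw [div_lt_iff₀ hpos] at ht
  have h1 := hK ((t : ℝ) • ψ)
  have h2 : 1 ≤ gaussKernel A ((t : ℝ) • ψ) := by
    rw [gaussKernel, map_smul, real_inner_smul_left, real_inner_smul_right]
    refine Real.one_le_exp ?_
    nlinarith [mul_self_nonneg (t : ℝ)]
  have hn : ‖(t : ℝ) • ψ‖ = t * ‖ψ‖ := by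
    rw [norm_smul, Real.norm_of_nonneg (Nat.cast_nonneg t)]
  rw [hn] at h1
  set r := (t : ℝ) * ‖ψ‖
  have hr : 0 ≤ r := by positivity
  have h3 : (1 + r) ^ (-((m : ℝ) + 1)) ≤ 1 :=
    Real.rpow_le_one_of_one_le_of_nonpos (by linarith) (by linarith [(m.cast_nonneg : (0 : ℝ) ≤ m)])
  have h4 : (0 : ℝ) < (1 + r) ^ (-((m : ℝ) + 1)) := by positivity
  have h5 : (1 + r) ^ 2 ≤ (1 + r) ^ 2 * gaussKernel A ((t : ℝ) • ψ) :=
    le_mul_of_one_le_right (by positivity) h2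
  rcases le_or_gt 0 K with hK0 | hK0
  · nlinarith
  · nlinarith

theorem eventually_re_int₀ (h : LaplaceData ρ D₁ D₂ k A B q₀ N δ C d) {ε : ℝ} (hε : 0 < ε) :
    ∀ᶠ x : ℕ × (Vec m × E) in atTop ×ˢ 𝓝 q₀,
      |Real.sqrt x.1 ^ m * (int₀ ρ x.1 ((x.1 : ℝ) • k x.2) x.2).re - ∫ ψ, gaussKernel A ψ| < ε := by
  have h1 := (Complex.continuous_re.tendsto _).comp h.tendsto_int₀
  filter_upwards [Metric.tendsto_nhds.1 h1 ε hε] with x hx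
  simpa only [Function.comp_apply, Real.dist_eq, Complex.smul_re, smul_eq_mul,
    Complex.ofReal_re] using hx

theorem eventually_re_int₀_pos (h : LaplaceData ρ D₁ D₂ k A B q₀ N δ C d) :
    ∀ᶠ x : ℕ × (Vec m × E) in atTop ×ˢ 𝓝 q₀,
      0 < (int₀ ρ x.1 ((x.1 : ℝ) • k x.2) x.2).re := by
  filter_upwards [h.eventually_re_int₀ h.integral_gaussKernel_pos] with x hx
  have : 0 < Real.sqrt x.1 ^ m * (int₀ ρ x.1 ((x.1 : ℝ) • k x.2) x.2).re := by
    linarith [(abs_lt.1 hx).1]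
  exact pos_of_mul_pos_right this (by positivity)

/-- Numerator and denominator carry the same factor `√n ^ m`, and the rescaled denominator has a
positive limit. -/
theorem eventually_ratio₁ (h : LaplaceData ρ D₁ D₂ k A B q₀ N δ C d) {ε : ℝ} (hε : 0 < ε) :
    ∀ᶠ x : ℕ × (Vec m × E) in atTop ×ˢ 𝓝 q₀, ∀ v,
      |((∫ φ, integrand₁ ρ D₁ x.1 ((x.1 : ℝ) • k x.2) x.2 φ) v).re /
        (int₀ ρ x.1 ((x.1 : ℝ) • k x.2) x.2).re| ≤ ε * Real.sqrt x.1 * ‖v‖ := by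
  set c := ∫ ψ, gaussKernel A ψ
  have hc : 0 < c := h.integral_gaussKernel_pos
  filter_upwards [h.eventually_re_int₀ (half_pos hc), eventually_ge 1,
    Metric.tendsto_nhds.1 h.tendsto_int₁ (ε * (c / 2)) (by positivity)] with x hx hn h1 v
  rw [integral_smul, dist_zero_right] at h1
  set T := ∫ φ, integrand₁ ρ D₁ x.1 ((x.1 : ℝ) • k x.2) x.2 φ
  set J := (int₀ ρ x.1 ((x.1 : ℝ) • k x.2) x.2).re
  have hs : 0 < Real.sqrt x.1 := Real.sqrt_pos.2 (by exact_mod_cast hn)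
  set s := Real.sqrt x.1
  have hJ : c / 2 < s ^ m * J := by linarith [(abs_lt.1 hx).1]
  have hJ0 : 0 < J := pos_of_mul_pos_right (by linarith : 0 < s ^ m * J) (by positivity)
  have h2 : ‖T v‖ ≤ ‖T‖ * ‖v‖ := T.le_opNorm v
  have h3 : |(T v).re| ≤ ‖T v‖ := Complex.abs_re_le_norm _
  rw [norm_smul, norm_smul, norm_pow, norm_inv, Real.norm_of_nonneg hs.le] at h1
  have h4 : s ^ m * ‖T‖ ≤ ε * s * (c / 2) := by
    have : s ^ m * ‖T‖ = s * (s ^ m * (s⁻¹ * ‖T‖)) := by field_simp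
    rw [this]
    nlinarith
  have h5 : ‖T‖ ≤ ε * s * J := by
    have h6 : s ^ m * ‖T‖ ≤ s ^ m * (ε * s * J) := by
      refine h4.trans ?_
      have : ε * s * (c / 2) ≤ ε * s * (s ^ m * J) := by gcongr
      linarith
    exact le_of_mul_le_mul_left h6 (by positivity)
  rw [abs_div, abs_of_pos hJ0, div_le_iff₀ hJ0]
  calc |(T v).re| ≤ ‖T‖ * ‖v‖ := h3.trans h2
    _ ≤ ε * s * J * ‖v‖ := by gcongr
    _ = ε * s * ‖v‖ * J := by ring

theorem eventually_ratio₂ (h : LaplaceData ρ D₁ D₂ k A B q₀ N δ C d)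
    (hA : ∀ x y, inner ℝ (A x) y = inner ℝ x (A y)) {Ai : Vec m →L[ℝ] Vec m}
    (hAi : ∀ x, A (Ai x) = x) {ε : ℝ} (hε : 0 < ε) :
    ∀ᶠ x : ℕ × (Vec m × E) in atTop ×ˢ 𝓝 q₀, ∀ v w,
      |(x.1 : ℝ)⁻¹ * (((∫ φ, integrand₂ ρ D₁ D₂ x.1 ((x.1 : ℝ) • k x.2) x.2 φ) v w).re /
        (int₀ ρ x.1 ((x.1 : ℝ) • k x.2) x.2).re) + inner ℝ (Ai (B v)) (B w)| ≤
        ε * ‖v‖ * ‖w‖ := by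
  set c := ∫ ψ, gaussKernel A ψ with hcdef
  have hc : 0 < c := h.integral_gaussKernel_pos
  -- Bounds the limiting bilinear form; the added one makes it a legitimate divisor.
  set b := ‖Ai‖ * ‖B‖ ^ 2 + 1
  have hb : 0 < b := by positivity
  filter_upwards [h.eventually_re_int₀ (half_pos hc), eventually_ge 1,
    h.eventually_re_int₀ (ε := ε * (c / 4) / b) (by positivity),
    (Metric.tendsto_nhds (α := E →L[ℝ] E →L[ℝ] ℂ)).1 h.tendsto_int₂ (ε * (c / 4)) (by positivity)] with x hx hn hx2 h1 v w
  have hL := h.integral_tensor_limitForm hA hAi v w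
  rw [← hcdef, schurForm_apply] at hL
  set T₀ := ∫ ψ : Vec m, (gaussKernel A ψ : ℂ) • tensor (limitForm B ψ) (limitForm B ψ)
  rw [integral_smul] at h1
  set T := ∫ φ, integrand₂ ρ D₁ D₂ x.1 ((x.1 : ℝ) • k x.2) x.2 φ
  set J := (int₀ ρ x.1 ((x.1 : ℝ) • k x.2) x.2).re
  have hn' : (0 : ℝ) < x.1 := by exact_mod_cast hn
  have hs : 0 < Real.sqrt x.1 := Real.sqrt_pos.2 hn'
  set s := Real.sqrt x.1
  have hJ : c / 2 < s ^ m * J := by linarith [(abs_lt.1 hx).1]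
  set P := s ^ m * J with hP
  have hP0 : 0 < P := by linarith
  have hJ0 : 0 < J := pos_of_mul_pos_right hP0 (by positivity)
  set S := inner ℝ (Ai (B v)) (B w)
  have hS : |S| ≤ b * ‖v‖ * ‖w‖ := by
    calc |S| ≤ ‖Ai (B v)‖ * ‖B w‖ := abs_real_inner_le_norm _ _
      _ ≤ (‖Ai‖ * (‖B‖ * ‖v‖)) * (‖B‖ * ‖w‖) := by
          gcongr
          · exact (Ai.le_opNorm _).trans (by gcongr; exact B.le_opNorm v)
          · exact B.le_opNorm w
      _ = ‖Ai‖ * ‖B‖ ^ 2 * (‖v‖ * ‖w‖) := by ring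
      _ ≤ (‖Ai‖ * ‖B‖ ^ 2 + 1) * (‖v‖ * ‖w‖) := by gcongr; linarith
      _ = _ := by ring
  set R := s ^ m • ((x.1 : ℝ)⁻¹ • T) with hR
  have h2 : ‖(R - T₀) v w‖ ≤ ε * (c / 4) * ‖v‖ * ‖w‖ := by
    refine ((R - T₀) v).le_opNorm w |>.trans ?_
    gcongr
    refine (R - T₀).le_opNorm v |>.trans ?_
    gcongr
    rw [← dist_eq_norm]
    exact h1.le
  have h3 : ((R - T₀) v w).re = s ^ m * ((x.1 : ℝ)⁻¹ * (T v w).re) + c * S := by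
    rw [sub_apply, sub_apply, hL, hR, smul_apply, smul_apply, smul_apply, smul_apply,
      Complex.sub_re, Complex.smul_re, Complex.smul_re, Complex.ofReal_re, smul_eq_mul,
      smul_eq_mul]
    ring
  have h4 := (Complex.abs_re_le_norm _).trans h2
  rw [h3] at h4
  -- The error splits into that of the numerator and that of replacing the limit `c` by the rescaled
  -- denominator `P`. Each is at most `ε c / 4` times the norms, and `P > c / 2`.
  have h5 : (x.1 : ℝ)⁻¹ * ((T v w).re / J) + S =
      (s ^ m * ((x.1 : ℝ)⁻¹ * (T v w).re) + c * S + (P - c) * S) / P := by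
    rw [hP]
    have : s ^ m ≠ 0 := by positivity
    field_simp
    ring
  rw [h5, abs_div, abs_of_pos hP0, div_le_iff₀ hP0]
  have h6 : |(P - c) * S| ≤ ε * (c / 4) * ‖v‖ * ‖w‖ := by
    rw [abs_mul]
    calc |P - c| * |S| ≤ (ε * (c / 4) / b) * (b * ‖v‖ * ‖w‖) := by gcongr
      _ = _ := by field_simp
  calc _ ≤ ε * (c / 4) * ‖v‖ * ‖w‖ + ε * (c / 4) * ‖v‖ * ‖w‖ :=
        (abs_add_le _ _).trans (add_le_add h4 h6)
    _ = ε * ‖v‖ * ‖w‖ * (c / 2) := by ring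
    _ ≤ _ := by gcongr

end LaplaceData

end LaplaceRatios

end Saddlepoint

namespace Saddlepoint

/-! ### Real coordinates `(φ, s, θ)` on the tube. -/

section ComplexCoordinates

variable {m p : ℕ}

/-- The real-linear map `(φ, s, θ) ↦ (s + i φ, θ)`. -/
noncomputable def cplxMap (m p : ℕ) : Vec m × (Vec m × Vec p) →L[ℝ] CVec m × Vec p :=
  LinearMap.toContinuousLinearMap
    { toFun := fun x => (cplx x.2.1 x.1, x.2.2)
      map_add' := fun x y => by
        refine Prod.ext ?_ rfl
        ext j
        simp [cplx]
        ring
      map_smul' := fun c x => by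
        refine Prod.ext ?_ rfl
        ext j
        simp [cplx]
        ring }

@[simp]
theorem cplxMap_apply (x : Vec m × (Vec m × Vec p)) :
    cplxMap m p x = (cplx x.2.1 x.1, x.2.2) := rfl

@[simp]
theorem cplx_apply (s φ : Vec m) (j : Fin m) :
    cplx s φ j = (s j : ℂ) + (φ j : ℂ) * Complex.I := rfl

/-- The derivative of `f(s + i φ, θ)` in `(φ, s, θ)` as a function of the partial derivatives
of `f`. -/
noncomputable def totalForm (m p : ℕ) :
    ((Fin m → ℂ) × (Fin p → ℂ)) →L[ℝ] (Vec m × (Vec m × Vec p) →L[ℝ] ℂ) :=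
  ((ContinuousLinearMap.compL ℝ (Vec m × (Vec m × Vec p)) (CVec m × Vec p) ℂ).flip
    (cplxMap m p)).comp
    (((ContinuousLinearMap.coprodEquivL (S := ℝ) (𝕜 := ℝ) (E := CVec m) (F := Vec p)
      (G := ℂ)) : ((CVec m →L[ℝ] ℂ) × (Vec p →L[ℝ] ℂ)) →L[ℝ] (CVec m × Vec p →L[ℝ] ℂ)).comp
      (complexForm.prodMap (coordForm (𝕜 := ℝ) (F := ℂ))))

theorem totalForm_eq (a : (Fin m → ℂ) × (Fin p → ℂ)) :
    totalForm m p a =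
      ((complexForm a.1).coprod (coordForm (𝕜 := ℝ) a.2)).comp (cplxMap m p) := rfl

theorem totalForm_apply (a : (Fin m → ℂ) × (Fin p → ℂ)) (x : Vec m × (Vec m × Vec p)) :
    totalForm m p a x = ∑ j, cplx x.2.1 x.1 j * a.1 j + ∑ i, x.2.2 i • a.2 i := by
  rw [totalForm_eq]
  simp

end ComplexCoordinates

/-! ### The moment generating function in real coordinates and on real arguments. -/

section Model

variable {m p : ℕ} {Θ : Set (Vec p)} {Q : Vec p → Measure (Vec m)}

/-- The partial derivatives of the moment generating function at `(s + i φ, θ)`. -/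
noncomputable def mgfOn (Q : Vec p → Measure (Vec m)) (is : List (Fin p)) (js : List (Fin m))
    (x : Vec m × (Vec m × Vec p)) : ℂ :=
  mgfPartial Q is js (cplx x.2.1 x.1) x.2.2

/-- The partial derivatives of the moment generating function at a real argument. -/
noncomputable def mgfReal (Q : Vec p → Measure (Vec m)) (js : List (Fin m))
    (q : Vec m × Vec p) : ℝ :=
  (mgfOn Q [] js (0, q)).re

/-- First-order regularity reaches one dual derivative further than second-order regularity: a list
of length three is one `sPartial` of a list of length two. -/
theorem hasFDerivAt_mgfOn (h : GrowthBound Θ Q) {js : List (Fin m)} (hjs : js.length ≤ 3)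
    {x : Vec m × (Vec m × Vec p)} (hx : x.2 ∈ interior (jointDomain Θ Q)) :
    HasFDerivAt (mgfOn Q [] js)
      (totalForm m p (fun j => mgfOn Q [] (j :: js) x, fun i => mgfOn Q [i] js x)) x := by
  have hx' : cplxMap m p x ∈ tube Θ Q := cplx_mem_tube hx
  have h1 : ContPartials (mgfPartial Q [] js) (tube Θ Q) := by
    rcases Nat.lt_or_ge js.length 3 with hlt | hge
    · exact (h.contPartialsTwo js (by omega)).first
    · match js, hge with
      | j :: js', hge =>
        simp only [List.length_cons] at hjs
        exact (h.contPartialsTwo js' (by omega)).second_s j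
  have h2 : HasFDerivAt (fun q : CVec m × Vec p => mgfPartial Q [] js q.1 q.2) _
      (cplxMap m p x) :=
    hasFDerivAt_uncurry_of_partial isOpen_tube (fun _ hq => h1.hasFDerivAt_s isOpen_tube hq)
      (fun _ hq => h1.hasFDerivAt_t isOpen_tube hq) h1.continuousOn_sForm
      h1.continuousOn_tForm hx'
  exact h2.comp x (cplxMap m p).hasFDerivAt

theorem hasFDerivAt_mgfOn_theta (h : GrowthBound Θ Q) {js : List (Fin m)} (hjs : js.length ≤ 2)
    (i : Fin p) {x : Vec m × (Vec m × Vec p)} (hx : x.2 ∈ interior (jointDomain Θ Q)) :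
    HasFDerivAt (mgfOn Q [i] js)
      (totalForm m p (fun j => mgfOn Q [i] (j :: js) x, fun k => mgfOn Q [k, i] js x)) x := by
  have hx' : cplxMap m p x ∈ tube Θ Q := cplx_mem_tube hx
  have h1 := h.contPartialsTwo js hjs
  have h2 : HasFDerivAt (fun q : CVec m × Vec p => mgfPartial Q [i] js q.1 q.2)
      ((complexForm fun j => mgfOn Q [i] (j :: js) x).coprod
        (coordForm (𝕜 := ℝ) fun k => mgfOn Q [k, i] js x))
      (cplxMap m p x) := by
    have h3 := ((h1.contDiffOn_thetaPartial isOpen_tube i).contDiffAt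
      (isOpen_tube.mem_nhds hx')).differentiableAt one_ne_zero |>.hasFDerivAt
    have hs : HasFDerivAt (fun z => mgfPartial Q [i] js z x.2.2)
        (complexForm fun j => mgfOn Q [i] (j :: js) x) (cplx x.2.1 x.1) :=
      h1.hasFDerivAt_thetaPartial_s isOpen_tube i hx'
    have ht : HasFDerivAt (fun t => mgfPartial Q [i] js (cplx x.2.1 x.1) t)
        (coordForm (𝕜 := ℝ) fun k => mgfOn Q [k, i] js x) x.2.2 := by
      have hev : ∀ᶠ t in 𝓝 x.2.2, (cplx x.2.1 x.1, t) ∈ tube Θ Q :=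
        (Continuous.prodMk_right (cplx x.2.1 x.1)).continuousAt.eventually
          (isOpen_tube.mem_nhds hx')
      refine hasFDerivAt_of_continuousAt_pd (𝕜 := ℝ)
        (hev.mono fun t ht k => h1.hasPd_tt _ ht i k) fun k => ?_
      exact ContinuousAt.comp (f := fun t => (cplx x.2.1 x.1, t)) (x := x.2.2)
        ((h1.cont_tt i k).continuousAt (isOpen_tube.mem_nhds hx'))
        (Continuous.prodMk_right _).continuousAt
    -- The total derivative exists by C¹ regularity; its two blocks are identified by uniqueness of
    -- the partial derivatives.
    have e1 := (HasFDerivAt.comp (cplx x.2.1 x.1)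
      (g := fun q : CVec m × Vec p => thetaPartial i (mgfPartial Q [] js) q.1 q.2) h3
      (hasFDerivAt_prodMk_left (𝕜 := ℝ) (cplx x.2.1 x.1) x.2.2)).unique hs
    have e2 := (HasFDerivAt.comp x.2.2
      (g := fun q : CVec m × Vec p => thetaPartial i (mgfPartial Q [] js) q.1 q.2) h3
      (hasFDerivAt_prodMk_right (𝕜 := ℝ) (cplx x.2.1 x.1) x.2.2)).unique ht
    rw [← e1, ← e2]
    refine h3.congr_fderiv ?_
    ext v <;> simp
  exact h2.comp x (cplxMap m p).hasFDerivAt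

theorem isOpen_snd_mem : IsOpen {x : Vec m × (Vec m × Vec p) | x.2 ∈ interior (jointDomain Θ Q)} :=
  isOpen_interior.preimage continuous_snd

theorem contDiffOn_mgfOn (h : GrowthBound Θ Q) {js : List (Fin m)} (hjs : js.length ≤ 2) :
    ContDiffOn ℝ 2 (mgfOn Q [] js) {x | x.2 ∈ interior (jointDomain Θ Q)} :=
  ((h.contPartialsTwo js hjs).contDiffOn isOpen_tube).comp
    (cplxMap m p).contDiff.contDiffOn fun _ hx => cplx_mem_tube hx

theorem contDiffOn_mgfReal (h : GrowthBound Θ Q) {js : List (Fin m)} (hjs : js.length ≤ 2) :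
    ContDiffOn ℝ 2 (mgfReal Q js) (interior (jointDomain Θ Q)) := by
  have h1 : ContDiffOn ℝ 2 (fun q : Vec m × Vec p => mgfOn Q [] js (0, q))
      (interior (jointDomain Θ Q)) :=
    (contDiffOn_mgfOn h hjs).comp (f := fun q : Vec m × Vec p => ((0 : Vec m), q))
      (by fun_prop) fun _ hq => hq
  exact Complex.reCLM.contDiff.comp_contDiffOn h1

theorem hasFDerivAt_mgfOn_real (h : GrowthBound Θ Q) {js : List (Fin m)} (hjs : js.length ≤ 3)
    {q : Vec m × Vec p} (hq : q ∈ interior (jointDomain Θ Q)) :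
    HasFDerivAt (fun s => mgfOn Q [] js (0, (s, q.2)))
      (coordForm (𝕜 := ℝ) fun j => mgfOn Q [] (j :: js) (0, q)) q.1 := by
  have h1 := hasFDerivAt_mgfOn h hjs (x := (0, q)) hq
  have h2 : HasFDerivAt (fun s : Vec m => ((0 : Vec m), (s, q.2)))
      ((ContinuousLinearMap.inr ℝ (Vec m) (Vec m × Vec p)).comp
        (ContinuousLinearMap.inl ℝ (Vec m) (Vec p))) q.1 :=
    (hasFDerivAt_prodMk_right (𝕜 := ℝ) (0 : Vec m) (q.1, q.2)).comp q.1
      (hasFDerivAt_prodMk_left (𝕜 := ℝ) q.1 q.2)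
  have h3 := HasFDerivAt.comp q.1 (g := mgfOn Q [] js) h1 h2
  refine h3.congr_fderiv ?_
  ext v
  simp [totalForm_apply]

/-- On real arguments `M₀` is real, and differentiating the vanishing imaginary part in a real
direction keeps it zero. -/
theorem im_mgfOn_zero (h : GrowthBound Θ Q) {js : List (Fin m)} (hjs : js.length ≤ 3)
    {q : Vec m × Vec p} (hq : q ∈ interior (jointDomain Θ Q)) :
    (mgfOn Q [] js (0, q)).im = 0 := by
  induction js generalizing q with
  | nil =>
    change (mgfC (Q q.2) (cplx q.1 0)).im = 0
    rw [mgfC_cplx_zero]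
    exact Complex.ofReal_im _
  | cons j js ih =>
    simp only [List.length_cons] at hjs
    have h1 := hasFDerivAt_mgfOn_real h (js := js) (by omega) hq
    have h2 := (Complex.imCLM.hasFDerivAt.comp q.1 h1)
    have hev : ∀ᶠ s in 𝓝 q.1, (s, q.2) ∈ interior (jointDomain Θ Q) :=
      (Continuous.prodMk_left q.2).continuousAt.eventually (isOpen_interior.mem_nhds hq)
    have h3 : HasFDerivAt (Complex.imCLM ∘ fun s => mgfOn Q [] js (0, (s, q.2)))
        (0 : Vec m →L[ℝ] ℝ) q.1 := by
      refine (hasFDerivAt_const (0 : ℝ) q.1).congr_of_eventuallyEq ?_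
      filter_upwards [hev] with s hs
      exact ih (by omega) hs
    have h4 := DFunLike.congr_fun (h2.unique h3) (EuclideanSpace.single j 1)
    simpa [Finset.sum_ite_eq, Pi.single_apply] using h4

theorem mgfOn_zero_eq (h : GrowthBound Θ Q) {js : List (Fin m)} (hjs : js.length ≤ 3)
    {q : Vec m × Vec p} (hq : q ∈ interior (jointDomain Θ Q)) :
    mgfOn Q [] js (0, q) = (mgfReal Q js q : ℂ) :=
  Complex.ext rfl (by rw [im_mgfOn_zero h hjs hq, Complex.ofReal_im])

theorem mgfReal_nil (q : Vec m × Vec p) :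
    mgfReal Q [] q = ∫ x, Real.exp (inner ℝ q.1 x) ∂(Q q.2) := by
  change (mgfC (Q q.2) (cplx q.1 0)).re = _
  rw [mgfC_cplx_zero, Complex.ofReal_re]

theorem hasFDerivAt_mgfReal (h : GrowthBound Θ Q) {js : List (Fin m)} (hjs : js.length ≤ 3)
    {q : Vec m × Vec p} (hq : q ∈ interior (jointDomain Θ Q)) :
    HasFDerivAt (fun s => mgfReal Q js (s, q.2))
      (coordForm (𝕜 := ℝ) fun j => mgfReal Q (j :: js) q) q.1 := by
  have h1 := Complex.reCLM.hasFDerivAt.comp q.1 (hasFDerivAt_mgfOn_real h hjs hq)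
  refine h1.congr_fderiv ?_
  ext v
  simp [mgfReal]

theorem mgfReal_nil_pos [∀ θ, IsProbabilityMeasure (Q θ)] {q : Vec m × Vec p}
    (hq : q ∈ jointDomain Θ Q) : 0 < mgfReal Q [] q := by
  rw [mgfReal_nil]
  exact integral_exp_pos_of_mem hq.2

end Model

end Saddlepoint

namespace Saddlepoint

/-! ### Locally uniform decay and growth bounds. -/

section Growth

variable {m p : ℕ} {Θ : Set (Vec p)} {Q : Vec p → Measure (Vec m)}

theorem norm_clm_pi_le {E F ι : Type*} [NormedAddCommGroup E] [NormedSpace ℝ E]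
    [NormedAddCommGroup F] [NormedSpace ℝ F] [Fintype ι] {f : ι → E →L[ℝ] F} {c : ℝ}
    (hc : 0 ≤ c) (hf : ∀ i, ‖f i‖ ≤ c) : ‖ContinuousLinearMap.pi f‖ ≤ c := by
  refine ContinuousLinearMap.opNorm_le_bound _ hc fun v => ?_
  rw [pi_norm_le_iff_of_nonneg (by positivity)]
  exact fun i => ((f i).le_opNorm v).trans (by gcongr; exact hf i)

theorem norm_clm_prod_le {E F G : Type*} [NormedAddCommGroup E] [NormedSpace ℝ E]
    [NormedAddCommGroup F] [NormedSpace ℝ F] [NormedAddCommGroup G] [NormedSpace ℝ G]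
    {f : E →L[ℝ] F} {g : E →L[ℝ] G} {c : ℝ} (hf : ‖f‖ ≤ c) (hg : ‖g‖ ≤ c) :
    ‖f.prod g‖ ≤ c := by
  have hc : 0 ≤ c := (norm_nonneg _).trans hf
  refine ContinuousLinearMap.opNorm_le_bound _ hc fun v => ?_
  rw [ContinuousLinearMap.prod_apply, Prod.norm_def]
  exact max_le ((f.le_opNorm v).trans (by gcongr)) ((g.le_opNorm v).trans (by gcongr))

theorem norm_totalForm_le {a : (Fin m → ℂ) × (Fin p → ℂ)} {c : ℝ} (hc : 0 ≤ c)
    (h1 : ∀ j, ‖a.1 j‖ ≤ c) (h2 : ∀ i, ‖a.2 i‖ ≤ c) :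
    ‖totalForm m p a‖ ≤ ‖totalForm m p‖ * c := by
  refine ((totalForm m p).le_opNorm a).trans ?_
  gcongr
  rw [Prod.norm_def]
  exact max_le ((pi_norm_le_iff_of_nonneg hc).2 h1) ((pi_norm_le_iff_of_nonneg hc).2 h2)

/-- Near `q₀` continuity gives `γ < γ(q₀) + 1`; one integer above that serves as both constant and
exponent. -/
theorem GrowthBound.exists_bound (h : GrowthBound Θ Q) {q₀ : Vec m × Vec p}
    (hq₀ : q₀ ∈ interior (jointDomain Θ Q)) : ∃ C ≥ 0, ∃ d : ℕ, ∀ᶠ q in 𝓝 q₀,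
      ∀ (is : List (Fin p)) (js : List (Fin m)), GrowthOrder is.length js.length →
        ∀ φ : Vec m, ‖mgfOn Q is js (φ, q)‖ ≤ C * (1 + ‖φ‖) ^ d := by
  obtain ⟨γ, hγc, hγ, -, -, hb⟩ := h
  have hγ' := (hγc.continuousAt (isOpen_interior.mem_nhds hq₀)).eventually
    (eventually_lt_nhds (lt_add_one (γ q₀)))
  obtain ⟨d, hd⟩ := exists_nat_ge (γ q₀ + 1)
  refine ⟨d, Nat.cast_nonneg d, d, ?_⟩
  filter_upwards [hγ', isOpen_interior.mem_nhds hq₀] with q hq hqi is js hg φ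
  refine ((hb is js hg).2 q.1 q.2 hqi φ).trans ?_
  have h1 : γ (q.1, q.2) ≤ d := by
    have : γ q < γ q₀ + 1 := hq
    exact this.le.trans hd
  have h2 : (1 + ‖φ‖) ^ (γ (q.1, q.2)) ≤ (1 + ‖φ‖) ^ d := by
    rw [← Real.rpow_natCast]
    exact Real.rpow_le_rpow_of_exponent_le (by linarith [norm_nonneg φ]) h1
  exact mul_le_mul h1 h2 (by positivity) (Nat.cast_nonneg d)

/-- The bound weakens as `δ` decreases, so half the value at `q₀` works nearby. -/
theorem DecayBound.exists_bound (h : DecayBound Θ Q) {q₀ : Vec m × Vec p}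
    (hq₀ : q₀ ∈ interior (jointDomain Θ Q)) : ∃ δ > 0, ∀ᶠ q in 𝓝 q₀, ∀ φ : Vec m,
      ‖mgfOn Q [] [] (φ, q) / mgfOn Q [] [] (0, q)‖ ≤ (1 + δ * ‖φ‖ ^ 2) ^ (-δ) := by
  obtain ⟨δ, hδc, hδ, hb⟩ := h
  have hpos := hδ q₀ hq₀
  have hδ' := (hδc.continuousAt (isOpen_interior.mem_nhds hq₀)).eventually
    (eventually_gt_nhds (half_lt_self hpos))
  refine ⟨δ q₀ / 2, half_pos hpos, ?_⟩
  filter_upwards [hδ', isOpen_interior.mem_nhds hq₀] with q hq hqi φ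
  refine (hb q.1 q.2 hqi φ).trans ?_
  have h1 : δ q₀ / 2 ≤ δ (q.1, q.2) := le_of_lt hq
  set e := δ q₀ / 2
  have he : 0 < e := half_pos hpos
  have h3 : 1 ≤ 1 + e * ‖φ‖ ^ 2 := by
    have : 0 ≤ e * ‖φ‖ ^ 2 := by positivity
    linarith
  calc (1 + δ (q.1, q.2) * ‖φ‖ ^ 2) ^ (-δ (q.1, q.2))
      ≤ (1 + e * ‖φ‖ ^ 2) ^ (-δ (q.1, q.2)) := by
        refine Real.rpow_le_rpow_of_nonpos (by linarith) ?_ (by linarith)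
        gcongr
    _ ≤ _ := Real.rpow_le_rpow_of_exponent_le h3 (by linarith)

/-- The normalised moment generating function `M(s + i φ, θ) / M(s, θ)` as a function of
`(φ, s, θ)`. -/
noncomputable def ratio (Q : Vec p → Measure (Vec m)) (x : Vec m × (Vec m × Vec p)) : ℂ :=
  mgfOn Q [] [] x / mgfOn Q [] [] (0, x.2)

variable [∀ θ, IsProbabilityMeasure (Q θ)]

theorem mgfOn_zero_ne_zero (h : GrowthBound Θ Q) {q : Vec m × Vec p}
    (hq : q ∈ interior (jointDomain Θ Q)) : mgfOn Q [] [] (0, q) ≠ 0 := by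
  rw [mgfOn_zero_eq h (by simp) hq]
  exact_mod_cast (mgfReal_nil_pos (interior_subset hq)).ne'

theorem ratio_zero (h : GrowthBound Θ Q) {q : Vec m × Vec p}
    (hq : q ∈ interior (jointDomain Θ Q)) : ratio Q (0, q) = 1 :=
  div_self (mgfOn_zero_ne_zero h hq)

theorem contDiffOn_inv_mgfOn (h : GrowthBound Θ Q) :
    ContDiffOn ℝ 2 (fun x : Vec m × (Vec m × Vec p) => (mgfOn Q [] [] (0, x.2))⁻¹)
      {x | x.2 ∈ interior (jointDomain Θ Q)} := by
  have h1 : ContDiffOn ℝ 2 (fun x : Vec m × (Vec m × Vec p) => mgfOn Q [] [] (0, x.2))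
      {x | x.2 ∈ interior (jointDomain Θ Q)} :=
    (contDiffOn_mgfOn h (js := []) (by simp)).comp
      (f := fun x : Vec m × (Vec m × Vec p) => ((0 : Vec m), x.2)) (by fun_prop) fun _ hq => hq
  exact h1.inv fun x hx => mgfOn_zero_ne_zero h hx

theorem contDiffOn_ratio (h : GrowthBound Θ Q) :
    ContDiffOn ℝ 2 (ratio Q) {x | x.2 ∈ interior (jointDomain Θ Q)} :=
  ((contDiffOn_mgfOn h (js := []) (by simp)).mul (contDiffOn_inv_mgfOn h)).congr
    fun x _ => div_eq_mul_inv _ _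

/-- Polynomial growth of the derivatives of the moment generating function. -/
theorem exists_bound_iteratedFDeriv_mgfOn (h : GrowthBound Θ Q) (hd : DecayBound Θ Q)
    {q₀ : Vec m × Vec p} (hq₀ : q₀ ∈ interior (jointDomain Θ Q)) :
    ∃ C ≥ 0, ∃ d : ℕ, ∀ᶠ q in 𝓝 q₀, ∀ j ≤ 2, ∀ φ : Vec m,
      ‖iteratedFDeriv ℝ j (mgfOn Q [] []) (φ, q)‖ ≤ C * (1 + ‖φ‖) ^ d := by
  obtain ⟨C, hC, d, hb⟩ := h.exists_bound hq₀
  obtain ⟨δ, hδ, hdec⟩ := hd.exists_bound hq₀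
  have hcont : ContinuousAt (fun q => mgfOn Q [] [] (0, q)) q₀ :=
    ContinuousAt.comp (f := fun q : Vec m × Vec p => ((0 : Vec m), q)) (x := q₀)
      ((contDiffOn_mgfOn h (js := []) (by simp)).continuousOn.continuousAt
      (isOpen_snd_mem.mem_nhds hq₀)) (by fun_prop)
  have hM := hcont.norm.eventually (eventually_lt_nhds (lt_add_one _))
  set M := ‖mgfOn Q [] [] (0, q₀)‖ + 1
  set t := ‖totalForm m p‖
  have ht : 0 ≤ t := ContinuousLinearMap.opNorm_nonneg _
  have hM0 : 0 ≤ M := by positivity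
  refine ⟨M + t * C + t * (t * C), by positivity, d, ?_⟩
  filter_upwards [hb, hdec, hM, isOpen_interior.mem_nhds hq₀] with q hb hdec hM hq j hj φ
  have hq' : ((φ, q) : Vec m × (Vec m × Vec p)).2 ∈ interior (jointDomain Θ Q) := hq
  have hP : 1 ≤ (1 + ‖φ‖) ^ d := one_le_pow₀ (by linarith [norm_nonneg φ])
  have hCP : 0 ≤ C * (1 + ‖φ‖) ^ d := by positivity
  interval_cases j
  -- Order zero is excluded from the growth condition; here the decay condition bounds `|M₀(s +
  -- iφ)|` by `|M₀(s)|`.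
  · rw [norm_iteratedFDeriv_zero]
    have h1 : ‖mgfOn Q [] [] (φ, q) / mgfOn Q [] [] (0, q)‖ ≤ 1 := by
      refine (hdec φ).trans (Real.rpow_le_one_of_one_le_of_nonpos ?_ (by linarith))
      have : 0 ≤ δ * ‖φ‖ ^ 2 := by positivity
      linarith
    rw [norm_div, div_le_one (norm_pos_iff.2 (mgfOn_zero_ne_zero h hq))] at h1
    calc ‖mgfOn Q [] [] (φ, q)‖ ≤ M := h1.trans hM.le
      _ ≤ M * (1 + ‖φ‖) ^ d := le_mul_of_one_le_right hM0 hP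
      _ ≤ _ := by gcongr; linarith [show 0 ≤ t * C + t * (t * C) by positivity]
  · rw [norm_iteratedFDeriv_one, (hasFDerivAt_mgfOn h (by simp) hq').fderiv]
    refine (norm_totalForm_le hCP ?_ ?_).trans ?_
    · exact fun j => hb [] [j] (Or.inl ⟨by simp, by simp, by simp⟩) φ
    · exact fun i => hb [i] [] (Or.inl ⟨by simp, by simp, by simp⟩) φ
    · rw [← mul_assoc]
      gcongr
      linarith [show 0 ≤ t * (t * C) by positivity]
  · rw [← norm_iteratedFDeriv_fderiv, norm_iteratedFDeriv_one]
    have h1 : HasFDerivAt (fun x => ((fun j => mgfOn Q [] [j] x), fun i => mgfOn Q [i] [] x)) 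
        (((ContinuousLinearMap.pi fun j => totalForm m p (fun j' => mgfOn Q [] [j', j] (φ, q),
          fun i => mgfOn Q [i] [j] (φ, q))).prod
          (ContinuousLinearMap.pi fun i => totalForm m p (fun j => mgfOn Q [i] [j] (φ, q),
            fun k => mgfOn Q [k, i] [] (φ, q))))) (φ, q) :=
      (hasFDerivAt_pi.2 fun j => hasFDerivAt_mgfOn h (by simp) hq').prodMk
        (hasFDerivAt_pi.2 fun i => hasFDerivAt_mgfOn_theta h (by simp) i hq')
    have h2 := (totalForm m p).hasFDerivAt.comp (φ, q) h1
    have h3 : fderiv ℝ (mgfOn Q [] []) =ᶠ[𝓝 (φ, q)]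
        (totalForm m p) ∘ fun x => ((fun j => mgfOn Q [] [j] x), fun i => mgfOn Q [i] [] x) := by
      filter_upwards [isOpen_snd_mem.mem_nhds hq'] with x hx
      exact (hasFDerivAt_mgfOn h (by simp) hx).fderiv
    rw [(h2.congr_of_eventuallyEq h3).fderiv]
    refine (ContinuousLinearMap.opNorm_comp_le _ _).trans ?_
    calc _ ≤ t * (t * (C * (1 + ‖φ‖) ^ d)) := by
          gcongr
          refine norm_clm_prod_le (norm_clm_pi_le (by positivity) fun j =>
            norm_totalForm_le hCP ?_ ?_) (norm_clm_pi_le (by positivity) fun i =>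
            norm_totalForm_le hCP ?_ ?_)
          · exact fun j' => hb [] [j', j] (Or.inl ⟨by simp, by simp, by simp⟩) φ
          · exact fun i => hb [i] [j] (Or.inl ⟨by simp, by simp, by simp⟩) φ
          · exact fun j => hb [i] [j] (Or.inl ⟨by simp, by simp, by simp⟩) φ
          · exact fun k => hb [k, i] [] (Or.inr ⟨by simp, by simp⟩) φ
      _ = t * (t * C) * (1 + ‖φ‖) ^ d := by ring
      _ ≤ _ := by gcongr; linarith [show 0 ≤ t * C by positivity]

theorem exists_bound_fderiv_fderiv_ratio (h : GrowthBound Θ Q) (hd : DecayBound Θ Q)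
    {q₀ : Vec m × Vec p} (hq₀ : q₀ ∈ interior (jointDomain Θ Q)) :
    ∃ C ≥ 0, ∃ d : ℕ, ∀ᶠ q in 𝓝 q₀, ∀ φ : Vec m,
      ‖fderiv ℝ (fderiv ℝ (ratio Q)) (φ, q)‖ ≤ C * (1 + ‖φ‖) ^ d := by
  obtain ⟨C, hC, d, hb⟩ := exists_bound_iteratedFDeriv_mgfOn h hd hq₀
  set D : Set (Vec m × (Vec m × Vec p)) := {x | x.2 ∈ interior (jointDomain Θ Q)}
  have hD : IsOpen D := isOpen_snd_mem
  set c : Vec m × (Vec m × Vec p) → ℂ := fun x => (mgfOn Q [] [] (0, x.2))⁻¹ with hcdef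
  have hc : ContDiffOn ℝ 2 c D := contDiffOn_inv_mgfOn h
  -- The normalising factor does not depend on `φ`, so its derivatives are translation invariant in
  -- `φ` and a bound at `φ = 0` suffices.
  have htrans : ∀ (j : ℕ) (φ : Vec m) (q : Vec m × Vec p),
      iteratedFDeriv ℝ j c (φ, q) = iteratedFDeriv ℝ j c (0, q) := by
    intro j φ q
    have h1 := iteratedFDeriv_comp_add_right (𝕜 := ℝ) (f := c) j (φ, (0 : Vec m × Vec p)) (0, q)
    have h2 : (fun z : Vec m × (Vec m × Vec p) => c (z + (φ, 0))) = c := by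
      ext z; simp [hcdef]
    rw [h2] at h1
    simpa using h1.symm
  have hcb : ∀ j ≤ 2, ∀ᶠ q in 𝓝 q₀,
      ‖iteratedFDeriv ℝ j c (0, q)‖ < ‖iteratedFDeriv ℝ j c (0, q₀)‖ + 1 := by
    intro j hj
    have h1 : ContinuousOn (iteratedFDeriv ℝ j c) D :=
      (hc.continuousOn_iteratedFDerivWithin (by exact_mod_cast hj) hD.uniqueDiffOn).congr
        fun x hx => (iteratedFDerivWithin_of_isOpen j hD hx).symm
    have h2 : ContinuousAt (fun q => iteratedFDeriv ℝ j c (0, q)) q₀ :=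
      ContinuousAt.comp (f := fun q : Vec m × Vec p => ((0 : Vec m), q)) (x := q₀)
        (h1.continuousAt (hD.mem_nhds hq₀)) (by fun_prop)
    exact h2.norm.eventually (eventually_lt_nhds (lt_add_one _))
  set K := ∑ j ∈ Finset.range 3, (‖iteratedFDeriv ℝ j c (0, q₀)‖ + 1)
  have hK0 : 0 ≤ K := Finset.sum_nonneg fun _ _ => by positivity
  have hKle : ∀ j ≤ 2, ‖iteratedFDeriv ℝ j c (0, q₀)‖ + 1 ≤ K := fun j hj =>
    Finset.single_le_sum (f := fun j => ‖iteratedFDeriv ℝ j c (0, q₀)‖ + 1)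
      (fun _ _ => by positivity) (Finset.mem_range.2 (by omega))
  -- Leibniz's rule at order two: the binomial coefficients sum to four.
  refine ⟨4 * C * K, by positivity, d, ?_⟩
  filter_upwards [hb, hcb 0 (by simp), hcb 1 (by simp), hcb 2 (by simp),
    isOpen_interior.mem_nhds hq₀] with q hb hc0 hc1 hc2 hq φ
  have hx : ((φ, q) : Vec m × (Vec m × Vec p)) ∈ D := hq
  have hP : 0 ≤ C * (1 + ‖φ‖) ^ d := by positivity
  have h1 := norm_iteratedFDerivWithin_mul_le (contDiffOn_mgfOn h (js := []) (by simp)) hc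
    hD.uniqueDiffOn hx (n := 2) (by norm_num)
  have h2 : ∀ j ≤ 2, ‖iteratedFDerivWithin ℝ j c D (φ, q)‖ ≤ K := by
    intro j hj
    rw [iteratedFDerivWithin_of_isOpen j hD hx, htrans]
    refine le_trans ?_ (hKle j hj)
    interval_cases j
    exacts [hc0.le, hc1.le, hc2.le]
  have h3 : ∀ j ≤ 2, ‖iteratedFDerivWithin ℝ j (mgfOn Q [] []) D (φ, q)‖ ≤
      C * (1 + ‖φ‖) ^ d := by
    intro j hj
    rw [iteratedFDerivWithin_of_isOpen j hD hx]
    exact hb j hj φ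
  rw [iteratedFDerivWithin_of_isOpen 2 hD hx] at h1
  have h4 : ratio Q = fun y => mgfOn Q [] [] y * c y := by
    ext y; exact div_eq_mul_inv _ _
  rw [← norm_iteratedFDeriv_one, norm_iteratedFDeriv_fderiv, h4]
  refine h1.trans ?_
  simp only [Finset.sum_range_succ, Finset.sum_range_zero, Nat.choose_zero_right,
    Nat.choose_one_right, Nat.choose_self, Nat.cast_one, Nat.cast_ofNat, zero_add, one_mul,
    Nat.sub_zero]
  have e0 := mul_le_mul (h3 0 (by simp)) (h2 2 (by simp)) (norm_nonneg _) hP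
  have e1 := mul_le_mul (h3 1 (by simp)) (h2 1 (by simp)) (norm_nonneg _) hP
  have e2 := mul_le_mul (h3 2 (by simp)) (h2 0 (by simp)) (norm_nonneg _) hP
  have e3 : (2 - 1 : ℕ) = 1 := rfl
  rw [e3]
  linarith

end Growth

end Saddlepoint

namespace Saddlepoint

/-! ### Exponential limits and a uniform Taylor expansion. -/

section Taylor

/-- Since `a - 1` is of order `1/n`, the quadratic error of `log a ≈ a - 1` vanishes even after
multiplication by `n`. -/
theorem tendsto_pow_exp {ι : Type*} {l : Filter ι} {n : ι → ℕ} {a : ι → ℂ} {b : ℂ}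
    (hn : Tendsto n l atTop) (ha : Tendsto (fun i => (n i : ℂ) * (a i - 1)) l (𝓝 b)) :
    Tendsto (fun i => a i ^ n i) l (𝓝 (Complex.exp b)) := by
  have hinv : Tendsto (fun i => ((n i : ℂ))⁻¹) l (𝓝 0) :=
    (tendsto_inv_atTop_nhds_zero_nat (𝕜 := ℂ)).comp hn
  have hpos : ∀ᶠ i in l, 1 ≤ n i := hn.eventually (eventually_ge_atTop 1)
  have hz : Tendsto (fun i => a i - 1) l (𝓝 0) := by
    have h1 := hinv.mul ha
    rw [zero_mul] at h1
    refine h1.congr' ?_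
    filter_upwards [hpos] with i hi
    have : (n i : ℂ) ≠ 0 := by exact_mod_cast (by omega : n i ≠ 0)
    field_simp
  have hsmall : ∀ᶠ i in l, ‖a i - 1‖ < 1 / 2 := by
    have := hz.norm.eventually (eventually_lt_nhds (b := (1 / 2 : ℝ)) (by simp))
    simpa using this
  have herr : Tendsto (fun i => (n i : ℂ) * (Complex.log (1 + (a i - 1)) - (a i - 1))) l (𝓝 0) := by
    have h1 : Tendsto (fun i => ‖(n i : ℂ) * (a i - 1)‖ * ‖a i - 1‖) l (𝓝 0) := by
      simpa using ha.norm.mul hz.norm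
    refine squeeze_zero_norm' ?_ h1
    filter_upwards [hsmall] with i hi
    have h2 := Complex.norm_log_one_add_sub_self_le (z := a i - 1) (by linarith)
    rw [norm_mul, norm_mul, mul_assoc]
    gcongr
    refine h2.trans ?_
    have h3 : (1 - ‖a i - 1‖)⁻¹ ≤ 2 := by
      rw [inv_le_comm₀ (by linarith) (by norm_num)]
      linarith
    calc ‖a i - 1‖ ^ 2 * (1 - ‖a i - 1‖)⁻¹ / 2 ≤ ‖a i - 1‖ ^ 2 * 2 / 2 := by gcongr
      _ = _ := by ring
  have h4 := herr.add ha
  rw [zero_add] at h4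
  refine ((Complex.continuous_exp.tendsto b).comp h4).congr' ?_
  filter_upwards [hsmall] with i hi
  have hne : a i ≠ 0 := by
    intro h0
    rw [h0] at hi
    norm_num at hi
  simp only [Function.comp_apply]
  rw [← mul_add, sub_add_cancel, add_sub_cancel, Complex.exp_nat_mul, Complex.exp_log hne]

/-- A second order Taylor expansion that is uniform in a parameter. -/
theorem tendsto_taylor_two {Y : Type*} [TopologicalSpace Y] {y₀ : Y} {h h' h'' : Y → ℝ → ℂ}
    {b : ℂ} (h1 : ∀ᶠ y in 𝓝 y₀, ∀ t, HasDerivAt (h y) (h' y t) t)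
    (h2 : ∀ᶠ y in 𝓝 y₀, ∀ t, HasDerivAt (h' y) (h'' y t) t)
    (h0 : ∀ᶠ y in 𝓝 y₀, h y 0 = 1 ∧ h' y 0 = 0)
    (hc : Tendsto (fun x : ℝ × Y => h'' x.2 x.1) (𝓝 (0, y₀)) (𝓝 b)) :
    Tendsto (fun x : ℕ × Y => (x.1 : ℂ) * (h x.2 (Real.sqrt x.1)⁻¹ - 1)) (atTop ×ˢ 𝓝 y₀)
      (𝓝 (b / 2)) := by
  rw [Metric.tendsto_nhds]
  intro ε hε
  have hev := Metric.tendsto_nhds.1 hc (ε / 2) (half_pos hε)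
  rw [nhds_prod_eq, eventually_prod_iff] at hev
  obtain ⟨pa, hpa, pb, hpb, hab⟩ := hev
  obtain ⟨r, hr, hball⟩ := Metric.eventually_nhds_iff.1 hpa
  have hr' : ∀ᶠ n : ℕ in atTop, (Real.sqrt n)⁻¹ < r :=
    tendsto_sqrt_inv.eventually (eventually_lt_nhds hr)
  filter_upwards [(hr'.and (eventually_ge_atTop 1)).prod_mk (hpb.and (h0.and (h1.and h2)))] with x
    ⟨⟨hxr, hn⟩, hb, ⟨hz, hz'⟩, hd1, hd2⟩
  have hpos : 0 < Real.sqrt x.1 := Real.sqrt_pos.2 (by exact_mod_cast hn)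
  set τ := (Real.sqrt x.1)⁻¹ with hτ
  have hτ0 : 0 < τ := inv_pos.2 hpos
  have hb2 : ∀ t ∈ Set.Icc 0 τ, ‖h'' x.2 t - b‖ ≤ ε / 2 := by
    intro t ht
    rw [← dist_eq_norm]
    refine (hab (hball ?_) hb).le
    rw [dist_zero_right, Real.norm_of_nonneg ht.1]
    exact ht.2.trans_lt hxr
  -- The closeness of `h''` to `b` is integrated twice over `[0, τ]`; the resulting `τ²` cancels the
  -- factor `n`.
  have hb1 : ∀ t ∈ Set.Icc 0 τ, ‖h' x.2 t - t * b‖ ≤ ε / 2 * τ := by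
    intro t ht
    have := norm_image_sub_le_of_norm_deriv_le_segment' (f := fun t : ℝ => h' x.2 t - t * b)
      (f' := fun t => h'' x.2 t - b) (a := 0) (b := t) (C := ε / 2)
      (fun u _ => by
        have h3 : HasDerivAt (fun t : ℝ => (t : ℂ) * b) (1 * b) u :=
          (Complex.ofRealCLM.hasDerivAt (x := u)).mul_const b
        rw [one_mul] at h3
        exact ((hd2 u).sub h3).hasDerivWithinAt)
      (fun u hu => hb2 u ⟨hu.1, hu.2.le.trans ht.2⟩) t ⟨ht.1, le_rfl⟩
    simp only [hz', Complex.ofReal_zero, zero_mul, sub_zero] at this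
    exact this.trans (by gcongr; exact ht.2)
  have hb0 := norm_image_sub_le_of_norm_deriv_le_segment' (f := fun t : ℝ => h x.2 t - t ^ 2 * (b / 2))
      (f' := fun t => h' x.2 t - t * b) (a := 0) (b := τ) (C := ε / 2 * τ)
      (fun u _ => by
        have h3 : HasDerivAt (fun t : ℝ => (t : ℂ) ^ 2 * (b / 2)) (2 * (u : ℂ) * (b / 2)) u := by
          have := ((Complex.ofRealCLM.hasDerivAt (x := u)).pow 2).mul_const (b / 2)
          simpa using this
        have h4 : 2 * (u : ℂ) * (b / 2) = u * b := by ring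
        rw [h4] at h3
        exact ((hd1 u).sub h3).hasDerivWithinAt)
      (fun u hu => hb1 u ⟨hu.1, hu.2.le⟩) τ ⟨hτ0.le, le_rfl⟩
  simp only [hz, Complex.ofReal_zero, sub_zero] at hb0
  have hsq : (x.1 : ℝ) = τ⁻¹ * τ⁻¹ := by
    rw [hτ, inv_inv, Real.mul_self_sqrt (Nat.cast_nonneg _)]
  have hne : (τ : ℂ) ≠ 0 := by exact_mod_cast hτ0.ne'
  have hsq' : (x.1 : ℂ) = (τ : ℂ)⁻¹ * (τ : ℂ)⁻¹ := by
    have := congrArg (fun r : ℝ => (r : ℂ)) hsq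
    simpa using this
  have e1 : (x.1 : ℂ) * (h x.2 τ - 1) - b / 2 =
      (τ : ℂ)⁻¹ * (τ : ℂ)⁻¹ * (h x.2 τ - τ ^ 2 * (b / 2) - (1 - 0 ^ 2 * (b / 2))) := by
    rw [hsq']
    field_simp
    ring
  rw [dist_eq_norm, e1, norm_mul, norm_mul, norm_inv, Complex.norm_real,
    Real.norm_of_nonneg hτ0.le]
  calc τ⁻¹ * τ⁻¹ * _ ≤ τ⁻¹ * τ⁻¹ * (ε / 2 * τ * τ) := by gcongr
    _ = ε / 2 := by field_simp
    _ < ε := half_lt_self hε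

end Taylor

/-! ### The gradient and curvature of the cumulant generating function; the local expansion. -/

section Gradient

variable {m p : ℕ} {Θ : Set (Vec p)} {Q : Vec p → Measure (Vec m)}

/-- The gradient of the cumulant generating function in the dual variable. -/
noncomputable def gradK (Q : Vec p → Measure (Vec m)) (q : Vec m × Vec p) : Vec m :=
  WithLp.toLp 2 fun j => mgfReal Q [j] q / mgfReal Q [] q

@[simp]
theorem gradK_apply (q : Vec m × Vec p) (j : Fin m) :
    gradK Q q j = mgfReal Q [j] q / mgfReal Q [] q := rfl

variable [∀ θ, IsProbabilityMeasure (Q θ)]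

theorem contDiffOn_gradK (h : GrowthBound Θ Q) :
    ContDiffOn ℝ 2 (gradK Q) (interior (jointDomain Θ Q)) := by
  rw [contDiffOn_piLp]
  intro j
  exact (contDiffOn_mgfReal h (by simp)).div (contDiffOn_mgfReal h (by simp)) fun q hq =>
    (mgfReal_nil_pos (interior_subset hq)).ne'

theorem cumGF_eq_log (q : Vec m × Vec p) : cumGF (Q q.2) q.1 = Real.log (mgfReal Q [] q) := by
  rw [mgfReal_nil, cumGF]

theorem contDiffOn_cumGF (h : GrowthBound Θ Q) :
    ContDiffOn ℝ 2 (fun q : Vec m × Vec p => cumGF (Q q.2) q.1) (interior (jointDomain Θ Q)) := by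
  simp_rw [cumGF_eq_log]
  exact (contDiffOn_mgfReal h (by simp)).log fun q hq =>
    (mgfReal_nil_pos (interior_subset hq)).ne'

theorem hasGradientAt_cumGF (h : GrowthBound Θ Q) {q : Vec m × Vec p}
    (hq : q ∈ interior (jointDomain Θ Q)) : HasGradientAt (cumGF (Q q.2)) (gradK Q q) q.1 := by
  rw [hasGradientAt_iff_hasFDerivAt]
  have h1 := (hasFDerivAt_mgfReal h (js := []) (by simp) hq).log
    (mgfReal_nil_pos (interior_subset hq)).ne'
  have h2 : cumGF (Q q.2) = fun s => Real.log (mgfReal Q [] (s, q.2)) := by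
    ext s; exact cumGF_eq_log (s, q.2)
  rw [h2]
  refine h1.congr_fderiv ?_
  ext v
  simp only [smul_apply, coordForm_apply, smul_eq_mul, InnerProductSpace.toDual_apply_apply,
    PiLp.inner_apply, RCLike.inner_apply, conj_trivial, gradK_apply, Finset.mul_sum]
  refine Finset.sum_congr rfl fun j _ => ?_
  rw [div_eq_mul_inv]
  ring

theorem hasFDerivAt_gradK_apply (h : GrowthBound Θ Q) {q : Vec m × Vec p}
    (hq : q ∈ interior (jointDomain Θ Q)) (v : Vec m) (j : Fin m) :
    fderiv ℝ (gradK Q) q (v, 0) j =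
      ∑ i, v i * (mgfReal Q [i, j] q / mgfReal Q [] q) - inner ℝ v (gradK Q q) * gradK Q q j := by
  have hpos := (mgfReal_nil_pos (interior_subset hq)).ne'
  have h1 := ((contDiffOn_gradK h).contDiffAt (isOpen_interior.mem_nhds hq)).differentiableAt
    two_ne_zero |>.hasFDerivAt
  have h2 : HasFDerivAt (fun s => gradK Q (s, q.2) j) _ q.1 :=
    ((EuclideanSpace.proj (𝕜 := ℝ) j).hasFDerivAt).comp q.1
      (HasFDerivAt.comp (g := gradK Q) q.1 h1 (hasFDerivAt_prodMk_left (𝕜 := ℝ) q.1 q.2))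
  have h3 : HasFDerivAt (fun s => gradK Q (s, q.2) j) _ q.1 :=
    (hasFDerivAt_mgfReal h (js := [j]) (by simp) hq).mul
      ((hasDerivAt_inv hpos).comp_hasFDerivAt q.1
        (hasFDerivAt_mgfReal h (js := []) (by simp) hq))
  have h4 := DFunLike.congr_fun (h2.unique h3) v
  simp only [ContinuousLinearMap.comp_apply, ContinuousLinearMap.inl_apply,
    PiLp.proj_apply, add_apply, smul_apply, coordForm_apply, smul_eq_mul] at h4
  rw [h4]
  simp only [gradK_apply, PiLp.inner_apply, RCLike.inner_apply, conj_trivial, Finset.mul_sum,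
    Finset.sum_mul, ← Finset.sum_add_distrib, ← Finset.sum_sub_distrib]
  refine Finset.sum_congr rfl fun i _ => ?_
  field_simp
  ring

/-- The curvature of the cumulant generating function in terms of the moment generating
function. -/
theorem inner_fderiv_gradK (h : GrowthBound Θ Q) {q : Vec m × Vec p}
    (hq : q ∈ interior (jointDomain Θ Q)) (v : Vec m) :
    inner ℝ v (fderiv ℝ (gradK Q) q (v, 0)) =
      ∑ j, ∑ i, v j * v i * (mgfReal Q [i, j] q / mgfReal Q [] q) -
        inner ℝ v (gradK Q q) ^ 2 := by
  have e : ∀ w : Vec m, inner ℝ v w = ∑ j, v j * w j := by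
    intro w
    simp only [PiLp.inner_apply, RCLike.inner_apply, conj_trivial]
    exact Finset.sum_congr rfl fun j _ => mul_comm _ _
  have e2 : inner ℝ v (gradK Q q) ^ 2 =
      ∑ j, v j * (inner ℝ v (gradK Q q) * gradK Q q j) := by
    rw [sq]
    nth_rewrite 2 [e]
    rw [Finset.mul_sum]
    exact Finset.sum_congr rfl fun j _ => by ring
  rw [e2, e, ← Finset.sum_sub_distrib]
  refine Finset.sum_congr rfl fun j _ => ?_
  rw [hasFDerivAt_gradK_apply h hq, mul_sub, Finset.mul_sum]
  congr 1
  exact Finset.sum_congr rfl fun i _ => by ring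

/-! ### The local expansion of the normalised moment generating function -/

theorem hasFDerivAt_mgfOn_left (h : GrowthBound Θ Q) {js : List (Fin m)} (hjs : js.length ≤ 3)
    {q : Vec m × Vec p} (hq : q ∈ interior (jointDomain Θ Q)) (φ : Vec m) :
    HasFDerivAt (fun φ => mgfOn Q [] js (φ, q))
      (Complex.I • coordForm (𝕜 := ℝ) fun j => mgfOn Q [] (j :: js) (φ, q)) φ := by
  have h1 := hasFDerivAt_mgfOn h hjs (x := (φ, q)) hq
  refine (HasFDerivAt.comp (g := mgfOn Q [] js) φ h1
    (hasFDerivAt_prodMk_left (𝕜 := ℝ) φ q)).congr_fderiv ?_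
  ext v
  simp only [ContinuousLinearMap.comp_apply, ContinuousLinearMap.inl_apply, totalForm_apply,
    cplx_apply, smul_apply, coordForm_apply, Finset.mul_sum, Complex.real_smul, smul_eq_mul,
    Prod.fst_zero, Prod.snd_zero, PiLp.zero_apply, Complex.ofReal_zero, zero_mul, zero_add,
    Finset.sum_const_zero, add_zero]
  exact Finset.sum_congr rfl fun j _ => by ring

theorem hasDerivAt_mgfOn_smul (h : GrowthBound Θ Q) {js : List (Fin m)} (hjs : js.length ≤ 3)
    {q : Vec m × Vec p} (hq : q ∈ interior (jointDomain Θ Q)) (ψ : Vec m) (t : ℝ) :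
    HasDerivAt (fun t : ℝ => mgfOn Q [] js (t • ψ, q))
      (Complex.I * ∑ j, (ψ j : ℂ) * mgfOn Q [] (j :: js) (t • ψ, q)) t := by
  have h1 := (hasFDerivAt_mgfOn_left h hjs hq (t • ψ)).comp_hasDerivAt t
    ((hasDerivAt_id t).smul_const ψ)
  simpa [Function.comp_def] using h1

theorem fderiv_ratio_inl (h : GrowthBound Θ Q) {q : Vec m × Vec p}
    (hq : q ∈ interior (jointDomain Θ Q)) (ψ : Vec m) :
    fderiv ℝ (ratio Q) (0, q) (ψ, 0) = Complex.I * (inner ℝ ψ (gradK Q q) : ℝ) := by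
  have hq' : ((0, q) : Vec m × (Vec m × Vec p)).2 ∈ interior (jointDomain Θ Q) := hq
  have h1 := ((contDiffOn_ratio h).contDiffAt (isOpen_snd_mem.mem_nhds hq')).differentiableAt
    two_ne_zero |>.hasFDerivAt
  have h2 := HasFDerivAt.comp (g := ratio Q) 0 h1 (hasFDerivAt_prodMk_left (𝕜 := ℝ) (0 : Vec m) q)
  have h3 : HasFDerivAt (fun φ : Vec m => ratio Q (φ, q)) _ 0 :=
    (hasFDerivAt_mgfOn_left h (js := []) (by simp) hq 0).mul_const ((mgfOn Q [] [] (0, q))⁻¹)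
  have h4 := DFunLike.congr_fun (h2.unique h3) ψ
  simp only [ContinuousLinearMap.comp_apply, ContinuousLinearMap.inl_apply] at h4
  rw [h4]
  simp only [smul_apply, coordForm_apply, smul_eq_mul, Complex.real_smul,
    mgfOn_zero_eq h (js := []) (by simp) hq, PiLp.inner_apply, RCLike.inner_apply, conj_trivial,
    gradK_apply]
  push_cast
  simp only [Finset.mul_sum]
  refine Finset.sum_congr rfl fun j _ => ?_
  rw [mgfOn_zero_eq h (js := [j]) (by simp) hq]
  rw [div_eq_mul_inv]
  ring

theorem continuousAt_mgfOn (h : GrowthBound Θ Q) {js : List (Fin m)} (hjs : js.length ≤ 3)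
    {q : Vec m × Vec p} (hq : q ∈ interior (jointDomain Θ Q)) (φ : Vec m) :
    ContinuousAt (mgfOn Q [] js) (φ, q) :=
  (hasFDerivAt_mgfOn h hjs (x := (φ, q)) hq).continuousAt

/-- The oscillation at frequency `K'(s; θ)` centres the tilted law at every nearby point. Thus the
first derivative along `tψ` vanishes identically in the parameters, the second tends to minus the
variance, and Taylor at `t = 1/√n` feeds `tendsto_pow_exp`. -/
theorem tendsto_ratio_pow (h : GrowthBound Θ Q) {q₀ : Vec m × Vec p}
    (hq₀ : q₀ ∈ interior (jointDomain Θ Q)) (ψ : Vec m) :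
    Tendsto (fun x : ℕ × (Vec m × Vec p) =>
      (ratio Q ((Real.sqrt x.1)⁻¹ • ψ, x.2) * osc (gradK Q x.2) ((Real.sqrt x.1)⁻¹ • ψ)) ^ x.1)
      (atTop ×ˢ 𝓝 q₀)
      (𝓝 (Real.exp (-(inner ℝ ψ (fderiv ℝ (gradK Q) q₀ (ψ, 0)) / 2)) : ℝ)) := by
  set κ : Vec m × Vec p → ℝ := fun q => inner ℝ ψ (gradK Q q) with hκ
  set M₀ : Vec m × Vec p → ℂ := fun q => mgfOn Q [] [] (0, q) with hM₀
  set e : Vec m × Vec p → ℝ → ℂ := fun q t => Complex.exp (-((t * κ q : ℝ) : ℂ) * Complex.I) with he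
  set g₀ : Vec m × Vec p → ℝ → ℂ := fun q t => mgfOn Q [] [] (t • ψ, q) / M₀ q with hg₀
  set g₁ : Vec m × Vec p → ℝ → ℂ := fun q t =>
    (∑ j, (ψ j : ℂ) * mgfOn Q [] [j] (t • ψ, q)) / M₀ q with hg₁
  set g₂ : Vec m × Vec p → ℝ → ℂ := fun q t =>
    (∑ j, (ψ j : ℂ) * ∑ i, (ψ i : ℂ) * mgfOn Q [] [i, j] (t • ψ, q)) / M₀ q with hg₂
  have hD : ∀ᶠ q in 𝓝 q₀, q ∈ interior (jointDomain Θ Q) := isOpen_interior.mem_nhds hq₀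
  have hd0 : ∀ q ∈ interior (jointDomain Θ Q), ∀ t,
      HasDerivAt (g₀ q) (Complex.I * g₁ q t) t := by
    intro q hq t
    have := (hasDerivAt_mgfOn_smul h (js := []) (by simp) hq ψ t).div_const (M₀ q)
    rwa [mul_div_assoc] at this
  have hd1 : ∀ q ∈ interior (jointDomain Θ Q), ∀ t,
      HasDerivAt (g₁ q) (Complex.I * g₂ q t) t := by
    intro q hq t
    have h1 : HasDerivAt (fun t : ℝ => ∑ j, (ψ j : ℂ) * mgfOn Q [] [j] (t • ψ, q))
        (∑ j, (ψ j : ℂ) * (Complex.I * ∑ i, (ψ i : ℂ) * mgfOn Q [] [i, j] (t • ψ, q))) t :=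
      HasDerivAt.fun_sum fun j _ =>
        (hasDerivAt_mgfOn_smul h (js := [j]) (by simp) hq ψ t).const_mul _
    refine (h1.div_const (M₀ q)).congr_deriv ?_
    simp only [hg₂, ← mul_div_assoc, Finset.mul_sum]
    congr 1
    exact Finset.sum_congr rfl fun j _ => Finset.sum_congr rfl fun i _ => by ring
  have hde : ∀ q t, HasDerivAt (e q) (-(κ q : ℂ) * Complex.I * e q t) t := by
    intro q t
    have h1 : HasDerivAt (fun t : ℝ => -((t * κ q : ℝ) : ℂ) * Complex.I)
        (-(κ q : ℂ) * Complex.I) t := by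
      have := (((hasDerivAt_id t).mul_const (κ q)).ofReal_comp.neg).mul_const Complex.I
      simpa using this
    refine h1.cexp.congr_deriv ?_
    simp only [he]
    ring
  have hosc : ∀ (q : Vec m × Vec p) (t : ℝ), osc (gradK Q q) (t • ψ) = e q t := by
    intro q t
    simp only [osc, he, real_inner_smul_left, hκ]
  have hg0 : ∀ q ∈ interior (jointDomain Θ Q), g₀ q 0 = 1 := fun q hq => by
    simp only [hg₀, zero_smul]
    exact div_self (mgfOn_zero_ne_zero h hq)
  have hg1 : ∀ q ∈ interior (jointDomain Θ Q), g₁ q 0 = κ q := fun q hq => by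
    simp only [hg₁, zero_smul, hM₀, hκ, mgfOn_zero_eq h (js := []) (by simp) hq, PiLp.inner_apply,
      RCLike.inner_apply, conj_trivial, gradK_apply, Finset.sum_div]
    push_cast
    refine Finset.sum_congr rfl fun j _ => ?_
    rw [mgfOn_zero_eq h (js := [j]) (by simp) hq]
    ring
  have key := tendsto_taylor_two (y₀ := q₀) (h := fun q t => g₀ q t * e q t)
    (h' := fun q t => Complex.I * (g₁ q t - κ q * g₀ q t) * e q t)
    (h'' := fun q t => -(g₂ q t - 2 * κ q * g₁ q t + κ q ^ 2 * g₀ q t) * e q t)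
    (b := ((-inner ℝ ψ (fderiv ℝ (gradK Q) q₀ (ψ, 0)) : ℝ) : ℂ)) ?_ ?_ ?_ ?_
  · have h1 := tendsto_pow_exp (n := fun x : ℕ × (Vec m × Vec p) => x.1) tendsto_fst key
    have e1 : Complex.exp (((-inner ℝ ψ (fderiv ℝ (gradK Q) q₀ (ψ, 0)) : ℝ) : ℂ) / 2) =
        ((Real.exp (-(inner ℝ ψ (fderiv ℝ (gradK Q) q₀ (ψ, 0)) / 2)) : ℝ) : ℂ) := by
      push_cast
      congr 1
      ring
    rw [e1] at h1
    refine h1.congr fun x => ?_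
    rw [hosc]
    rfl
  · filter_upwards [hD] with q hq t
    refine ((hd0 q hq t).mul (hde q t)).congr_deriv ?_
    ring
  · filter_upwards [hD] with q hq t
    refine ((((hd1 q hq t).sub ((hd0 q hq t).const_mul (κ q : ℂ))).const_mul Complex.I).mul
      (hde q t)).congr_deriv ?_
    simp only [Pi.sub_apply]
    linear_combination (g₂ q t - 2 * κ q * g₁ q t + κ q ^ 2 * g₀ q t) * e q t * Complex.I_mul_I
  · filter_upwards [hD] with q hq
    refine ⟨?_, ?_⟩
    · simp [hg0 q hq, he]
    · simp [hg0 q hq, hg1 q hq]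
  · have hpath : ContinuousAt (fun x : ℝ × (Vec m × Vec p) => (x.1 • ψ, x.2)) (0, q₀) := by
      fun_prop
    have hcm : ∀ js : List (Fin m), js.length ≤ 3 →
        ContinuousAt (fun x : ℝ × (Vec m × Vec p) => mgfOn Q [] js (x.1 • ψ, x.2)) (0, q₀) :=
      fun js hjs => ContinuousAt.comp (g := mgfOn Q [] js) (x := ((0 : ℝ), q₀))
        (f := fun x : ℝ × (Vec m × Vec p) => (x.1 • ψ, x.2))
        (continuousAt_mgfOn h hjs hq₀ _) hpath
    have hcM : ContinuousAt (fun x : ℝ × (Vec m × Vec p) => M₀ x.2) (0, q₀) :=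
      ContinuousAt.comp (g := mgfOn Q [] []) (x := ((0 : ℝ), q₀))
        (f := fun x : ℝ × (Vec m × Vec p) => ((0 : Vec m), x.2))
        (continuousAt_mgfOn h (by simp) hq₀ _) (by fun_prop)
    have hM0 : M₀ ((0 : ℝ), q₀).2 ≠ 0 := mgfOn_zero_ne_zero h hq₀
    have hcκ : ContinuousAt (fun x : ℝ × (Vec m × Vec p) => κ x.2) (0, q₀) := by
      have h1 : ContinuousAt (fun x : ℝ × (Vec m × Vec p) => gradK Q x.2) (0, q₀) :=
        ContinuousAt.comp (g := gradK Q) (x := ((0 : ℝ), q₀))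
          (f := fun x : ℝ × (Vec m × Vec p) => x.2)
          ((contDiffOn_gradK h).continuousOn.continuousAt (isOpen_interior.mem_nhds hq₀))
          (by fun_prop)
      exact continuousAt_const.inner h1
    have hcκ' : ContinuousAt (fun x : ℝ × (Vec m × Vec p) => (κ x.2 : ℂ)) (0, q₀) :=
      Complex.continuous_ofReal.continuousAt.comp hcκ
    have hc0 : ContinuousAt (fun x : ℝ × (Vec m × Vec p) => g₀ x.2 x.1) (0, q₀) :=
      (hcm [] (by simp)).div hcM hM0
    have hc1 : ContinuousAt (fun x : ℝ × (Vec m × Vec p) => g₁ x.2 x.1) (0, q₀) :=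
      (tendsto_finsetSum _ fun j _ => continuousAt_const.mul (hcm [j] (by simp))).div hcM hM0
    have hc2 : ContinuousAt (fun x : ℝ × (Vec m × Vec p) => g₂ x.2 x.1) (0, q₀) :=
      (tendsto_finsetSum _ fun j _ => continuousAt_const.mul (tendsto_finsetSum _ fun i _ =>
        continuousAt_const.mul (hcm [i, j] (by simp)))).div hcM hM0
    have hce : ContinuousAt (fun x : ℝ × (Vec m × Vec p) => e x.2 x.1) (0, q₀) := by
      refine Complex.continuous_exp.continuousAt.comp ?_
      refine (Complex.continuous_ofReal.continuousAt.comp ?_).neg.mul continuousAt_const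
      exact continuousAt_fst.mul hcκ
    have hlim : -(g₂ q₀ 0 - 2 * κ q₀ * g₁ q₀ 0 + κ q₀ ^ 2 * g₀ q₀ 0) * e q₀ 0 =
        ((-inner ℝ ψ (fderiv ℝ (gradK Q) q₀ (ψ, 0)) : ℝ) : ℂ) := by
      have hg2 : g₂ q₀ 0 = ((∑ j, ∑ i, ψ j * ψ i * (mgfReal Q [i, j] q₀ / mgfReal Q [] q₀) : ℝ) :
          ℂ) := by
        simp only [hg₂, zero_smul, hM₀, mgfOn_zero_eq h (js := []) (by simp) hq₀, Finset.sum_div,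
          Finset.mul_sum]
        push_cast
        refine Finset.sum_congr rfl fun j _ => Finset.sum_congr rfl fun i _ => ?_
        rw [mgfOn_zero_eq h (js := [i, j]) (by simp) hq₀]
        ring
      have he0 : e q₀ 0 = 1 := by simp [he]
      rw [inner_fderiv_gradK h hq₀, hg0 q₀ hq₀, hg1 q₀ hq₀, hg2, he0]
      simp only [hκ]
      push_cast
      ring
    rw [← hlim]
    exact (((hc2.sub ((continuousAt_const.mul hcκ').mul hc1)).add
      ((hcκ'.pow 2).mul hc0)).neg).mul hce

end Gradient

end Saddlepoint

namespace Saddlepoint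

/-! ### The model as an instance of the Laplace integral. -/

section ModelLaplace

variable {m p : ℕ} {Θ : Set (Vec p)} {Q : Vec p → Measure (Vec m)}

/-- The inclusion of the parameter space. -/
noncomputable def inclTheta (m p : ℕ) : Vec p →L[ℝ] Vec m × (Vec m × Vec p) :=
  (ContinuousLinearMap.inr ℝ (Vec m) (Vec m × Vec p)).comp
    (ContinuousLinearMap.inr ℝ (Vec m) (Vec p))

@[simp]
theorem inclTheta_apply (v : Vec p) : inclTheta m p v = (0, (0, v)) := rfl

/-- The restriction of a linear form to the parameter space. -/
noncomputable def restrictTheta (m p : ℕ) :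
    (Vec m × (Vec m × Vec p) →L[ℝ] ℂ) →L[ℝ] (Vec p →L[ℝ] ℂ) :=
  (ContinuousLinearMap.compL ℝ (Vec p) (Vec m × (Vec m × Vec p)) ℂ).flip (inclTheta m p)

@[simp]
theorem restrictTheta_apply (T : Vec m × (Vec m × Vec p) →L[ℝ] ℂ) (v : Vec p) :
    restrictTheta m p T v = T (0, (0, v)) := rfl

/-- The parameter derivative of the normalised moment generating function. -/
noncomputable def ratioD₁ (Q : Vec p → Measure (Vec m)) (φ : Vec m) (q : Vec m × Vec p) :
    Vec p →L[ℝ] ℂ :=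
  restrictTheta m p (fderiv ℝ (ratio Q) (φ, q))

/-- The second parameter derivative of the normalised moment generating function. -/
noncomputable def ratioD₂ (Q : Vec p → Measure (Vec m)) (φ : Vec m) (q : Vec m × Vec p) :
    Vec p →L[ℝ] Vec p →L[ℝ] ℂ :=
  (restrictTheta m p).comp ((fderiv ℝ (fderiv ℝ (ratio Q)) (φ, q)).comp (inclTheta m p))

/-- The derivative of `gradK` in the dual variable, i.e. the matrix `A`. -/
noncomputable def opA (Q : Vec p → Measure (Vec m)) (q : Vec m × Vec p) : Vec m →L[ℝ] Vec m :=
  (fderiv ℝ (gradK Q) q).comp (ContinuousLinearMap.inl ℝ (Vec m) (Vec p))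

/-- The derivative of `gradK` in the parameter, i.e. the matrix `B`. -/
noncomputable def opB (Q : Vec p → Measure (Vec m)) (q : Vec m × Vec p) : Vec p →L[ℝ] Vec m :=
  (fderiv ℝ (gradK Q) q).comp (ContinuousLinearMap.inr ℝ (Vec m) (Vec p))

variable [∀ θ, IsProbabilityMeasure (Q θ)]

theorem contDiffAt_ratio (h : GrowthBound Θ Q) {q : Vec m × Vec p}
    (hq : q ∈ interior (jointDomain Θ Q)) (φ : Vec m) : ContDiffAt ℝ 2 (ratio Q) (φ, q) :=
  (contDiffOn_ratio h).contDiffAt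
    (isOpen_snd_mem.mem_nhds (show ((φ, q) : Vec m × (Vec m × Vec p)).2 ∈ _ from hq))

theorem hasFDerivAt_ratio (h : GrowthBound Θ Q) {q : Vec m × Vec p}
    (hq : q ∈ interior (jointDomain Θ Q)) (φ : Vec m) :
    HasFDerivAt (ratio Q) (fderiv ℝ (ratio Q) (φ, q)) (φ, q) :=
  ((contDiffAt_ratio h hq φ).differentiableAt two_ne_zero).hasFDerivAt

theorem contDiffAt_fderiv_ratio (h : GrowthBound Θ Q) {q : Vec m × Vec p}
    (hq : q ∈ interior (jointDomain Θ Q)) (φ : Vec m) :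
    ContDiffAt ℝ 1 (fderiv ℝ (ratio Q)) (φ, q) :=
  (contDiffAt_ratio h hq φ).fderiv_right (by norm_num)

theorem hasFDerivAt_fderiv_ratio (h : GrowthBound Θ Q) {q : Vec m × Vec p}
    (hq : q ∈ interior (jointDomain Θ Q)) (φ : Vec m) :
    HasFDerivAt (fderiv ℝ (ratio Q)) (fderiv ℝ (fderiv ℝ (ratio Q)) (φ, q)) (φ, q) :=
  ((contDiffAt_fderiv_ratio h hq φ).differentiableAt one_ne_zero).hasFDerivAt

theorem hasFDerivAt_prodMk_theta (φ s : Vec m) (θ : Vec p) :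
    HasFDerivAt (fun θ => (φ, (s, θ))) (inclTheta m p) θ :=
  (hasFDerivAt_prodMk_right (𝕜 := ℝ) φ (s, θ)).comp θ (hasFDerivAt_prodMk_right (𝕜 := ℝ) s θ)

theorem hasFDerivAt_ratio_theta (h : GrowthBound Θ Q) {q : Vec m × Vec p}
    (hq : q ∈ interior (jointDomain Θ Q)) (φ : Vec m) :
    HasFDerivAt (fun θ => ratio Q (φ, (q.1, θ))) (ratioD₁ Q φ q) q.2 :=
  HasFDerivAt.comp (g := ratio Q) q.2 (hasFDerivAt_ratio h hq φ)
    (hasFDerivAt_prodMk_theta φ q.1 q.2)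

theorem hasFDerivAt_ratioD₁ (h : GrowthBound Θ Q) {q : Vec m × Vec p}
    (hq : q ∈ interior (jointDomain Θ Q)) (φ : Vec m) :
    HasFDerivAt (fun θ => ratioD₁ Q φ (q.1, θ)) (ratioD₂ Q φ q) q.2 :=
  (restrictTheta m p).hasFDerivAt.comp q.2
    (HasFDerivAt.comp (g := fderiv ℝ (ratio Q)) q.2 (hasFDerivAt_fderiv_ratio h hq φ)
      (hasFDerivAt_prodMk_theta φ q.1 q.2))

/-- The ratio is normalised to `1` at `φ = 0` for all parameters, so its parameter derivatives
vanish there. -/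
theorem ratioD₁_zero (h : GrowthBound Θ Q) {q : Vec m × Vec p}
    (hq : q ∈ interior (jointDomain Θ Q)) : ratioD₁ Q 0 q = 0 := by
  refine (hasFDerivAt_ratio_theta h hq 0).unique
    ((hasFDerivAt_const (1 : ℂ) q.2).congr_of_eventuallyEq ?_)
  have hev : ∀ᶠ θ in 𝓝 q.2, (q.1, θ) ∈ interior (jointDomain Θ Q) :=
    (Continuous.prodMk_right q.1).continuousAt.eventually (isOpen_interior.mem_nhds hq)
  filter_upwards [hev] with θ hθ
  exact ratio_zero h hθ

theorem ratioD₂_zero (h : GrowthBound Θ Q) {q : Vec m × Vec p}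
    (hq : q ∈ interior (jointDomain Θ Q)) : ratioD₂ Q 0 q = 0 := by
  refine (hasFDerivAt_ratioD₁ h hq 0).unique
    ((hasFDerivAt_const (0 : Vec p →L[ℝ] ℂ) q.2).congr_of_eventuallyEq ?_)
  have hev : ∀ᶠ θ in 𝓝 q.2, (q.1, θ) ∈ interior (jointDomain Θ Q) :=
    (Continuous.prodMk_right q.1).continuousAt.eventually (isOpen_interior.mem_nhds hq)
  filter_upwards [hev] with θ hθ
  exact ratioD₁_zero h hθ

theorem hasDerivAt_ratioD₁_smul (h : GrowthBound Θ Q) {q : Vec m × Vec p}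
    (hq : q ∈ interior (jointDomain Θ Q)) (φ : Vec m) (t : ℝ) :
    HasDerivAt (fun t : ℝ => ratioD₁ Q (t • φ) q)
      (restrictTheta m p (fderiv ℝ (fderiv ℝ (ratio Q)) (t • φ, q) (φ, 0))) t := by
  have h1 : HasDerivAt (fun t : ℝ => (t • φ, q)) (φ, 0) t := by
    have := ((hasDerivAt_id t).smul_const φ).prodMk (hasDerivAt_const t q)
    simpa using this
  exact (restrictTheta m p).hasFDerivAt.comp_hasDerivAt t
    (HasFDerivAt.comp_hasDerivAt (l := fderiv ℝ (ratio Q)) t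
      (hasFDerivAt_fderiv_ratio h hq (t • φ)) h1)

/-- The decisive factor `‖φ‖` comes from the mean value inequality along the segment from `0`, where
the derivative vanishes. -/
theorem norm_ratioD₁_le (h : GrowthBound Θ Q) {q : Vec m × Vec p}
    (hq : q ∈ interior (jointDomain Θ Q)) {C : ℝ} (hC : 0 ≤ C) {d : ℕ}
    (hb : ∀ φ, ‖fderiv ℝ (fderiv ℝ (ratio Q)) (φ, q)‖ ≤ C * (1 + ‖φ‖) ^ d) (φ : Vec m) :
    ‖ratioD₁ Q φ q‖ ≤ ‖restrictTheta m p‖ * C * ‖φ‖ * (1 + ‖φ‖) ^ d := by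
  have h1 := norm_image_sub_le_of_norm_deriv_le_segment' (f := fun t : ℝ => ratioD₁ Q (t • φ) q)
    (f' := fun t => restrictTheta m p (fderiv ℝ (fderiv ℝ (ratio Q)) (t • φ, q) (φ, 0)))
    (a := 0) (b := 1) (C := ‖restrictTheta m p‖ * C * ‖φ‖ * (1 + ‖φ‖) ^ d)
    (fun t _ => (hasDerivAt_ratioD₁_smul h hq φ t).hasDerivWithinAt) (fun t ht => ?_) 1
    ⟨zero_le_one, le_rfl⟩
  · simpa [ratioD₁_zero h hq] using h1
  · refine ((restrictTheta m p).le_opNorm _).trans ?_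
    have h2 : ‖((φ, 0) : Vec m × (Vec m × Vec p))‖ = ‖φ‖ := by simp [Prod.norm_def]
    have h3 : ‖t • φ‖ ≤ ‖φ‖ := by
      rw [norm_smul, Real.norm_of_nonneg ht.1]
      exact mul_le_of_le_one_left (norm_nonneg _) ht.2.le
    calc ‖restrictTheta m p‖ * ‖fderiv ℝ (fderiv ℝ (ratio Q)) (t • φ, q) (φ, 0)‖
        ≤ ‖restrictTheta m p‖ * (C * (1 + ‖φ‖) ^ d * ‖φ‖) := by
          gcongr
          refine (ContinuousLinearMap.le_opNorm _ _).trans ?_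
          rw [h2]
          gcongr
          exact (hb _).trans (by gcongr)
      _ = _ := by ring

theorem norm_ratioD₂_le (φ : Vec m) (q : Vec m × Vec p) :
    ‖ratioD₂ Q φ q‖ ≤
      ‖restrictTheta m p‖ * ‖inclTheta m p‖ * ‖fderiv ℝ (fderiv ℝ (ratio Q)) (φ, q)‖ := by
  refine (ContinuousLinearMap.opNorm_comp_le _ _).trans ?_
  rw [mul_assoc]
  gcongr
  refine (ContinuousLinearMap.opNorm_comp_le _ _).trans (mul_comm _ _).le

/-- By symmetry of the second derivative the parameter derivative may be taken last. The
`φ`-derivative at zero is `i ⟪ψ, K'⟫`, and differentiating `K'` in `θ` gives `B`. -/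
theorem restrictTheta_fderiv_fderiv_ratio (h : GrowthBound Θ Q) {q : Vec m × Vec p}
    (hq : q ∈ interior (jointDomain Θ Q)) (ψ : Vec m) :
    restrictTheta m p (fderiv ℝ (fderiv ℝ (ratio Q)) (0, q) (ψ, 0)) = LaplaceData.limitForm (opB Q q) ψ := by
  ext v
  rw [restrictTheta_apply, (contDiffAt_ratio h hq 0).isSymmSndFDerivAt (by simp) (ψ, 0) (0, (0, v)),
    LaplaceData.limitForm_apply]
  have hev : ∀ᶠ θ in 𝓝 q.2, (q.1, θ) ∈ interior (jointDomain Θ Q) :=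
    (Continuous.prodMk_right q.1).continuousAt.eventually (isOpen_interior.mem_nhds hq)
  have h1 : HasFDerivAt (fun θ => fderiv ℝ (ratio Q) (0, (q.1, θ)) (ψ, 0)) _ q.2 :=
    (ContinuousLinearMap.apply ℝ ℂ ((ψ, 0) : Vec m × (Vec m × Vec p))).hasFDerivAt.comp q.2
      (HasFDerivAt.comp (g := fderiv ℝ (ratio Q)) q.2 (hasFDerivAt_fderiv_ratio h hq 0)
        (hasFDerivAt_prodMk_theta 0 q.1 q.2))
  have hk := (((contDiffOn_gradK h).contDiffAt (isOpen_interior.mem_nhds hq)).differentiableAt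
    two_ne_zero).hasFDerivAt
  have h2 : HasFDerivAt (fun θ => inner ℝ ψ (gradK Q (q.1, θ))) _ q.2 :=
    (innerSL ℝ ψ).hasFDerivAt.comp q.2
      (HasFDerivAt.comp (g := gradK Q) q.2 hk (hasFDerivAt_prodMk_right (𝕜 := ℝ) q.1 q.2))
  have h3 : HasFDerivAt (fun θ => Complex.I * ((inner ℝ ψ (gradK Q (q.1, θ)) : ℝ) : ℂ)) _ q.2 :=
    (Complex.ofRealCLM.hasFDerivAt.comp q.2 h2).const_mul Complex.I
  have h4 := h3.congr_of_eventuallyEq (hev.mono fun θ hθ => fderiv_ratio_inl h hθ ψ)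
  have h5 := DFunLike.congr_fun (h1.unique h4) v
  simpa [opB] using h5

/-- The normalised moment generating function is the data of a Laplace integral. -/
theorem exists_laplaceData (h : GrowthBound Θ Q) (hd : DecayBound Θ Q) {q₀ : Vec m × Vec p}
    (hq₀ : q₀ ∈ interior (jointDomain Θ Q)) : ∃ N ⊆ interior (jointDomain Θ Q), ∃ (δ C : ℝ) (d : ℕ),
      LaplaceData (fun φ q => ratio Q (φ, q)) (ratioD₁ Q) (ratioD₂ Q) (gradK Q) (opA Q q₀)
        (opB Q q₀) q₀ N δ C d := by
  obtain ⟨δ, hδ, hdec⟩ := hd.exists_bound hq₀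
  obtain ⟨C, hC, d, hb⟩ := exists_bound_fderiv_fderiv_ratio h hd hq₀
  obtain ⟨N, hN, hNo, hqN⟩ := eventually_nhds_iff.1
    (hdec.and (hb.and (isOpen_interior.mem_nhds hq₀)))
  have hNS : N ⊆ interior (jointDomain Θ Q) := fun q hq => (hN q hq).2.2
  set r := ‖restrictTheta m p‖
  have hr : 0 ≤ r := ContinuousLinearMap.opNorm_nonneg _
  set C' := r * C + r * ‖inclTheta m p‖ * C
  have hC' : 0 ≤ C' := by positivity
  refine ⟨N, hNS, δ, C', d, hNo, hqN, hδ, hC', fun q hq => (hN q hq).1, ?_, ?_, ?_, ?_, ?_, ?_, ?_,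
    ratio_zero h hq₀, ratioD₂_zero h hq₀, ?_, ?_⟩
  · exact fun q hq φ => (contDiffAt_ratio h (hNS hq) φ).continuousAt
  · exact fun q hq φ => (restrictTheta m p).continuous.continuousAt.comp
      (f := fun x : Vec m × (Vec m × Vec p) => fderiv ℝ (ratio Q) x)
      (contDiffAt_fderiv_ratio h (hNS hq) φ).continuousAt
  · intro q hq φ
    have h1 : ContinuousAt (fderiv ℝ (fderiv ℝ (ratio Q))) (φ, q) :=
      ((contDiffAt_fderiv_ratio h (hNS hq) φ).fderiv_right (m := 0) (by norm_num)).continuousAt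
    exact (continuousAt_const (y := restrictTheta m p)).clm_comp
      (h1.clm_comp (continuousAt_const (y := inclTheta m p)))
  · exact fun q hq φ => hasFDerivAt_ratio_theta h (hNS hq) φ
  · exact fun q hq φ => hasFDerivAt_ratioD₁ h (hNS hq) φ
  · intro q hq φ
    refine (norm_ratioD₁_le h (hNS hq) hC (hN q hq).2.1 φ).trans ?_
    gcongr
    linarith [show 0 ≤ r * ‖inclTheta m p‖ * C by positivity]
  · intro q hq φ
    refine (norm_ratioD₂_le φ q).trans ?_
    calc r * ‖inclTheta m p‖ * ‖fderiv ℝ (fderiv ℝ (ratio Q)) (φ, q)‖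
        ≤ r * ‖inclTheta m p‖ * (C * (1 + ‖φ‖) ^ d) := by
          gcongr
          exact (hN q hq).2.1 φ
      _ = r * ‖inclTheta m p‖ * C * (1 + ‖φ‖) ^ d := by ring
      _ ≤ _ := by gcongr; linarith [show 0 ≤ r * C by positivity]
  · exact fun ψ => tendsto_ratio_pow h hq₀ ψ
  -- `ratioD₁` vanishes at `φ = 0`, so its multiple by `√n` at `ψ / √n` is a difference quotient.
  -- The mean value inequality makes its convergence uniform in nearby parameters.
  · intro ψ
    have hT := restrictTheta_fderiv_fderiv_ratio h hq₀ ψ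
    change Tendsto _ _ (𝓝 (LaplaceData.limitForm (opB Q q₀) ψ))
    rw [← hT]
    set G : Vec m × (Vec m × Vec p) → Vec p →L[ℝ] ℂ := fun x =>
      restrictTheta m p (fderiv ℝ (fderiv ℝ (ratio Q)) x (ψ, 0)) with hG
    have h1 : ContinuousAt G (0, q₀) := by
      have h1 : ContinuousAt (fderiv ℝ (fderiv ℝ (ratio Q))) (0, q₀) :=
        ((contDiffAt_fderiv_ratio h hq₀ 0).fderiv_right (m := 0) (by norm_num)).continuousAt
      exact (restrictTheta m p).continuous.continuousAt.comp
        (h1.clm_apply (continuousAt_const (y := ((ψ, 0) : Vec m × (Vec m × Vec p)))))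
    have h2 : ContinuousAt (fun x : ℝ × (Vec m × Vec p) => G (x.1 • ψ, x.2)) (0, q₀) :=
      ContinuousAt.comp (g := G) (x := ((0 : ℝ), q₀))
        (f := fun x : ℝ × (Vec m × Vec p) => (x.1 • ψ, x.2)) (by simpa using h1) (by fun_prop)
    rw [Metric.tendsto_nhds]
    intro ε hε
    have hev := Metric.tendsto_nhds.1 h2.tendsto (ε / 2) (half_pos hε)
    simp only [zero_smul] at hev
    rw [nhds_prod_eq, eventually_prod_iff] at hev
    obtain ⟨pa, hpa, pb, hpb, hab⟩ := hev
    obtain ⟨ρ, hρ, hball⟩ := Metric.eventually_nhds_iff.1 hpa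
    have hρ' : ∀ᶠ n : ℕ in atTop, (Real.sqrt n)⁻¹ < ρ :=
      tendsto_sqrt_inv.eventually (eventually_lt_nhds hρ)
    filter_upwards [(hρ'.and (eventually_ge_atTop 1)).prod_mk
      (hpb.and (isOpen_interior.mem_nhds hq₀))] with x ⟨⟨hxρ, hn⟩, hb, hq⟩
    have hpos : 0 < Real.sqrt x.1 := Real.sqrt_pos.2 (by exact_mod_cast hn)
    set τ := (Real.sqrt x.1)⁻¹ with hτ
    have hτ0 : 0 < τ := inv_pos.2 hpos
    have h3 := norm_image_sub_le_of_norm_deriv_le_segment'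
      (f := fun t : ℝ => ratioD₁ Q (t • ψ) x.2 - t • G (0, q₀))
      (f' := fun t => G (t • ψ, x.2) - G (0, q₀)) (a := 0) (b := τ) (C := ε / 2)
      (fun t _ => by
        have h4 : HasDerivAt (fun t : ℝ => t • G (0, q₀)) (G (0, q₀)) t := by
          simpa using (hasDerivAt_id t).smul_const (G (0, q₀))
        exact ((hasDerivAt_ratioD₁_smul h hq ψ t).sub h4).hasDerivWithinAt)
      (fun t ht => by
        rw [← dist_eq_norm]
        refine (hab (hball ?_) hb).le
        rw [dist_zero_right, Real.norm_of_nonneg ht.1]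
        exact ht.2.trans hxρ) τ ⟨hτ0.le, le_rfl⟩
    simp only [zero_smul ℝ ψ, ratioD₁_zero h hq] at h3
    have h5 : Real.sqrt x.1 • ratioD₁ Q (τ • ψ) x.2 - G (0, q₀) =
        τ⁻¹ • (ratioD₁ Q (τ • ψ) x.2 - τ • G (0, q₀)) := by
      rw [smul_sub, smul_smul, inv_mul_cancel₀ hτ0.ne', one_smul, hτ, inv_inv]
    rw [dist_eq_norm, h5, norm_smul, norm_inv, Real.norm_of_nonneg hτ0.le]
    have h6 : ratioD₁ Q (τ • ψ) x.2 - τ • G (0, q₀) - (0 - (0 : ℝ) • G (0, q₀)) =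
        ratioD₁ Q (τ • ψ) x.2 - τ • G (0, q₀) := by
      ext v
      simp
    rw [h6, sub_zero] at h3
    calc τ⁻¹ * _ ≤ τ⁻¹ * (ε / 2 * τ) := by gcongr
      _ = ε / 2 := by field_simp
      _ < ε := half_lt_self hε

end ModelLaplace

end Saddlepoint

namespace Saddlepoint

/-! ### The matrices `A`, `B`, `H` as derivatives of the joint cumulant generating function. -/

section Matrices

variable {m p : ℕ} {Θ : Set (Vec p)} {Q : Vec p → Measure (Vec m)}

theorem pd_eq_of_hasFDerivAt {d : ℕ} {f : Vec d → ℝ} {f' : Vec d →L[ℝ] ℝ} {x : Vec d}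
    (h : HasFDerivAt f f' x) (i : Fin d) : pd i f x = f' (EuclideanSpace.single i 1) :=
  (h.hasLineDerivAt _).lineDeriv

theorem pd_eq_of_eventuallyEq {d : ℕ} {f g : Vec d → ℝ} {g' : Vec d →L[ℝ] ℝ} {x : Vec d}
    (hfg : f =ᶠ[𝓝 x] g) (h : HasFDerivAt g g' x) (i : Fin d) :
    pd i f x = g' (EuclideanSpace.single i 1) :=
  pd_eq_of_hasFDerivAt (h.congr_of_eventuallyEq hfg) i

/-- The cumulant generating function as a function of both variables. -/
noncomputable def jointK (Q : Vec p → Measure (Vec m)) (q : Vec m × Vec p) : ℝ :=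
  cumGF (Q q.2) q.1

/-- The quadratic form of the parameter Hessian of the cumulant generating function. -/
noncomputable def hessTheta (Q : Vec p → Measure (Vec m)) (q : Vec m × Vec p) (v w : Vec p) : ℝ :=
  fderiv ℝ (fderiv ℝ (jointK Q)) q (0, v) (0, w)

variable [∀ θ, IsProbabilityMeasure (Q θ)]

theorem contDiffAt_jointK (h : GrowthBound Θ Q) {q : Vec m × Vec p}
    (hq : q ∈ interior (jointDomain Θ Q)) : ContDiffAt ℝ 2 (jointK Q) q :=
  (contDiffOn_cumGF h).contDiffAt (isOpen_interior.mem_nhds hq)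

theorem contDiffAt_gradK (h : GrowthBound Θ Q) {q : Vec m × Vec p}
    (hq : q ∈ interior (jointDomain Θ Q)) : ContDiffAt ℝ 2 (gradK Q) q :=
  (contDiffOn_gradK h).contDiffAt (isOpen_interior.mem_nhds hq)

theorem hasFDerivAt_jointK (h : GrowthBound Θ Q) {q : Vec m × Vec p}
    (hq : q ∈ interior (jointDomain Θ Q)) : HasFDerivAt (jointK Q) (fderiv ℝ (jointK Q) q) q :=
  ((contDiffAt_jointK h hq).differentiableAt two_ne_zero).hasFDerivAt

theorem hasFDerivAt_gradK (h : GrowthBound Θ Q) {q : Vec m × Vec p}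
    (hq : q ∈ interior (jointDomain Θ Q)) : HasFDerivAt (gradK Q) (fderiv ℝ (gradK Q) q) q :=
  ((contDiffAt_gradK h hq).differentiableAt two_ne_zero).hasFDerivAt

theorem contDiffAt_fderiv_jointK (h : GrowthBound Θ Q) {q : Vec m × Vec p}
    (hq : q ∈ interior (jointDomain Θ Q)) : ContDiffAt ℝ 1 (fderiv ℝ (jointK Q)) q :=
  (contDiffAt_jointK h hq).fderiv_right (by norm_num)

theorem hasFDerivAt_fderiv_jointK (h : GrowthBound Θ Q) {q : Vec m × Vec p}
    (hq : q ∈ interior (jointDomain Θ Q)) :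
    HasFDerivAt (fderiv ℝ (jointK Q)) (fderiv ℝ (fderiv ℝ (jointK Q)) q) q :=
  ((contDiffAt_fderiv_jointK h hq).differentiableAt one_ne_zero).hasFDerivAt

theorem fderiv_jointK_inl (h : GrowthBound Θ Q) {q : Vec m × Vec p}
    (hq : q ∈ interior (jointDomain Θ Q)) (v : Vec m) :
    fderiv ℝ (jointK Q) q (v, 0) = inner ℝ (gradK Q q) v := by
  have h1 := HasFDerivAt.comp (g := jointK Q) q.1 (hasFDerivAt_jointK h hq)
    (hasFDerivAt_prodMk_left (𝕜 := ℝ) q.1 q.2)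
  have h2 := (hasGradientAt_cumGF h hq).hasFDerivAt
  exact congrArg (fun L : Vec m →L[ℝ] ℝ => L v) (h1.unique h2)

theorem eventually_mem_interior {q : Vec m × Vec p} (hq : q ∈ interior (jointDomain Θ Q)) :
    ∀ᶠ q' in 𝓝 q, q' ∈ interior (jointDomain Θ Q) :=
  isOpen_interior.mem_nhds hq

theorem eventually_mem_interior_left {q : Vec m × Vec p} (hq : q ∈ interior (jointDomain Θ Q)) :
    ∀ᶠ s in 𝓝 q.1, (s, q.2) ∈ interior (jointDomain Θ Q) :=
  (Continuous.prodMk_left q.2).continuousAt.eventually (isOpen_interior.mem_nhds hq)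

theorem eventually_mem_interior_right {q : Vec m × Vec p}
    (hq : q ∈ interior (jointDomain Θ Q)) :
    ∀ᶠ θ in 𝓝 q.2, (q.1, θ) ∈ interior (jointDomain Θ Q) :=
  (Continuous.prodMk_right q.1).continuousAt.eventually (isOpen_interior.mem_nhds hq)

theorem fderiv_fderiv_jointK_inl (h : GrowthBound Θ Q) {q : Vec m × Vec p}
    (hq : q ∈ interior (jointDomain Θ Q)) (x : Vec m × Vec p) (v : Vec m) :
    fderiv ℝ (fderiv ℝ (jointK Q)) q x (v, 0) = inner ℝ (fderiv ℝ (gradK Q) q x) v := by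
  have h1 : HasFDerivAt (fun q => fderiv ℝ (jointK Q) q (v, 0)) _ q :=
    (hasFDerivAt_fderiv_jointK h hq).clm_apply (hasFDerivAt_const (v, 0) q)
  have h2 : HasFDerivAt (fun q => inner ℝ (gradK Q q) v) _ q :=
    (hasFDerivAt_gradK h hq).inner ℝ (hasFDerivAt_const v q)
  have h3 := h1.unique (h2.congr_of_eventuallyEq
    ((eventually_mem_interior hq).mono fun q' hq' => fderiv_jointK_inl h hq' v))
  have h4 := congrArg (fun L : Vec m × Vec p →L[ℝ] ℝ => L x) h3
  simpa using h4

theorem isSymmSndFDerivAt_jointK (h : GrowthBound Θ Q) {q : Vec m × Vec p}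
    (hq : q ∈ interior (jointDomain Θ Q)) : IsSymmSndFDerivAt ℝ (jointK Q) q :=
  (contDiffAt_jointK h hq).isSymmSndFDerivAt (by simp)

theorem hessTheta_symm (h : GrowthBound Θ Q) {q : Vec m × Vec p}
    (hq : q ∈ interior (jointDomain Θ Q)) (v w : Vec p) :
    hessTheta Q q v w = hessTheta Q q w v :=
  isSymmSndFDerivAt_jointK h hq _ _

theorem opA_symm (h : GrowthBound Θ Q) {q : Vec m × Vec p}
    (hq : q ∈ interior (jointDomain Θ Q)) (v w : Vec m) :
    inner ℝ (opA Q q v) w = inner ℝ v (opA Q q w) := by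
  have h1 := isSymmSndFDerivAt_jointK h hq (v, 0) (w, 0)
  rw [fderiv_fderiv_jointK_inl h hq, fderiv_fderiv_jointK_inl h hq] at h1
  exact h1.trans (real_inner_comm _ _)

theorem fderiv_fderiv_jointK_inl_inr (h : GrowthBound Θ Q) {q : Vec m × Vec p}
    (hq : q ∈ interior (jointDomain Θ Q)) (v : Vec m) (w : Vec p) :
    fderiv ℝ (fderiv ℝ (jointK Q)) q (v, 0) (0, w) = inner ℝ (opB Q q w) v := by
  rw [isSymmSndFDerivAt_jointK h hq (v, 0) (0, w), fderiv_fderiv_jointK_inl h hq]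
  rfl

theorem hasFDerivAt_gradK_left (h : GrowthBound Θ Q) {q : Vec m × Vec p}
    (hq : q ∈ interior (jointDomain Θ Q)) : HasFDerivAt (fun s => gradK Q (s, q.2)) (opA Q q) q.1 :=
  HasFDerivAt.comp (g := gradK Q) q.1 (hasFDerivAt_gradK h hq)
    (hasFDerivAt_prodMk_left (𝕜 := ℝ) q.1 q.2)

theorem hasFDerivAt_cumGF_theta (h : GrowthBound Θ Q) {q : Vec m × Vec p}
    (hq : q ∈ interior (jointDomain Θ Q)) :
    HasFDerivAt (fun θ => cumGF (Q θ) q.1)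
      ((fderiv ℝ (jointK Q) q).comp (ContinuousLinearMap.inr ℝ (Vec m) (Vec p))) q.2 :=
  HasFDerivAt.comp (g := jointK Q) q.2 (hasFDerivAt_jointK h hq)
    (hasFDerivAt_prodMk_right (𝕜 := ℝ) q.1 q.2)

theorem pd_cumGF_theta (h : GrowthBound Θ Q) {q : Vec m × Vec p}
    (hq : q ∈ interior (jointDomain Θ Q)) (i : Fin p) :
    pd i (fun θ => cumGF (Q θ) q.1) q.2 =
      fderiv ℝ (jointK Q) q (0, EuclideanSpace.single i 1) :=
  pd_eq_of_hasFDerivAt (hasFDerivAt_cumGF_theta h hq) i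

theorem hess_cumGF_apply (h : GrowthBound Θ Q) {q : Vec m × Vec p}
    (hq : q ∈ interior (jointDomain Θ Q)) (i j : Fin m) :
    hess (cumGF (Q q.2)) q.1 i j = opA Q q (EuclideanSpace.single i 1) j := by
  have h1 : (fun s => pd j (cumGF (Q q.2)) s) =ᶠ[𝓝 q.1] fun s => gradK Q (s, q.2) j := by
    filter_upwards [eventually_mem_interior_left hq] with s hs
    rw [pd_eq_of_hasFDerivAt (hasGradientAt_cumGF h hs).hasFDerivAt]
    simp [EuclideanSpace.inner_single_right]
  exact pd_eq_of_eventuallyEq h1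
    ((EuclideanSpace.proj (𝕜 := ℝ) j).hasFDerivAt.comp q.1 (hasFDerivAt_gradK_left h hq)) i

/-- The order of differentiation in `hess` yields the transposed entry, so symmetry of `opA` is
needed. -/
theorem matA_apply (h : GrowthBound Θ Q) {q : Vec m × Vec p}
    (hq : q ∈ interior (jointDomain Θ Q)) (i j : Fin m) :
    matA Q q.1 q.2 i j = opA Q q (EuclideanSpace.single j 1) i := by
  rw [matA, hess_cumGF_apply h hq]
  have h1 := opA_symm h hq (EuclideanSpace.single i 1) (EuclideanSpace.single j 1)
  simpa [EuclideanSpace.inner_single_right, EuclideanSpace.inner_single_left] using h1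

theorem matB_apply (h : GrowthBound Θ Q) {q : Vec m × Vec p}
    (hq : q ∈ interior (jointDomain Θ Q)) (i : Fin m) (j : Fin p) :
    matB Q q.1 q.2 i j = opB Q q (EuclideanSpace.single j 1) i := by
  have h1 : (fun s => pd j (fun t => cumGF (Q t) s) q.2) =ᶠ[𝓝 q.1]
      fun s => fderiv ℝ (jointK Q) (s, q.2) (0, EuclideanSpace.single j 1) := by
    filter_upwards [eventually_mem_interior_left hq] with s hs
    exact pd_cumGF_theta h hs j
  have h2 : HasFDerivAt (fun s => fderiv ℝ (jointK Q) (s, q.2) (0, EuclideanSpace.single j 1)) _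
      q.1 :=
    (HasFDerivAt.comp (g := fderiv ℝ (jointK Q)) q.1 (hasFDerivAt_fderiv_jointK h hq)
      (hasFDerivAt_prodMk_left (𝕜 := ℝ) q.1 q.2)).clm_apply (hasFDerivAt_const _ _)
  rw [matB, Matrix.of_apply, pd_eq_of_eventuallyEq h1 h2]
  have h3 := fderiv_fderiv_jointK_inl_inr h hq (EuclideanSpace.single i 1)
    (EuclideanSpace.single j 1)
  simpa [EuclideanSpace.inner_single_right] using h3

theorem hess_theta_apply (h : GrowthBound Θ Q) {q : Vec m × Vec p}
    (hq : q ∈ interior (jointDomain Θ Q)) (i j : Fin p) :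
    hess (fun t => cumGF (Q t) q.1) q.2 i j =
      hessTheta Q q (EuclideanSpace.single i 1) (EuclideanSpace.single j 1) := by
  have h1 : (fun θ => pd j (fun t => cumGF (Q t) q.1) θ) =ᶠ[𝓝 q.2]
      fun θ => fderiv ℝ (jointK Q) (q.1, θ) (0, EuclideanSpace.single j 1) := by
    filter_upwards [eventually_mem_interior_right hq] with θ hθ
    exact pd_cumGF_theta h hθ j
  have h2 : HasFDerivAt (fun θ => fderiv ℝ (jointK Q) (q.1, θ) (0, EuclideanSpace.single j 1)) _
      q.2 :=
    (HasFDerivAt.comp (g := fderiv ℝ (jointK Q)) q.2 (hasFDerivAt_fderiv_jointK h hq)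
      (hasFDerivAt_prodMk_right (𝕜 := ℝ) q.1 q.2)).clm_apply (hasFDerivAt_const _ _)
  rw [hess, Matrix.of_apply, pd_eq_of_eventuallyEq h1 h2]
  simp [hessTheta]

/-- The continuous linear map of a matrix between Euclidean spaces. -/
noncomputable def matOp {c d : ℕ} (M : Matrix (Fin c) (Fin d) ℝ) : Vec d →L[ℝ] Vec c :=
  LinearMap.toContinuousLinearMap (Matrix.toEuclideanLin M)

theorem matOp_apply {c d : ℕ} (M : Matrix (Fin c) (Fin d) ℝ) (v : Vec d) (i : Fin c) :
    matOp M v i = ∑ j, M i j * v j := by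
  simp [matOp, Matrix.toLpLin_apply, Matrix.mulVec, dotProduct]

theorem matOp_single {c d : ℕ} (M : Matrix (Fin c) (Fin d) ℝ) (j : Fin d) (i : Fin c) :
    matOp M (EuclideanSpace.single j 1) i = M i j := by
  simp [matOp_apply]

theorem ext_single {c d : ℕ} {S T : Vec d →L[ℝ] Vec c}
    (h : ∀ j i, S (EuclideanSpace.single j 1) i = T (EuclideanSpace.single j 1) i) : S = T := by
  refine ContinuousLinearMap.coe_injective ((EuclideanSpace.basisFun (Fin d) ℝ).toBasis.ext fun j => ?_)
  ext i
  simpa using h j i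

theorem matOp_mul {b c d : ℕ} (M : Matrix (Fin b) (Fin c) ℝ) (N : Matrix (Fin c) (Fin d) ℝ) :
    matOp (M * N) = (matOp M).comp (matOp N) :=
  ext_single fun j i => by
    rw [matOp_single, Matrix.mul_apply, ContinuousLinearMap.comp_apply, matOp_apply]
    simp_rw [matOp_single]

theorem matOp_one {d : ℕ} : matOp (1 : Matrix (Fin d) (Fin d) ℝ) = .id ℝ (Vec d) :=
  ext_single fun j i => by
    simp [matOp_single, Matrix.one_apply]

theorem matOp_neg {c d : ℕ} (M : Matrix (Fin c) (Fin d) ℝ) : matOp (-M) = -matOp M :=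
  ext_single fun j i => by
    simp [matOp_single]

theorem matOp_sub {c d : ℕ} (M N : Matrix (Fin c) (Fin d) ℝ) : matOp (M - N) = matOp M - matOp N :=
  ext_single fun j i => by
    simp [matOp_single]

theorem inner_matOp {c d : ℕ} (M : Matrix (Fin c) (Fin d) ℝ) (v : Vec d) (w : Vec c) :
    inner ℝ (matOp M v) w = ∑ i, ∑ j, M i j * v j * w i := by
  simp only [PiLp.inner_apply, RCLike.inner_apply, conj_trivial, matOp_apply, Finset.mul_sum]
  exact Finset.sum_congr rfl fun i _ => Finset.sum_congr rfl fun j _ => by ring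

theorem inner_matOp_transpose {c d : ℕ} (M : Matrix (Fin c) (Fin d) ℝ) (v : Vec c) (w : Vec d) :
    inner ℝ (matOp M.transpose v) w = inner ℝ v (matOp M w) := by
  rw [real_inner_comm (matOp M w) v, inner_matOp, inner_matOp, Finset.sum_comm]
  exact Finset.sum_congr rfl fun i _ => Finset.sum_congr rfl fun j _ => by
    rw [Matrix.transpose_apply]; ring

theorem inner_matOp_single {c d : ℕ} (M : Matrix (Fin c) (Fin d) ℝ) (j : Fin d) (i : Fin c) :
    inner ℝ (matOp M (EuclideanSpace.single j 1)) (EuclideanSpace.single i 1) = M i j := by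
  simp [EuclideanSpace.inner_single_right, matOp_single]

theorem matOp_matA (h : GrowthBound Θ Q) {q : Vec m × Vec p}
    (hq : q ∈ interior (jointDomain Θ Q)) : matOp (matA Q q.1 q.2) = opA Q q :=
  ext_single fun j i => by rw [matOp_single, matA_apply h hq]

theorem matOp_matB (h : GrowthBound Θ Q) {q : Vec m × Vec p}
    (hq : q ∈ interior (jointDomain Θ Q)) : matOp (matB Q q.1 q.2) = opB Q q :=
  ext_single fun j i => by rw [matOp_single, matB_apply h hq]

theorem inner_matOp_hess_theta (h : GrowthBound Θ Q) {q : Vec m × Vec p}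
    (hq : q ∈ interior (jointDomain Θ Q)) (v w : Vec p) :
    inner ℝ (matOp (hess (fun t => cumGF (Q t) q.1) q.2) v) w = hessTheta Q q v w := by
  have e : ∀ u : Vec p, ((0 : Vec m), u) = ∑ i, u i • ((0 : Vec m), (EuclideanSpace.single i 1 : Vec p)) := by
    intro u
    refine Prod.ext (by simp [Prod.fst_sum]) ?_
    rw [Prod.snd_sum]
    ext i
    simp [Finset.sum_apply, Pi.single_apply]
  rw [inner_matOp, hessTheta, e v, e w]
  simp only [map_sum, map_smul, ContinuousLinearMap.sum_apply, ContinuousLinearMap.smul_apply,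
    smul_eq_mul, Finset.mul_sum, hess_theta_apply h hq]
  refine Finset.sum_congr rfl fun i _ => Finset.sum_congr rfl fun j _ => ?_
  rw [hessTheta_symm h hq, hessTheta]
  ring

variable (Q) in
/-- `A` is positive definite. -/
theorem matA_posDef (h : GrowthBound Θ Q) (hd : DecayBound Θ Q) {q : Vec m × Vec p}
    (hq : q ∈ interior (jointDomain Θ Q)) : (matA Q q.1 q.2).PosDef := by
  -- Strict positivity is extracted from the decay condition, through the integrable Gaussian limit
  -- of the Laplace integrand.
  obtain ⟨N, -, δ, C, d, hL⟩ := exists_laplaceData h hd hq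
  refine Matrix.PosDef.of_dotProduct_mulVec_pos ?_ fun x hx => ?_
  · ext i j
    rw [Matrix.conjTranspose_apply, star_trivial,
      ← inner_matOp_single (matA Q q.1 q.2) i j, ← inner_matOp_single (matA Q q.1 q.2) j i,
      matOp_matA h hq, opA_symm h hq, real_inner_comm]
  · have h1 := hL.inner_self_pos (ψ := WithLp.toLp 2 x) (by simpa using hx)
    rw [← matOp_matA h hq, real_inner_comm, inner_matOp] at h1
    refine h1.trans_eq ?_
    simp only [dotProduct, Matrix.mulVec, Finset.mul_sum, Pi.star_apply, star_trivial]
    exact Finset.sum_congr rfl fun i _ => Finset.sum_congr rfl fun j _ => mul_comm _ _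

theorem inner_opA_self_pos (h : GrowthBound Θ Q) (hd : DecayBound Θ Q) {q : Vec m × Vec p}
    (hq : q ∈ interior (jointDomain Θ Q)) {v : Vec m} (hv : v ≠ 0) :
    0 < inner ℝ v (opA Q q v) := by
  obtain ⟨N, -, δ, C, d, hL⟩ := exists_laplaceData h hd hq
  exact hL.inner_self_pos hv

theorem matOp_inv {d : ℕ} {M : Matrix (Fin d) (Fin d) ℝ} (hM : IsUnit M.det) (v : Vec d) :
    matOp M (matOp M⁻¹ v) = v ∧ matOp M⁻¹ (matOp M v) = v := by
  have h1 := Matrix.mul_nonsing_inv M hM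
  have h2 := Matrix.nonsing_inv_mul M hM
  constructor
  · rw [← ContinuousLinearMap.comp_apply, ← matOp_mul, h1, matOp_one]; rfl
  · rw [← ContinuousLinearMap.comp_apply, ← matOp_mul, h2, matOp_one]; rfl

/-- The inverse of the operator `A`. -/
noncomputable def opAi (Q : Vec p → Measure (Vec m)) (q : Vec m × Vec p) : Vec m →L[ℝ] Vec m :=
  matOp (matA Q q.1 q.2)⁻¹

theorem opA_opAi (h : GrowthBound Θ Q) (hd : DecayBound Θ Q) {q : Vec m × Vec p}
    (hq : q ∈ interior (jointDomain Θ Q)) (v : Vec m) : opA Q q (opAi Q q v) = v := by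
  rw [← matOp_matA h hq]
  exact (matOp_inv (matA_posDef Q h hd hq).det_pos.ne'.isUnit v).1

theorem opAi_opA (h : GrowthBound Θ Q) (hd : DecayBound Θ Q) {q : Vec m × Vec p}
    (hq : q ∈ interior (jointDomain Θ Q)) (v : Vec m) : opAi Q q (opA Q q v) = v := by
  rw [← matOp_matA h hq]
  exact (matOp_inv (matA_posDef Q h hd hq).det_pos.ne'.isUnit v).2

/-- The Schur complement `H`, as an operator. -/
noncomputable def opH (Q : Vec p → Measure (Vec m)) (q : Vec m × Vec p) : Vec p →L[ℝ] Vec p :=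
  matOp (matH Q q.1 q.2)

theorem inner_opH (h : GrowthBound Θ Q) {q : Vec m × Vec p}
    (hq : q ∈ interior (jointDomain Θ Q)) (v w : Vec p) :
    inner ℝ (opH Q q v) w = hessTheta Q q v w - inner ℝ (opAi Q q (opB Q q v)) (opB Q q w) := by
  rw [opH, matH, matOp_sub, ContinuousLinearMap.sub_apply, inner_sub_left,
    inner_matOp_hess_theta h hq, matOp_mul, matOp_mul, ContinuousLinearMap.comp_apply,
    ContinuousLinearMap.comp_apply, inner_matOp_transpose, matOp_matB h hq, opAi]

end Matrices

end Saddlepoint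

namespace Saddlepoint

/-! ### Convexity of `K` and uniqueness of the saddlepoint. -/

section Uniqueness

variable {m p : ℕ} {Θ : Set (Vec p)} {Q : Vec p → Measure (Vec m)}

/-- The pointwise inequality behind Hölder: convexity of `exp` applied to exponents normalised by
`K`. Integrating it yields convexity of both the domain and `K`. -/
theorem exp_le_of_cumGF {P : Measure (Vec m)} {a b : ℝ} (ha : 0 ≤ a) (hb : 0 ≤ b) (hab : a + b = 1)
    (s t x : Vec m) :
    Real.exp (inner ℝ (a • s + b • t) x) ≤ Real.exp (a * cumGF P s + b * cumGF P t) *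
      (a * (Real.exp (-cumGF P s) * Real.exp (inner ℝ s x)) +
        b * (Real.exp (-cumGF P t) * Real.exp (inner ℝ t x))) := by
  have h1 := convexOn_exp.2 (Set.mem_univ (-cumGF P s + inner ℝ s x))
    (Set.mem_univ (-cumGF P t + inner ℝ t x)) ha hb hab
  simp only [smul_eq_mul] at h1
  rw [← Real.exp_add, ← Real.exp_add]
  refine le_trans (le_of_eq ?_) (mul_le_mul_of_nonneg_left h1 (Real.exp_nonneg _))
  rw [← Real.exp_add, inner_add_left, real_inner_smul_left, real_inner_smul_left]
  congr 1
  ring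

theorem integral_exp_eq {P : Measure (Vec m)} [IsProbabilityMeasure P] {s : Vec m}
    (hs : s ∈ expDomain P) :
    ∫ x, Real.exp (inner ℝ s x) ∂P = Real.exp (cumGF P s) := by
  rw [cumGF, Real.exp_log (integral_exp_pos_of_mem hs)]

theorem convexOn_cumGF {P : Measure (Vec m)} [IsProbabilityMeasure P] :
    ConvexOn ℝ (expDomain P) (cumGF P) := by
  have key : ∀ s ∈ expDomain P, ∀ t ∈ expDomain P, ∀ a b : ℝ, Integrable (fun x =>
      Real.exp (a * cumGF P s + b * cumGF P t) *
      (a * (Real.exp (-cumGF P s) * Real.exp (inner ℝ s x)) +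
        b * (Real.exp (-cumGF P t) * Real.exp (inner ℝ t x)))) P := fun s hs t ht a b =>
    (((Integrable.const_mul hs _).const_mul _).add ((Integrable.const_mul ht _).const_mul _)).const_mul _
  have hmem : ∀ s ∈ expDomain P, ∀ t ∈ expDomain P, ∀ a b : ℝ, 0 ≤ a → 0 ≤ b → a + b = 1 →
      a • s + b • t ∈ expDomain P := fun s hs t ht a b ha hb hab =>
    (key s hs t ht a b).mono' (by fun_prop) (Eventually.of_forall fun x => by
      rw [Real.norm_of_nonneg (Real.exp_nonneg _)]
      exact exp_le_of_cumGF ha hb hab s t x)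
  refine ⟨fun s hs t ht a b ha hb hab => hmem s hs t ht a b ha hb hab,
    fun s hs t ht a b ha hb hab => ?_⟩
  have h1 := integral_mono (hmem s hs t ht a b ha hb hab) (key s hs t ht a b)
    fun x => exp_le_of_cumGF ha hb hab s t x
  rw [integral_const_mul, integral_add ((Integrable.const_mul hs _).const_mul _)
    ((Integrable.const_mul ht _).const_mul _), integral_const_mul, integral_const_mul,
    integral_const_mul, integral_const_mul, integral_exp_eq hs, integral_exp_eq ht,
    ← Real.exp_add, ← Real.exp_add, neg_add_cancel, neg_add_cancel, Real.exp_zero, mul_one, mul_one,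
    hab, mul_one, integral_exp_eq (hmem s hs t ht a b ha hb hab)] at h1
  exact Real.exp_le_exp.1 h1

variable [∀ θ, IsProbabilityMeasure (Q θ)]

/-- Smoothness is known only near `q`, and `t` may lie outside the joint interior. Plain convexity
on the segment suffices, since the strict increase of the derivative at the end `q.1`, from `A > 0`,
already rules out equal end slopes. -/
theorem eq_of_hasGradientAt (h : GrowthBound Θ Q) (hd : DecayBound Θ Q) {q : Vec m × Vec p}
    (hq : q ∈ interior (jointDomain Θ Q)) {t : Vec m} (ht : t ∈ expDomain (Q q.2))
    (hg : HasGradientAt (cumGF (Q q.2)) (gradK Q q) t) : t = q.1 := by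
  by_contra hne
  set u := t - q.1 with hu
  have hu0 : u ≠ 0 := sub_ne_zero.2 hne
  set γ : ℝ → Vec m := fun r => q.1 + r • u with hγ
  have hγd : ∀ r, HasDerivAt γ u r := fun r => by
    have h1 := ((hasDerivAt_id r).smul_const u).const_add q.1
    rwa [one_smul] at h1
  have hγ1 : γ 1 = t := by simp [γ, u]
  have hγ0 : γ 0 = q.1 := by simp [γ]
  have hq1 : q.1 ∈ expDomain (Q q.2) := (interior_subset hq).2
  have hconv : ConvexOn ℝ (Set.Icc (0 : ℝ) 1) fun r => cumGF (Q q.2) (γ r) := by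
    have h1 : ConvexOn ℝ _ (cumGF (Q q.2) ∘ AffineMap.lineMap (k := ℝ) q.1 t) :=
      (convexOn_cumGF (P := Q q.2)).comp_affineMap (AffineMap.lineMap (k := ℝ) q.1 t)
    have h2 : (cumGF (Q q.2) ∘ AffineMap.lineMap (k := ℝ) q.1 t) = fun r => cumGF (Q q.2) (γ r) := by
      ext r
      simp [γ, u, AffineMap.lineMap_apply, add_comm]
    rw [h2] at h1
    refine h1.subset (fun r hr => ?_) (convex_Icc 0 1)
    have := (convexOn_cumGF (P := Q q.2)).1 hq1 ht (sub_nonneg.2 hr.2) hr.1 (by ring)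
    simpa [AffineMap.lineMap_apply_module] using this
  have hder : ∀ᶠ r in 𝓝 (0 : ℝ), HasDerivAt (fun r => cumGF (Q q.2) (γ r))
      (inner ℝ (gradK Q (γ r, q.2)) u) r := by
    have hc : Tendsto γ (𝓝 0) (𝓝 q.1) := by
      have := (hγd 0).continuousAt.tendsto
      rwa [hγ0] at this
    filter_upwards [hc.eventually (eventually_mem_interior_left hq)] with r hr
    exact (hasGradientAt_cumGF h hr).hasFDerivAt.comp_hasDerivAt r (hγd r)
  have hder1 : HasDerivAt (fun r => cumGF (Q q.2) (γ r)) (inner ℝ (gradK Q q) u) 1 := by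
    have h1 := hg.hasFDerivAt
    rw [← hγ1] at h1
    exact h1.comp_hasDerivAt 1 (hγd 1)
  have hpos : HasDerivAt (fun r => inner ℝ (gradK Q (γ r, q.2)) u) (inner ℝ (opA Q q u) u) 0 := by
    have h1 := hasFDerivAt_gradK_left h hq
    rw [← hγ0] at h1
    have h2 := (h1.comp_hasDerivAt 0 (hγd 0)).inner ℝ (hasDerivAt_const 0 u)
    simpa using h2
  have hA : 0 < inner ℝ (opA Q q u) u := by
    rw [opA_symm h hq]
    exact inner_opA_self_pos h hd hq hu0
  have h1 := (hasDerivAt_iff_tendsto_slope.1 hpos).eventually (eventually_gt_nhds hA)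
  have h2 : ∀ᶠ r in 𝓝[>] (0 : ℝ), 0 < slope (fun r => inner ℝ (gradK Q (γ r, q.2)) u) 0 r :=
    h1.filter_mono (nhdsWithin_mono _ fun r (hr : 0 < r) => hr.ne')
  have h3 : ∀ᶠ r in 𝓝[>] (0 : ℝ), r ∈ Set.Ioo (0 : ℝ) 1 := Ioo_mem_nhdsGT zero_lt_one
  obtain ⟨r, ⟨hr1, hr2⟩, hr3⟩ := ((h2.and h3).and (hder.filter_mono nhdsWithin_le_nhds)).exists
  -- The derivative at `r` is at most the slope from `r` to `1`, which is at most the derivative at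
  -- `1`. The latter equals the derivative at `0`, which is strictly smaller than that at `r`.
  have h4 := hconv.le_slope_of_hasDerivAt (Set.Ioo_subset_Icc_self hr2) (Set.right_mem_Icc.2 zero_le_one)
    hr2.2 hr3
  have h5 := hconv.slope_le_of_hasDerivAt (Set.Ioo_subset_Icc_self hr2) (Set.right_mem_Icc.2 zero_le_one)
    hr2.2 hder1
  rw [slope_def_field, sub_zero] at hr1
  have h6 := (div_pos_iff_of_pos_right hr2.1).1 hr1
  rw [hγ0] at h6
  linarith

end Uniqueness

/-! ### The saddlepoint as a C² function of observation and parameter. -/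

section SaddleMap

variable {m p : ℕ} {Θ : Set (Vec p)} {Q : Vec p → Measure (Vec m)}
  [∀ θ, IsProbabilityMeasure (Q θ)]

theorem fderiv_gradK_apply (q : Vec m × Vec p) (v : Vec m) (w : Vec p) :
    fderiv ℝ (gradK Q) q (v, w) = opA Q q v + opB Q q w := by
  rw [opA, opB, ContinuousLinearMap.comp_apply, ContinuousLinearMap.comp_apply, ← map_add]
  simp

/-- The derivative of `(s, θ) ↦ (K'(s; θ), θ)`, as an equivalence. -/
noncomputable def saddleEquiv (h : GrowthBound Θ Q) (hd : DecayBound Θ Q) {q : Vec m × Vec p}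
    (hq : q ∈ interior (jointDomain Θ Q)) : (Vec m × Vec p) ≃L[ℝ] (Vec m × Vec p) :=
  ContinuousLinearEquiv.equivOfInverse
    ((fderiv ℝ (gradK Q) q).prod (ContinuousLinearMap.snd ℝ (Vec m) (Vec p)))
    (((opAi Q q).comp (ContinuousLinearMap.fst ℝ (Vec m) (Vec p) -
      (opB Q q).comp (ContinuousLinearMap.snd ℝ (Vec m) (Vec p)))).prod
        (ContinuousLinearMap.snd ℝ (Vec m) (Vec p)))
    (fun x => by
      obtain ⟨v, w⟩ := x
      refine Prod.ext ?_ rfl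
      change opAi Q q (fderiv ℝ (gradK Q) q (v, w) - opB Q q w) = v
      rw [fderiv_gradK_apply, add_sub_cancel_right, opAi_opA h hd hq])
    (fun x => by
      obtain ⟨v, w⟩ := x
      refine Prod.ext ?_ rfl
      change fderiv ℝ (gradK Q) q (opAi Q q (v - opB Q q w), w) = v
      rw [fderiv_gradK_apply, opA_opAi h hd hq, sub_add_cancel])

/-- Carrying `θ` along turns the implicit equation into the inversion of `(s, θ) ↦ (K', θ)`, whose
derivative is block triangular with diagonal blocks `A` and the identity. -/
theorem exists_saddleMap (h : GrowthBound Θ Q) (hd : DecayBound Θ Q) {q₀ : Vec m × Vec p}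
    (hq₀ : q₀ ∈ interior (jointDomain Θ Q)) : ∃ σ : Vec m × Vec p → Vec m,
      σ (gradK Q q₀, q₀.2) = q₀.1 ∧ ∀ᶠ x in 𝓝 (gradK Q q₀, q₀.2), ContDiffAt ℝ 2 σ x ∧
        (σ x, x.2) ∈ interior (jointDomain Θ Q) ∧ gradK Q (σ x, x.2) = x.1 := by
  set Φ : Vec m × Vec p → Vec m × Vec p := fun q => (gradK Q q, q.2) with hΦ
  have h1 : ContDiffAt ℝ 2 Φ q₀ := (contDiffAt_gradK h hq₀).prodMk contDiffAt_snd
  have h2 : HasFDerivAt Φ (saddleEquiv h hd hq₀ : Vec m × Vec p →L[ℝ] Vec m × Vec p) q₀ :=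
    (hasFDerivAt_gradK h hq₀).prodMk hasFDerivAt_snd
  set Ψ := h1.localInverse h2 two_ne_zero with hΨ
  have h3 : ContDiffAt ℝ 2 Ψ (Φ q₀) := h1.to_localInverse h2 two_ne_zero
  have h4 : Ψ (Φ q₀) = q₀ := h1.localInverse_apply_image h2 two_ne_zero
  have h5 : ∀ᶠ x in 𝓝 (Φ q₀), Φ (Ψ x) = x :=
    (h1.hasStrictFDerivAt' h2 two_ne_zero).eventually_right_inverse
  have h6 : ∀ᶠ x in 𝓝 (Φ q₀), Ψ x ∈ interior (jointDomain Θ Q) := by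
    refine h3.continuousAt.eventually ?_
    rw [h4]
    exact eventually_mem_interior hq₀
  refine ⟨fun x => (Ψ x).1, congrArg Prod.fst h4, ?_⟩
  filter_upwards [h5, h6, h3.eventually (by simp)] with x hx hx' hx''
  have h9 : (gradK Q (Ψ x), (Ψ x).2) = x := hx
  have h7 : (Ψ x).2 = x.2 := (Prod.ext_iff.1 h9).2
  have h8 : ((Ψ x).1, x.2) = Ψ x := Prod.ext rfl h7.symm
  rw [h8]
  exact ⟨contDiffAt_fst.comp x hx'', hx', (Prod.ext_iff.1 h9).1⟩

/-- A local solution `σ` of the saddlepoint equation `K'(σ(y, θ); θ) = y`. -/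
structure IsSaddleMapAt (Θ : Set (Vec p)) (Q : Vec p → Measure (Vec m))
    (σ : Vec m × Vec p → Vec m) (x : Vec m × Vec p) : Prop where
  contDiffAt : ContDiffAt ℝ 2 σ x
  eventually : ∀ᶠ x' in 𝓝 x, (σ x', x'.2) ∈ interior (jointDomain Θ Q) ∧ gradK Q (σ x', x'.2) = x'.1

namespace IsSaddleMapAt

variable {σ : Vec m × Vec p → Vec m} {x : Vec m × Vec p}

theorem mem (hσ : IsSaddleMapAt Θ Q σ x) : (σ x, x.2) ∈ interior (jointDomain Θ Q) :=
  hσ.eventually.self_of_nhds.1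

theorem gradK_eq (hσ : IsSaddleMapAt Θ Q σ x) : gradK Q (σ x, x.2) = x.1 :=
  hσ.eventually.self_of_nhds.2

theorem eventually_isSaddleMapAt (hσ : IsSaddleMapAt Θ Q σ x) :
    ∀ᶠ x' in 𝓝 x, IsSaddleMapAt Θ Q σ x' := by
  filter_upwards [hσ.contDiffAt.eventually (by simp), hσ.eventually.eventually_nhds] with x' h1 h2
  exact ⟨h1, h2⟩

theorem hasFDerivAt (hσ : IsSaddleMapAt Θ Q σ x) : HasFDerivAt σ (fderiv ℝ σ x) x :=
  (hσ.contDiffAt.differentiableAt two_ne_zero).hasFDerivAt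

/-- Implicit differentiation of the saddlepoint equation: `A dσ + B dθ = dy`. -/
theorem fderiv_apply (hσ : IsSaddleMapAt Θ Q σ x) (h : GrowthBound Θ Q) (hd : DecayBound Θ Q)
    (v : Vec m) (w : Vec p) :
    fderiv ℝ σ x (v, w) = opAi Q (σ x, x.2) (v - opB Q (σ x, x.2) w) := by
  have h1 : HasFDerivAt (fun x => gradK Q (σ x, x.2)) _ x :=
    HasFDerivAt.comp (g := gradK Q) x (hasFDerivAt_gradK h hσ.mem)
      (hσ.hasFDerivAt.prodMk hasFDerivAt_snd)
  have h2 : HasFDerivAt (fun x => gradK Q (σ x, x.2)) (ContinuousLinearMap.fst ℝ (Vec m) (Vec p)) x :=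
    hasFDerivAt_fst.congr_of_eventuallyEq (hσ.eventually.mono fun x' hx' => hx'.2)
  have h3 := congrArg (fun L : Vec m × Vec p →L[ℝ] Vec m => L (v, w)) (h1.unique h2)
  have h4 : opA Q (σ x, x.2) (fderiv ℝ σ x (v, w)) + opB Q (σ x, x.2) w = v := by
    rw [← fderiv_gradK_apply]
    exact h3
  rw [← eq_sub_iff_add_eq.2 h4, opAi_opA h hd hσ.mem]

end IsSaddleMapAt

theorem exists_isSaddleMapAt (h : GrowthBound Θ Q) (hd : DecayBound Θ Q) {q₀ : Vec m × Vec p}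
    (hq₀ : q₀ ∈ interior (jointDomain Θ Q)) : ∃ σ : Vec m × Vec p → Vec m,
      σ (gradK Q q₀, q₀.2) = q₀.1 ∧ IsSaddleMapAt Θ Q σ (gradK Q q₀, q₀.2) := by
  obtain ⟨σ, h1, h2⟩ := exists_saddleMap h hd hq₀
  exact ⟨σ, h1, h2.self_of_nhds.1, h2.mono fun x hx => hx.2⟩

end SaddleMap

end Saddlepoint

namespace Saddlepoint

/-! ### Deterministic M-estimation for regular likelihoods. -/

section MEstimation

variable {m p : ℕ}

/-- The normalised log-likelihood as a function of the observation mean and the parameter. -/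
noncomputable def logLik (L : ℕ → Vec m → Vec p → ℝ) (n : ℕ) (y : Vec m) (θ : Vec p) : ℝ :=
  (n : ℝ)⁻¹ * Real.log (L n ((n : ℝ) • y) θ)

/-- Regularity of a family of likelihoods near `(y₀, θ₀)`: the normalised log-likelihood has
asymptotic Hessian `H` and the score at `θ₀` is asymptotically `C (y - y₀)`. -/
structure IsRegularLik (L : ℕ → Vec m → Vec p → ℝ) (y₀ : Vec m) (θ₀ : Vec p)
    (C : Vec m →L[ℝ] Vec p) (H : Vec p →L[ℝ] Vec p) : Prop where
  pos : ∀ᶠ z : ℕ × (Vec m × Vec p) in atTop ×ˢ 𝓝 (y₀, θ₀), 0 < L z.1 ((z.1 : ℝ) • z.2.1) z.2.2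
  cont : ∀ᶠ z : ℕ × (Vec m × Vec p) in atTop ×ˢ 𝓝 (y₀, θ₀),
    ContinuousAt (fun x : Vec m × Vec p => L z.1 ((z.1 : ℝ) • x.1) x.2) z.2
  diff : ∀ᶠ z : ℕ × (Vec m × Vec p) in atTop ×ˢ 𝓝 (y₀, θ₀),
    DifferentiableAt ℝ (logLik L z.1 z.2.1) z.2.2
  score : ∀ ε > 0, ∀ᶠ z : ℕ × Vec m in atTop ×ˢ 𝓝 y₀, ∀ v,
    |fderiv ℝ (logLik L z.1 z.2) θ₀ v - inner ℝ (C (z.2 - y₀)) v| ≤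
      ε * ((Real.sqrt z.1)⁻¹ + ‖z.2 - y₀‖) * ‖v‖
  hess : ∀ ε > 0, ∀ᶠ z : ℕ × (Vec m × Vec p) in atTop ×ˢ 𝓝 (y₀, θ₀), ∀ v,
    ∃ D : Vec p →L[ℝ] ℝ, HasFDerivAt (fun θ => fderiv ℝ (logLik L z.1 z.2.1) θ v) D z.2.2 ∧
      ∀ w, |D w - inner ℝ (H w) v| ≤ ε * ‖v‖ * ‖w‖

/-- Separates the parameter from `(n, y)`: its ball is then independent of both, as a neighbourhood
`U` fixed in advance requires. -/
theorem exists_ball_of_eventually {y₀ : Vec m} {θ₀ : Vec p} {P : ℕ → Vec m → Vec p → Prop}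
    (h : ∀ᶠ z : ℕ × (Vec m × Vec p) in atTop ×ˢ 𝓝 (y₀, θ₀), P z.1 z.2.1 z.2.2) :
    ∃ ρ > 0, ∀ᶠ z : ℕ × Vec m in atTop ×ˢ 𝓝 y₀, ∀ θ ∈ Metric.ball θ₀ ρ, P z.1 z.2 θ := by
  rw [nhds_prod_eq, ← prod_assoc, eventually_map, eventually_prod_iff] at h
  obtain ⟨pa, hpa, pb, hpb, hab⟩ := h
  obtain ⟨ρ, hρ, hball⟩ := Metric.eventually_nhds_iff_ball.1 hpb
  exact ⟨ρ, hρ, hpa.mono fun z hz θ hθ => hab hz (hball θ hθ)⟩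

/-- Uniform regularity of the likelihood `L n (n y)` on a ball. -/
structure IsGood (L : ℕ → Vec m → Vec p → ℝ) (θ₀ : Vec p) (H : Vec p →L[ℝ] Vec p) (ε ρ : ℝ)
    (n : ℕ) (y : Vec m) : Prop where
  one_le : 1 ≤ n
  pos : ∀ θ ∈ Metric.ball θ₀ ρ, 0 < L n ((n : ℝ) • y) θ
  cont : ∀ θ ∈ Metric.ball θ₀ ρ,
    ContinuousAt (fun x : Vec m × Vec p => L n ((n : ℝ) • x.1) x.2) (y, θ)
  diff : ∀ θ ∈ Metric.ball θ₀ ρ, DifferentiableAt ℝ (logLik L n y) θ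
  lip : ∀ θ ∈ Metric.ball θ₀ ρ, ∀ θ' ∈ Metric.ball θ₀ ρ, ∀ v,
    |fderiv ℝ (logLik L n y) θ' v - fderiv ℝ (logLik L n y) θ v - inner ℝ (H (θ' - θ)) v| ≤
      ε * ‖v‖ * ‖θ' - θ‖

variable {L : ℕ → Vec m → Vec p → ℝ} {y₀ : Vec m} {θ₀ : Vec p}
  {C : Vec m →L[ℝ] Vec p} {H : Vec p →L[ℝ] Vec p} {ε ρ c r : ℝ} {n : ℕ} {y : Vec m}

namespace IsRegularLik

theorem eventually_isGood (h : IsRegularLik L y₀ θ₀ C H) (hε : 0 < ε) :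
    ∃ ρ > 0, ∀ᶠ z : ℕ × Vec m in atTop ×ˢ 𝓝 y₀, IsGood L θ₀ H ε ρ z.1 z.2 := by
  obtain ⟨ρ, hρ, hev⟩ := exists_ball_of_eventually
    (P := fun n y θ => 0 < L n ((n : ℝ) • y) θ ∧
      ContinuousAt (fun x : Vec m × Vec p => L n ((n : ℝ) • x.1) x.2) (y, θ) ∧
      DifferentiableAt ℝ (logLik L n y) θ ∧ ∀ v, ∃ D : Vec p →L[ℝ] ℝ,
      HasFDerivAt (fun θ => fderiv ℝ (logLik L n y) θ v) D θ ∧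
      ∀ w, |D w - inner ℝ (H w) v| ≤ ε * ‖v‖ * ‖w‖)
    (h.pos.and (h.cont.and (h.diff.and (h.hess ε hε))))
  refine ⟨ρ, hρ, ?_⟩
  filter_upwards [hev, tendsto_fst.eventually (eventually_ge_atTop 1)] with z hz hn
  refine ⟨hn, fun θ hθ => (hz θ hθ).1, fun θ hθ => (hz θ hθ).2.1, fun θ hθ => (hz θ hθ).2.2.1,
    fun θ hθ θ' hθ' v => ?_⟩
  choose! D hD hDb using fun θ hθ => (hz θ hθ).2.2.2 v
  have h1 := Convex.norm_image_sub_le_of_norm_hasFDerivWithin_le' (𝕜 := ℝ)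
    (f := fun θ => fderiv ℝ (logLik L z.1 z.2) θ v) (f' := D) (φ := (innerSL ℝ v).comp H)
    (C := ε * ‖v‖) (s := Metric.ball θ₀ ρ) (fun x hx => (hD x hx).hasFDerivWithinAt)
    (fun x hx => ContinuousLinearMap.opNorm_le_bound _ (by positivity) fun w => by
      have h2 := hDb x hx w
      rwa [real_inner_comm] at h2)
    (convex_ball θ₀ ρ) hθ hθ'
  rw [ContinuousLinearMap.comp_apply, innerSL_apply_apply, real_inner_comm] at h1
  exact h1

theorem eventually_score_le (h : IsRegularLik L y₀ θ₀ C H) (hε : 0 < ε) :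
    ∀ᶠ z : ℕ × Vec m in atTop ×ˢ 𝓝 y₀, ∀ v,
      |fderiv ℝ (logLik L z.1 z.2) θ₀ v| ≤ ε * ‖v‖ := by
  have h1 : Tendsto (fun z : ℕ × Vec m => 1 * ((Real.sqrt z.1)⁻¹ + ‖z.2 - y₀‖) + ‖C (z.2 - y₀)‖)
      (atTop ×ˢ 𝓝 y₀) (𝓝 (1 * (0 + ‖y₀ - y₀‖) + ‖C (y₀ - y₀)‖)) := by
    have h2 : Tendsto (fun z : ℕ × Vec m => z.2 - y₀) (atTop ×ˢ 𝓝 y₀) (𝓝 (y₀ - y₀)) :=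
      tendsto_snd.sub_const y₀
    exact (((tendsto_sqrt_inv.comp tendsto_fst).add h2.norm).const_mul 1).add
      ((C.continuous.tendsto _).comp h2).norm
  simp only [sub_self, norm_zero, map_zero, add_zero, mul_zero] at h1
  filter_upwards [h.score 1 one_pos, h1.eventually (eventually_le_nhds hε)] with z hz hz' v
  have h3 := abs_real_inner_le_norm (C (z.2 - y₀)) v
  calc _ ≤ |fderiv ℝ (logLik L z.1 z.2) θ₀ v - inner ℝ (C (z.2 - y₀)) v| +
        |inner ℝ (C (z.2 - y₀)) v| := by
        simpa using abs_sub_abs_le_abs_sub (fderiv ℝ (logLik L z.1 z.2) θ₀ v) (inner ℝ (C (z.2 - y₀)) v)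
    _ ≤ 1 * ((Real.sqrt z.1)⁻¹ + ‖z.2 - y₀‖) * ‖v‖ + ‖C (z.2 - y₀)‖ * ‖v‖ := add_le_add (hz v) h3
    _ = (1 * ((Real.sqrt z.1)⁻¹ + ‖z.2 - y₀‖) + ‖C (z.2 - y₀)‖) * ‖v‖ := by ring
    _ ≤ ε * ‖v‖ := by gcongr

end IsRegularLik

namespace IsGood

theorem fderiv_logLik_eq_zero (h : IsGood L θ₀ H ε ρ n y) {θ : Vec p} (hθ : θ ∈ Metric.ball θ₀ ρ)
    (hmax : IsLocalMax (L n ((n : ℝ) • y)) θ) : fderiv ℝ (logLik L n y) θ = 0 := by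
  refine IsLocalMax.fderiv_eq_zero ?_
  filter_upwards [hmax, Metric.isOpen_ball.mem_nhds hθ] with θ' h1 h2
  exact mul_le_mul_of_nonneg_left (Real.log_le_log (h.pos θ' h2) h1) (by positivity)

/-- Strong concavity in terms of the score. Two critical points in the ball must therefore coincide.
-/
theorem strong_mono (h : IsGood L θ₀ H ε ρ n y) (hH : ∀ v, inner ℝ (H v) v ≤ -c * ‖v‖ ^ 2)
    {θ θ' : Vec p} (hθ : θ ∈ Metric.ball θ₀ ρ) (hθ' : θ' ∈ Metric.ball θ₀ ρ) :
    fderiv ℝ (logLik L n y) θ' (θ' - θ) - fderiv ℝ (logLik L n y) θ (θ' - θ) ≤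
      -(c - ε) * ‖θ' - θ‖ ^ 2 := by
  have h1 := (abs_le.1 (h.lip θ hθ θ' hθ' (θ' - θ))).2
  have h2 := hH (θ' - θ)
  nlinarith

theorem eq_of_isLocalMax (h : IsGood L θ₀ H ε ρ n y) (hH : ∀ v, inner ℝ (H v) v ≤ -c * ‖v‖ ^ 2)
    (hε : ε < c) {θ θ' : Vec p} (hθ : θ ∈ Metric.ball θ₀ ρ) (hθ' : θ' ∈ Metric.ball θ₀ ρ)
    (hm : IsLocalMax (L n ((n : ℝ) • y)) θ) (hm' : IsLocalMax (L n ((n : ℝ) • y)) θ') :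
    θ = θ' := by
  have h1 := h.strong_mono hH hθ hθ'
  rw [h.fderiv_logLik_eq_zero hθ hm, h.fderiv_logLik_eq_zero hθ' hm'] at h1
  simp only [ContinuousLinearMap.zero_apply, sub_self] at h1
  have h2 : ‖θ' - θ‖ ^ 2 ≤ 0 := by nlinarith [sq_nonneg ‖θ' - θ‖]
  have h3 : ‖θ' - θ‖ = 0 := by nlinarith [norm_nonneg (θ' - θ)]
  exact (sub_eq_zero.1 (norm_eq_zero.1 h3)).symm

/-- At a constrained maximum the derivative towards the centre is nonpositive. With strong concavity
and the small score at `θ₀` this puts the maximiser within `r / 2` of `θ₀`, off the boundary. -/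
theorem mem_ball_of_isMaxOn (h : IsGood L θ₀ H ε ρ n y)
    (hH : ∀ v, inner ℝ (H v) v ≤ -c * ‖v‖ ^ 2) (hε : ε < c) (hr : 0 < r) (hrρ : r < ρ)
    (hs : ∀ v, |fderiv ℝ (logLik L n y) θ₀ v| ≤ (c - ε) * r / 2 * ‖v‖) {θ : Vec p}
    (hθ : θ ∈ Metric.closedBall θ₀ r)
    (hm : IsMaxOn (L n ((n : ℝ) • y)) (Metric.closedBall θ₀ r) θ) : θ ∈ Metric.ball θ₀ r := by
  have hsub : Metric.closedBall θ₀ r ⊆ Metric.ball θ₀ ρ := Metric.closedBall_subset_ball hrρ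
  have hl : IsMaxOn (logLik L n y) (Metric.closedBall θ₀ r) θ := fun θ' h1 =>
    mul_le_mul_of_nonneg_left (Real.log_le_log (h.pos θ' (hsub h1)) (hm h1)) (by positivity)
  have hc : θ₀ ∈ Metric.closedBall θ₀ r := Metric.mem_closedBall_self hr.le
  have h1 : fderiv ℝ (logLik L n y) θ (θ₀ - θ) ≤ 0 :=
    hl.localize.hasFDerivWithinAt_nonpos (h.diff θ (hsub hθ)).hasFDerivAt.hasFDerivWithinAt
      (sub_mem_posTangentConeAt_of_segment_subset ((convex_closedBall θ₀ r).segment_subset hθ hc))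
  have h2 := h.strong_mono hH (hsub hc) (hsub hθ)
  have h3 := (abs_le.1 (hs (θ - θ₀))).2
  have h4 : fderiv ℝ (logLik L n y) θ (θ - θ₀) = -fderiv ℝ (logLik L n y) θ (θ₀ - θ) := by
    rw [← map_neg, neg_sub]
  rw [mem_ball_iff_norm]
  by_contra! hlt
  have h5 : 0 < ‖θ - θ₀‖ := hr.trans_le hlt
  have h6 : 0 < (c - ε) * ‖θ - θ₀‖ := mul_pos (sub_pos.2 hε) h5
  nlinarith [mul_le_mul_of_nonneg_left hlt h6.le, mul_pos h6 hr]

theorem exists_isMaxOn (h : IsGood L θ₀ H ε ρ n y) (hr : 0 < r) (hrρ : r < ρ) :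
    ∃ θ ∈ Metric.closedBall θ₀ r, IsMaxOn (L n ((n : ℝ) • y)) (Metric.closedBall θ₀ r) θ := by
  refine (isCompact_closedBall θ₀ r).exists_isMaxOn ⟨θ₀, Metric.mem_closedBall_self hr.le⟩ ?_
  intro θ hθ
  have h1 := h.cont θ (Metric.closedBall_subset_ball hrρ hθ)
  exact (ContinuousAt.comp (g := fun x : Vec m × Vec p => L n ((n : ℝ) • x.1) x.2) (x := θ)
    (f := fun θ => (y, θ)) h1 (by fun_prop)).continuousWithinAt

theorem exists_isLocalMax (h : IsGood L θ₀ H ε ρ n y)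
    (hH : ∀ v, inner ℝ (H v) v ≤ -c * ‖v‖ ^ 2) (hε : ε < c) (hr : 0 < r) (hrρ : r < ρ)
    (hs : ∀ v, |fderiv ℝ (logLik L n y) θ₀ v| ≤ (c - ε) * r / 2 * ‖v‖) :
    ∃ θ ∈ Metric.ball θ₀ r, IsLocalMax (L n ((n : ℝ) • y)) θ ∧
      IsMaxOn (L n ((n : ℝ) • y)) (Metric.closedBall θ₀ r) θ := by
  obtain ⟨θ, hθ, hm⟩ := h.exists_isMaxOn hr hrρ
  have h1 := h.mem_ball_of_isMaxOn hH hε hr hrρ hs hθ hm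
  exact ⟨θ, h1, hm.isLocalMax
    (mem_of_superset (Metric.isOpen_ball.mem_nhds h1) Metric.ball_subset_closedBall), hm⟩

end IsGood

theorem isLocalMaximiserIn_iff {U : Set (Vec p)} (hU : IsOpen U) {f : Vec p → ℝ} {θ : Vec p} :
    IsLocalMaximiserIn U f θ ↔ θ ∈ U ∧ IsLocalMax f θ :=
  and_congr_right fun hθ => by
    rw [IsLocalMaxOn, hU.nhdsWithin_eq hθ]; rfl

namespace IsRegularLik

theorem eventually_existsUnique (h : IsRegularLik L y₀ θ₀ C H) (hc : 0 < c)
    (hH : ∀ v, inner ℝ (H v) v ≤ -c * ‖v‖ ^ 2) : ∃ ρ > 0, ∀ r > 0, r < ρ →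
      ∀ᶠ z : ℕ × Vec m in atTop ×ˢ 𝓝 y₀, IsGood L θ₀ H (c / 2) ρ z.1 z.2 ∧
        (∀ v, |fderiv ℝ (logLik L z.1 z.2) θ₀ v| ≤ (c - c / 2) * r / 2 * ‖v‖) ∧
        ∃! θ, IsLocalMaximiserIn (Metric.ball θ₀ r) (L z.1 ((z.1 : ℝ) • z.2)) θ := by
  obtain ⟨ρ, hρ, hgood⟩ := h.eventually_isGood (half_pos hc)
  refine ⟨ρ, hρ, fun r hr hrρ => ?_⟩
  have hε : c / 2 < c := half_lt_self hc
  have hη : 0 < (c - c / 2) * r / 2 := by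
    have := sub_pos.2 hε
    positivity
  filter_upwards [hgood, h.eventually_score_le hη] with z hz hs
  refine ⟨hz, hs, ?_⟩
  obtain ⟨θ, hθ, hloc, -⟩ := hz.exists_isLocalMax hH hε hr hrρ hs
  have hsub : Metric.ball θ₀ r ⊆ Metric.ball θ₀ ρ := Metric.ball_subset_ball hrρ.le
  refine ⟨θ, (isLocalMaximiserIn_iff Metric.isOpen_ball).2 ⟨hθ, hloc⟩, fun θ' hθ' => ?_⟩
  obtain ⟨h1, h2⟩ := (isLocalMaximiserIn_iff Metric.isOpen_ball).1 hθ'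
  exact hz.eq_of_isLocalMax hH hε (hsub h1) (hsub hθ) h2 hloc

/-- The score equation says `H d + C u ≈ 0` for `d = θ - θ₀`, `u = y - y₀`. Testing it on the error
`e = d - Λ u`, for which `H e = H d + C u`, negative definiteness bounds `‖e‖` by the approximation
errors. -/
theorem expansion (h : IsRegularLik L y₀ θ₀ C H) (hc : 0 < c)
    (hH : ∀ v, inner ℝ (H v) v ≤ -c * ‖v‖ ^ 2) {Λ : Vec m →L[ℝ] Vec p}
    (hΛ : ∀ u, H (Λ u) = -C u) {U : Set (Vec p)} (hU : U ∈ 𝓝 θ₀) {V : Set (Vec m)}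
    (hV : V ∈ 𝓝 y₀) {n₀ : ℕ}
    (huniq : ∀ n ≥ n₀, ∀ y ∈ V, ∃! θ, IsLocalMaximiserIn U (L n ((n : ℝ) • y)) θ)
    {T : ℕ → Vec m → Vec p} (hT : IsLocalMLE L U V n₀ T) (hε : 0 < ε) :
    ∀ᶠ z : ℕ × Vec m in atTop ×ˢ 𝓝 y₀,
      ‖T z.1 ((z.1 : ℝ) • z.2) - θ₀ - Λ (z.2 - y₀)‖ ≤ ε * ((Real.sqrt z.1)⁻¹ + ‖z.2 - y₀‖) := by
  have hΛ0 : 0 < ‖Λ‖ + 1 := by positivity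
  -- The first bound absorbs `ε₁ ‖e‖` into `c ‖e‖`; the second pays for `‖d‖ ≤ ‖e‖ + ‖Λ‖ ‖u‖`.
  set ε₁ := min (c / 2) (ε * (c / 2) / (‖Λ‖ + 1)) with hε₁
  have hε₁0 : 0 < ε₁ := lt_min (half_pos hc) (by positivity)
  have hε₁c : ε₁ ≤ c / 2 := min_le_left _ _
  have hε₁ε : ε₁ * (‖Λ‖ + 1) ≤ ε * (c / 2) := by
    rw [← le_div_iff₀ hΛ0]; exact min_le_right _ _
  have hlt : ε₁ < c := hε₁c.trans_lt (half_lt_self hc)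
  obtain ⟨ρ, hρ, hgood⟩ := h.eventually_isGood hε₁0
  obtain ⟨r', hr', hrU⟩ := Metric.mem_nhds_iff.1 hU
  set r := min r' (ρ / 2) with hrdef
  have hr : 0 < r := lt_min hr' (half_pos hρ)
  have hrρ : r < ρ := (min_le_right _ _).trans_lt (half_lt_self hρ)
  have hη : 0 < (c - ε₁) * r / 2 := by
    have := sub_pos.2 hlt
    positivity
  filter_upwards [hgood, h.eventually_score_le hη, h.score ε₁ hε₁0,
    (eventually_ge_atTop n₀).prod_mk hV] with z hz hs hsc ⟨hn, hy⟩
  obtain ⟨θ, hθ, hloc, -⟩ := hz.exists_isLocalMax hH hlt hr hrρ hs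
  have hθU : IsLocalMaximiserIn U (L z.1 ((z.1 : ℝ) • z.2)) θ :=
    ⟨hrU (Metric.ball_subset_ball (min_le_left _ _) hθ), hloc.filter_mono nhdsWithin_le_nhds⟩
  -- `U` is arbitrary: the maximiser found in a small ball inside `U` is also a local maximiser
  -- relative to `U`, so uniqueness there identifies it with the estimator.
  have hTθ : T z.1 ((z.1 : ℝ) • z.2) = θ :=
    (huniq z.1 hn z.2 hy).unique (hT z.1 hn z.2 hy) hθU
  rw [hTθ]
  have hθρ : θ ∈ Metric.ball θ₀ ρ := Metric.ball_subset_ball hrρ.le hθ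
  set d := θ - θ₀ with hd
  set u := z.2 - y₀ with hu
  set e := d - Λ u with he
  set w := (Real.sqrt z.1)⁻¹ + ‖u‖ with hw
  have hw0 : 0 ≤ (Real.sqrt z.1)⁻¹ := by positivity
  have h1 := (abs_le.1 (hz.lip θ₀ (Metric.mem_ball_self hρ) θ hθρ e)).2
  rw [hz.fderiv_logLik_eq_zero hθρ hloc, ContinuousLinearMap.zero_apply, ← hd] at h1
  have h2 := (abs_le.1 (hsc e)).2
  have h3 : H e = H d + C u := by rw [he, map_sub, hΛ, sub_neg_eq_add]
  have h4 := hH e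
  rw [h3, inner_add_left] at h4
  have h5 : c * ‖e‖ ^ 2 ≤ ε₁ * (‖d‖ + w) * ‖e‖ := by linarith
  have h6 : ‖d‖ ≤ ‖e‖ + ‖Λ‖ * ‖u‖ := by
    have : d = e + Λ u := by rw [he, sub_add_cancel]
    calc ‖d‖ = ‖e + Λ u‖ := by rw [← this]
      _ ≤ ‖e‖ + ‖Λ u‖ := norm_add_le _ _
      _ ≤ _ := by gcongr; exact Λ.le_opNorm u
  rcases eq_or_lt_of_le (norm_nonneg e) with he0 | he0
  · rw [← he0]; positivity
  have h7 : c * ‖e‖ ≤ ε₁ * (‖d‖ + w) := by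
    refine le_of_mul_le_mul_right ?_ he0
    linarith
  have h8 : ‖Λ‖ * ‖u‖ ≤ ‖Λ‖ * w := by gcongr; linarith
  have h9 : ε₁ * (‖d‖ + w) ≤ c / 2 * ‖e‖ + ε * (c / 2) * w := by
    calc ε₁ * (‖d‖ + w) ≤ ε₁ * (‖e‖ + (‖Λ‖ + 1) * w) :=
          mul_le_mul_of_nonneg_left (by linarith) hε₁0.le
      _ = ε₁ * ‖e‖ + ε₁ * (‖Λ‖ + 1) * w := by ring
      _ ≤ _ := by gcongr
  have h10 : c / 2 * ‖e‖ ≤ c / 2 * (ε * w) := by linarith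
  exact le_of_mul_le_mul_left h10 (half_pos hc)

end IsRegularLik

/-- On an open set of observations where the likelihood is regular, its local maximiser is a
continuous function of the observation. -/
theorem continuousOn_localMaximiser (hc : 0 < c) (hH : ∀ v, inner ℝ (H v) v ≤ -c * ‖v‖ ^ 2)
    (hr : 0 < r) (hrρ : r < ρ) {V : Set (Vec m)} (hV : IsOpen V)
    (hgood : ∀ y ∈ V, IsGood L θ₀ H (c / 2) ρ n y)
    (hs : ∀ y ∈ V, ∀ v, |fderiv ℝ (logLik L n y) θ₀ v| ≤ (c - c / 2) * r / 2 * ‖v‖)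
    {τ : Vec m → Vec p}
    (hτ : ∀ y ∈ V, IsLocalMaximiserIn (Metric.ball θ₀ r) (L n ((n : ℝ) • y)) (τ y)) :
    ContinuousOn τ V := by
  have hε : c / 2 < c := half_lt_self hc
  have hsub : Metric.ball θ₀ r ⊆ Metric.ball θ₀ ρ := Metric.ball_subset_ball hrρ.le
  have hsub' : Metric.closedBall θ₀ r ⊆ Metric.ball θ₀ ρ := Metric.closedBall_subset_ball hrρ
  have huniq : ∀ y ∈ V, ∀ θ ∈ Metric.closedBall θ₀ r,
      IsMaxOn (L n ((n : ℝ) • y)) (Metric.closedBall θ₀ r) θ → θ = τ y := by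
    intro y hy θ hθ hm
    obtain ⟨h1, h2⟩ := (isLocalMaximiserIn_iff Metric.isOpen_ball).1 (hτ y hy)
    have h3 := (hgood y hy).mem_ball_of_isMaxOn hH hε hr hrρ (hs y hy) hθ hm
    exact (hgood y hy).eq_of_isLocalMax hH hε (hsub h3) (hsub h1) (hm.isLocalMax
      (mem_of_superset (Metric.isOpen_ball.mem_nhds h3) Metric.ball_subset_closedBall)) h2
  -- The local maximiser is the maximum over a fixed compact ball, which makes a compactness
  -- argument for continuity possible.
  have hmax : ∀ y ∈ V, IsMaxOn (L n ((n : ℝ) • y)) (Metric.closedBall θ₀ r) (τ y) := by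
    intro y hy
    obtain ⟨θ, hθ, hm⟩ := (hgood y hy).exists_isMaxOn hr hrρ
    rwa [← huniq y hy θ hθ hm]
  intro y₁ hy₁
  refine ContinuousAt.continuousWithinAt ?_
  rw [ContinuousAt, Metric.tendsto_nhds]
  intro η hη
  -- Away from `τ y₁` the likelihood at `y₁` is strictly smaller; by compactness this persists for
  -- `y` near `y₁`, so the maximiser cannot lie in `K`.
  set K := Metric.closedBall θ₀ r \ Metric.ball (τ y₁) η with hK
  have hKc : IsCompact K := (isCompact_closedBall θ₀ r).diff Metric.isOpen_ball
  have hball : ∀ y ∈ V, τ y ∈ Metric.closedBall θ₀ r := fun y hy =>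
    Metric.ball_subset_closedBall (hτ y hy).1
  have hcont : ∀ θ ∈ Metric.closedBall θ₀ r,
      ContinuousAt (fun x : Vec m × Vec p => L n ((n : ℝ) • x.1) x.2) (y₁, θ) := fun θ hθ =>
    (hgood y₁ hy₁).cont θ (hsub' hθ)
  have hlt : ∀ θ ∈ K, ∀ᶠ x : Vec m × Vec p in 𝓝 (y₁, θ),
      L n ((n : ℝ) • x.1) x.2 < L n ((n : ℝ) • x.1) (τ y₁) := by
    intro θ hθ
    have h1 : L n ((n : ℝ) • y₁) θ < L n ((n : ℝ) • y₁) (τ y₁) := by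
      refine lt_of_le_of_ne (hmax y₁ hy₁ hθ.1) fun heq => hθ.2 ?_
      have h2 : IsMaxOn (L n ((n : ℝ) • y₁)) (Metric.closedBall θ₀ r) θ := fun θ' hθ' => by
        have := hmax y₁ hy₁ hθ'
        rw [← heq] at this
        exact this
      rw [huniq y₁ hy₁ θ hθ.1 h2]
      exact Metric.mem_ball_self hη
    have h2 : ContinuousAt (fun x : Vec m × Vec p => L n ((n : ℝ) • x.1) (τ y₁)) (y₁, θ) :=
      ContinuousAt.comp (g := fun x : Vec m × Vec p => L n ((n : ℝ) • x.1) x.2) (x := (y₁, θ))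
        (f := fun x : Vec m × Vec p => (x.1, τ y₁)) (hcont _ (hball y₁ hy₁)) (by fun_prop)
    exact (hcont θ hθ.1).eventually_lt h2 h1
  filter_upwards [hKc.eventually_forall_of_forall_eventually
    (P := fun y θ => L n ((n : ℝ) • y) θ < L n ((n : ℝ) • y) (τ y₁)) hlt, hV.mem_nhds hy₁] with y h1 h2
  by_contra hd
  exact absurd (hmax y h2 (hball y₁ hy₁)) (not_le.2 (h1 (τ y) ⟨hball y h2, hd⟩))

end MEstimation

end Saddlepoint

namespace Saddlepoint

/-! ### The score of the profile function and its derivatives. -/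

section Profile

variable {m p : ℕ} {Θ : Set (Vec p)} {Q : Vec p → Measure (Vec m)}
  [∀ θ, IsProbabilityMeasure (Q θ)] {σ : Vec m × Vec p → Vec m} {x : Vec m × Vec p}

/-- The parameter gradient of `K` at the saddlepoint. -/
noncomputable def profileScore (Q : Vec p → Measure (Vec m)) (σ : Vec m × Vec p → Vec m)
    (x : Vec m × Vec p) : Vec p →L[ℝ] ℝ :=
  (fderiv ℝ (jointK Q) (σ x, x.2)).comp (ContinuousLinearMap.inr ℝ (Vec m) (Vec p))

theorem profileScore_apply (v : Vec p) :
    profileScore Q σ x v = fderiv ℝ (jointK Q) (σ x, x.2) (0, v) := rfl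

namespace IsSaddleMapAt

theorem contDiffAt_pair (hσ : IsSaddleMapAt Θ Q σ x) :
    ContDiffAt ℝ 2 (fun x : Vec m × Vec p => (σ x, x.2)) x :=
  hσ.contDiffAt.prodMk contDiffAt_snd

theorem contDiffAt_profileScore (hσ : IsSaddleMapAt Θ Q σ x) (h : GrowthBound Θ Q) :
    ContDiffAt ℝ 1 (profileScore Q σ) x := by
  have h1 : ContDiffAt ℝ 1 (fun x : Vec m × Vec p => fderiv ℝ (jointK Q) (σ x, x.2)) x :=
    ContDiffAt.comp x (g := fderiv ℝ (jointK Q)) (contDiffAt_fderiv_jointK h hσ.mem)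
      (hσ.contDiffAt_pair.of_le (by norm_num))
  exact h1.clm_comp contDiffAt_const

theorem hasFDerivAt_profileScore (hσ : IsSaddleMapAt Θ Q σ x) (h : GrowthBound Θ Q) :
    HasFDerivAt (profileScore Q σ) (fderiv ℝ (profileScore Q σ) x) x :=
  ((hσ.contDiffAt_profileScore h).differentiableAt one_ne_zero).hasFDerivAt

/-- Chain rule with `dσ = A⁻¹ (u - B w)`: the `u` part gives `Bᵀ A⁻¹`, and the `w` part completes
the parameter Hessian to the Schur complement. -/
theorem fderiv_profileScore_apply (hσ : IsSaddleMapAt Θ Q σ x) (h : GrowthBound Θ Q)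
    (hd : DecayBound Θ Q) (u : Vec m) (w v : Vec p) :
    fderiv ℝ (profileScore Q σ) x (u, w) v =
      inner ℝ (opAi Q (σ x, x.2) u) (opB Q (σ x, x.2) v) + inner ℝ (opH Q (σ x, x.2) w) v := by
  set q := (σ x, x.2) with hq
  have h1 : HasFDerivAt (fun x => profileScore Q σ x v) _ x :=
    (hσ.hasFDerivAt_profileScore h).clm_apply (hasFDerivAt_const v x)
  have h2 : HasFDerivAt (fun x : Vec m × Vec p => fderiv ℝ (jointK Q) (σ x, x.2)) _ x :=
    HasFDerivAt.comp (g := fderiv ℝ (jointK Q)) x (hasFDerivAt_fderiv_jointK h hσ.mem)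
      (hσ.hasFDerivAt.prodMk hasFDerivAt_snd)
  have h3 := h1.unique (h2.clm_apply (hasFDerivAt_const ((0, v) : Vec m × Vec p) x))
  have h4 := congrArg (fun T : Vec m × Vec p →L[ℝ] ℝ => T (u, w)) h3
  have h5 : fderiv ℝ (profileScore Q σ) x (u, w) v =
      fderiv ℝ (fderiv ℝ (jointK Q)) q (fderiv ℝ σ x (u, w), w) (0, v) := by
    simpa using h4
  have h6 : ((fderiv ℝ σ x (u, w), w) : Vec m × Vec p) = (fderiv ℝ σ x (u, w), 0) + (0, w) := by
    simp
  rw [h5, h6, map_add, ContinuousLinearMap.add_apply, fderiv_fderiv_jointK_inl_inr h hσ.mem,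
    hσ.fderiv_apply h hd, inner_opH h hσ.mem, hessTheta, map_sub, inner_sub_right,
    real_inner_comm (opAi Q (σ x, x.2) u), real_inner_comm (opAi Q (σ x, x.2) (opB Q (σ x, x.2) w))]
  ring

/-- The first-order expansion of the profile score at `θ₀` as a function of the observation. -/
theorem eventually_profileScore (hσ : IsSaddleMapAt Θ Q σ x) (h : GrowthBound Θ Q)
    (hd : DecayBound Θ Q) (hcrit : profileScore Q σ x = 0) {C : Vec m →L[ℝ] Vec p}
    (hC : ∀ u v, inner ℝ (C u) v = inner ℝ (opAi Q (σ x, x.2) u) (opB Q (σ x, x.2) v))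
    {ε : ℝ} (hε : 0 < ε) :
    ∀ᶠ y in 𝓝 x.1, ∀ v,
      |profileScore Q σ (y, x.2) v - inner ℝ (C (y - x.1)) v| ≤ ε * ‖y - x.1‖ * ‖v‖ := by
  have h1 : HasFDerivAt (fun y => profileScore Q σ (y, x.2)) _ x.1 :=
    HasFDerivAt.comp (g := profileScore Q σ) x.1 (hσ.hasFDerivAt_profileScore h)
      (hasFDerivAt_prodMk_left (𝕜 := ℝ) x.1 x.2)
  filter_upwards [h1.isLittleO.def hε] with y hy v
  have h2 : (profileScore Q σ (y, x.2) - profileScore Q σ (x.1, x.2) -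
      (fderiv ℝ (profileScore Q σ) x) (y - x.1, 0)) v =
      profileScore Q σ (y, x.2) v - inner ℝ (C (y - x.1)) v := by
    have h3 : profileScore Q σ (x.1, x.2) = 0 := hcrit
    rw [h3, sub_zero, ContinuousLinearMap.sub_apply, hσ.fderiv_profileScore_apply h hd, hC, map_zero,
      inner_zero_left, add_zero]
  rw [← h2, ← Real.norm_eq_abs]
  refine (ContinuousLinearMap.le_opNorm _ _).trans ?_
  gcongr
  exact hy

theorem eventually_fderiv_profileScore (hσ : IsSaddleMapAt Θ Q σ x) (h : GrowthBound Θ Q)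
    (hd : DecayBound Θ Q) {ε : ℝ} (hε : 0 < ε) :
    ∀ᶠ x' in 𝓝 x, ∀ w v, |fderiv ℝ (profileScore Q σ) x' (0, w) v -
      inner ℝ (opH Q (σ x, x.2) w) v| ≤ ε * ‖v‖ * ‖w‖ := by
  have h1 : ContinuousAt (fderiv ℝ (profileScore Q σ)) x :=
    ((hσ.contDiffAt_profileScore h).fderiv_right (m := 0) (by norm_num)).continuousAt
  filter_upwards [Metric.tendsto_nhds (α := Vec m × Vec p →L[ℝ] Vec p →L[ℝ] ℝ) |>.1 h1.tendsto ε hε] with x' hx' w v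
  have h2 : (fderiv ℝ (profileScore Q σ) x' - fderiv ℝ (profileScore Q σ) x) (0, w) v =
      fderiv ℝ (profileScore Q σ) x' (0, w) v - inner ℝ (opH Q (σ x, x.2) w) v := by
    rw [ContinuousLinearMap.sub_apply, ContinuousLinearMap.sub_apply,
      hσ.fderiv_profileScore_apply h hd, map_zero, inner_zero_left, zero_add]
  have hx'' : ‖fderiv ℝ (profileScore Q σ) x' - fderiv ℝ (profileScore Q σ) x‖ ≤ ε :=
    (dist_eq_norm (E := Vec m × Vec p →L[ℝ] Vec p →L[ℝ] ℝ) _ _).symm.trans_le hx'.le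
  rw [← h2, ← Real.norm_eq_abs]
  have h3 : ‖((0, w) : Vec m × Vec p)‖ = ‖w‖ := by simp [Prod.norm_def]
  calc _ ≤ ‖(fderiv ℝ (profileScore Q σ) x' - fderiv ℝ (profileScore Q σ) x) (0, w)‖ * ‖v‖ :=
        ContinuousLinearMap.le_opNorm _ _
    _ ≤ (ε * ‖w‖) * ‖v‖ := by
        gcongr
        refine (ContinuousLinearMap.le_opNorm _ _).trans ?_
        rw [h3]
        gcongr
    _ = _ := by ring

end IsSaddleMapAt

/-- It is enough to approximate the profile score to `o(n^(-1/2))`: at `θ₀` that score is itself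
linear in `y - y₀` to first order. -/
theorem IsRegularLik.of_profile {L : ℕ → Vec m → Vec p → ℝ} {y₀ : Vec m} {θ₀ : Vec p}
    (hσ : IsSaddleMapAt Θ Q σ (y₀, θ₀)) (h : GrowthBound Θ Q) (hd : DecayBound Θ Q)
    (hcrit : profileScore Q σ (y₀, θ₀) = 0) {C : Vec m →L[ℝ] Vec p}
    (hC : ∀ u v, inner ℝ (C u) v =
      inner ℝ (opAi Q (σ (y₀, θ₀), θ₀) u) (opB Q (σ (y₀, θ₀), θ₀) v)) {H : Vec p →L[ℝ] Vec p}
    (hpos : ∀ᶠ z : ℕ × (Vec m × Vec p) in atTop ×ˢ 𝓝 (y₀, θ₀),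
      0 < L z.1 ((z.1 : ℝ) • z.2.1) z.2.2)
    (hcont : ∀ᶠ z : ℕ × (Vec m × Vec p) in atTop ×ˢ 𝓝 (y₀, θ₀),
      ContinuousAt (fun x : Vec m × Vec p => L z.1 ((z.1 : ℝ) • x.1) x.2) z.2)
    (hdiff : ∀ᶠ z : ℕ × (Vec m × Vec p) in atTop ×ˢ 𝓝 (y₀, θ₀),
      DifferentiableAt ℝ (logLik L z.1 z.2.1) z.2.2)
    (hscore : ∀ ε > 0, ∀ᶠ z : ℕ × (Vec m × Vec p) in atTop ×ˢ 𝓝 (y₀, θ₀), ∀ v,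
      |fderiv ℝ (logLik L z.1 z.2.1) z.2.2 v - profileScore Q σ z.2 v| ≤
        ε * (Real.sqrt z.1)⁻¹ * ‖v‖)
    (hhess : ∀ ε > 0, ∀ᶠ z : ℕ × (Vec m × Vec p) in atTop ×ˢ 𝓝 (y₀, θ₀), ∀ v,
      ∃ D : Vec p →L[ℝ] ℝ, HasFDerivAt (fun θ => fderiv ℝ (logLik L z.1 z.2.1) θ v) D z.2.2 ∧
        ∀ w, |D w - inner ℝ (H w) v| ≤ ε * ‖v‖ * ‖w‖) :
    IsRegularLik L y₀ θ₀ C H := by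
  refine ⟨hpos, hcont, hdiff, fun ε hε => ?_, hhess⟩
  have h1 : Tendsto (fun z : ℕ × Vec m => (z.1, (z.2, θ₀))) (atTop ×ˢ 𝓝 y₀)
      (atTop ×ˢ 𝓝 (y₀, θ₀)) :=
    tendsto_fst.prodMk (((Continuous.prodMk_left θ₀).tendsto y₀).comp tendsto_snd)
  filter_upwards [h1.eventually (hscore ε hε),
    tendsto_snd.eventually (hσ.eventually_profileScore h hd hcrit hC hε)] with z h2 h3 v
  calc _ ≤ |fderiv ℝ (logLik L z.1 z.2) θ₀ v - profileScore Q σ (z.2, θ₀) v| +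
        |profileScore Q σ (z.2, θ₀) v - inner ℝ (C (z.2 - y₀)) v| := abs_sub_le _ _ _
    _ ≤ ε * (Real.sqrt z.1)⁻¹ * ‖v‖ + ε * ‖z.2 - y₀‖ * ‖v‖ := add_le_add (h2 v) (h3 v)
    _ = _ := by ring

end Profile

/-! ### Regularity of the saddlepoint likelihood. -/

section SaddleLik

variable {m p : ℕ} {Θ : Set (Vec p)} {Q : Vec p → Measure (Vec m)}

theorem pd_const_mul {d : ℕ} (c : ℝ) (f : Vec d → ℝ) (i : Fin d) (x : Vec d) :
    pd i (fun x => c * f x) x = c * pd i f x := by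
  simp only [pd, lineDeriv]
  exact deriv_const_mul_field c

theorem hess_const_mul {d : ℕ} (c : ℝ) (f : Vec d → ℝ) (x : Vec d) :
    hess (fun x => c * f x) x = c • hess f x := by
  ext i j
  simp [hess, pd_const_mul]

variable [∀ θ, IsProbabilityMeasure (Q θ)]

/-- Two parameter derivatives of a second dual derivative: the case `k = 2`, `ℓ = 2` of the growth
condition, needed to differentiate `log det A` twice. -/
theorem contDiffOn_matA (h : GrowthBound Θ Q) (i j : Fin m) :
    ContDiffOn ℝ 2 (fun q : Vec m × Vec p => matA Q q.1 q.2 i j) (interior (jointDomain Θ Q)) := by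
  have h1 : ∀ q ∈ interior (jointDomain Θ Q), matA Q q.1 q.2 i j =
      mgfReal Q [j, i] q / mgfReal Q [] q - gradK Q q j * gradK Q q i := fun q hq => by
    rw [matA_apply h hq]
    have := hasFDerivAt_gradK_apply h hq (EuclideanSpace.single j 1) i
    simpa [opA, EuclideanSpace.inner_single_left, Pi.single_apply] using this
  refine ContDiffOn.congr ?_ h1
  have h2 := (contDiffOn_piLp 2).1 (contDiffOn_gradK h)
  exact ((contDiffOn_mgfReal h (by simp)).div (contDiffOn_mgfReal h (by simp)) fun q hq =>
    (mgfReal_nil_pos (interior_subset hq)).ne').sub ((h2 j).mul (h2 i))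

theorem contDiffOn_det_matA (h : GrowthBound Θ Q) :
    ContDiffOn ℝ 2 (fun q : Vec m × Vec p => (matA Q q.1 q.2).det)
      (interior (jointDomain Θ Q)) := by
  simp_rw [Matrix.det_apply]
  exact ContDiffOn.sum fun τ _ => (contDiffOn_prod fun i _ => contDiffOn_matA h _ _).const_smul _

namespace IsSaddleMapAt

variable {σ : Vec m × Vec p → Vec m} {x : Vec m × Vec p}

theorem isSaddlepoint_sumLaw (hσ : IsSaddleMapAt Θ Q σ x) (h : GrowthBound Θ Q) {n : ℕ}
    (hn : n ≠ 0) : IsSaddlepoint (sumLaw (Q x.2) n) ((n : ℝ) • x.1) (σ x) := by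
  constructor
  · rw [expDomain_sumLaw _ _ hn, mem_interior_iff_mem_nhds]
    filter_upwards [eventually_mem_interior_left hσ.mem] with s hs
    exact (interior_subset hs).2
  · rw [cumGF_sumLaw]
    have h1 := (hasGradientAt_cumGF h hσ.mem).hasFDerivAt.const_mul (n : ℝ)
    rw [hasGradientAt_iff_hasFDerivAt, map_smul, ← hσ.gradK_eq]
    exact h1

/-- By uniqueness over the whole domain, the solution chosen in `saddlepoint` is the smooth local
one. -/
theorem saddlepoint_sumLaw (hσ : IsSaddleMapAt Θ Q σ x) (h : GrowthBound Θ Q)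
    (hd : DecayBound Θ Q) {n : ℕ} (hn : n ≠ 0) :
    saddlepoint (sumLaw (Q x.2) n) ((n : ℝ) • x.1) = σ x := by
  have hex : ∃ s, IsSaddlepoint (sumLaw (Q x.2) n) ((n : ℝ) • x.1) s :=
    ⟨_, hσ.isSaddlepoint_sumLaw h hn⟩
  rw [saddlepoint, dif_pos hex]
  obtain ⟨h1, h2⟩ := hex.choose_spec
  set t := hex.choose
  have hn' : (n : ℝ) ≠ 0 := Nat.cast_ne_zero.2 hn
  rw [expDomain_sumLaw _ _ hn] at h1
  refine eq_of_hasGradientAt h hd hσ.mem (interior_subset h1) ?_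
  have h3 := h2.hasFDerivAt.const_mul (n : ℝ)⁻¹
  rw [hasGradientAt_iff_hasFDerivAt, hσ.gradK_eq]
  rw [cumGF_sumLaw, map_smul, smul_smul, inv_mul_cancel₀ hn', one_smul] at h3
  exact h3.congr_of_eventuallyEq (Eventually.of_forall fun s => (inv_mul_cancel_left₀ hn' _).symm)

theorem saddleLik_eq (hσ : IsSaddleMapAt Θ Q σ x) (h : GrowthBound Θ Q)
    (hd : DecayBound Θ Q) {n : ℕ} (hn : n ≠ 0) :
    saddleLik Q n ((n : ℝ) • x.1) x.2 =
      Real.exp (n * (jointK Q (σ x, x.2) - inner ℝ (σ x) x.1)) /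
        Real.sqrt ((2 * Real.pi * n) ^ m * (matA Q (σ x) x.2).det) := by
  rw [saddleLik, saddlepointDensity, hσ.saddlepoint_sumLaw h hd hn, cumGF_sumLaw, hess_const_mul,
    smul_smul, Matrix.det_smul, Fintype.card_fin, inner_smul_right, mul_sub]
  rfl

theorem det_matA_pos (hσ : IsSaddleMapAt Θ Q σ x) (h : GrowthBound Θ Q) (hd : DecayBound Θ Q) :
    0 < (matA Q (σ x) x.2).det :=
  (matA_posDef Q h hd hσ.mem).det_pos

theorem saddleLik_pos (hσ : IsSaddleMapAt Θ Q σ x) (h : GrowthBound Θ Q)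
    (hd : DecayBound Θ Q) {n : ℕ} (hn : n ≠ 0) : 0 < saddleLik Q n ((n : ℝ) • x.1) x.2 := by
  rw [hσ.saddleLik_eq h hd hn]
  have h1 := hσ.det_matA_pos h hd
  have h2 : (0 : ℝ) < n := Nat.cast_pos.2 (Nat.pos_of_ne_zero hn)
  positivity

theorem logLik_saddleLik (hσ : IsSaddleMapAt Θ Q σ x) (h : GrowthBound Θ Q)
    (hd : DecayBound Θ Q) {n : ℕ} (hn : n ≠ 0) :
    logLik (saddleLik Q) n x.1 x.2 = jointK Q (σ x, x.2) - inner ℝ (σ x) x.1 -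
      (n : ℝ)⁻¹ * (Real.log (matA Q (σ x) x.2).det / 2) -
      (n : ℝ)⁻¹ * (Real.log ((2 * Real.pi * n) ^ m) / 2) := by
  have h1 := hσ.det_matA_pos h hd
  have h2 : (0 : ℝ) < n := Nat.cast_pos.2 (Nat.pos_of_ne_zero hn)
  rw [logLik, hσ.saddleLik_eq h hd hn, Real.log_div (Real.exp_ne_zero _) (by positivity),
    Real.log_exp, Real.log_sqrt (by positivity), Real.log_mul (by positivity) h1.ne']
  field_simp
  ring

/-- The envelope theorem for the exponent of the saddlepoint approximation. -/
theorem hasFDerivAt_exponent (hσ : IsSaddleMapAt Θ Q σ x) (h : GrowthBound Θ Q) :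
    HasFDerivAt (fun θ => jointK Q (σ (x.1, θ), θ) - inner ℝ (σ (x.1, θ)) x.1)
      (profileScore Q σ x) x.2 := by
  have h1 : HasFDerivAt (fun θ => σ (x.1, θ)) _ x.2 :=
    HasFDerivAt.comp (g := σ) x.2 hσ.hasFDerivAt (hasFDerivAt_prodMk_right (𝕜 := ℝ) x.1 x.2)
  have h2 : HasFDerivAt (fun θ => jointK Q (σ (x.1, θ), θ)) _ x.2 :=
    HasFDerivAt.comp (g := jointK Q) (f := fun θ => (σ (x.1, θ), θ)) x.2
      (hasFDerivAt_jointK h hσ.mem) (h1.prodMk (hasFDerivAt_id x.2))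
  refine (h2.sub (h1.inner ℝ (hasFDerivAt_const x.1 x.2))).congr_fderiv ?_
  ext v
  have h3 : ((fderiv ℝ σ x (0, v), v) : Vec m × Vec p) = (fderiv ℝ σ x (0, v), 0) + (0, v) := by
    simp
  have h4 : fderiv ℝ (jointK Q) (σ x, x.2) (fderiv ℝ σ x (0, v), v) =
      inner ℝ x.1 (fderiv ℝ σ x (0, v)) + profileScore Q σ x v := by
    rw [h3, map_add, fderiv_jointK_inl h hσ.mem, hσ.gradK_eq, profileScore_apply]
  have h5 := real_inner_comm (fderiv ℝ σ x (0, v)) x.1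
  simp
  linarith

theorem contDiffAt_log_det (hσ : IsSaddleMapAt Θ Q σ x) (h : GrowthBound Θ Q)
    (hd : DecayBound Θ Q) :
    ContDiffAt ℝ 2 (fun x => Real.log (matA Q (σ x) x.2).det / 2) x := by
  have h0 := (contDiffOn_det_matA h).contDiffAt (isOpen_interior.mem_nhds hσ.mem)
  have h2 := hσ.det_matA_pos h hd
  have h3 : ContDiffAt ℝ 2 (fun x => (matA Q (σ x) x.2).det) x :=
    ContDiffAt.comp (g := fun q : Vec m × Vec p => (matA Q q.1 q.2).det)
      (f := fun x : Vec m × Vec p => (σ x, x.2)) x h0 hσ.contDiffAt_pair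
  exact (h3.log h2.ne').div_const 2

theorem eventually_theta (hσ : IsSaddleMapAt Θ Q σ x) :
    ∀ᶠ θ in 𝓝 x.2, IsSaddleMapAt Θ Q σ (x.1, θ) :=
  (Continuous.prodMk_right x.1).continuousAt.eventually hσ.eventually_isSaddleMapAt

theorem hasFDerivAt_logLik_saddleLik (hσ : IsSaddleMapAt Θ Q σ x) (h : GrowthBound Θ Q)
    (hd : DecayBound Θ Q) {n : ℕ} (hn : n ≠ 0) :
    HasFDerivAt (logLik (saddleLik Q) n x.1) (profileScore Q σ x - (n : ℝ)⁻¹ •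
      (fderiv ℝ (fun x => Real.log (matA Q (σ x) x.2).det / 2) x).comp
        (ContinuousLinearMap.inr ℝ (Vec m) (Vec p))) x.2 := by
  have h0 := ((hσ.contDiffAt_log_det h hd).differentiableAt two_ne_zero).hasFDerivAt
  have heq : ∀ᶠ θ in 𝓝 x.2, logLik (saddleLik Q) n x.1 θ = jointK Q (σ (x.1, θ), θ) -
      inner ℝ (σ (x.1, θ)) x.1 - (n : ℝ)⁻¹ * (fun x => Real.log (matA Q (σ x) x.2).det / 2) (x.1, θ) -
      (n : ℝ)⁻¹ * (Real.log ((2 * Real.pi * n) ^ m) / 2) := by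
    filter_upwards [hσ.eventually_theta] with θ hθ
    exact hθ.logLik_saddleLik h hd hn
  generalize (fun x => Real.log (matA Q (σ x) x.2).det / 2) = W at h0 heq ⊢
  have h1 : HasFDerivAt (fun θ => W (x.1, θ)) _ x.2 :=
    HasFDerivAt.comp (g := W) x.2 h0 (hasFDerivAt_prodMk_right (𝕜 := ℝ) x.1 x.2)
  exact (((hσ.hasFDerivAt_exponent h).sub (h1.const_mul (n : ℝ)⁻¹)).sub_const
    ((n : ℝ)⁻¹ * (Real.log ((2 * Real.pi * n) ^ m) / 2))).congr_of_eventuallyEq heq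

theorem hasFDerivAt_fderiv_logLik_saddleLik (hσ : IsSaddleMapAt Θ Q σ x) (h : GrowthBound Θ Q)
    (hd : DecayBound Θ Q) {n : ℕ} (hn : n ≠ 0) (v : Vec p) :
    ∃ D : Vec p →L[ℝ] ℝ,
      HasFDerivAt (fun θ => fderiv ℝ (logLik (saddleLik Q) n x.1) θ v) D x.2 ∧ ∀ w,
      D w = fderiv ℝ (profileScore Q σ) x (0, w) v - (n : ℝ)⁻¹ *
        fderiv ℝ (fderiv ℝ (fun x => Real.log (matA Q (σ x) x.2).det / 2)) x (0, w) (0, v) := by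
  set W : Vec m × Vec p → ℝ := fun x => Real.log (matA Q (σ x) x.2).det / 2 with hW
  have h1 : HasFDerivAt (fderiv ℝ W) (fderiv ℝ (fderiv ℝ W) x) x :=
    (((hσ.contDiffAt_log_det h hd).fderiv_right (m := 1) (by norm_num)).differentiableAt
      one_ne_zero).hasFDerivAt
  have h2 : HasFDerivAt (fun x => profileScore Q σ x v - (n : ℝ)⁻¹ * fderiv ℝ W x (0, v)) _ x :=
    ((hσ.hasFDerivAt_profileScore h).clm_apply (hasFDerivAt_const v x)).sub
      ((h1.clm_apply (hasFDerivAt_const ((0, v) : Vec m × Vec p) x)).const_mul (n : ℝ)⁻¹)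
  have h3 := HasFDerivAt.comp (g := fun x => profileScore Q σ x v - (n : ℝ)⁻¹ * fderiv ℝ W x (0, v))
    x.2 h2 (hasFDerivAt_prodMk_right (𝕜 := ℝ) x.1 x.2)
  refine ⟨_, h3.congr_of_eventuallyEq ?_, fun w => ?_⟩
  · filter_upwards [hσ.eventually_theta] with θ hθ
    rw [(hθ.hasFDerivAt_logLik_saddleLik h hd hn).fderiv]
    rfl
  · simp

theorem isRegularLik_saddleLik {y₀ : Vec m} {θ₀ : Vec p} (hσ : IsSaddleMapAt Θ Q σ (y₀, θ₀))
    (h : GrowthBound Θ Q) (hd : DecayBound Θ Q) (hcrit : profileScore Q σ (y₀, θ₀) = 0)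
    {C : Vec m →L[ℝ] Vec p} (hC : ∀ u v, inner ℝ (C u) v =
      inner ℝ (opAi Q (σ (y₀, θ₀), θ₀) u) (opB Q (σ (y₀, θ₀), θ₀) v)) :
    IsRegularLik (saddleLik Q) y₀ θ₀ C (opH Q (σ (y₀, θ₀), θ₀)) := by
  set W : Vec m × Vec p → ℝ := fun x => Real.log (matA Q (σ x) x.2).det / 2 with hW
  have hev : ∀ᶠ z : ℕ × (Vec m × Vec p) in atTop ×ˢ 𝓝 (y₀, θ₀),
      z.1 ≠ 0 ∧ IsSaddleMapAt Θ Q σ z.2 :=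
    (eventually_ne_atTop 0).prod_mk hσ.eventually_isSaddleMapAt
  have hWc : ContDiffAt ℝ 2 W (y₀, θ₀) := hσ.contDiffAt_log_det h hd
  have hb1 : ∀ᶠ x in 𝓝 (y₀, θ₀), ‖fderiv ℝ W x‖ ≤ ‖fderiv ℝ W (y₀, θ₀)‖ + 1 :=
    ((hWc.fderiv_right (m := 0) (by norm_num)).continuousAt.norm.eventually
      (eventually_le_nhds (lt_add_one _)))
  have hb2 : ∃ b, 0 ≤ b ∧ ∀ᶠ x in 𝓝 (y₀, θ₀), ∀ w v : Vec p,
      |fderiv ℝ (fderiv ℝ W) x (0, w) (0, v)| ≤ b * ‖w‖ * ‖v‖ := by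
    have h1 : ContinuousAt (fderiv ℝ (fderiv ℝ W)) (y₀, θ₀) :=
      (((hWc.fderiv_right (m := 1) (by norm_num)).fderiv_right (m := 0)
        (by norm_num)).continuousAt)
    refine ⟨‖fderiv ℝ (fderiv ℝ W) (y₀, θ₀)‖ + 1,
      add_nonneg (ContinuousLinearMap.opNorm_nonneg _) zero_le_one, ?_⟩
    have h2 := (ContinuousAt.norm (E := Vec m × Vec p →L[ℝ] Vec m × Vec p →L[ℝ] ℝ) h1).eventually (eventually_le_nhds (lt_add_one _))
    filter_upwards [h2] with x hx w v
    have h3 : ∀ u : Vec p, ‖((0, u) : Vec m × Vec p)‖ = ‖u‖ := fun u => by simp [Prod.norm_def]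
    have h4 := (fderiv ℝ (fderiv ℝ W) x).le_opNorm₂ (0, w) (0, v)
    rw [h3, h3, Real.norm_eq_abs] at h4
    exact h4.trans (by gcongr)
  obtain ⟨b, hb0, hb2⟩ := hb2
  refine IsRegularLik.of_profile hσ h hd hcrit hC (hev.mono fun z hz => hz.2.saddleLik_pos h hd hz.1)
    (hev.mono fun z hz => ?_)
    (hev.mono fun z hz => (hz.2.hasFDerivAt_logLik_saddleLik h hd hz.1).differentiableAt)
    (fun ε hε => ?_) (fun ε hε => ?_)
  · obtain ⟨hn, hz⟩ := hz
    have hn' : (0 : ℝ) < z.1 := Nat.cast_pos.2 (Nat.pos_of_ne_zero hn)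
    have h1 : ContinuousAt (fun x : Vec m × Vec p =>
        Real.exp (z.1 * (jointK Q (σ x, x.2) - inner ℝ (σ x) x.1)) /
        Real.sqrt ((2 * Real.pi * z.1) ^ m * (matA Q (σ x) x.2).det)) z.2 := by
      have h2 : ContinuousAt (fun x : Vec m × Vec p => jointK Q (σ x, x.2)) z.2 :=
        ContinuousAt.comp (g := jointK Q) (f := fun x => (σ x, x.2))
          (hasFDerivAt_jointK h hz.mem).continuousAt hz.contDiffAt_pair.continuousAt
      have h3 : ContinuousAt (fun x : Vec m × Vec p => (matA Q (σ x) x.2).det) z.2 :=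
        ContinuousAt.comp (g := fun q : Vec m × Vec p => (matA Q q.1 q.2).det)
          (f := fun x => (σ x, x.2))
          ((contDiffOn_det_matA h).contDiffAt (isOpen_interior.mem_nhds hz.mem)).continuousAt
          hz.contDiffAt_pair.continuousAt
      have h4 := hz.det_matA_pos h hd
      refine ContinuousAt.div ?_ ?_ (by positivity)
      · exact ((h2.sub (ContinuousAt.inner (𝕜 := ℝ) hz.contDiffAt.continuousAt continuousAt_fst)).const_mul _).rexp
      · exact (h3.const_mul _).sqrt
    refine h1.congr ?_
    filter_upwards [hz.eventually_isSaddleMapAt] with x hx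
    exact (hx.saddleLik_eq h hd hn).symm
  -- The determinant term contributes at most `b₁ / n` to the score; one factor `1/√n` makes it
  -- small relative to the other.
  · set b₁ := ‖fderiv ℝ W (y₀, θ₀)‖ + 1
    have hb₁ : 0 < b₁ := by positivity
    have hlim := tendsto_sqrt_inv.eventually (eventually_le_nhds (div_pos hε hb₁))
    filter_upwards [hev, hlim.prod_mk hb1] with z ⟨hn, hz⟩ ⟨h1, h2⟩ v
    rw [(hz.hasFDerivAt_logLik_saddleLik h hd hn).fderiv]
    have h3 : ‖((0, v) : Vec m × Vec p)‖ = ‖v‖ := by simp [Prod.norm_def]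
    have h4 : |fderiv ℝ W z.2 (0, v)| ≤ b₁ * ‖v‖ := by
      rw [← h3, ← Real.norm_eq_abs]
      exact (ContinuousLinearMap.le_opNorm _ _).trans (by gcongr)
    have h5 : (z.1 : ℝ)⁻¹ = (Real.sqrt z.1)⁻¹ * (Real.sqrt z.1)⁻¹ := by
      rw [← mul_inv, Real.mul_self_sqrt (Nat.cast_nonneg _)]
    have h6 : 0 ≤ (Real.sqrt z.1)⁻¹ := by positivity
    rw [ContinuousLinearMap.sub_apply, sub_sub_cancel_left, abs_neg, ContinuousLinearMap.smul_apply,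
      smul_eq_mul, abs_mul, abs_of_nonneg (by positivity : (0 : ℝ) ≤ (z.1 : ℝ)⁻¹), h5]
    calc _ ≤ (Real.sqrt z.1)⁻¹ * (Real.sqrt z.1)⁻¹ * (b₁ * ‖v‖) := by
          gcongr
          exact h4
      _ ≤ (ε / b₁) * (Real.sqrt z.1)⁻¹ * (b₁ * ‖v‖) := by gcongr
      _ = _ := by field_simp
  · have hlim : ∀ᶠ n : ℕ in atTop, (n : ℝ)⁻¹ * b ≤ ε / 2 := by
      have h1 := (tendsto_inv_atTop_nhds_zero_nat (𝕜 := ℝ)).mul_const b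
      rw [zero_mul] at h1
      exact h1.eventually (eventually_le_nhds (half_pos hε))
    filter_upwards [hev, hlim.prod_mk hb2,
      tendsto_snd.eventually (hσ.eventually_fderiv_profileScore h hd (half_pos hε))]
      with z ⟨hn, hz⟩ ⟨h1, h2⟩ h3 v
    obtain ⟨D, hD, hDw⟩ := hz.hasFDerivAt_fderiv_logLik_saddleLik h hd hn v
    refine ⟨D, hD, fun w => ?_⟩
    rw [hDw]
    have h4 : |(z.1 : ℝ)⁻¹ * fderiv ℝ (fderiv ℝ W) z.2 (0, w) (0, v)| ≤ ε / 2 * ‖v‖ * ‖w‖ := by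
      rw [abs_mul, abs_of_nonneg (by positivity : (0 : ℝ) ≤ (z.1 : ℝ)⁻¹)]
      calc _ ≤ (z.1 : ℝ)⁻¹ * (b * ‖w‖ * ‖v‖) := by gcongr; exact h2 w v
        _ = ((z.1 : ℝ)⁻¹ * b) * ‖v‖ * ‖w‖ := by ring
        _ ≤ _ := by gcongr
    have h5 := h3 w v
    rw [abs_le] at h4 h5 ⊢
    constructor <;> linarith [h4.1, h4.2, h5.1, h5.2]

end IsSaddleMapAt

end SaddleLik

end Saddlepoint

namespace Saddlepoint

/-! ### Regularity of the true likelihood. -/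

section TrueLik

variable {m p : ℕ} {Θ : Set (Vec p)} {Q : Vec p → Measure (Vec m)}

/-- The real part of the Fourier integral in the inversion formula for the density. -/
noncomputable def invInt (Q : Vec p → Measure (Vec m)) (n : ℕ) (x : Vec m) (q : Vec m × Vec p) : ℝ :=
  (LaplaceData.int₀ (fun φ q => ratio Q (φ, q)) n x q).re

/-- The parameter derivative of `invInt`. -/
noncomputable def invInt₁ (Q : Vec p → Measure (Vec m)) (n : ℕ) (x : Vec m) (q : Vec m × Vec p) :
    Vec p →L[ℝ] ℝ :=
  Complex.reCLM.comp (∫ φ, LaplaceData.integrand₁ (fun φ q => ratio Q (φ, q)) (ratioD₁ Q) n x q φ)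

/-- The second parameter derivative of `invInt`, evaluated at one vector. -/
noncomputable def invInt₂ (Q : Vec p → Measure (Vec m)) (n : ℕ) (x : Vec m) (q : Vec m × Vec p)
    (v : Vec p) : Vec p →L[ℝ] ℝ :=
  Complex.reCLM.comp ((ContinuousLinearMap.apply ℝ ℂ v).comp
    (∫ φ, LaplaceData.integrand₂ (fun φ q => ratio Q (φ, q)) (ratioD₁ Q) (ratioD₂ Q) n x q φ))

variable [∀ θ, IsProbabilityMeasure (Q θ)]

/-- The left side does not involve `q.1`: every admissible tilt represents the same density, and
this freedom is exploited below. -/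
theorem trueLik_eq {n : ℕ} (hn : n ≠ 0) {q : Vec m × Vec p}
    (hq : q ∈ interior (jointDomain Θ Q)) (hint : ∀ x, Integrable fun φ => ratio Q (φ, q) ^ n * osc x φ)
    (x : Vec m) :
    trueLik Q n x q.2 =
      ((2 * Real.pi) ^ m)⁻¹ * Real.exp (n * jointK Q q - inner ℝ q.1 x) * invInt Q n x q := by
  have hs : q.1 ∈ expDomain (Q q.2) := (interior_subset hq).2
  have hr : ∀ φ, mgfC (sumLaw (Q q.2) n) (cplx q.1 φ) / mgfC (sumLaw (Q q.2) n) (cplx q.1 0) =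
      ratio Q (φ, q) ^ n := fun φ => by
    rw [mgfC_sumLaw, mgfC_sumLaw, ← div_pow]; rfl
  have h0 : (fun φ : Vec m => ratio Q (φ, q) ^ n * osc 0 φ) = fun φ => ratio Q (φ, q) ^ n := by
    ext φ; simp [osc]
  have h1 := density_eq_integral (P := sumLaw (Q q.2) n) (s := q.1)
    (by rwa [expDomain_sumLaw _ _ hn]) (by simp_rw [hr]; rw [← h0]; exact hint 0) x
  simp_rw [hr] at h1
  rw [integral_exp_sumLaw, integral_exp_eq hs, ← Real.exp_nat_mul] at h1
  have h2 := congrArg Complex.re h1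
  rw [Complex.ofReal_re, Complex.re_ofReal_mul] at h2
  rw [trueLik, h2, invInt, sub_eq_add_neg, Real.exp_add, ← mul_assoc]
  rfl

/-- The differentiability properties of the Fourier integral near `q₀`. -/
structure IsInvRegular (Θ : Set (Vec p)) (Q : Vec p → Measure (Vec m)) (N : Set (Vec m × Vec p))
    (n : ℕ) : Prop where
  isOpen : IsOpen N
  subset : N ⊆ interior (jointDomain Θ Q)
  ne_zero : n ≠ 0
  integrable : ∀ q ∈ N, ∀ x, Integrable fun φ => ratio Q (φ, q) ^ n * osc x φ
  cont : ∀ q ∈ N, ∀ x, ContinuousAt (fun y : Vec m × (Vec m × Vec p) => invInt Q n y.1 y.2) (x, q)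
  deriv_one : ∀ q ∈ N, ∀ x, HasFDerivAt (fun θ => invInt Q n x (q.1, θ)) (invInt₁ Q n x q) q.2
  deriv_two : ∀ q ∈ N, ∀ x v,
    HasFDerivAt (fun θ => invInt₁ Q n x (q.1, θ) v) (invInt₂ Q n x q v) q.2

theorem exists_isInvRegular (h : GrowthBound Θ Q) (hd : DecayBound Θ Q) {q₀ : Vec m × Vec p}
    (hq₀ : q₀ ∈ interior (jointDomain Θ Q)) :
    ∃ N, q₀ ∈ N ∧ ∃ n₀, ∀ n ≥ n₀, IsInvRegular Θ Q N n := by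
  obtain ⟨N, hN, δ, C, d, hL⟩ := exists_laplaceData h hd hq₀
  obtain ⟨n₀, hn₀, hall⟩ := hL.exists_hasFDerivAt
  refine ⟨N, hL.mem, n₀, fun n hn => ⟨hL.isOpen, hN, by omega, fun q hq x => (hall n hn q hq x).1,
    fun q hq x => ?_, fun q hq x => ?_, fun q hq x v => ?_⟩⟩
  · exact Complex.continuous_re.continuousAt.comp (hall n hn q hq x).2.1
  · exact Complex.reCLM.hasFDerivAt.comp q.2 (hall n hn q hq x).2.2.1
  · exact Complex.reCLM.hasFDerivAt.comp q.2 ((ContinuousLinearMap.apply ℝ ℂ v).hasFDerivAt.comp q.2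
      (hall n hn q hq x).2.2.2)

theorem eventually_invInt (h : GrowthBound Θ Q) (hd : DecayBound Θ Q) {q₀ : Vec m × Vec p}
    (hq₀ : q₀ ∈ interior (jointDomain Θ Q)) {ε : ℝ} (hε : 0 < ε) :
    ∀ᶠ z : ℕ × (Vec m × Vec p) in atTop ×ˢ 𝓝 q₀,
      0 < invInt Q z.1 ((z.1 : ℝ) • gradK Q z.2) z.2 ∧
      (∀ v, |invInt₁ Q z.1 ((z.1 : ℝ) • gradK Q z.2) z.2 v /
        invInt Q z.1 ((z.1 : ℝ) • gradK Q z.2) z.2| ≤ ε * Real.sqrt z.1 * ‖v‖) ∧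
      ∀ v w, |(z.1 : ℝ)⁻¹ * (invInt₂ Q z.1 ((z.1 : ℝ) • gradK Q z.2) z.2 v w /
        invInt Q z.1 ((z.1 : ℝ) • gradK Q z.2) z.2) +
        inner ℝ (opAi Q q₀ (opB Q q₀ w)) (opB Q q₀ v)| ≤ ε * ‖w‖ * ‖v‖ := by
  obtain ⟨N, hN, δ, C, d, hL⟩ := exists_laplaceData h hd hq₀
  filter_upwards [hL.eventually_re_int₀_pos, hL.eventually_ratio₁ hε,
    hL.eventually_ratio₂ (opA_symm h hq₀) (opA_opAi h hd hq₀) hε] with z h1 h2 h3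
  exact ⟨h1, h2, fun v w => h3 w v⟩

namespace IsInvRegular

variable {N : Set (Vec m × Vec p)} {n : ℕ} {q : Vec m × Vec p} {y : Vec m}

theorem trueLik_eq (hR : IsInvRegular Θ Q N n) (hq : q ∈ N) (x : Vec m) : trueLik Q n x q.2 =
      ((2 * Real.pi) ^ m)⁻¹ * Real.exp (n * jointK Q q - inner ℝ q.1 x) * invInt Q n x q :=
  Saddlepoint.trueLik_eq hR.ne_zero (hR.subset hq) (hR.integrable q hq) x

theorem cast_pos (hR : IsInvRegular Θ Q N n) : (0 : ℝ) < n :=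
  Nat.cast_pos.2 (Nat.pos_of_ne_zero hR.ne_zero)

theorem trueLik_pos (hR : IsInvRegular Θ Q N n) (hq : q ∈ N) {x : Vec m}
    (hpos : 0 < invInt Q n x q) : 0 < trueLik Q n x q.2 := by
  rw [hR.trueLik_eq hq]
  positivity

theorem logLik_eq (hR : IsInvRegular Θ Q N n) (hq : q ∈ N)
    (hpos : 0 < invInt Q n ((n : ℝ) • y) q) :
    logLik (trueLik Q) n y q.2 = jointK Q q - inner ℝ q.1 y +
      (n : ℝ)⁻¹ * Real.log (invInt Q n ((n : ℝ) • y) q) +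
      (n : ℝ)⁻¹ * Real.log (((2 * Real.pi) ^ m)⁻¹) := by
  have hn := hR.cast_pos
  rw [logLik, hR.trueLik_eq hq, Real.log_mul (by positivity) hpos.ne',
    Real.log_mul (by positivity) (Real.exp_ne_zero _), Real.log_exp, inner_smul_right]
  field_simp
  ring

theorem eventually_theta (hR : IsInvRegular Θ Q N n) (hq : q ∈ N) {x : Vec m}
    (hpos : 0 < invInt Q n x q) :
    ∀ᶠ θ in 𝓝 q.2, (q.1, θ) ∈ N ∧ 0 < invInt Q n x (q.1, θ) :=
  ((Continuous.prodMk_right q.1).continuousAt.eventually (hR.isOpen.mem_nhds hq)).and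
    ((hR.deriv_one q hq x).continuousAt.eventually (eventually_gt_nhds hpos))

/-- The tilt `q.1` is frozen while `θ` varies, so no derivative of the saddlepoint enters. -/
theorem hasFDerivAt_logLik (hR : IsInvRegular Θ Q N n) (h : GrowthBound Θ Q) (hq : q ∈ N)
    (hpos : 0 < invInt Q n ((n : ℝ) • y) q) :
    HasFDerivAt (logLik (trueLik Q) n y)
      ((fderiv ℝ (jointK Q) q).comp (ContinuousLinearMap.inr ℝ (Vec m) (Vec p)) +
        (n : ℝ)⁻¹ • ((invInt Q n ((n : ℝ) • y) q)⁻¹ • invInt₁ Q n ((n : ℝ) • y) q)) q.2 := by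
  have h1 : HasFDerivAt (fun θ => jointK Q (q.1, θ)) _ q.2 :=
    HasFDerivAt.comp (g := jointK Q) q.2 (hasFDerivAt_jointK h (hR.subset hq))
      (hasFDerivAt_prodMk_right (𝕜 := ℝ) q.1 q.2)
  have h2 := ((hR.deriv_one q hq ((n : ℝ) • y)).log hpos.ne').const_mul (n : ℝ)⁻¹
  refine (((h1.sub_const (inner ℝ q.1 y)).add h2).add_const
    ((n : ℝ)⁻¹ * Real.log (((2 * Real.pi) ^ m)⁻¹))).congr_of_eventuallyEq ?_
  filter_upwards [hR.eventually_theta hq hpos] with θ hθ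
  exact hR.logLik_eq hθ.1 hθ.2

theorem fderiv_logLik_apply (hR : IsInvRegular Θ Q N n) (h : GrowthBound Θ Q) (hq : q ∈ N)
    (hpos : 0 < invInt Q n ((n : ℝ) • y) q) (v : Vec p) :
    fderiv ℝ (logLik (trueLik Q) n y) q.2 v = fderiv ℝ (jointK Q) q (0, v) +
      (n : ℝ)⁻¹ * (invInt₁ Q n ((n : ℝ) • y) q v * (invInt Q n ((n : ℝ) • y) q)⁻¹) := by
  rw [(hR.hasFDerivAt_logLik h hq hpos).fderiv, mul_comm (invInt₁ Q n ((n : ℝ) • y) q v)]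
  rfl

theorem hasFDerivAt_fderiv_logLik (hR : IsInvRegular Θ Q N n) (h : GrowthBound Θ Q) (hq : q ∈ N)
    (hpos : 0 < invInt Q n ((n : ℝ) • y) q) (v : Vec p) :
    ∃ D : Vec p →L[ℝ] ℝ,
      HasFDerivAt (fun θ => fderiv ℝ (logLik (trueLik Q) n y) θ v) D q.2 ∧ ∀ w,
      D w = hessTheta Q q w v + (n : ℝ)⁻¹ * (invInt₂ Q n ((n : ℝ) • y) q v w /
          invInt Q n ((n : ℝ) • y) q) -
        (n : ℝ)⁻¹ * (invInt₁ Q n ((n : ℝ) • y) q v / invInt Q n ((n : ℝ) • y) q) *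
          (invInt₁ Q n ((n : ℝ) • y) q w / invInt Q n ((n : ℝ) • y) q) := by
  have h1 : HasFDerivAt (fun θ => fderiv ℝ (jointK Q) (q.1, θ) (0, v)) _ q.2 :=
    (HasFDerivAt.comp (g := fderiv ℝ (jointK Q)) q.2 (hasFDerivAt_fderiv_jointK h (hR.subset hq))
      (hasFDerivAt_prodMk_right (𝕜 := ℝ) q.1 q.2)).clm_apply (hasFDerivAt_const _ _)
  have h2 : HasFDerivAt (fun θ => (invInt Q n ((n : ℝ) • y) (q.1, θ))⁻¹)
      (-((invInt Q n ((n : ℝ) • y) q) ^ 2)⁻¹ • invInt₁ Q n ((n : ℝ) • y) q) q.2 :=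
    (hasDerivAt_inv hpos.ne').comp_hasFDerivAt q.2 (hR.deriv_one q hq ((n : ℝ) • y))
  have h3 := ((hR.deriv_two q hq ((n : ℝ) • y) v).mul h2).const_mul (n : ℝ)⁻¹
  refine ⟨_, (h1.add h3).congr_of_eventuallyEq ?_, fun w => ?_⟩
  · filter_upwards [hR.eventually_theta hq hpos] with θ hθ
    exact hR.fderiv_logLik_apply h hθ.1 hθ.2 v
  · have hp := hpos.ne'
    simp [hessTheta]
    field_simp
    ring

theorem continuousAt_trueLik (hR : IsInvRegular Θ Q N n) (h : GrowthBound Θ Q) (hq : q ∈ N) :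
    ContinuousAt (fun x : Vec m × Vec p => trueLik Q n ((n : ℝ) • x.1) x.2) (y, q.2) := by
  have h0 : ContinuousAt (fun x : Vec m × Vec p => invInt Q n ((n : ℝ) • x.1) (q.1, x.2)) (y, q.2) :=
    ContinuousAt.comp (g := fun y : Vec m × (Vec m × Vec p) => invInt Q n y.1 y.2)
      (f := fun x : Vec m × Vec p => ((n : ℝ) • x.1, (q.1, x.2))) (x := (y, q.2))
      (hR.cont q hq _) (by fun_prop)
  have h1 : ContinuousAt (fun x : Vec m × Vec p => jointK Q (q.1, x.2)) (y, q.2) :=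
    ContinuousAt.comp (g := jointK Q) (f := fun x : Vec m × Vec p => (q.1, x.2)) (x := (y, q.2))
      (hasFDerivAt_jointK h (hR.subset hq)).continuousAt (by fun_prop)
  have h2 : ContinuousAt (fun x : Vec m × Vec p => ((2 * Real.pi) ^ m)⁻¹ *
      Real.exp (n * jointK Q (q.1, x.2) - inner ℝ q.1 ((n : ℝ) • x.1)) *
      invInt Q n ((n : ℝ) • x.1) (q.1, x.2)) (y, q.2) :=
    ((((h1.const_mul _).sub (by fun_prop)).rexp).const_mul _).mul h0
  refine h2.congr ?_
  have h3 : ContinuousAt (fun x : Vec m × Vec p => (q.1, x.2)) (y, q.2) := by fun_prop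
  filter_upwards [h3.eventually (hR.isOpen.mem_nhds hq)] with x hx
  exact (hR.trueLik_eq hx _).symm

end IsInvRegular

/-- At the saddlepoint tilt the exponent gives the profile score exactly and `J' / (n J)` is
`o(n^(-1/2))`. In the Hessian `J'' / (n J)` supplies the Schur term and `(J' / J)² / n` vanishes. -/
theorem IsSaddleMapAt.isRegularLik_trueLik {σ : Vec m × Vec p → Vec m} {y₀ : Vec m} {θ₀ : Vec p}
    (hσ : IsSaddleMapAt Θ Q σ (y₀, θ₀)) (h : GrowthBound Θ Q) (hd : DecayBound Θ Q)
    (hcrit : profileScore Q σ (y₀, θ₀) = 0) {C : Vec m →L[ℝ] Vec p}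
    (hC : ∀ u v, inner ℝ (C u) v =
      inner ℝ (opAi Q (σ (y₀, θ₀), θ₀) u) (opB Q (σ (y₀, θ₀), θ₀) v)) :
    IsRegularLik (trueLik Q) y₀ θ₀ C (opH Q (σ (y₀, θ₀), θ₀)) := by
  set q₀ : Vec m × Vec p := (σ (y₀, θ₀), θ₀) with hq₀
  obtain ⟨N, hN, n₀, hR⟩ := exists_isInvRegular h hd hσ.mem
  have hpair : Tendsto (fun x : Vec m × Vec p => (σ x, x.2)) (𝓝 (y₀, θ₀)) (𝓝 q₀) :=
    hσ.contDiffAt_pair.continuousAt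
  have hpairn : Tendsto (fun z : ℕ × (Vec m × Vec p) => (z.1, (σ z.2, z.2.2)))
      (atTop ×ˢ 𝓝 (y₀, θ₀)) (atTop ×ˢ 𝓝 q₀) :=
    tendsto_fst.prodMk (hpair.comp tendsto_snd)
  have hNo : N ∈ 𝓝 q₀ := (hR n₀ le_rfl).isOpen.mem_nhds hN
  have key : ∀ ε > 0, ∀ᶠ z : ℕ × (Vec m × Vec p) in atTop ×ˢ 𝓝 (y₀, θ₀),
      IsInvRegular Θ Q N z.1 ∧ (σ z.2, z.2.2) ∈ N ∧ IsSaddleMapAt Θ Q σ z.2 ∧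
      0 < invInt Q z.1 ((z.1 : ℝ) • z.2.1) (σ z.2, z.2.2) ∧
      (∀ v, |invInt₁ Q z.1 ((z.1 : ℝ) • z.2.1) (σ z.2, z.2.2) v /
        invInt Q z.1 ((z.1 : ℝ) • z.2.1) (σ z.2, z.2.2)| ≤ ε * Real.sqrt z.1 * ‖v‖) ∧
      ∀ v w, |(z.1 : ℝ)⁻¹ * (invInt₂ Q z.1 ((z.1 : ℝ) • z.2.1) (σ z.2, z.2.2) v w /
        invInt Q z.1 ((z.1 : ℝ) • z.2.1) (σ z.2, z.2.2)) +
        inner ℝ (opAi Q q₀ (opB Q q₀ w)) (opB Q q₀ v)| ≤ ε * ‖w‖ * ‖v‖ := by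
    intro ε hε
    filter_upwards [hpairn.eventually (eventually_invInt h hd hσ.mem hε),
      (eventually_ge_atTop n₀).prod_mk ((hpair.eventually hNo).and hσ.eventually_isSaddleMapAt)]
      with z h1 ⟨h2, h3, h4⟩
    -- The Laplace asymptotics hold at observation mean `K'(s; θ)`; along the saddle map this is
    -- `y`.
    rw [h4.gradK_eq] at h1
    exact ⟨hR _ h2, h3, h4, h1⟩
  refine IsRegularLik.of_profile hσ h hd hcrit hC
    ((key 1 one_pos).mono fun z ⟨h1, h2, _, h3, _⟩ => h1.trueLik_pos h2 h3)
    ((key 1 one_pos).mono fun z ⟨h1, h2, _⟩ => h1.continuousAt_trueLik (y := z.2.1) (q := (σ z.2, z.2.2)) h h2)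
    ((key 1 one_pos).mono fun z ⟨h1, h2, _, h3, _⟩ => (h1.hasFDerivAt_logLik h h2 h3).differentiableAt)
    (fun ε hε => ?_) (fun ε hε => ?_)
  · filter_upwards [key ε hε] with z ⟨h1, h2, _, h3, h4, _⟩ v
    have hn := h1.cast_pos
    rw [h1.fderiv_logLik_apply h h2 h3, profileScore_apply, add_sub_cancel_left, ← div_eq_mul_inv,
      abs_mul, abs_of_nonneg (by positivity : (0 : ℝ) ≤ (z.1 : ℝ)⁻¹)]
    have h5 : (z.1 : ℝ)⁻¹ * Real.sqrt z.1 = (Real.sqrt z.1)⁻¹ := by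
      have := Real.sqrt_pos.2 hn
      field_simp
      exact Real.sq_sqrt hn.le
    calc _ ≤ (z.1 : ℝ)⁻¹ * (ε * Real.sqrt z.1 * ‖v‖) := by gcongr; exact h4 v
      _ = ε * ((z.1 : ℝ)⁻¹ * Real.sqrt z.1) * ‖v‖ := by ring
      _ = _ := by rw [h5]
  -- Three error terms of size at most `ε / 3`; `η ≤ 1` reduces the squared first-derivative term
  -- from `η²` to `η`.
  · set η := min 1 (ε / 3) with hη
    have hη0 : 0 < η := lt_min one_pos (by positivity)
    have hη1 : η ≤ 1 := min_le_left _ _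
    have hηε : η ≤ ε / 3 := min_le_right _ _
    have hcont : ∀ᶠ x in 𝓝 (y₀, θ₀), ∀ w v : Vec p,
        |hessTheta Q (σ x, x.2) w v - hessTheta Q q₀ w v| ≤ η * ‖w‖ * ‖v‖ := by
      have c1 : ContinuousAt (fderiv ℝ (fderiv ℝ (jointK Q))) q₀ :=
        ((contDiffAt_fderiv_jointK h hσ.mem).fderiv_right (m := 0) (by norm_num)).continuousAt
      have c2 := Metric.tendsto_nhds (α := Vec m × Vec p →L[ℝ] Vec m × Vec p →L[ℝ] ℝ) |>.1
        (c1.tendsto.comp hpair) η hη0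
      filter_upwards [c2] with x hx w v
      have c3 : ‖fderiv ℝ (fderiv ℝ (jointK Q)) (σ x, x.2) - fderiv ℝ (fderiv ℝ (jointK Q)) q₀‖ ≤ η :=
        (dist_eq_norm (E := Vec m × Vec p →L[ℝ] Vec m × Vec p →L[ℝ] ℝ) _ _).symm.trans_le hx.le
      have c4 : ∀ u : Vec p, ‖((0, u) : Vec m × Vec p)‖ = ‖u‖ := fun u => by simp [Prod.norm_def]
      have c5 := (fderiv ℝ (fderiv ℝ (jointK Q)) (σ x, x.2) -
        fderiv ℝ (fderiv ℝ (jointK Q)) q₀).le_opNorm₂ (0, w) (0, v)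
      rw [c4, c4, Real.norm_eq_abs] at c5
      exact c5.trans (by gcongr)
    filter_upwards [key η hη0, tendsto_snd.eventually hcont] with z ⟨h1, h2, _, h3, h4, h5⟩ h6 v
    obtain ⟨D, hD, hDw⟩ := h1.hasFDerivAt_fderiv_logLik h h2 h3 v
    refine ⟨D, hD, fun w => ?_⟩
    have hn := h1.cast_pos
    rw [hDw, inner_opH h hσ.mem]
    have h7 : |(z.1 : ℝ)⁻¹ * (invInt₁ Q z.1 ((z.1 : ℝ) • z.2.1) (σ z.2, z.2.2) v /
        invInt Q z.1 ((z.1 : ℝ) • z.2.1) (σ z.2, z.2.2)) *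
        (invInt₁ Q z.1 ((z.1 : ℝ) • z.2.1) (σ z.2, z.2.2) w /
        invInt Q z.1 ((z.1 : ℝ) • z.2.1) (σ z.2, z.2.2))| ≤ η * ‖w‖ * ‖v‖ := by
      rw [abs_mul, abs_mul, abs_of_nonneg (by positivity : (0 : ℝ) ≤ (z.1 : ℝ)⁻¹)]
      calc _ ≤ (z.1 : ℝ)⁻¹ * (η * Real.sqrt z.1 * ‖v‖) * (η * Real.sqrt z.1 * ‖w‖) := by
            gcongr
            · exact h4 v
            · exact h4 w
        _ = η * η * ((z.1 : ℝ)⁻¹ * (Real.sqrt z.1 * Real.sqrt z.1)) * ‖w‖ * ‖v‖ := by ring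
        _ = η * η * ‖w‖ * ‖v‖ := by
            rw [Real.mul_self_sqrt hn.le, inv_mul_cancel₀ hn.ne', mul_one]
        _ ≤ η * 1 * ‖w‖ * ‖v‖ := by gcongr
        _ = _ := by rw [mul_one]
    have h8 := h5 v w
    have h9 := h6 w v
    have h10 : η * ‖w‖ * ‖v‖ ≤ ε / 3 * ‖w‖ * ‖v‖ := by gcongr
    have h11 : ε * ‖v‖ * ‖w‖ = 3 * (ε / 3 * ‖w‖ * ‖v‖) := by ring
    rw [h11]
    rw [abs_le] at h7 h8 h9 ⊢
    constructor <;> linarith [h7.1, h7.2, h8.1, h8.2, h9.1, h9.2]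

end TrueLik

end Saddlepoint

namespace Saddlepoint

/-! ### Convergence in distribution on varying probability spaces. -/

section Distribution

variable {Ω : ℕ → Type*} [∀ n, MeasurableSpace (Ω n)] {μ : ∀ n, Measure (Ω n)}
  [∀ n, IsProbabilityMeasure (μ n)] {Ω' : Type*} [MeasurableSpace Ω'] {μ' : Measure Ω'}
  [IsProbabilityMeasure μ']
  {E : Type*} [NormedAddCommGroup E] [MeasurableSpace E] [BorelSpace E]

theorem tendstoInDistribution_of_map_eq {Ω'' : Type*} [MeasurableSpace Ω''] {μ'' : Measure Ω''}
    [IsProbabilityMeasure μ''] {X : ∀ n, Ω n → E} {Z : Ω' → E} {Z' : Ω'' → E}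
    (h : TendstoInDistribution X atTop Z μ μ') (hZ' : AEMeasurable Z' μ'')
    (hmap : μ'.map Z = μ''.map Z') : TendstoInDistribution X atTop Z' μ μ'' where
  forall_aemeasurable := h.forall_aemeasurable
  aemeasurable_limit := hZ'
  tendsto := by
    have h1 := h.tendsto
    have h2 : (⟨μ'.map Z, Measure.isProbabilityMeasure_map h.aemeasurable_limit⟩ :
        ProbabilityMeasure E) = ⟨μ''.map Z', Measure.isProbabilityMeasure_map hZ'⟩ :=
      Subtype.ext hmap
    rwa [h2] at h1

/-- Sequences that converge in distribution are bounded in probability. -/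
theorem eventually_measure_norm_le {X : ∀ n, Ω n → E} {Z : Ω' → E}
    (h : TendstoInDistribution X atTop Z μ μ') {η : ENNReal} (hη : 0 < η) :
    ∃ K : ℝ, 0 < K ∧ ∀ᶠ n in atTop, μ n {ω | K ≤ ‖X n ω‖} ≤ η := by
  have hclosed : ∀ K : ℝ, IsClosed {x : E | K ≤ ‖x‖} := fun K =>
    isClosed_le continuous_const continuous_norm
  have hprob : IsProbabilityMeasure (μ'.map Z) :=
    Measure.isProbabilityMeasure_map h.aemeasurable_limit
  have h1 : Tendsto (fun k : ℕ => μ'.map Z {x : E | (k : ℝ) ≤ ‖x‖}) atTop (𝓝 0) := by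
    have h2 := tendsto_measure_iInter_atTop (μ := μ'.map Z) (s := fun k : ℕ => {x : E | (k : ℝ) ≤ ‖x‖})
      (fun k => (hclosed k).measurableSet.nullMeasurableSet)
      (fun i j hij x (hx : (j : ℝ) ≤ ‖x‖) => le_trans (Nat.cast_le.2 hij) hx)
      ⟨0, measure_ne_top _ _⟩
    have h3 : ⋂ k : ℕ, {x : E | (k : ℝ) ≤ ‖x‖} = ∅ := by
      refine Set.eq_empty_of_forall_notMem fun x hx => ?_
      obtain ⟨k, hk⟩ := exists_nat_gt ‖x‖
      exact absurd (Set.mem_iInter.1 hx k) (not_le.2 hk)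
    rwa [h3, measure_empty] at h2
  obtain ⟨k, hk, hk1⟩ := ((h1.eventually (eventually_lt_nhds hη)).and (eventually_ge_atTop 1)).exists
  refine ⟨k, by exact_mod_cast hk1, ?_⟩
  -- Portmanteau for the closed complement of a ball transfers the tail bound from the limit law.
  have h4 := (ProbabilityMeasure.limsup_measure_closed_le_of_tendsto h.tendsto (hclosed k)).trans_lt hk
  filter_upwards [eventually_lt_of_limsup_lt h4] with n hn
  change (μ n).map (X n) {x : E | (k : ℝ) ≤ ‖x‖} < η at hn
  rw [Measure.map_apply_of_aemeasurable (h.forall_aemeasurable n) (hclosed k).measurableSet] at hn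
  exact hn.le

/-- A perturbation that tends to zero in probability does not affect convergence in
distribution, for random variables on varying probability spaces. -/
theorem tendstoInDistribution_of_sub [SecondCountableTopology E] {X Y : ∀ n, Ω n → E} {Z : Ω' → E}
    (h : TendstoInDistribution X atTop Z μ μ') (hY : ∀ n, AEMeasurable (Y n) (μ n))
    (hXY : ∀ ε > 0, Tendsto (fun n => μ n {ω | ε ≤ ‖Y n ω - X n ω‖}) atTop (𝓝 0)) :
    TendstoInDistribution Y atTop Z μ μ' := by
  -- All variables are lifted to one product space, where Slutsky's theorem applies; the individual
  -- laws are unchanged.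
  set P := Measure.infinitePi μ
  have hev : ∀ n, MeasurePreserving (Function.eval n) P (μ n) := fun n =>
    measurePreserving_eval_infinitePi μ n
  have hlift : ∀ {W : ∀ n, Ω n → E}, (∀ n, AEMeasurable (W n) (μ n)) →
      ∀ n, AEMeasurable (fun ω : ∀ n, Ω n => W n (ω n)) P := fun hW n =>
    (hW n).comp_quasiMeasurePreserving (hev n).quasiMeasurePreserving
  have hmap : ∀ {W : ∀ n, Ω n → E}, (∀ n, AEMeasurable (W n) (μ n)) →
      ∀ n, P.map (fun ω : ∀ n, Ω n => W n (ω n)) = (μ n).map (W n) := by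
    intro W hW n
    have h1 : AEMeasurable (W n) (P.map (Function.eval n)) := by rw [(hev n).map_eq]; exact hW n
    have h2 := AEMeasurable.map_map_of_aemeasurable h1 (hev n).measurable.aemeasurable
    rw [(hev n).map_eq] at h2
    exact h2.symm
  have hX' : TendstoInDistribution (fun n (ω : ∀ n, Ω n) => X n (ω n)) atTop Z (fun _ => P) μ' := by
    refine ⟨hlift h.forall_aemeasurable, h.aemeasurable_limit, ?_⟩
    refine h.tendsto.congr fun n => Subtype.ext ?_
    exact (hmap h.forall_aemeasurable n).symm
  have hY' := tendstoInDistribution_of_tendstoInMeasure_sub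
    (fun n (ω : ∀ n, Ω n) => Y n (ω n)) Z hX' ?_ (hlift hY)
  · refine ⟨hY, h.aemeasurable_limit, ?_⟩
    refine hY'.tendsto.congr fun n => Subtype.ext ?_
    exact hmap hY n
  · rw [tendstoInMeasure_iff_norm]
    intro ε hε
    refine (hXY ε hε).congr fun n => ?_
    have h1 : NullMeasurableSet {ω | ε ≤ ‖Y n ω - X n ω‖} (μ n) :=
      ((hY n).sub (h.forall_aemeasurable n)).norm.nullMeasurable measurableSet_Ici
    rw [← (hev n).measure_preimage h1]
    simp

end Distribution

/-! ### Linear images of Gaussian laws. -/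

section Gaussian

variable {m p : ℕ}

theorem map_multivariateGaussian {S : Matrix (Fin m) (Fin m) ℝ} (hS : S.PosSemidef)
    (M : Matrix (Fin p) (Fin m) ℝ) :
    (multivariateGaussian 0 S).map (matOp M) = multivariateGaussian 0 (M * S * M.transpose) := by
  have hS' : (M * S * M.transpose).PosSemidef := by
    have := hS.mul_mul_conjTranspose_same M
    rwa [Matrix.conjTranspose_eq_transpose_of_trivial] at this
  refine Measure.ext_of_charFun (funext fun t => ?_)
  have h1 : charFun ((multivariateGaussian 0 S).map (matOp M)) t =
      charFun (multivariateGaussian 0 S) (matOp M.transpose t) := by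
    rw [charFun_apply, charFun_apply, integral_map (by fun_prop)
      (Continuous.aestronglyMeasurable (by fun_prop))]
    congr 1
    ext x
    rw [real_inner_comm (matOp M.transpose t) x, inner_matOp_transpose, real_inner_comm t]
  rw [h1, charFun_multivariateGaussian hS, charFun_multivariateGaussian hS', inner_zero_right,
    inner_zero_right]
  congr 3
  have h2 : (matOp M.transpose t : Fin m → ℝ) = M.transpose.mulVec t := by
    ext i
    rw [matOp_apply]; rfl
  rw [h2, Matrix.mul_assoc, ← Matrix.mulVec_mulVec, ← Matrix.mulVec_mulVec, Matrix.dotProduct_mulVec,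
    Matrix.dotProduct_mulVec t, Matrix.mulVec_transpose, Matrix.dotProduct_mulVec]

end Gaussian

/-! ### From the linear expansion to the joint limit law. -/

section Estimator

variable {m p : ℕ} {Ω : ℕ → Type*} [∀ n, MeasurableSpace (Ω n)] {μ : ∀ n, Measure (Ω n)}
  [∀ n, IsProbabilityMeasure (μ n)] {Ω' : Type*} [MeasurableSpace Ω'] {μ' : Measure Ω'}
  [IsProbabilityMeasure μ']

/-- An estimator with a linear expansion differs from its linearisation by a term that tends to
zero in probability. -/
theorem tendsto_measure_linearisation {χ : ∀ n, Ω n → Vec m} {y₀ : Vec m} {Z : Ω' → Vec m}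
    (hclt : TendstoInDistribution
      (fun (n : ℕ) ω => (Real.sqrt (n : ℝ))⁻¹ • (χ n ω - (n : ℝ) • y₀)) atTop Z μ μ')
    {T : ℕ → Vec m → Vec p} {θ₀ : Vec p} {Λ : Vec m →L[ℝ] Vec p}
    (hT : ∀ ε > 0, ∀ᶠ z : ℕ × Vec m in atTop ×ˢ 𝓝 y₀,
      ‖T z.1 ((z.1 : ℝ) • z.2) - θ₀ - Λ (z.2 - y₀)‖ ≤ ε * ((Real.sqrt z.1)⁻¹ + ‖z.2 - y₀‖))
    {ε : ℝ} (hε : 0 < ε) :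
    Tendsto (fun n => μ n {ω | ε ≤ ‖Real.sqrt (n : ℝ) • (T n (χ n ω) - θ₀) -
      Λ ((Real.sqrt (n : ℝ))⁻¹ • (χ n ω - (n : ℝ) • y₀))‖}) atTop (𝓝 0) := by
  rw [ENNReal.tendsto_nhds_zero]
  intro η hη
  obtain ⟨K, hK, hev⟩ := eventually_measure_norm_le hclt hη
  -- Where the normalised observation has norm below `K`, the error after multiplication by `√n` is
  -- then at most `ε / 2`.
  have h1 := hT (ε / (2 * (1 + K))) (by positivity)
  rw [eventually_prod_iff] at h1
  obtain ⟨pa, hpa, pb, hpb, hab⟩ := h1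
  obtain ⟨r, hr, hball⟩ := Metric.eventually_nhds_iff.1 hpb
  have hlim : ∀ᶠ n : ℕ in atTop, (Real.sqrt n)⁻¹ * K < r := by
    have h2 := tendsto_sqrt_inv.mul_const K
    rw [zero_mul] at h2
    exact h2.eventually (eventually_lt_nhds hr)
  filter_upwards [hev, hpa, hlim, eventually_ge_atTop 1] with n hn hna hnr hn1
  refine (measure_mono fun ω hω => ?_).trans hn
  by_contra hlt
  simp only [Set.mem_setOf_eq, not_le] at hω hlt
  have hn0 : (0 : ℝ) < n := by exact_mod_cast hn1
  have hs : 0 < Real.sqrt n := Real.sqrt_pos.2 hn0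
  set X := (Real.sqrt (n : ℝ))⁻¹ • (χ n ω - (n : ℝ) • y₀) with hX
  set y := (n : ℝ)⁻¹ • χ n ω with hy
  have hny : (n : ℝ) • y = χ n ω := by rw [hy, smul_smul, mul_inv_cancel₀ hn0.ne', one_smul]
  have hyX : y - y₀ = (Real.sqrt n)⁻¹ • X := by
    rw [hX, smul_smul, ← mul_inv, Real.mul_self_sqrt hn0.le, smul_sub, smul_smul,
      inv_mul_cancel₀ hn0.ne', one_smul]
  have hyn : ‖y - y₀‖ = (Real.sqrt n)⁻¹ * ‖X‖ := by
    rw [hyX, norm_smul, Real.norm_of_nonneg (by positivity)]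
  have h3 : dist y y₀ < r := by
    rw [dist_eq_norm, hyn]
    refine lt_of_le_of_lt ?_ hnr
    gcongr
  have h4 := hab hna (hball h3)
  simp only at h4
  rw [hny, hyn, hyX, map_smul] at h4
  have h5 : Real.sqrt (n : ℝ) • (T n (χ n ω) - θ₀) - Λ X =
      Real.sqrt (n : ℝ) • (T n (χ n ω) - θ₀ - (Real.sqrt n)⁻¹ • Λ X) := by
    rw [smul_sub (Real.sqrt n) (T n (χ n ω) - θ₀), smul_smul, mul_inv_cancel₀ hs.ne', one_smul]
  rw [h5, norm_smul, Real.norm_of_nonneg hs.le] at hω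
  have h6 : Real.sqrt n * ‖T n (χ n ω) - θ₀ - (Real.sqrt n)⁻¹ • Λ X‖ ≤ ε / (2 * (1 + K)) * (1 + K) := by
    calc _ ≤ Real.sqrt n * (ε / (2 * (1 + K)) * ((Real.sqrt n)⁻¹ + (Real.sqrt n)⁻¹ * ‖X‖)) := by gcongr
      _ = ε / (2 * (1 + K)) * (1 + ‖X‖) := by field_simp
      _ ≤ _ := by gcongr
  have h7 : ε / (2 * (1 + K)) * (1 + K) = ε / 2 := by field_simp
  linarith

/-- Joint asymptotic normality of two estimators with the same linear expansion. -/
theorem tendstoInDistribution_pair {χ : ∀ n, Ω n → Vec m} {y₀ : Vec m}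
    {S : Matrix (Fin m) (Fin m) ℝ} (hS : S.PosSemidef)
    (hclt : TendstoInDistribution
      (fun (n : ℕ) ω => (Real.sqrt (n : ℝ))⁻¹ • (χ n ω - (n : ℝ) • y₀)) atTop
      (fun z => z) μ (multivariateGaussian 0 S))
    {T T' : ℕ → Vec m → Vec p} {θ₀ : Vec p} {M : Matrix (Fin p) (Fin m) ℝ}
    (hT : ∀ ε > 0, ∀ᶠ z : ℕ × Vec m in atTop ×ˢ 𝓝 y₀,
      ‖T z.1 ((z.1 : ℝ) • z.2) - θ₀ - matOp M (z.2 - y₀)‖ ≤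
        ε * ((Real.sqrt z.1)⁻¹ + ‖z.2 - y₀‖))
    (hT' : ∀ ε > 0, ∀ᶠ z : ℕ × Vec m in atTop ×ˢ 𝓝 y₀,
      ‖T' z.1 ((z.1 : ℝ) • z.2) - θ₀ - matOp M (z.2 - y₀)‖ ≤
        ε * ((Real.sqrt z.1)⁻¹ + ‖z.2 - y₀‖))
    (hm : ∀ n, AEMeasurable (fun ω => T n (χ n ω)) (μ n))
    (hm' : ∀ n, AEMeasurable (fun ω => T' n (χ n ω)) (μ n)) :
    TendstoInDistribution
      (fun (n : ℕ) ω => (Real.sqrt (n : ℝ) • (T n (χ n ω) - θ₀),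
        Real.sqrt (n : ℝ) • (T' n (χ n ω) - θ₀)))
      atTop (fun z => (z, z)) μ (multivariateGaussian 0 (M * S * M.transpose)) := by
  have hg : Continuous fun x : Vec m => (matOp M x, matOp M x) := by fun_prop
  have h1 := hclt.continuous_comp hg
  have h2 : TendstoInDistribution
      (fun (n : ℕ) ω => (Real.sqrt (n : ℝ) • (T n (χ n ω) - θ₀),
        Real.sqrt (n : ℝ) • (T' n (χ n ω) - θ₀)))
      atTop ((fun x : Vec m => (matOp M x, matOp M x)) ∘ fun z => z) μ
      (multivariateGaussian 0 S) := by
    refine tendstoInDistribution_of_sub h1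
      (fun n => (((hm n).sub_const θ₀).const_smul (Real.sqrt (n : ℝ))).prodMk
        (((hm' n).sub_const θ₀).const_smul (Real.sqrt (n : ℝ))))
      fun ε hε => ?_
    have h3 := (tendsto_measure_linearisation hclt hT hε).add
      (tendsto_measure_linearisation hclt hT' hε)
    rw [add_zero] at h3
    refine tendsto_of_tendsto_of_tendsto_of_le_of_le tendsto_const_nhds h3 (fun n => bot_le)
      fun n => ?_
    refine (measure_mono fun ω hω => ?_).trans (measure_union_le _ _)
    have h4 : ε ≤ max ‖Real.sqrt (n : ℝ) • (T n (χ n ω) - θ₀) -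
        matOp M ((Real.sqrt (n : ℝ))⁻¹ • (χ n ω - (n : ℝ) • y₀))‖
        ‖Real.sqrt (n : ℝ) • (T' n (χ n ω) - θ₀) -
        matOp M ((Real.sqrt (n : ℝ))⁻¹ • (χ n ω - (n : ℝ) • y₀))‖ := hω
    exact le_max_iff.1 h4
  refine tendstoInDistribution_of_map_eq h2 (by fun_prop) ?_
  have h4 : ((fun x : Vec m => (matOp M x, matOp M x)) ∘ fun z => z) =
      (fun z : Vec p => (z, z)) ∘ matOp M := rfl
  rw [h4, ← Measure.map_map (by fun_prop) (by fun_prop), map_multivariateGaussian hS]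

end Estimator

end Saddlepoint

namespace Saddlepoint

/-! ### Neighbourhoods and measurable estimators. -/

section Existence

variable {m p : ℕ} {L : ℕ → Vec m → Vec p → ℝ} {θ₀ : Vec p} {H : Vec p →L[ℝ] Vec p} {c r ρ : ℝ}

/-- On the open set `V` the maximiser is continuous in `y`; off the corresponding set of `x` it is
set to `θ₀`, which gives a measurable function. -/
theorem exists_measurable_isLocalMLE (hc : 0 < c) (hH : ∀ v, inner ℝ (H v) v ≤ -c * ‖v‖ ^ 2)
    (hr : 0 < r) (hrρ : r < ρ) {V : Set (Vec m)} (hV : IsOpen V) {n₀ : ℕ}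
    (hgood : ∀ n ≥ n₀, ∀ y ∈ V, IsGood L θ₀ H (c / 2) ρ n y ∧
      (∀ v, |fderiv ℝ (logLik L n y) θ₀ v| ≤ (c - c / 2) * r / 2 * ‖v‖) ∧
      ∃! θ, IsLocalMaximiserIn (Metric.ball θ₀ r) (L n ((n : ℝ) • y)) θ) :
    ∃ T : ℕ → Vec m → Vec p, IsLocalMLE L (Metric.ball θ₀ r) V n₀ T ∧ ∀ n, Measurable (T n) := by
  classical
  choose! τ hτ _ using fun n (hn : n ≥ n₀) y (hy : y ∈ V) => (hgood n hn y hy).2.2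
  refine ⟨fun n => if n₀ ≤ n ∧ 1 ≤ n then
    Set.piecewise ((fun x => (n : ℝ)⁻¹ • x) ⁻¹' V) (fun x => τ n ((n : ℝ)⁻¹ • x)) (fun _ => θ₀)
    else fun _ => θ₀, fun n hn y hy => ?_, fun n => ?_⟩
  · have h1 := (hgood n hn y hy).1.one_le
    have h2 : (n : ℝ)⁻¹ • (n : ℝ) • y = y := by
      rw [smul_smul, inv_mul_cancel₀ (by positivity), one_smul]
    simp only [hn.le, h1, and_self, if_true]
    rw [Set.piecewise_eq_of_mem _ _ _ (by rw [Set.mem_preimage, h2]; exact hy), h2]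
    exact hτ n hn y hy
  · beta_reduce
    split_ifs with hn
    · have h1 : ContinuousOn (τ n) V := continuousOn_localMaximiser hc hH hr hrρ hV
        (fun y hy => (hgood n hn.1 y hy).1) (fun y hy => (hgood n hn.1 y hy).2.1)
        fun y hy => hτ n hn.1 y hy
      have h2 : Continuous fun x : Vec m => (n : ℝ)⁻¹ • x := by fun_prop
      exact (h1.comp h2.continuousOn fun _ hx => hx).measurable_piecewise continuousOn_const
        (h2.measurable hV.measurableSet)
    · exact measurable_const

theorem exists_isMLENeighbourhood {Θ : Set (Vec p)} (hΘ : Θ ∈ 𝓝 θ₀) {Q : Vec p → Measure (Vec m)}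
    {y₀ : Vec m} {C : Vec m →L[ℝ] Vec p} (hc : 0 < c) (hH : ∀ v, inner ℝ (H v) v ≤ -c * ‖v‖ ^ 2)
    (h₁ : IsRegularLik (trueLik Q) y₀ θ₀ C H) (h₂ : IsRegularLik (saddleLik Q) y₀ θ₀ C H) :
    ∃ (U : Set (Vec p)) (V : Set (Vec m)) (n₀ : ℕ) (T That : ℕ → Vec m → Vec p),
      IsMLENeighbourhood Θ Q θ₀ y₀ U V n₀ ∧
      IsLocalMLE (trueLik Q) U V n₀ T ∧ IsLocalMLE (saddleLik Q) U V n₀ That ∧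
      (∀ n, Measurable (T n)) ∧ (∀ n, Measurable (That n)) := by
  obtain ⟨ρ₁, hρ₁, hev₁⟩ := h₁.eventually_existsUnique hc hH
  obtain ⟨ρ₂, hρ₂, hev₂⟩ := h₂.eventually_existsUnique hc hH
  obtain ⟨ρ₃, hρ₃, hsub⟩ := Metric.mem_nhds_iff.1 hΘ
  set r := min (ρ₁ / 2) (min (ρ₂ / 2) ρ₃) with hrdef
  have hr : 0 < r := by positivity
  have hr₁ : r < ρ₁ := (min_le_left _ _).trans_lt (half_lt_self hρ₁)
  have hr₂ : r < ρ₂ := ((min_le_right _ _).trans (min_le_left _ _)).trans_lt (half_lt_self hρ₂)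
  have hr₃ : r ≤ ρ₃ := (min_le_right _ _).trans (min_le_right _ _)
  have hev := (hev₁ r hr hr₁).and (hev₂ r hr hr₂)
  rw [eventually_prod_iff] at hev
  obtain ⟨pa, hpa, pb, hpb, hab⟩ := hev
  obtain ⟨n₀, hn₀⟩ := eventually_atTop.1 hpa
  obtain ⟨V, hVb, hV, hyV⟩ := eventually_nhds_iff.1 hpb
  have h1 := fun n (hn : n ≥ n₀) y (hy : y ∈ V) => (hab (hn₀ n hn) (hVb y hy)).1
  have h2 := fun n (hn : n ≥ n₀) y (hy : y ∈ V) => (hab (hn₀ n hn) (hVb y hy)).2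
  obtain ⟨T, hT, hTm⟩ := exists_measurable_isLocalMLE hc hH hr hr₁ hV h1
  obtain ⟨That, hThat, hThatm⟩ := exists_measurable_isLocalMLE hc hH hr hr₂ hV h2
  exact ⟨Metric.ball θ₀ r, V, n₀, T, That, ⟨(Metric.ball_subset_ball hr₃).trans hsub,
    Metric.ball_mem_nhds θ₀ hr, hV.mem_nhds hyV, fun n hn y hy => (h1 n hn y hy).2.2,
    fun n hn y hy => (h2 n hn y hy).2.2⟩, hT, hThat, hTm, hThatm⟩

theorem exists_pos_of_posDef {M : Matrix (Fin p) (Fin p) ℝ} (hM : M.PosDef) :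
    ∃ c > 0, ∀ v, c * ‖v‖ ^ 2 ≤ inner ℝ (matOp M v) v := by
  have hpos : ∀ v : Vec p, v ≠ 0 → 0 < inner ℝ (matOp M v) v := by
    intro v hv
    have h1 := hM.dotProduct_mulVec_pos (x := v.ofLp) (by simpa using hv)
    rw [inner_matOp]
    refine h1.trans_eq ?_
    simp only [dotProduct, Matrix.mulVec, Finset.mul_sum, Pi.star_apply, star_trivial]
    exact Finset.sum_congr rfl fun i _ => Finset.sum_congr rfl fun j _ => mul_comm _ _
  -- The sphere is empty exactly when `p = 0`; otherwise the constant is the minimum of the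
  -- quadratic form on it.
  rcases (Metric.sphere (0 : Vec p) 1).eq_empty_or_nonempty with he | hne
  · refine ⟨1, one_pos, fun v => ?_⟩
    have hv : v = 0 := by
      by_contra hv
      have : (‖v‖⁻¹ • v) ∈ Metric.sphere (0 : Vec p) 1 := by
        rw [mem_sphere_zero_iff_norm, norm_smul, norm_inv, norm_norm,
          inv_mul_cancel₀ (norm_ne_zero_iff.2 hv)]
      rw [he] at this
      exact this
    simp [hv]
  · obtain ⟨u, hu, hmin⟩ := (isCompact_sphere (0 : Vec p) 1).exists_isMinOn hne
      (f := fun v => inner ℝ (matOp M v) v) (Continuous.continuousOn (by fun_prop))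
    have hu1 : ‖u‖ = 1 := mem_sphere_zero_iff_norm.1 hu
    refine ⟨inner ℝ (matOp M u) u, hpos u fun h0 => by simp [h0] at hu1, fun v => ?_⟩
    rcases eq_or_ne v 0 with rfl | hv
    · simp
    have hv0 := norm_ne_zero_iff.2 hv
    have h1 : inner ℝ (matOp M u) u ≤ inner ℝ (matOp M (‖v‖⁻¹ • v)) (‖v‖⁻¹ • v) :=
      hmin (mem_sphere_zero_iff_norm.2 (by
        rw [norm_smul, norm_inv, norm_norm, inv_mul_cancel₀ hv0]))
    rw [map_smul, real_inner_smul_left, real_inner_smul_right] at h1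
    calc _ ≤ ‖v‖⁻¹ * (‖v‖⁻¹ * inner ℝ (matOp M v) v) * ‖v‖ ^ 2 := by gcongr
      _ = _ := by field_simp

end Existence

/-! ### Algebra of the limiting covariance. -/

section Matrices

variable {m p : ℕ} {A : Matrix (Fin m) (Fin m) ℝ} {B : Matrix (Fin m) (Fin p) ℝ}
  {H : Matrix (Fin p) (Fin p) ℝ}

theorem covariance_eq (hA : A.transpose = A) (hH : H.transpose = H) (S : Matrix (Fin m) (Fin m) ℝ) :
    -(H⁻¹ * B.transpose * A⁻¹) * S * (-(H⁻¹ * B.transpose * A⁻¹)).transpose =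
      H⁻¹ * B.transpose * A⁻¹ * S * A⁻¹ * B * H⁻¹ := by
  rw [Matrix.transpose_neg, Matrix.transpose_mul, Matrix.transpose_mul, Matrix.transpose_transpose,
    Matrix.transpose_nonsing_inv, Matrix.transpose_nonsing_inv, hA, hH]
  simp only [Matrix.neg_mul, Matrix.mul_neg, neg_neg, Matrix.mul_assoc]

theorem covariance_eq_neg_inv (hA : IsUnit A.det) (hH : IsUnit H.det)
    (hHB : H = -(B.transpose * A⁻¹ * B)) :
    H⁻¹ * B.transpose * A⁻¹ * A * A⁻¹ * B * H⁻¹ = -H⁻¹ := by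
  have h1 : B.transpose * A⁻¹ * B = -H := by rw [hHB, neg_neg]
  rw [Matrix.mul_assoc _ A⁻¹ A, Matrix.nonsing_inv_mul A hA, Matrix.mul_one,
    Matrix.mul_assoc H⁻¹, Matrix.mul_assoc H⁻¹, h1, Matrix.mul_neg, Matrix.neg_mul,
    Matrix.nonsing_inv_mul H hH, Matrix.one_mul]

end Matrices

end Saddlepoint

namespace Saddlepoint

/-! ### Assembly of the main theorem. -/

section Main

variable {m p : ℕ} {Θ : Set (Vec p)} {Q : Vec p → Measure (Vec m)}
  [∀ θ, IsProbabilityMeasure (Q θ)]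

theorem profileScore_eq_zero (h : GrowthBound Θ Q) {σ : Vec m × Vec p → Vec m} {y₀ : Vec m}
    {q₀ : Vec m × Vec p} (hq₀ : q₀ ∈ interior (jointDomain Θ Q)) (hσ : σ (y₀, q₀.2) = q₀.1)
    (hcrit : ∀ i : Fin p, pd i (fun θ => cumGF (Q θ) q₀.1) q₀.2 = 0) :
    profileScore Q σ (y₀, q₀.2) = 0 := by
  refine ContinuousLinearMap.coe_injective
    ((EuclideanSpace.basisFun (Fin p) ℝ).toBasis.ext fun i => ?_)
  have h1 := hcrit i
  rw [pd_cumGF_theta h hq₀] at h1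
  simpa [profileScore_apply, hσ] using h1

/-- The local maximum likelihood estimators have the linear expansion with matrix
`-H⁻¹ Bᵀ A⁻¹`. -/
theorem exists_isRegularLik (h : GrowthBound Θ Q) (hd : DecayBound Θ Q) {s₀ : Vec m} {θ₀ : Vec p}
    (hq₀ : (s₀, θ₀) ∈ interior (jointDomain Θ Q))
    (hcrit : ∀ i : Fin p, pd i (fun θ => cumGF (Q θ) s₀) θ₀ = 0) :
    let C := matOp ((matB Q s₀ θ₀).transpose * (matA Q s₀ θ₀)⁻¹)
    IsRegularLik (trueLik Q) (gradK Q (s₀, θ₀)) θ₀ C (matOp (matH Q s₀ θ₀)) ∧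
      IsRegularLik (saddleLik Q) (gradK Q (s₀, θ₀)) θ₀ C (matOp (matH Q s₀ θ₀)) := by
  intro C
  obtain ⟨σ, hσ0, hσ⟩ := exists_isSaddleMapAt h hd hq₀
  have h1 := profileScore_eq_zero h hq₀ hσ0 hcrit
  have hC : ∀ u v, inner ℝ (C u) v = inner ℝ (opAi Q (s₀, θ₀) u) (opB Q (s₀, θ₀) v) := by
    intro u v
    change inner ℝ (matOp ((matB Q s₀ θ₀).transpose * (matA Q s₀ θ₀)⁻¹) u) v = _
    rw [matOp_mul, ContinuousLinearMap.comp_apply, inner_matOp_transpose, ← matOp_matB h hq₀]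
    rfl
  have h2 := hσ.isRegularLik_trueLik h hd h1 (C := C) (by rw [hσ0]; exact hC)
  have h3 := hσ.isRegularLik_saddleLik h hd h1 (C := C) (by rw [hσ0]; exact hC)
  rw [hσ0] at h2 h3
  exact ⟨h2, h3⟩

/-- Each `Q θ` has total mass one, so `K₀(0; θ) = 0` identically and the parameter Hessian vanishes.
-/
theorem matH_of_zero (θ₀ : Vec p) : matH Q 0 θ₀ =
    -((matB Q 0 θ₀).transpose * (matA Q 0 θ₀)⁻¹ * matB Q 0 θ₀) := by
  have h1 : (fun t => cumGF (Q t) 0) = fun _ => 0 := by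
    ext t
    simp [cumGF]
  have h2 : hess (fun t => cumGF (Q t) 0) θ₀ = 0 := by
    rw [h1]
    ext i j
    simp [hess, pd, lineDeriv]
  rw [matH, h2, zero_sub]

end Main

end Saddlepoint

open Saddlepoint in
theorem mainTheorem5 {m p : ℕ}
    -- the model: an open parameter domain and the law `Q θ` of a summand `Y_θ`
    (Θ : Set (Vec p)) (hΘ : IsOpen Θ)
    (Q : Vec p → Measure (Vec m)) [∀ θ, IsProbabilityMeasure (Q θ)]
    (hdecay : DecayBound Θ Q) (hgrowth : GrowthBound Θ Q)
    -- the base point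
    (s₀ : Vec m) (θ₀ : Vec p) (y₀ : Vec m)
    (hint : (s₀, θ₀) ∈ interior (jointDomain Θ Q))
    (hsaddle : HasGradientAt (cumGF (Q θ₀)) y₀ s₀)
    (hcrit : ∀ i : Fin p, pd i (fun θ => cumGF (Q θ) s₀) θ₀ = 0)
    (hH : (-matH Q s₀ θ₀).PosDef)
    -- the random observations
    {Ω : ℕ → Type*} [∀ n, MeasurableSpace (Ω n)]
    (μ : ∀ n, Measure (Ω n)) [∀ n, IsProbabilityMeasure (μ n)]
    (χ : ∀ n, Ω n → Vec m)
    (S : Matrix (Fin m) (Fin m) ℝ) (hS : S.PosSemidef)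
    (hclt : TendstoInDistribution
      (fun (n : ℕ) ω => (Real.sqrt (n : ℝ))⁻¹ • (χ n ω - (n : ℝ) • y₀)) atTop
      (fun z => z) μ (multivariateGaussian 0 S)) :
    (∃ (U : Set (Vec p)) (V : Set (Vec m)) (n₀ : ℕ) (T That : ℕ → Vec m → Vec p),
      IsMLENeighbourhood Θ Q θ₀ y₀ U V n₀ ∧
      IsLocalMLE (trueLik Q) U V n₀ T ∧ IsLocalMLE (saddleLik Q) U V n₀ That ∧
      (∀ n, Measurable (T n)) ∧ (∀ n, Measurable (That n))) ∧
    ∀ (U : Set (Vec p)) (V : Set (Vec m)) (n₀ : ℕ) (T That : ℕ → Vec m → Vec p),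
      IsMLENeighbourhood Θ Q θ₀ y₀ U V n₀ →
      IsLocalMLE (trueLik Q) U V n₀ T → IsLocalMLE (saddleLik Q) U V n₀ That →
      (∀ n, AEMeasurable (fun ω => T n (χ n ω)) (μ n)) →
      (∀ n, AEMeasurable (fun ω => That n (χ n ω)) (μ n)) →
      TendstoInDistribution
        (fun (n : ℕ) ω => (Real.sqrt (n : ℝ) • (T n (χ n ω) - θ₀), Real.sqrt (n : ℝ) • (That n (χ n ω) - θ₀)))
        atTop (fun z => (z, z)) μ
        (multivariateGaussian 0
          ((matH Q s₀ θ₀)⁻¹ * (matB Q s₀ θ₀).transpose * (matA Q s₀ θ₀)⁻¹ * S *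
            (matA Q s₀ θ₀)⁻¹ * matB Q s₀ θ₀ * (matH Q s₀ θ₀)⁻¹)) ∧
      (HasGradientAt (cumGF (Q θ₀)) y₀ 0 → S = matA Q 0 θ₀ →
        TendstoInDistribution
          (fun (n : ℕ) ω => (Real.sqrt (n : ℝ) • (T n (χ n ω) - θ₀), Real.sqrt (n : ℝ) • (That n (χ n ω) - θ₀)))
          atTop (fun z => (z, z)) μ (multivariateGaussian 0 (-(matH Q s₀ θ₀)⁻¹))) := by
  have hposH := exists_pos_of_posDef hH
  obtain ⟨c, hc, hcH⟩ := hposH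
  have hneg : ∀ v, inner ℝ (matOp (matH Q s₀ θ₀) v) v ≤ -c * ‖v‖ ^ 2 := fun v => by
    have h1 := hcH v
    rw [matOp_neg, ContinuousLinearMap.neg_apply, inner_neg_left] at h1
    linarith
  have hy₀ : gradK Q (s₀, θ₀) = y₀ := (hasGradientAt_cumGF hgrowth hint).unique hsaddle
  obtain ⟨hL, hL'⟩ := exists_isRegularLik hgrowth hdecay hint hcrit
  rw [hy₀] at hL hL'
  have hθ₀ : θ₀ ∈ Θ := (interior_subset hint).1
  refine ⟨exists_isMLENeighbourhood (hΘ.mem_nhds hθ₀) hc hneg hL hL',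
    fun U V n₀ T That hUV hT hThat hTm hThatm => ?_⟩
  have hA := matA_posDef Q hgrowth hdecay hint
  have hAu : IsUnit (matA Q s₀ θ₀).det := hA.det_pos.ne'.isUnit
  have hHu : IsUnit (matH Q s₀ θ₀).det := by
    have h1 := hH.isUnit
    rw [IsUnit.neg_iff] at h1
    exact (Matrix.isUnit_iff_isUnit_det _).1 h1
  have hAt : (matA Q s₀ θ₀).transpose = matA Q s₀ θ₀ := by
    have h1 := hA.isHermitian.eq
    rwa [Matrix.conjTranspose_eq_transpose_of_trivial] at h1
  have hHt : (matH Q s₀ θ₀).transpose = matH Q s₀ θ₀ := by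
    have h1 := hH.isHermitian.eq
    rw [Matrix.conjTranspose_eq_transpose_of_trivial, Matrix.transpose_neg] at h1
    exact neg_injective h1
  have hΛ : ∀ u, matOp (matH Q s₀ θ₀) (matOp (-((matH Q s₀ θ₀)⁻¹ * (matB Q s₀ θ₀).transpose *
      (matA Q s₀ θ₀)⁻¹)) u) = -matOp ((matB Q s₀ θ₀).transpose * (matA Q s₀ θ₀)⁻¹) u := fun u => by
    rw [matOp_neg, ContinuousLinearMap.neg_apply, map_neg, Matrix.mul_assoc, matOp_mul,
      ContinuousLinearMap.comp_apply, (matOp_inv hHu _).1]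
  have key := tendstoInDistribution_pair hS hclt
    (fun ε hε => hL.expansion hc hneg hΛ hUV.mem_nhds_param hUV.mem_nhds_obs hUV.unique_true hT hε)
    (fun ε hε => hL'.expansion hc hneg hΛ hUV.mem_nhds_param hUV.mem_nhds_obs hUV.unique_saddle
      hThat hε) hTm hThatm
  rw [covariance_eq hAt hHt] at key
  refine ⟨key, fun h0 hS0 => ?_⟩
  -- `0` and `s₀` solve the same saddlepoint equation. Uniqueness asks only that `0` have a finite
  -- exponential moment, so nothing is needed about `(0, θ₀)` being interior.
  have hs₀ : 0 = s₀ := eq_of_hasGradientAt hgrowth hdecay hint (t := 0) (by simp [expDomain])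
    (by rw [hy₀]; exact h0)
  subst hs₀
  rw [hS0] at key
  rwa [covariance_eq_neg_inv hAu hHu (matH_of_zero θ₀)] at key
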